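/- Let $F,\nu>0$, $1\le r\le 2$, $0\le s\le 2$. Consider the profile equation of the viscous St. Venant equations for travelling waves $(\tau,u)(x-ct)$ with $\tau>0$, $u=q-c\tau>0$, $$c^2\tau'+\big((2F)^{-1}\tau^{-2}\big)'=1-\tau^{s+1}(q-c\tau)^r-c\nu(\tau^{-2}\tau')'.\qquad(1)$$ Suppose that for $(c,q)=(c_0,q_0)$ the point $(\tau_0,0)$, $\tau_0>0$, is a saddle equilibrium, that is, with $u_0=q_0-c_0\tau_0>0$, $\tau_0^{s+1}u_0^r=1$ and $c_0\big(\tfrac{s+1}{r}\tfrac{u_0}{\tau_0}-c_0\big)<0$, and that the stable and unstable manifolds of this saddle meet, i.e. there is a nonconstant solution $\bar\tau$ of (1) on $\mathbb R$ with $(\bar\tau,\bar\tau')\to(\tau_0,0)$ as $x\to\pm\infty$ (a homoclinic orbit), $\bar u=q_0-c_0\bar\tau>0$. *Melnikov separation.* Let $c$ vary with the end state $(\tau_0,u_0)$ held fixed, so that $q=q(c)=u_0+c\tau_0$. For $c$ near $c_0$ let $\tau^+(c;\cdot)$ on $[0,\infty)$ and $\tau^-(c;\cdot)$ on $(-\infty,0]$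 be solutions of (1) with parameters $(c,q(c))$ (again with $\tau^\pm>0$, $q(c)-c\tau^\pm>0$) that parametrize the stable, respectively unstable, manifold of $(\tau_0,0)$: $(\tau^\pm,\tau^{\pm\prime})\to(\tau_0,0)$ as $x\to\pm\infty$, $(\tau^\pm,\tau^{\pm\prime})(c;\cdot)\to(\bar\tau,\bar\tau')$ uniformly on the half-line as $c\to c_0$ (with equality at $c=c_0$), and $(\tau^\pm,\tau^{\pm\prime})(c;0)$ lies on the line through $(\bar\tau,\bar\tau')(0)$ normal to $(\bar\tau',\bar\tau'')(0)$. Put $$d(c)=\det\begin{pmatrix}\bar\tau' & \tau^+-\tau^-\\ \bar\tau'' & (\tau^+-\tau^-)'\end{pmatrix}\Big|_{x=0}.$$ *Evans function.* The St. Venant equations linearized about $(\bar\tau,\bar u)$ give the eigenvalue equations $W'=A(x,\lambda)W$ for $W=(\tau,u,\bar\tau^{-2}u')^T$, where, with $c=c_0$, $q=q_0$, $\bar\alpha=\bar\tau^{-3}(F^{-1}+2c\nu\bar\tau')$, $$A=\begin{pmatrix}\lambda/c&0&-\bar\tau^2/c\\0&0&\bar\tau^2\\ \frac{(s+1)\bar\tau^s\bar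 u^r-\bar\alpha'-\bar\alpha\lambda/c}{\nu}&\frac{\lambda+r\bar\tau^{s+1}\bar u^{r-1}}{\nu}&\frac{-c\bar\tau^2+\bar\alpha\bar\tau^2/c}{\nu}\end{pmatrix},$$ and $A_0(\lambda)=\lim_{x\to\pm\infty}A(x,\lambda)$. Its Evans function is $$D(\lambda)=\frac{\det(W_1^-,W_2^-,W_3^+)|_{x=0}}{\det(V_1^-,V_2^-,V_3^+)},$$ where $V_3^+$ spans the eigenline of $A_0(\lambda)$ for an eigenvalue whose real part is strictly smaller than those of the other two, $V_1^-,V_2^-$ is a basis of the complementary invariant plane, and $W_j^\pm$ are solutions with $W_j^\pm\sim e^{A_0x}V_j^\pm$ as $x\to\pm\infty$. Here, for the eigenvalue $\mu$ of $V_3^+$ and the matrix $M$ with $A_0(V_1^-,V_2^-)=(V_1^-,V_2^-)M$, this means $e^{-\mu x}W_3^+\to V_3^+$ as $x\to+\infty$ and $(W_1^-,W_2^-)e^{-Mx}\to(V_1^-,V_2^-)$ as $x\to-\infty$. Then the families $\tau^\pm$ exist; $D(\lambda)$ exists and is independent of all choices for $\lambda\in\mathbb C$ near $0$; $d(c_0)=0$;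 $D$ is (complex) differentiable at $0$ with $D'(0)$ real; $d$ is differentiable at $c_0$, with derivative independent of the choice of $\tau^\pm$; and $$\operatorname{sgn}D'(0)=-\operatorname{sgn}\,\frac{d}{dc}d(c)\Big|_{c=c_0}.$$ -/

import Mathlib

open Filter Topology Set

/-- Parameters of the viscous St. Venant equations: Froude number `F`, viscosity `nu`,
friction exponents `r` and `s`. -/
structure StVenant where
  F : ℝ
  nu : ℝ
  r : ℝ
  s : ℝ

namespace StVenant

/-- `(t, tx)` is, on the interval `I`, a solution (with `tx` the derivative of `t`, and with
`t > 0` and `u = q - c t > 0`) of the profile equation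
`c² t' + ((2F)⁻¹ t⁻²)' = 1 - t ^ (s+1) (q - c t) ^ r - c ν (t⁻² t')'`,
the three derivatives being collected on one side. -/
def IsProfileOn (P : StVenant) (c q : ℝ) (t tx : ℝ → ℝ) (I : Set ℝ) : Prop :=
  ∀ x ∈ I, 0 < t x ∧ 0 < q - c * t x ∧ HasDerivWithinAt t (tx x) I x ∧
    HasDerivWithinAt
      (fun y => c ^ 2 * t y + (2 * P.F)⁻¹ * (t y ^ 2)⁻¹ + c * P.nu * ((t y ^ 2)⁻¹ * tx y))
      (1 - t x ^ (P.s + 1) * (q - c * t x) ^ P.r) I x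

/-- `t₀` is a saddle equilibrium of the profile equation: `t₀ ^ (s+1) u₀ ^ r = 1` and
`c (df_*(t₀) - c) < 0`, where `u₀ = q - c t₀ > 0` and `df_*(t₀) = ((s+1)/r) u₀ / t₀`. -/
def IsSaddle (P : StVenant) (c q t₀ : ℝ) : Prop :=
  0 < t₀ ∧ 0 < q - c * t₀ ∧ t₀ ^ (P.s + 1) * (q - c * t₀) ^ P.r = 1 ∧
    c * ((P.s + 1) / P.r * ((q - c * t₀) / t₀) - c) < 0

/-- `(t, tx)` is a homoclinic orbit of the profile equation, based at `(t₀, 0)`. -/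
def IsHomoclinic (P : StVenant) (c q t₀ : ℝ) (t tx : ℝ → ℝ) : Prop :=
  P.IsProfileOn c q t tx univ ∧ (∃ x, t x ≠ t₀) ∧
    Tendsto t atTop (𝓝 t₀) ∧ Tendsto tx atTop (𝓝 0) ∧
    Tendsto t atBot (𝓝 t₀) ∧ Tendsto tx atBot (𝓝 0)

/-! ### Melnikov separation -/

/-- The pairs `(T c, Tx c)`, for `c` near `c₀`, parametrize the branch close to the orbit `(t, tx)`
of an invariant manifold of the saddle `(t₀, 0)` of the profile equation with speed `c`, the end
state `(t₀, u₀)` being held fixed, so that `q = u₀ + c t₀ = q₀ + (c - c₀) t₀`. For `I = [0, ∞)` and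
`l = atTop` it is the stable manifold, for `I = (-∞, 0]` and `l = atBot` the unstable one. The phase
is fixed by asking that at `x = 0` the point lies on the normal section to the orbit `(t, tx)`. -/
def IsManifoldBranch (P : StVenant) (c₀ q₀ t₀ : ℝ) (t tx : ℝ → ℝ) (I : Set ℝ) (l : Filter ℝ)
    (T Tx : ℝ → ℝ → ℝ) : Prop :=
  (∀ᶠ c in 𝓝 c₀,
    P.IsProfileOn c (q₀ + (c - c₀) * t₀) (T c) (Tx c) I ∧
    Tendsto (T c) l (𝓝 t₀) ∧ Tendsto (Tx c) l (𝓝 0) ∧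
    (T c 0 - t 0) * tx 0 + (Tx c 0 - tx 0) * deriv tx 0 = 0) ∧
  TendstoUniformlyOn T t (𝓝 c₀) I ∧ TendstoUniformlyOn Tx tx (𝓝 c₀) I

/-- The Melnikov separation `c ↦ det (t_x, T⁺ - T⁻ ; (t_x)', (T⁺ - T⁻)')` at `x = 0`. -/
noncomputable def melnikov (tx : ℝ → ℝ) (Tp Tpx Tm Tmx : ℝ → ℝ → ℝ) (c : ℝ) : ℝ :=
  Matrix.det !![tx 0, Tp c 0 - Tm c 0; deriv tx 0, Tpx c 0 - Tmx c 0]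

/-! ### Evans function -/

/-- The coefficient `α = t⁻³ (F⁻¹ + 2 c ν t_x)`. -/
noncomputable def alpha (P : StVenant) (c : ℝ) (t tx : ℝ → ℝ) (x : ℝ) : ℝ :=
  (t x ^ 3)⁻¹ * (P.F⁻¹ + 2 * c * P.nu * tx x)

/-- The matrix `A(x, z)` of the eigenvalue equations (spectral parameter `z`) linearized about the
profile `(t, q - c t)`, as a first-order system in `W = (τ, u, t⁻² u')`. -/
noncomputable def evansMatrix (P : StVenant) (c q : ℝ) (t tx : ℝ → ℝ) (x : ℝ) (z : ℂ) :
    Matrix (Fin 3) (Fin 3) ℂ :=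
  let a : ℂ := (P.alpha c t tx x : ℝ)
  let ax : ℂ := (deriv (P.alpha c t tx) x : ℝ)
  let t2 : ℂ := ((t x ^ 2 : ℝ) : ℂ)
  let gt : ℂ := (((P.s + 1) * t x ^ P.s * (q - c * t x) ^ P.r : ℝ) : ℂ)
  let gu : ℂ := ((P.r * t x ^ (P.s + 1) * (q - c * t x) ^ (P.r - 1) : ℝ) : ℂ)
  !![z / c, 0, -t2 / c;
     0, 0, t2;
     (gt - ax - a * z / c) / P.nu, (z + gu) / P.nu, (-c * t2 + a * t2 / c) / P.nu]

/-- The limiting matrix `A₀(z)`: the same matrix at the constant profile `t₀`. -/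
noncomputable def limitMatrix (P : StVenant) (c q t₀ : ℝ) (z : ℂ) : Matrix (Fin 3) (Fin 3) ℂ :=
  P.evansMatrix c q (fun _ => t₀) (fun _ => 0) 0 z

/-- The determinant of three vectors. -/
noncomputable def det3 (a b d : Fin 3 → ℂ) : ℂ := Matrix.det (Matrix.of ![a, b, d]).transpose

/-- `D` is the value at `z` of the Evans function, `det (W₁⁻, W₂⁻, W₃⁺)|ₓ₌₀ / det (V₁⁻, V₂⁻, V₃⁺)`.
Here `V 0, V 1` is a basis of a two-dimensional invariant subspace of `A₀(z)` (on which `A₀(z)` acts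
by the matrix `M`) and `v` an eigenvector of `A₀(z)` whose eigenvalue `m` has smaller real part than
every eigenvalue of `M`; the `W j` and `w` are solutions of `W' = A(x, z) W` with
`W j ~ exp (A₀ x) V j` at `-∞`, that is `(W 0, W 1) exp (-x M) → (V 0, V 1)`, and
`w ~ exp (A₀ x) v = exp (m x) v` at `+∞`. -/
def IsEvansValue (P : StVenant) (c q t₀ : ℝ) (t tx : ℝ → ℝ) (z D : ℂ) : Prop :=
  ∃ (V : Fin 2 → Fin 3 → ℂ) (v : Fin 3 → ℂ) (M : Matrix (Fin 2) (Fin 2) ℂ) (m : ℂ)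
    (W : Fin 2 → ℝ → Fin 3 → ℂ) (w : ℝ → Fin 3 → ℂ),
    (∀ j, (P.limitMatrix c q t₀ z).mulVec (V j) = ∑ i, M i j • V i) ∧
    (P.limitMatrix c q t₀ z).mulVec v = m • v ∧
    (∀ k ∈ spectrum ℂ M, m.re < k.re) ∧
    det3 (V 0) (V 1) v ≠ 0 ∧
    (∀ j x, HasDerivAt (W j) ((P.evansMatrix c q t tx x z).mulVec (W j x)) x) ∧
    (∀ x, HasDerivAt w ((P.evansMatrix c q t tx x z).mulVec (w x)) x) ∧
    (∀ j, Tendsto (fun x : ℝ => ∑ i, NormedSpace.exp (-(x : ℂ) • M) i j • W i x) atBot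
      (𝓝 (V j))) ∧
    Tendsto (fun x : ℝ => Complex.exp (-m * x) • w x) atTop (𝓝 v) ∧
    D = det3 (W 0 0) (W 1 0) (w 0) / det3 (V 0) (V 1) v

/-- The Evans function. -/
noncomputable def evans (P : StVenant) (c q t₀ : ℝ) (t tx : ℝ → ℝ) (z : ℂ) : ℂ :=
  Classical.epsilon (P.IsEvansValue c q t₀ t tx z)

end StVenant

/-! ### Fixed points among continuous functions on the half-line vanishing at infinity -/

section FixedPoint

variable {E : Type*} [NormedAddCommGroup E]

/-! With the end state held fixed, the profile equation is a planar field τ'' = H(c, τ, τ') having a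
saddle at (τ₀, 0) with rates m₁ < 0 < m₂. Write (t, p) for the homoclinic orbit, px = p', and H_c,
H_s for the derivatives of H along it with respect to the speed and to τ'. The theorem holds because
both derivatives are given by the same integral over the line, up to a factor of known sign.

Melnikov side. Put E(x) = exp(-∫₀ˣ H_s); then E times the Wronskian of two solutions of the
variational equation is constant. In the orthonormal frame tangent and normal to the orbit, the
bounded solution of the inhomogeneous variational equation comes from integrating the tangential
part forwards and the normal part from infinity (`melS`). A contraction among continuous functions
vanishing at infinity then produces the perturbed branches (`NearOrbit.exists_branch`). Conversely,
every uniformly close branch is `melS` of its own remainder and deviates by O(c - c₀), so its normal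
displacement at 0 is differentiable (`NearOrbit.hasDerivAt_separation`). The unstable branch is the
stable branch of the reversed field. The outcome is d'(c₀) = -∫ E p H_c.

Evans side. The cross product of W₁⁻ and W₂⁻ solves the adjoint system up to a trace factor, so D =
e^{-Θ₀} η(0)·w(0), where w is the solution of fastest decay at +∞ and η, in reversed time, the
adjoint solution of fastest decay at -∞ (`EvansData.value_eq`). Both belong to the single eigenvalue
of least real part, which is m₁ at z = 0. Relative to it no direction decays, so a Gronwall argument
from infinity gives uniqueness, uniform bounds and continuity in z (`norm_le_of_tendsto_zero`,
`tendsto_extremal`); the zero eigenvalue of the limit matrix at z = 0 does no harm.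

At z = 0 one has w = kΦ with Φ the translation mode, and η = βψ₁ with ψ₁ the adjoint solution
vanishing at -∞. Let B be the coefficient of z in A. Pairing a perturbed solution with a bounded
solution of the opposite problem at z = 0 produces a factor z (`tendsto_pairing`). Together with the
constant adjoint solution ψ₂ = (c, 1, 0), which expresses a conservation law, these pairings
determine everything: η·w = z G(z) with G continuous at 0, hence D'(0) = -e^{-Θ₀} k β ∫ ψ₁·BΦ.

The link. The sum ψ₁·BΦ + E p H_c is the derivative of a function vanishing at both ends
(`hasDerivAt_boundary`), so ∫ ψ₁·BΦ = d'(c₀). It remains to see that kβ > 0. The maximum principle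
gives c₀ > 0 and τ ≤ τ₀, so p is positive near +∞ and negative near -∞; against the chosen
normalization of the eigenvectors, both k and β are then negative. -/

theorem exists_bound_of_tendsto_zero {f : ℝ → E} (hf : Continuous f)
    (hf0 : Tendsto f atTop (𝓝 0)) : ∃ M, 0 ≤ M ∧ ∀ x, 0 ≤ x → ‖f x‖ ≤ M := by
  have h1 : ∀ᶠ x in atTop, ‖f x‖ < 1 := by
    have := hf0.norm
    rw [norm_zero] at this
    exact this.eventually (gt_mem_nhds one_pos)
  obtain ⟨X, hX⟩ := eventually_atTop.1 h1
  obtain ⟨M, hM⟩ := (isCompact_Icc (a := (0 : ℝ)) (b := X)).exists_bound_of_continuousOn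
    hf.continuousOn
  refine ⟨max M 1, le_max_of_le_right zero_le_one, fun x hx => ?_⟩
  rcases le_total x X with h | h
  · exact (hM x ⟨hx, h⟩).trans (le_max_left _ _)
  · exact (hX x h).le.trans (le_max_right _ _)

-- Freezing the argument at `max x 0` places a function on the half-line in the complete space of
-- bounded continuous functions on the line, where the contraction principle is available.
open BoundedContinuousFunction in
theorem exists_bcf_of_tendsto_zero {f : ℝ → E} (hf : Continuous f)
    (hf0 : Tendsto f atTop (𝓝 0)) :
    ∃ F : ℝ →ᵇ E, Tendsto F atTop (𝓝 0) ∧ ∀ x, F x = f (max x 0) := by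
  obtain ⟨M, -, hM⟩ := exists_bound_of_tendsto_zero hf hf0
  refine ⟨BoundedContinuousFunction.ofNormedAddCommGroup (fun x => f (max x 0))
    (hf.comp (continuous_id.max continuous_const)) M (fun x => hM _ (le_max_right _ _)), ?_,
    fun x => rfl⟩
  exact hf0.comp (tendsto_atTop_mono (fun x => le_max_left x 0) tendsto_id)

open BoundedContinuousFunction in
/-- Contraction principle for `Y = g + S (G (·, Y))` among functions vanishing at infinity. -/
theorem exists_fixedPoint_halfLine [CompleteSpace E] (S : (ℝ → E) → ℝ → E) {C L : ℝ}
    (hcont : ∀ f, Continuous f → Tendsto f atTop (𝓝 0) → Continuous (S f))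
    (htend : ∀ f, Continuous f → Tendsto f atTop (𝓝 0) → Tendsto (S f) atTop (𝓝 0))
    (hC : 0 ≤ C) (hL : 0 ≤ L) (hCL : C * L < 1)
    (hlip : ∀ f g, Continuous f → Tendsto f atTop (𝓝 0) → Continuous g → Tendsto g atTop (𝓝 0) →
      ∀ M, (∀ x, 0 ≤ x → ‖f x - g x‖ ≤ M) → ∀ x, 0 ≤ x → ‖S f x - S g x‖ ≤ C * M)
    (G : ℝ → E → E) (hG : ∀ Y : ℝ → E, Continuous Y → Continuous fun x => G x (Y x))
    (hGL : ∀ x, 0 ≤ x → ∀ y y', ‖G x y - G x y'‖ ≤ L * ‖y - y'‖)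
    (hG0 : Tendsto (fun x => G x 0) atTop (𝓝 0))
    (g : ℝ → E) (hg : Continuous g) (hg0 : Tendsto g atTop (𝓝 0)) :
    ∃ Y : ℝ → E, Continuous Y ∧ Tendsto Y atTop (𝓝 0) ∧
      ∀ x, 0 ≤ x → Y x = g x + S (fun y => G y (Y y)) x := by
  have hGt : ∀ Y : ℝ → E, Tendsto Y atTop (𝓝 0) → Tendsto (fun x => G x (Y x)) atTop (𝓝 0) := by
    intro Y hY
    have h1 : Tendsto (fun x => G x (Y x) - G x 0) atTop (𝓝 0) := by
      refine squeeze_zero_norm' (a := fun x => L * ‖Y x‖) ?_ ?_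
      · filter_upwards [eventually_ge_atTop 0] with x hx
        simpa using hGL x hx (Y x) 0
      · simpa using hY.norm.const_mul L
    simpa using h1.add hG0
  -- Vanishing at infinity survives uniform limits, so this set is complete and the Banach fixed
  -- point automatically vanishes at infinity.
  let s : Set (ℝ →ᵇ E) := {Y | Tendsto Y atTop (𝓝 0)}
  have hs : IsClosed s := by
    refine isClosed_of_closure_subset fun Y hY => ?_
    rw [Metric.mem_closure_iff] at hY
    change Tendsto Y atTop (𝓝 0)
    rw [Metric.tendsto_nhds]
    intro ε hε
    obtain ⟨Z, hZ, hYZ⟩ := hY (ε / 2) (half_pos hε)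
    filter_upwards [(Metric.tendsto_nhds.1 (hZ : Tendsto Z atTop (𝓝 0))) (ε / 2) (half_pos hε)]
      with x hx
    calc dist (Y x) 0 ≤ dist (Y x) (Z x) + dist (Z x) 0 := dist_triangle _ _ _
      _ < ε / 2 + ε / 2 := add_lt_add_of_le_of_lt
          ((BoundedContinuousFunction.dist_coe_le_dist x).trans hYZ.le) hx
      _ = ε := by ring
  have hex : ∀ Y : s, ∃ F : s, ∀ x, F.1 x = g (max x 0) + S (fun y => G y (Y.1 y)) (max x 0) := by
    intro Y
    have c1 := hG Y.1 Y.1.continuous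
    have t1 := hGt Y.1 Y.2
    obtain ⟨F, hF, hF'⟩ := exists_bcf_of_tendsto_zero (hg.add (hcont _ c1 t1))
      (by have := hg0.add (htend _ c1 t1); rwa [add_zero] at this)
    exact ⟨⟨F, hF⟩, hF'⟩
  choose Φ hΦ using hex
  have : CompleteSpace s := hs.completeSpace_coe
  have : Nonempty s := ⟨⟨0, tendsto_const_nhds⟩⟩
  have hcontr : ContractingWith (Real.toNNReal (C * L)) Φ := by
    refine ⟨by simpa using hCL, LipschitzWith.of_dist_le_mul fun Y Z => ?_⟩
    rw [Real.coe_toNNReal _ (mul_nonneg hC hL)]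
    rw [Subtype.dist_eq, BoundedContinuousFunction.dist_le (by positivity)]
    intro x
    rw [hΦ, hΦ, dist_add_left, dist_eq_norm, mul_assoc]
    refine hlip _ _ (hG _ Y.1.continuous) (hGt _ Y.2) (hG _ Z.1.continuous) (hGt _ Z.2) _ ?_ _
      (le_max_right _ _)
    intro y hy
    refine (hGL y hy _ _).trans ?_
    gcongr
    rw [← dist_eq_norm, Subtype.dist_eq]
    exact BoundedContinuousFunction.dist_coe_le_dist y
  refine ⟨(ContractingWith.fixedPoint Φ hcontr).1, (ContractingWith.fixedPoint Φ hcontr).1.continuous,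
    (ContractingWith.fixedPoint Φ hcontr).2, fun x hx => ?_⟩
  have := hΦ (ContractingWith.fixedPoint Φ hcontr) x
  rw [hcontr.fixedPoint_isFixedPt, max_eq_left hx] at this
  exact this

end FixedPoint

/-! ### Scalar solution operators -/

section ScalarOps

variable {𝕜 : Type*} [RCLike 𝕜]

/-- The solution of `y' = (e' / e) y + f`, `y 0 = 0`. -/
noncomputable def stableOp (e f : ℝ → 𝕜) (x : ℝ) : 𝕜 := e x * ∫ y in (0 : ℝ)..x, (e y)⁻¹ * f y

/-- The solution of `y' = (e' / e) y + f` given by integration from infinity. -/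
noncomputable def unstableOp (e f : ℝ → 𝕜) (x : ℝ) : 𝕜 :=
  -(e x * ((∫ y in Ioi (0 : ℝ), (e y)⁻¹ * f y) - ∫ y in (0 : ℝ)..x, (e y)⁻¹ * f y))

theorem continuous_inv_mul {e f : ℝ → 𝕜} (he : Continuous e) (hne : ∀ x, e x ≠ 0)
    (hf : Continuous f) : Continuous fun y => (e y)⁻¹ * f y := (he.inv₀ hne).mul hf

theorem hasDerivAt_primitive {e f : ℝ → 𝕜} (he : Continuous e) (hne : ∀ x, e x ≠ 0)
    (hf : Continuous f) (x : ℝ) :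
    HasDerivAt (fun x => ∫ y in (0 : ℝ)..x, (e y)⁻¹ * f y) ((e x)⁻¹ * f x) x :=
  intervalIntegral.integral_hasDerivAt_right
    ((continuous_inv_mul he hne hf).intervalIntegrable _ _)
    ((continuous_inv_mul he hne hf).stronglyMeasurableAtFilter _ _) (continuous_inv_mul he hne hf).continuousAt

theorem hasDerivAt_stableOp {e f : ℝ → 𝕜} {ζ : 𝕜} {x : ℝ} (he : Continuous e)
    (hne : ∀ x, e x ≠ 0) (hf : Continuous f) (hde : HasDerivAt e (ζ * e x) x) :
    HasDerivAt (stableOp e f) (ζ * stableOp e f x + f x) x := by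
  have := hde.mul (hasDerivAt_primitive he hne hf x)
  refine this.congr_deriv ?_
  simp only [stableOp]
  rw [mul_inv_cancel_left₀ (hne x)]
  ring

theorem hasDerivAt_unstableOp {e f : ℝ → 𝕜} {ζ : 𝕜} {x : ℝ} (he : Continuous e)
    (hne : ∀ x, e x ≠ 0) (hf : Continuous f) (hde : HasDerivAt e (ζ * e x) x) :
    HasDerivAt (unstableOp e f) (ζ * unstableOp e f x + f x) x := by
  have := (hde.mul ((hasDerivAt_primitive he hne hf x).const_sub
    (∫ y in Ioi (0 : ℝ), (e y)⁻¹ * f y))).neg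
  refine this.congr_deriv ?_
  simp only [unstableOp]
  have h := mul_inv_cancel_left₀ (hne x) (f x)
  linear_combination h

theorem continuous_stableOp {e f : ℝ → 𝕜} (he : Continuous e) (hne : ∀ x, e x ≠ 0)
    (hf : Continuous f) : Continuous (stableOp e f) :=
  he.mul (continuous_iff_continuousAt.2 fun x => (hasDerivAt_primitive he hne hf x).continuousAt)

theorem continuous_unstableOp {e f : ℝ → 𝕜} (he : Continuous e) (hne : ∀ x, e x ≠ 0)
    (hf : Continuous f) : Continuous (unstableOp e f) :=
  (he.mul (continuous_const.sub (continuous_iff_continuousAt.2 fun x =>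
    (hasDerivAt_primitive he hne hf x).continuousAt))).neg

open MeasureTheory

theorem integral_exp_neg_mul_sub_le {κ : ℝ} (hκ : 0 < κ) (a x : ℝ) :
    ∫ y in a..x, Real.exp (-κ * (x - y)) ≤ 1 / κ := by
  have h : ∀ y ∈ uIcc a x, HasDerivAt (fun y => Real.exp (-κ * (x - y)) / κ)
      (Real.exp (-κ * (x - y))) y := by
    intro y _
    have h1 : HasDerivAt (fun y => -κ * (x - y)) κ y := by
      simpa using ((hasDerivAt_id y).const_sub x).const_mul (-κ)
    refine (h1.exp.div_const κ).congr_deriv ?_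
    field_simp
  rw [intervalIntegral.integral_eq_sub_of_hasDerivAt h
    ((by fun_prop : Continuous fun y => Real.exp (-κ * (x - y))).intervalIntegrable _ _)]
  simp only [sub_self, mul_zero, Real.exp_zero]
  have : 0 < Real.exp (-κ * (x - a)) / κ := by positivity
  linarith

/-- The kernel e(x)/e(y) is dominated by an exponential whose integral is at most 1/κ. Only the
ratio is assumed bounded, so exact exponentials and the norm of a homoclinic orbit are treated
alike. -/
theorem norm_mul_integral_le {e f : ℝ → 𝕜} {C κ M a x : ℝ} (hκ : 0 < κ)
    (hC : 0 ≤ C) (hM : 0 ≤ M) (hax : a ≤ x)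
    (hb : ∀ y, a ≤ y → y ≤ x → ‖e x‖ * ‖e y‖⁻¹ ≤ C * Real.exp (-κ * (x - y)))
    (hf : ∀ y, a ≤ y → y ≤ x → ‖f y‖ ≤ M) :
    ‖e x * ∫ y in a..x, (e y)⁻¹ * f y‖ ≤ C / κ * M := by
  rw [← intervalIntegral.integral_const_mul]
  have h1 : ‖∫ y in a..x, e x * ((e y)⁻¹ * f y)‖ ≤
      ∫ y in a..x, C * M * Real.exp (-κ * (x - y)) := by
    refine intervalIntegral.norm_integral_le_of_norm_le hax (ae_of_all _ fun y hy => ?_)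
      ((by fun_prop : Continuous fun y => C * M * Real.exp (-κ * (x - y))).intervalIntegrable _ _)
    rw [norm_mul, norm_mul, norm_inv, ← mul_assoc]
    calc ‖e x‖ * ‖e y‖⁻¹ * ‖f y‖ ≤ C * Real.exp (-κ * (x - y)) * M := 
          mul_le_mul (hb y hy.1.le hy.2) (hf y hy.1.le hy.2) (norm_nonneg _) (by positivity)
      _ = _ := by ring
  refine h1.trans ?_
  rw [intervalIntegral.integral_const_mul]
  calc C * M * _ ≤ C * M * (1 / κ) := by
        gcongr; exact integral_exp_neg_mul_sub_le hκ a x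
    _ = _ := by ring

theorem norm_stableOp_le {e f : ℝ → 𝕜} {C κ M x : ℝ} (hκ : 0 < κ) (hC : 0 ≤ C) (hM : 0 ≤ M)
    (hx : 0 ≤ x)
    (hb : ∀ y x, 0 ≤ y → y ≤ x → ‖e x‖ * ‖e y‖⁻¹ ≤ C * Real.exp (-κ * (x - y)))
    (hf : ∀ y, 0 ≤ y → ‖f y‖ ≤ M) : ‖stableOp e f x‖ ≤ C / κ * M :=
  norm_mul_integral_le hκ hC hM hx (fun y h h' => hb y x h h') fun y h _ => hf y h

theorem stableOp_sub {e f g : ℝ → 𝕜} (he : Continuous e) (hne : ∀ x, e x ≠ 0)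
    (hf : Continuous f) (hg : Continuous g) (x : ℝ) :
    stableOp e f x - stableOp e g x = stableOp e (fun x => f x - g x) x := by
  simp only [stableOp, mul_sub]
  rw [intervalIntegral.integral_sub ((continuous_inv_mul he hne hf).intervalIntegrable _ _)
    ((continuous_inv_mul he hne hg).intervalIntegrable _ _)]
  ring

/-- Split the integral at a point Y beyond which f is small: the contribution of the past is damped
by the kernel, and the rest costs at most C/κ times the small bound. -/
theorem tendsto_stableOp {e f : ℝ → 𝕜} {C κ : ℝ} (hκ : 0 < κ) (hC : 0 ≤ C) (he : Continuous e)
    (hne : ∀ x, e x ≠ 0)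
    (hb : ∀ y x, 0 ≤ y → y ≤ x → ‖e x‖ * ‖e y‖⁻¹ ≤ C * Real.exp (-κ * (x - y)))
    (hf : Continuous f) (hf0 : Tendsto f atTop (𝓝 0)) :
    Tendsto (stableOp e f) atTop (𝓝 0) := by
  rw [Metric.tendsto_atTop]
  intro ε hε
  set δ := ε / 2 / (C / κ + 1) with hδ
  have hδ0 : 0 < δ := by positivity
  obtain ⟨X, hX⟩ := Metric.tendsto_atTop.1 hf0 δ hδ0
  set Y := max X 0
  have hY0 : (0 : ℝ) ≤ Y := le_max_right _ _
  have hlim : Tendsto (fun x => C * Real.exp (-κ * (x - Y)) * ‖stableOp e f Y‖) atTop (𝓝 0) := by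
    have h1 : Tendsto (fun x : ℝ => -κ * (x - Y)) atTop atBot := by
      refine Tendsto.const_mul_atTop_of_neg (by linarith) ?_
      exact tendsto_atTop_add_const_right _ _ tendsto_id
    simpa using ((Real.tendsto_exp_atBot.comp h1).const_mul C).mul_const ‖stableOp e f Y‖
  obtain ⟨X', hX'⟩ := Metric.tendsto_atTop.1 hlim (ε / 2) (half_pos hε)
  refine ⟨max X' Y, fun x hx => ?_⟩
  have hxY : Y ≤ x := (le_max_right _ _).trans hx
  have key : stableOp e f x = e x * (e Y)⁻¹ * stableOp e f Y + e x * ∫ y in Y..x, (e y)⁻¹ * f y := by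
    simp only [stableOp]
    have hc := (continuous_inv_mul he hne hf)
    rw [← intervalIntegral.integral_add_adjacent_intervals (hc.intervalIntegrable 0 Y)
      (hc.intervalIntegrable Y x)]
    have := hne Y
    field_simp
  rw [dist_zero_right, key]
  have h1 : ‖e x * (e Y)⁻¹ * stableOp e f Y‖ < ε / 2 := by
    have h2 := hX' x ((le_max_left _ _).trans hx)
    rw [dist_zero_right, Real.norm_of_nonneg (by positivity)] at h2
    refine lt_of_le_of_lt ?_ h2
    rw [norm_mul, norm_mul, norm_inv]
    exact mul_le_mul_of_nonneg_right (hb Y x hY0 hxY) (norm_nonneg _)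
  have h2 : ‖e x * ∫ y in Y..x, (e y)⁻¹ * f y‖ ≤ C / κ * δ := by
    refine norm_mul_integral_le hκ hC hδ0.le hxY
      (fun y h h' => hb y x (hY0.trans h) h') fun y h _ => ?_
    have := hX y ((le_max_left _ _).trans h)
    rw [dist_zero_right] at this
    exact this.le
  have h3 : C / κ * δ ≤ ε / 2 := by
    rw [hδ, ← mul_div_assoc, div_le_iff₀ (by positivity)]
    nlinarith [div_nonneg hC hκ.le]
  calc _ ≤ _ := norm_add_le _ _
    _ < ε / 2 + ε / 2 := add_lt_add_of_lt_of_le h1 (h2.trans h3)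
    _ = ε := by ring

theorem integrableOn_Ioi_inv_mul {e f : ℝ → 𝕜} {C κ M : ℝ} (hκ : 0 < κ)
    (he : Continuous e) (hne : ∀ x, e x ≠ 0)
    (hb : ∀ x y, 0 ≤ x → x ≤ y → ‖e x‖ * ‖e y‖⁻¹ ≤ C * Real.exp (-κ * (y - x)))
    (hf : Continuous f) (hfM : ∀ y, 0 ≤ y → ‖f y‖ ≤ M) :
    IntegrableOn (fun y => (e y)⁻¹ * f y) (Ioi 0) := by
  have h0 : (0 : ℝ) < ‖e 0‖ := norm_pos_iff.2 (hne 0)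
  have hi : IntegrableOn (fun y : ℝ => ‖e 0‖⁻¹ * (C * M) * Real.exp (-κ * y)) (Ioi 0) :=
    (exp_neg_integrableOn_Ioi 0 hκ).const_mul _
  refine Integrable.mono' hi
    (continuous_inv_mul he hne hf).aestronglyMeasurable.restrict ?_
  refine (ae_restrict_iff' measurableSet_Ioi).2 (ae_of_all _ fun y hy => ?_)
  have h1 := hb 0 y le_rfl (mem_Ioi.1 hy).le
  rw [sub_zero] at h1
  rw [norm_mul, norm_inv]
  have h2 : ‖e y‖⁻¹ ≤ ‖e 0‖⁻¹ * (C * Real.exp (-κ * y)) := by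
    rw [le_inv_mul_iff₀ h0]; exact h1
  calc ‖e y‖⁻¹ * ‖f y‖ ≤ ‖e 0‖⁻¹ * (C * Real.exp (-κ * y)) * M := by
        have := hfM y (mem_Ioi.1 hy).le
        gcongr
        exact le_trans (by positivity) h2
    _ = _ := by ring

/-- The definition subtracts a partial integral from the full one, so that it can be differentiated
without any integrability. Estimates need the tail integral, which is recovered here once the
integrand is integrable. -/
theorem unstableOp_eq {e f : ℝ → 𝕜} {C κ M x : ℝ} (hκ : 0 < κ)
    (he : Continuous e) (hne : ∀ x, e x ≠ 0)
    (hb : ∀ x y, 0 ≤ x → x ≤ y → ‖e x‖ * ‖e y‖⁻¹ ≤ C * Real.exp (-κ * (y - x)))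
    (hf : Continuous f) (hfM : ∀ y, 0 ≤ y → ‖f y‖ ≤ M) (hx : 0 ≤ x) :
    unstableOp e f x = -(e x * ∫ y in Ioi x, (e y)⁻¹ * f y) := by
  have hi := integrableOn_Ioi_inv_mul hκ he hne hb hf hfM
  rw [unstableOp, intervalIntegral.integral_of_le hx, ← Ioc_union_Ioi_eq_Ioi hx,
    setIntegral_union (Ioc_disjoint_Ioi le_rfl) measurableSet_Ioi (hi.mono_set Ioc_subset_Ioi_self)
    (hi.mono_set (Ioi_subset_Ioi hx))]
  ring

/-- The global bound M' serves only convergence of the integral; the estimate sees just the bound M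
on the tail, which is what the limit at infinity requires. -/
theorem norm_unstableOp_le_of_tail {e f : ℝ → 𝕜} {C κ M M' x : ℝ} (hκ : 0 < κ) (hC : 0 ≤ C)
    (he : Continuous e) (hne : ∀ x, e x ≠ 0)
    (hb : ∀ x y, 0 ≤ x → x ≤ y → ‖e x‖ * ‖e y‖⁻¹ ≤ C * Real.exp (-κ * (y - x)))
    (hf : Continuous f) (hfM' : ∀ y, 0 ≤ y → ‖f y‖ ≤ M') (hx : 0 ≤ x)
    (hfM : ∀ y, x ≤ y → ‖f y‖ ≤ M) : ‖unstableOp e f x‖ ≤ C / κ * M := by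
  rw [unstableOp_eq hκ he hne hb hf hfM' hx, norm_neg, ← integral_const_mul]
  have hi : IntegrableOn (fun y : ℝ => C * M * Real.exp (κ * x) * Real.exp (-κ * y)) (Ioi x) :=
    (exp_neg_integrableOn_Ioi x hκ).const_mul _
  have h1 : ‖∫ y in Ioi x, e x * ((e y)⁻¹ * f y)‖ ≤
      ∫ y in Ioi x, C * M * Real.exp (κ * x) * Real.exp (-κ * y) := by
    refine norm_integral_le_of_norm_le hi
      ((ae_restrict_iff' measurableSet_Ioi).2 (ae_of_all _ fun y hy => ?_))
    rw [norm_mul, norm_mul, norm_inv, ← mul_assoc]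
    have hy' := (mem_Ioi.1 hy).le
    calc ‖e x‖ * ‖e y‖⁻¹ * ‖f y‖ ≤ C * Real.exp (-κ * (y - x)) * M := 
          mul_le_mul (hb x y hx hy') (hfM y hy') (norm_nonneg _) (by positivity)
      _ = _ := by
          rw [show -κ * (y - x) = κ * x + -κ * y by ring, Real.exp_add]; ring
  refine h1.trans (le_of_eq ?_)
  rw [integral_const_mul, integral_exp_mul_Ioi (by linarith : -κ < 0)]
  have : Real.exp (κ * x) * Real.exp (-κ * x) = 1 := by rw [← Real.exp_add]; simp
  rw [neg_div_neg_eq, ← mul_div_assoc, mul_assoc (C * M), this]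
  ring

theorem norm_unstableOp_le {e f : ℝ → 𝕜} {C κ M x : ℝ} (hκ : 0 < κ) (hC : 0 ≤ C)
    (he : Continuous e) (hne : ∀ x, e x ≠ 0)
    (hb : ∀ x y, 0 ≤ x → x ≤ y → ‖e x‖ * ‖e y‖⁻¹ ≤ C * Real.exp (-κ * (y - x)))
    (hf : Continuous f) (hfM : ∀ y, 0 ≤ y → ‖f y‖ ≤ M) (hx : 0 ≤ x) :
    ‖unstableOp e f x‖ ≤ C / κ * M :=
  norm_unstableOp_le_of_tail hκ hC he hne hb hf hfM hx fun y hy => hfM y (hx.trans hy)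

theorem unstableOp_sub {e f g : ℝ → 𝕜} {C κ M M' : ℝ} (hκ : 0 < κ)
    (he : Continuous e) (hne : ∀ x, e x ≠ 0)
    (hb : ∀ x y, 0 ≤ x → x ≤ y → ‖e x‖ * ‖e y‖⁻¹ ≤ C * Real.exp (-κ * (y - x)))
    (hf : Continuous f) (hfM : ∀ y, 0 ≤ y → ‖f y‖ ≤ M)
    (hg : Continuous g) (hgM : ∀ y, 0 ≤ y → ‖g y‖ ≤ M') (x : ℝ) :
    unstableOp e f x - unstableOp e g x = unstableOp e (fun x => f x - g x) x := by
  simp only [unstableOp, mul_sub]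
  rw [intervalIntegral.integral_sub ((continuous_inv_mul he hne hf).intervalIntegrable _ _)
    ((continuous_inv_mul he hne hg).intervalIntegrable _ _),
    integral_sub (integrableOn_Ioi_inv_mul hκ he hne hb hf hfM)
    (integrableOn_Ioi_inv_mul hκ he hne hb hg hgM)]
  ring

theorem tendsto_unstableOp {e f : ℝ → 𝕜} {C κ : ℝ} (hκ : 0 < κ) (hC : 0 ≤ C)
    (he : Continuous e) (hne : ∀ x, e x ≠ 0)
    (hb : ∀ x y, 0 ≤ x → x ≤ y → ‖e x‖ * ‖e y‖⁻¹ ≤ C * Real.exp (-κ * (y - x)))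
    (hf : Continuous f) (hf0 : Tendsto f atTop (𝓝 0)) :
    Tendsto (unstableOp e f) atTop (𝓝 0) := by
  obtain ⟨M, -, hM⟩ := exists_bound_of_tendsto_zero hf hf0
  rw [Metric.tendsto_atTop]
  intro ε hε
  set δ := ε / 2 / (C / κ + 1) with hδ
  have hδ0 : 0 < δ := by positivity
  obtain ⟨X, hX⟩ := Metric.tendsto_atTop.1 hf0 δ hδ0
  refine ⟨max X 0, fun x hx => ?_⟩
  rw [dist_zero_right]
  have h2 := norm_unstableOp_le_of_tail (x := x) hκ hC he hne hb hf hM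
    ((le_max_right _ _).trans hx) fun y hy => by
      have := hX y (((le_max_left _ _).trans hx).trans hy)
      rw [dist_zero_right] at this
      exact this.le
  have h3 : C / κ * δ ≤ ε / 2 := by
    rw [hδ, ← mul_div_assoc, div_le_iff₀ (by positivity)]
    nlinarith [div_nonneg hC hκ.le]
  linarith

end ScalarOps

/-! ### Linear systems on the half-line -/

section LinearSystems

variable {ι : Type*} [Fintype ι]

theorem norm_mulVec_le_of_entry_le {A : Matrix ι ι ℂ} {m : ℝ} (hm : 0 ≤ m)
    (hA : ∀ i j, ‖A i j‖ ≤ m) (v : ι → ℂ) : ‖A.mulVec v‖ ≤ Fintype.card ι * m * ‖v‖ := by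
  rw [pi_norm_le_iff_of_nonneg (by positivity)]
  intro i
  calc ‖∑ j, A i j * v j‖ ≤ ∑ j, ‖A i j * v j‖ := norm_sum_le _ _
    _ ≤ ∑ _j : ι, m * ‖v‖ := by
        refine Finset.sum_le_sum fun j _ => ?_
        rw [norm_mul]
        exact mul_le_mul (hA i j) (norm_le_pi_norm v j) (norm_nonneg _) hm
    _ = _ := by simp [mul_assoc]

theorem continuous_mulVec {A : ℝ → Matrix ι ι ℂ} (hA : ∀ i j, Continuous fun x => A x i j)
    {v : ℝ → ι → ℂ} (hv : Continuous v) : Continuous fun x => (A x).mulVec (v x) := by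
  refine continuous_pi fun i => ?_
  exact continuous_finsetSum _ fun j _ => (hA i j).mul ((continuous_apply j).comp hv)

/-- Componentwise solution operator of `y' = a y + f` on the half-line. -/
noncomputable def diagOp (a : ι → ℂ) (f : ℝ → ι → ℂ) (x : ℝ) (i : ι) : ℂ :=
  if (a i).re < 0 then stableOp (fun y => Complex.exp (a i * y)) (fun y => f y i) x
  else unstableOp (fun y => Complex.exp (a i * y)) (fun y => f y i) x

theorem continuous_cexp_mul (b : ℂ) : Continuous fun y : ℝ => Complex.exp (b * y) := by
  fun_prop

theorem hasDerivAt_cexp_mul (b : ℂ) (x : ℝ) :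
    HasDerivAt (fun y : ℝ => Complex.exp (b * y)) (b * Complex.exp (b * x)) x := by
  have h : HasDerivAt (fun y : ℝ => b * (y : ℂ)) b x := by
    simpa using (Complex.ofRealCLM.hasDerivAt (x := x)).const_mul b
  simpa [mul_comm] using h.cexp

theorem norm_cexp_mul (b : ℂ) (x : ℝ) : ‖Complex.exp (b * x)‖ = Real.exp (b.re * x) := by
  rw [Complex.norm_exp]; simp

theorem cexp_stable_bound {b : ℂ} {κ : ℝ} (hb : b.re ≤ -κ) (y x : ℝ) (_ : 0 ≤ y) (h : y ≤ x) :
    ‖Complex.exp (b * x)‖ * ‖Complex.exp (b * y)‖⁻¹ ≤ 1 * Real.exp (-κ * (x - y)) := by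
  rw [norm_cexp_mul, norm_cexp_mul, ← Real.exp_neg, ← Real.exp_add, one_mul, Real.exp_le_exp]
  nlinarith

theorem cexp_unstable_bound {b : ℂ} {κ : ℝ} (hb : κ ≤ b.re) (x y : ℝ) (_ : 0 ≤ x) (h : x ≤ y) :
    ‖Complex.exp (b * x)‖ * ‖Complex.exp (b * y)‖⁻¹ ≤ 1 * Real.exp (-κ * (y - x)) := by
  rw [norm_cexp_mul, norm_cexp_mul, ← Real.exp_neg, ← Real.exp_add, one_mul, Real.exp_le_exp]
  nlinarith

variable {a : ι → ℂ} {κ : ℝ}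

theorem norm_diagOp_sub_le (hκ : 0 < κ) (ha : ∀ i, κ ≤ |(a i).re|) {f g : ℝ → ι → ℂ}
    (hf : Continuous f) (hf0 : Tendsto f atTop (𝓝 0)) (hg : Continuous g)
    (hg0 : Tendsto g atTop (𝓝 0)) {M : ℝ} (hM : ∀ x, 0 ≤ x → ‖f x - g x‖ ≤ M) {x : ℝ}
    (hx : 0 ≤ x) : ‖diagOp a f x - diagOp a g x‖ ≤ 1 / κ * M := by
  have hM0 : 0 ≤ M := (norm_nonneg _).trans (hM 0 le_rfl)
  rw [pi_norm_le_iff_of_nonneg (by positivity)]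
  intro i
  have he := continuous_cexp_mul (a i)
  have hne : ∀ x : ℝ, Complex.exp (a i * x) ≠ 0 := fun x => Complex.exp_ne_zero _
  have hfi : Continuous fun y => f y i := (continuous_apply i).comp hf
  have hgi : Continuous fun y => g y i := (continuous_apply i).comp hg
  have hMi : ∀ y, 0 ≤ y → ‖f y i - g y i‖ ≤ M := fun y hy =>
    (norm_le_pi_norm (f y - g y) i).trans (hM y hy)
  simp only [Pi.sub_apply, diagOp]
  split_ifs with h
  · have hb := cexp_stable_bound (b := a i) (κ := κ) (by
      have := ha i; rw [abs_of_neg h] at this; linarith)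
    rw [stableOp_sub he hne hfi hgi]
    exact norm_stableOp_le hκ zero_le_one hM0 hx hb hMi
  · have hb := cexp_unstable_bound (b := a i) (κ := κ) (by
      have := ha i; rwa [abs_of_nonneg (not_lt.1 h)] at this)
    obtain ⟨Mf, -, hMf⟩ := exists_bound_of_tendsto_zero hf hf0
    obtain ⟨Mg, -, hMg⟩ := exists_bound_of_tendsto_zero hg hg0
    rw [unstableOp_sub hκ he hne hb hfi (fun y hy => (norm_le_pi_norm _ i).trans (hMf y hy)) hgi
      (fun y hy => (norm_le_pi_norm _ i).trans (hMg y hy))]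
    exact norm_unstableOp_le hκ zero_le_one he hne hb (hfi.sub hgi) hMi hx

omit [Fintype ι] in
theorem continuous_diagOp {f : ℝ → ι → ℂ} (hf : Continuous f) : Continuous (diagOp a f) := by
  refine continuous_pi fun i => ?_
  have hfi : Continuous fun y => f y i := (continuous_apply i).comp hf
  simp only [diagOp]
  split_ifs
  · exact continuous_stableOp (continuous_cexp_mul _) (fun x => Complex.exp_ne_zero _) hfi
  · exact continuous_unstableOp (continuous_cexp_mul _) (fun x => Complex.exp_ne_zero _) hfi

omit [Fintype ι] in
theorem tendsto_diagOp (hκ : 0 < κ) (ha : ∀ i, κ ≤ |(a i).re|) {f : ℝ → ι → ℂ}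
    (hf : Continuous f) (hf0 : Tendsto f atTop (𝓝 0)) : Tendsto (diagOp a f) atTop (𝓝 0) := by
  refine tendsto_pi_nhds.2 fun i => ?_
  have hfi : Continuous fun y => f y i := (continuous_apply i).comp hf
  have hfi0 : Tendsto (fun y => f y i) atTop (𝓝 0) := tendsto_pi_nhds.1 hf0 i
  simp only [diagOp]
  split_ifs with h
  · exact tendsto_stableOp hκ zero_le_one (continuous_cexp_mul _)
      (fun x => Complex.exp_ne_zero _) (cexp_stable_bound (by
      have := ha i; rw [abs_of_neg h] at this; linarith)) hfi hfi0
  · exact tendsto_unstableOp hκ zero_le_one (continuous_cexp_mul _)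
      (fun x => Complex.exp_ne_zero _) (cexp_unstable_bound (by
      have := ha i; rwa [abs_of_nonneg (not_lt.1 h)] at this)) hfi hfi0

omit [Fintype ι] in
theorem hasDerivAt_diagOp {f : ℝ → ι → ℂ} (hf : Continuous f) (x : ℝ) (i : ι) :
    HasDerivAt (fun x => diagOp a f x i) (a i * diagOp a f x i + f x i) x := by
  have hfi : Continuous fun y => f y i := (continuous_apply i).comp hf
  simp only [diagOp]
  split_ifs
  · exact hasDerivAt_stableOp (continuous_cexp_mul _) (fun x => Complex.exp_ne_zero _) hfi
      (hasDerivAt_cexp_mul _ _)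
  · exact hasDerivAt_unstableOp (continuous_cexp_mul _) (fun x => Complex.exp_ne_zero _) hfi
      (hasDerivAt_cexp_mul _ _)

/-- Solutions of a small perturbation of a hyperbolic diagonal system vanishing at infinity. -/
theorem exists_tendsto_zero_solution (hκ : 0 < κ) (ha : ∀ i, κ ≤ |(a i).re|)
    {R : ℝ → Matrix ι ι ℂ} (hR : ∀ i j, Continuous fun x => R x i j) {L : ℝ} (hL0 : 0 ≤ L)
    (hL : L < κ) (hRL : ∀ x, 0 ≤ x → ∀ v, ‖(R x).mulVec v‖ ≤ L * ‖v‖)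
    {f : ℝ → ι → ℂ} (hf : Continuous f) (hf0 : Tendsto f atTop (𝓝 0)) (y₀ : ι → ℂ) :
    ∃ Y : ℝ → ι → ℂ, Tendsto Y atTop (𝓝 0) ∧ (∀ i, (a i).re < 0 → Y 0 i = y₀ i) ∧
      ∀ x, 0 ≤ x →
        HasDerivWithinAt Y (fun i => a i * Y x i + (R x).mulVec (Y x) i + f x i) (Ici 0) x := by
  -- The homogeneous solution carrying the prescribed initial values in the decaying directions; the
  -- other directions are integrated from infinity and have no free data.
  set g : ℝ → ι → ℂ := fun x i => if (a i).re < 0 then Complex.exp (a i * x) * y₀ i else 0 with hg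
  have hgc : Continuous g := by
    refine continuous_pi fun i => ?_
    simp only [hg]
    split_ifs
    · exact (continuous_cexp_mul _).mul continuous_const
    · exact continuous_const
  have hg0 : Tendsto g atTop (𝓝 0) := by
    refine tendsto_pi_nhds.2 fun i => ?_
    simp only [hg]
    split_ifs with h
    · have h1 : Tendsto (fun x : ℝ => Complex.exp (a i * x)) atTop (𝓝 0) := by
        rw [tendsto_zero_iff_norm_tendsto_zero]
        simp only [norm_cexp_mul]
        exact Real.tendsto_exp_atBot.comp (tendsto_id.const_mul_atTop_of_neg h)
      simpa using h1.mul_const (y₀ i)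
    · exact tendsto_const_nhds
  have hgd : ∀ x i, HasDerivAt (fun x => g x i) (a i * g x i) x := by
    intro x i
    simp only [hg]
    split_ifs
    · exact ((hasDerivAt_cexp_mul (a i) x).mul_const (y₀ i)).congr_deriv (by ring)
    · simpa using hasDerivAt_const x (0 : ℂ)
  have hGc : ∀ Y : ℝ → ι → ℂ, Continuous Y → Continuous fun x => (R x).mulVec (Y x) + f x :=
    fun Y hY => (continuous_mulVec hR hY).add hf
  obtain ⟨Y, hYc, hY0, hY⟩ := exists_fixedPoint_halfLine (diagOp a) (C := 1 / κ) (L := L)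
    (fun f hf _ => continuous_diagOp hf) (fun f hf hf0 => tendsto_diagOp hκ ha hf hf0)
    (by positivity) hL0 (by rw [one_div, inv_mul_lt_iff₀ hκ]; linarith)
    (fun f g hf hf0 hg hg0 M hM x hx => norm_diagOp_sub_le hκ ha hf hf0 hg hg0 hM hx)
    (fun x Y => (R x).mulVec Y + f x) hGc
    (fun x hx y y' => by
      rw [add_sub_add_right_eq_sub, ← Matrix.mulVec_sub]; exact hRL x hx _)
    (by simpa using hf0) g hgc hg0
  refine ⟨Y, hY0, fun i hi => ?_, fun x hx => ?_⟩
  · have := congrFun (hY 0 le_rfl) i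
    simp only [Pi.add_apply, diagOp, hg, if_pos hi, stableOp] at this
    simpa using this
  · rw [hasDerivWithinAt_pi]
    intro i
    have h1 := ((hgd x i).add (hasDerivAt_diagOp (a := a) (hGc Y hYc) x i)).hasDerivWithinAt
      (s := Ici 0)
    refine (h1.congr_of_mem (fun z hz => congrFun (hY z hz) i) hx).congr_deriv ?_
    have := congrFun (hY x hx) i
    simp only [Pi.add_apply] at this ⊢
    rw [this]; ring

theorem hasDerivAt_ite_of_Ici_Iic {E : Type*} [NormedAddCommGroup E] [NormedSpace ℝ E]
    {f g : ℝ → E} {F : ℝ → E → E} {x₀ : ℝ} (h0 : f x₀ = g x₀)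
    (hf : ∀ x, x₀ ≤ x → HasDerivWithinAt f (F x (f x)) (Ici x₀) x)
    (hg : ∀ x, x ≤ x₀ → HasDerivWithinAt g (F x (g x)) (Iic x₀) x) (x : ℝ) :
    HasDerivAt (fun x => if x₀ ≤ x then f x else g x)
      (F x (if x₀ ≤ x then f x else g x)) x := by
  rcases lt_trichotomy x x₀ with h | h | h
  · rw [if_neg (not_le.2 h)]
    refine ((hg x h.le).hasDerivAt (Iic_mem_nhds h)).congr_of_eventuallyEq ?_
    filter_upwards [gt_mem_nhds h] with y hy
    exact if_neg (not_le.2 hy)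
  · subst h
    rw [if_pos le_rfl]
    have h1 : HasDerivWithinAt (fun y => if x ≤ y then f y else g y) (F x (f x)) (Ici x) x :=
      (hf x le_rfl).congr_of_mem (fun y hy => if_pos hy) self_mem_Ici
    have h2 : HasDerivWithinAt (fun y => if x ≤ y then f y else g y) (F x (f x)) (Iic x) x := by
      rw [h0]
      refine (hg x le_rfl).congr_of_mem (fun y hy => ?_) self_mem_Iic
      split_ifs with h
      · rw [le_antisymm hy h, h0]
      · rfl
    have := h1.union h2
    rwa [union_comm, Iic_union_Ici, hasDerivWithinAt_univ] at this
  · rw [if_pos h.le]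
    refine ((hf x h.le).hasDerivAt (Ici_mem_nhds h)).congr_of_eventuallyEq ?_
    filter_upwards [lt_mem_nhds h] with y hy
    exact if_pos hy.le

theorem hasDerivWithinAt_comp_neg_Ici {E : Type*} [NormedAddCommGroup E] [NormedSpace ℝ E]
    {f : ℝ → E} {f' : E} {x₀ x : ℝ} (h : HasDerivWithinAt f f' (Ici 0) (x₀ - x)) :
    HasDerivWithinAt (fun y => f (x₀ - y)) (-f') (Iic x₀) x := by
  have := h.scomp x (((hasDerivAt_id x).const_sub x₀).hasDerivWithinAt (s := Iic x₀))
    (fun y hy => by simpa using hy)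
  simpa [Function.comp_def] using this

theorem hasDerivWithinAt_comp_sub_Ici {E : Type*} [NormedAddCommGroup E] [NormedSpace ℝ E]
    {f : ℝ → E} {f' : E} {x₀ x : ℝ} (h : HasDerivWithinAt f f' (Ici 0) (x - x₀)) :
    HasDerivWithinAt (fun y => f (y - x₀)) f' (Ici x₀) x := by
  have := h.scomp x (((hasDerivAt_id x).sub_const x₀).hasDerivWithinAt (s := Ici x₀))
    (fun y hy => by simpa using hy)
  simpa [Function.comp_def] using this

/-- After the factor exp(kx) is removed, with k larger than the operator bound, the system is a
small perturbation of Y' = -kY. The half-line fixed point thus gives a global solution at once. -/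
theorem exists_linear_solution_Ici {A : ℝ → Matrix ι ι ℂ} {Λ : ℝ}
    (hA : ∀ i j, Continuous fun x => A x i j) (hΛ : ∀ x i j, ‖A x i j‖ ≤ Λ) (y₀ : ι → ℂ) :
    ∃ y : ℝ → ι → ℂ, y 0 = y₀ ∧
      ∀ x, 0 ≤ x → HasDerivWithinAt y ((A x).mulVec (y x)) (Ici 0) x := by
  set m : ℝ := max Λ 0
  set k : ℝ := Fintype.card ι * m + 1
  have hk : 0 < k := by positivity
  obtain ⟨Y, -, hY0, hY⟩ := exists_tendsto_zero_solution (ι := ι) (a := fun _ => ((-k : ℝ) : ℂ))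
    (κ := k) hk (fun i => by simp [abs_of_pos hk]) hA (L := Fintype.card ι * m) (by positivity)
    (by simp [k]) (fun x _ v => norm_mulVec_le_of_entry_le (le_max_right _ _)
      (fun i j => (hΛ x i j).trans (le_max_left _ _)) v)
    (f := fun _ => 0) continuous_const tendsto_const_nhds y₀
  refine ⟨fun x => Complex.exp (k * x) • Y x, ?_, fun x hx => ?_⟩
  · ext i
    simpa using hY0 i (by simpa using hk)
  · refine ((hasDerivAt_cexp_mul k x).hasDerivWithinAt.smul (hY x hx)).congr_deriv ?_
    rw [Matrix.mulVec_smul]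
    ext i
    simp only [Pi.add_apply, Pi.smul_apply, smul_eq_mul, Pi.zero_apply]
    push_cast
    ring

/-- Global solvability of linear systems with bounded continuous coefficients. -/
theorem exists_linear_solution {A : ℝ → Matrix ι ι ℂ} {Λ : ℝ}
    (hA : ∀ i j, Continuous fun x => A x i j) (hΛ : ∀ x i j, ‖A x i j‖ ≤ Λ) (x₀ : ℝ)
    (y₀ : ι → ℂ) :
    ∃ y : ℝ → ι → ℂ, y x₀ = y₀ ∧ ∀ x, HasDerivAt y ((A x).mulVec (y x)) x := by
  obtain ⟨y, hy0, hy⟩ := exists_linear_solution_Ici (A := fun x => A (x + x₀))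
    (fun i j => (hA i j).comp (by fun_prop)) (fun x => hΛ _) y₀
  obtain ⟨z, hz0, hz⟩ := exists_linear_solution_Ici (A := fun x => -A (x₀ - x))
    (fun i j => ((hA i j).comp (g := fun x => A x i j) (f := fun x => x₀ - x) (by fun_prop)).neg)
    (fun x i j => by simpa using hΛ (x₀ - x) i j) y₀
  refine ⟨fun x => if x₀ ≤ x then y (x - x₀) else z (x₀ - x), by simpa using hy0, ?_⟩
  refine hasDerivAt_ite_of_Ici_Iic (F := fun x v => (A x).mulVec v) (by simp [hy0, hz0])
    (fun x hx => ?_) (fun x hx => ?_)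
  · have := hasDerivWithinAt_comp_sub_Ici (x₀ := x₀) (hy (x - x₀) (by linarith))
    simpa using this
  · have := hasDerivWithinAt_comp_neg_Ici (x₀ := x₀) (hz (x₀ - x) (by linarith))
    simpa [Matrix.neg_mulVec] using this

end LinearSystems

/-! ### Solutions with prescribed asymptotic direction (Levinson's theorem) -/

section Levinson

variable {ι : Type*} [Fintype ι]

theorem norm_conj_mulVec_le {B T T' : Matrix ι ι ℂ} {m t t' : ℝ} (hm : 0 ≤ m) (ht : 0 ≤ t)
    (ht' : 0 ≤ t') (hB : ∀ i j, ‖B i j‖ ≤ m) (hT : ∀ i j, ‖T i j‖ ≤ t)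
    (hT' : ∀ i j, ‖T' i j‖ ≤ t') (v : ι → ℂ) :
    ‖(T' * B * T).mulVec v‖ ≤ Fintype.card ι ^ 3 * t' * t * m * ‖v‖ := by
  rw [← Matrix.mulVec_mulVec, ← Matrix.mulVec_mulVec]
  calc _ ≤ Fintype.card ι * t' * (Fintype.card ι * m * (Fintype.card ι * t * ‖v‖)) :=
        (norm_mulVec_le_of_entry_le ht' hT' _).trans
          (mul_le_mul_of_nonneg_left ((norm_mulVec_le_of_entry_le hm hB _).trans
            (mul_le_mul_of_nonneg_left (norm_mulVec_le_of_entry_le ht hT _) (by positivity)))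
            (by positivity))
    _ = _ := by ring

theorem exists_entry_bound (T : Matrix ι ι ℂ) : ∃ t, 0 ≤ t ∧ ∀ i j, ‖T i j‖ ≤ t := by
  refine ⟨∑ i, ∑ j, ‖T i j‖, by positivity, fun i j => ?_⟩
  calc ‖T i j‖ ≤ ∑ j, ‖T i j‖ :=
        Finset.single_le_sum (f := fun j => ‖T i j‖) (fun _ _ => norm_nonneg _) (Finset.mem_univ j)
    _ ≤ _ := Finset.single_le_sum (f := fun i => ∑ j, ‖T i j‖)
        (fun _ _ => Finset.sum_nonneg fun _ _ => norm_nonneg _) (Finset.mem_univ i)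

theorem continuous_conj_entry {A : ℝ → Matrix ι ι ℂ} (hA : ∀ i j, Continuous fun x => A x i j)
    (A₀ T T' : Matrix ι ι ℂ) (i j : ι) : Continuous fun x => (T' * (A x - A₀) * T) i j := by
  simp only [Matrix.mul_apply, Matrix.sub_apply]
  exact continuous_finsetSum _ fun k _ => (continuous_finsetSum _ fun l _ =>
    continuous_const.mul ((hA l k).sub continuous_const)).mul continuous_const

/-- Serves to move exponents off the imaginary axis by a shift smaller than the rate at which the
coefficients converge. -/
theorem exists_pos_avoid (a : ι → ℝ) {κ : ℝ} (hκ : 0 < κ) :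
    ∃ k, 0 < k ∧ k < κ ∧ ∀ i, a i + k ≠ 0 := by
  have hfin : (range fun i => -a i).Finite := finite_range _
  obtain ⟨k, hk, hk'⟩ := (Ioo_infinite hκ).exists_notMem_finite hfin
  exact ⟨k, hk.1, hk.2, fun i hi => hk' ⟨i, by linarith⟩⟩

theorem exists_pos_le_abs (a : ι → ℝ) (ha : ∀ i, a i ≠ 0) : ∃ k, 0 < k ∧ ∀ i, k ≤ |a i| := by
  classical
  rcases isEmpty_or_nonempty ι with h | h
  · exact ⟨1, one_pos, fun i => (h.false i).elim⟩
  · obtain ⟨i, hi⟩ := Finite.exists_min fun i => |a i|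
    exact ⟨|a i|, abs_pos.2 (ha i), hi⟩

/-- Every eigenvector of the limit of an exponentially convergent linear system is the
asymptotic direction of a solution. -/
theorem exists_asymptotic_solution [DecidableEq ι] {A : ℝ → Matrix ι ι ℂ} {Λ : ℝ}
    (hA : ∀ i j, Continuous fun x => A x i j) (hΛ : ∀ x i j, ‖A x i j‖ ≤ Λ)
    {A₀ T T' : Matrix ι ι ℂ} {a : ι → ℂ} (hT : T' * T = 1)
    (hAT : A₀ * T = T * Matrix.diagonal a) {C κ : ℝ} (hκ : 0 < κ)
    (hdecay : ∀ x, 0 ≤ x → ∀ i j, ‖A x i j - A₀ i j‖ ≤ C * Real.exp (-κ * x)) (k : ι) :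
    ∃ w : ℝ → ι → ℂ, (∀ x, HasDerivAt w ((A x).mulVec (w x)) x) ∧
      Tendsto (fun x : ℝ => Complex.exp (-a k * x) • w x) atTop (𝓝 fun i => T i k) := by
  obtain ⟨t, ht0, ht⟩ := exists_entry_bound T
  obtain ⟨t', ht0', ht'⟩ := exists_entry_bound T'
  have hC0 : 0 ≤ C := by
    have := (norm_nonneg _).trans (hdecay 0 le_rfl k k)
    simpa using this
  set R : ℝ → Matrix ι ι ℂ := fun x => T' * (A x - A₀) * T with hRdef
  set C₁ : ℝ := Fintype.card ι ^ 3 * t' * t * C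
  have hC₁ : 0 ≤ C₁ := by positivity
  have hR : ∀ x, 0 ≤ x → ∀ v, ‖(R x).mulVec v‖ ≤ C₁ * Real.exp (-κ * x) * ‖v‖ := by
    intro x hx v
    have := norm_conj_mulVec_le (m := C * Real.exp (-κ * x)) (by positivity) ht0 ht0'
      (fun i j => hdecay x hx i j) ht ht' v
    calc _ ≤ _ := this
      _ = _ := by ring
  have hRc : ∀ i j, Continuous fun x => R x i j := continuous_conj_entry hA A₀ T T'
  -- In eigencoordinates and relative to the rate a_k, the solution is sought as e_k + exp(-κ's) Y.
  -- Then Y has exponents a_j - a_k + κ', which must avoid the imaginary axis, while κ' < κ keeps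
  -- the forcing exp(κ's) R e_k decaying.
  obtain ⟨κ', hκ'0, hκ', hne⟩ := exists_pos_avoid (fun j => (a j - a k).re) hκ
  obtain ⟨κ₀, hκ₀, hb⟩ := exists_pos_le_abs (fun j => (a j - a k).re + κ') hne
  have hexp0 : Tendsto (fun X => C₁ * Real.exp (-κ * X)) atTop (𝓝 0) := by
    simpa using (Real.tendsto_exp_atBot.comp
      (tendsto_id.const_mul_atTop_of_neg (by linarith : -κ < 0))).const_mul C₁
  -- Starting late enough makes the perturbation smaller than the distance κ₀ of the exponents from
  -- the imaginary axis.
  obtain ⟨X, hX, hX0⟩ := ((hexp0.eventually (gt_mem_nhds hκ₀)).and (eventually_ge_atTop 0)).exists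
  set ek : ι → ℂ := Pi.single k 1
  set f : ℝ → ι → ℂ := fun s => Complex.exp (κ' * s) • (R (s + X)).mulVec ek with hfdef
  have hRX : ∀ i j, Continuous fun s => R (s + X) i j := fun i j =>
    (hRc i j).comp (g := fun x => R x i j) (f := fun s => s + X) (by fun_prop)
  have hfc : Continuous f :=
    (continuous_cexp_mul (κ' : ℂ)).smul (continuous_mulVec hRX continuous_const)
  have hf0 : Tendsto f atTop (𝓝 0) := by
    have h1 : Tendsto (fun s => C₁ * Real.exp ((κ' - κ) * s) * ‖ek‖) atTop (𝓝 0) := by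
      simpa using ((Real.tendsto_exp_atBot.comp
        (tendsto_id.const_mul_atTop_of_neg (by linarith : κ' - κ < 0))).const_mul C₁).mul_const ‖ek‖
    refine squeeze_zero_norm' ?_ h1
    filter_upwards [eventually_ge_atTop 0] with s hs
    rw [hfdef]
    simp only
    rw [norm_smul, norm_cexp_mul, Complex.ofReal_re]
    have h2 := hR (s + X) (by linarith) ek
    calc _ ≤ Real.exp (κ' * s) * (C₁ * Real.exp (-κ * (s + X)) * ‖ek‖) := by gcongr
      _ ≤ Real.exp (κ' * s) * (C₁ * Real.exp (-κ * s) * ‖ek‖) := by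
          gcongr _ * (_ * ?_ * _)
          rw [Real.exp_le_exp]; nlinarith
      _ = _ := by rw [show (κ' - κ) * s = κ' * s + -κ * s by ring, Real.exp_add]; ring
  obtain ⟨Y, hY0, -, hY⟩ := exists_tendsto_zero_solution (a := fun j => a j - a k + κ') hκ₀
    (fun j => by simpa using hb j) hRX (L := C₁ * Real.exp (-κ * X)) (by positivity) hX
    (fun s hs v => (hR (s + X) (by linarith) v).trans (by
      gcongr ?_ * _
      gcongr _ * ?_
      rw [Real.exp_le_exp]; nlinarith)) hfc hf0 0
  set Z : ℝ → ι → ℂ := fun s => ek + Complex.exp ((-κ' : ℂ) * s) • Y s with hZdef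
  have hZ : ∀ s, 0 ≤ s → HasDerivWithinAt Z
      (fun j => (a j - a k) * Z s j + (R (s + X)).mulVec (Z s) j) (Ici 0) s := by
    intro s hs
    refine (((hasDerivAt_cexp_mul (-κ' : ℂ) s).hasDerivWithinAt.smul (hY s hs)).const_add
      ek).congr_deriv ?_
    ext j
    have he : Complex.exp ((-κ' : ℂ) * s) * Complex.exp (κ' * s) = 1 := by
      rw [← Complex.exp_add]; simp
    have hk : (a j - a k) * ek j = 0 := by
      by_cases h : j = k
      · subst h; simp
      · simp [ek, h]
    simp only [hZdef, hfdef, Matrix.mulVec_add, Matrix.mulVec_smul, Pi.add_apply, Pi.smul_apply,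
      smul_eq_mul]
    linear_combination ((R (s + X)).mulVec ek j) * he - hk
  have hZlim : Tendsto Z atTop (𝓝 ek) := by
    have h1 : Tendsto (fun s : ℝ => Complex.exp ((-κ' : ℂ) * s) • Y s) atTop (𝓝 0) := by
      refine squeeze_zero_norm' ?_ (by simpa using hY0.norm)
      filter_upwards [eventually_ge_atTop 0] with s hs
      rw [norm_smul, norm_cexp_mul]
      refine mul_le_of_le_one_left (norm_nonneg _) (Real.exp_le_one_iff.2 ?_)
      simpa using mul_nonneg hκ'0.le hs
    simpa [hZdef] using h1.const_add ek
  set w₁ : ℝ → ι → ℂ := fun x => Complex.exp (a k * x) • T.mulVec (Z (x - X)) with hw₁def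
  have hTT : T * T' = 1 := mul_eq_one_comm.1 hT
  have hw₁ : ∀ x, X ≤ x → HasDerivWithinAt w₁ ((A x).mulVec (w₁ x)) (Ici X) x := by
    intro x hx
    have h1 := hasDerivWithinAt_comp_sub_Ici (x₀ := X) (hZ (x - X) (by linarith))
    have h2 : HasDerivWithinAt (fun x => T.mulVec (Z (x - X)))
        (T.mulVec fun j => (a j - a k) * Z (x - X) j + (R x).mulVec (Z (x - X)) j) (Ici X) x := by
      rw [sub_add_cancel] at h1
      rw [hasDerivWithinAt_pi] at h1 ⊢
      intro i
      simp only [Matrix.mulVec, dotProduct]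
      exact HasDerivWithinAt.fun_sum fun j _ => (h1 j).const_mul (T i j)
    refine ((hasDerivAt_cexp_mul (a k) x).hasDerivWithinAt.smul h2).congr_deriv ?_
    have h3 : ∀ v : ι → ℂ, (A x).mulVec (T.mulVec v) =
        T.mulVec (fun j => (a j - a k) * v j + (R x).mulVec v j) + a k • T.mulVec v := by
      intro v
      have e1 : (fun j => (a j - a k) * v j + (R x).mulVec v j) =
          (Matrix.diagonal a).mulVec v - a k • v + (R x).mulVec v := by
        ext j; simp [Matrix.mulVec_diagonal]; ring
      have e2 : A x * T = T * Matrix.diagonal a + T * R x := by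
        rw [← hAT, hRdef]
        simp only [← mul_assoc, hTT, one_mul]
        rw [sub_mul]; abel
      rw [e1, Matrix.mulVec_add, Matrix.mulVec_sub, Matrix.mulVec_smul, Matrix.mulVec_mulVec,
        Matrix.mulVec_mulVec, Matrix.mulVec_mulVec, e2, Matrix.add_mulVec]
      abel
    rw [hw₁def]
    simp only
    rw [Matrix.mulVec_smul, h3]
    module
  -- The solution built on [X, ∞) is continued to the left by linear solvability.
  obtain ⟨y, hy0, hy⟩ := exists_linear_solution hA hΛ X (w₁ X)
  refine ⟨fun x => if X ≤ x then w₁ x else y x, hasDerivAt_ite_of_Ici_Iic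
    (F := fun x v => (A x).mulVec v) hy0.symm hw₁ (fun x _ => (hy x).hasDerivWithinAt), ?_⟩
  have hlim : Tendsto (fun x => T.mulVec (Z (x - X))) atTop (𝓝 (T.mulVec ek)) := by
    have h1 : Tendsto (fun x => Z (x - X)) atTop (𝓝 ek) :=
      hZlim.comp (tendsto_atTop_add_const_right _ _ tendsto_id)
    exact ((continuous_const (y := T)).matrix_mulVec continuous_id).continuousAt.tendsto.comp h1
  have hTk : T.mulVec ek = fun i => T i k := by
    ext i; simp [ek, Matrix.mulVec_single]
  rw [← hTk]
  refine hlim.congr' ?_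
  filter_upwards [eventually_ge_atTop X] with x hx
  rw [if_pos hx, hw₁def]
  simp only
  rw [smul_smul, ← Complex.exp_add]
  simp

end Levinson

/-! ### Solutions of extremal decay: uniqueness and uniform asymptotics -/

section Backward

variable {ι : Type*} [Fintype ι]

open MeasureTheory in
/-- A Gronwall inequality from infinity for systems without decaying directions. -/
theorem norm_le_of_tendsto_zero {b : ι → ℂ} (hb : ∀ j, 0 ≤ (b j).re) {D φ : ℝ → ι → ℂ}
    (hφc : Continuous φ) (hD : ∀ x j, HasDerivAt (fun x => D x j) (b j * D x j + φ x j) x)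
    (hlim : Tendsto D atTop (𝓝 0)) {κ A C : ℝ} (hκ : 0 < κ) (hA : 0 ≤ A) (hC : 0 ≤ C)
    (hφ : ∀ x, 0 ≤ x → ‖φ x‖ ≤ Real.exp (-κ * x) * (A + C * ‖D x‖)) {x : ℝ} (hx : 0 ≤ x) :
    ‖D x‖ ≤ A * (Real.exp (C / κ) / κ) * Real.exp (-κ * x) := by
  have hDc : Continuous D := continuous_pi fun j =>
    continuous_iff_continuousAt.2 fun x => (hD x j).continuousAt
  obtain ⟨M, hM0, hM⟩ := exists_bound_of_tendsto_zero hDc hlim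
  set u : ℝ → ℝ := fun x => Real.exp (-κ * x) * (A + C * ‖D x‖) with hu
  have huc : Continuous u := by fun_prop
  have hu0 : ∀ x, 0 ≤ u x := fun x => by positivity
  have hui : IntegrableOn u (Ioi 0) := by
    have hi : IntegrableOn (fun y : ℝ => Real.exp (-κ * y) * (A + C * M)) (Ioi 0) :=
      (exp_neg_integrableOn_Ioi 0 hκ).mul_const _
    refine Integrable.mono' hi huc.aestronglyMeasurable.restrict
      ((ae_restrict_iff' measurableSet_Ioi).2 (ae_of_all _ fun y hy => ?_))
    rw [Real.norm_of_nonneg (hu0 y)]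
    simp only [hu]
    gcongr
    exact hM y (mem_Ioi.1 hy).le
  set I := ∫ y in Ioi (0 : ℝ), u y
  set h : ℝ → ℝ := fun x => I - ∫ y in (0 : ℝ)..x, u y with hh
  have hhd : ∀ x, HasDerivAt h (-u x) x := fun x =>
    (huc.integral_hasStrictDerivAt 0 x).hasDerivAt.const_sub I
  have hh0 : Tendsto h atTop (𝓝 0) := by
    have := (intervalIntegral_tendsto_integral_Ioi 0 hui tendsto_id).const_sub I
    simpa [h, I] using this
  -- Variation of constants from X back to x: since Re b ≥ 0 the kernel has modulus at most 1, and
  -- the boundary term D(X) disappears as X → ∞.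
  have hDh : ∀ x, 0 ≤ x → ‖D x‖ ≤ h x := by
    intro x hx
    have hle : ∀ X, x ≤ X → ∀ j, ‖D x j‖ ≤ ‖D X‖ + (h x - h X) := by
      intro X hX j
      set G : ℝ → ℂ := fun y => Complex.exp (-b j * y) * D y j
      have hG : ∀ y : ℝ, HasDerivAt G (Complex.exp (-b j * y) * φ y j) y := fun y =>
        ((hasDerivAt_cexp_mul (-b j) y).mul (hD y j)).congr_deriv (by ring)
      have hGc : Continuous fun y : ℝ => Complex.exp (-b j * y) * φ y j :=
        (continuous_cexp_mul _).mul ((continuous_apply j).comp hφc)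
      have hint := intervalIntegral.integral_eq_sub_of_hasDerivAt (a := x) (b := X)
        (fun y _ => hG y) (hGc.intervalIntegrable _ _)
      have hDx : D x j = Complex.exp (b j * x) * Complex.exp (-b j * X) * D X j -
          Complex.exp (b j * x) * ∫ y in x..X, Complex.exp (-b j * y) * φ y j := by
        have he : Complex.exp (b j * x) * Complex.exp (-b j * x) = 1 := by
          rw [← Complex.exp_add]; simp
        rw [hint]
        simp only [G]
        linear_combination (-D x j) * he
      have hle1 : ∀ y : ℝ, x ≤ y → ‖Complex.exp (b j * x) * Complex.exp (-b j * y)‖ ≤ 1 := by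
        intro y hy
        rw [norm_mul, norm_cexp_mul, norm_cexp_mul, ← Real.exp_add, Real.exp_le_one_iff,
          Complex.neg_re]
        nlinarith [hb j]
      have hhx : h x - h X = ∫ y in x..X, u y := by
        simp only [hh]
        rw [← intervalIntegral.integral_add_adjacent_intervals (huc.intervalIntegrable 0 x)
          (huc.intervalIntegrable x X)]
        ring
      rw [hDx, hhx, ← intervalIntegral.integral_const_mul]
      refine (norm_sub_le _ _).trans (add_le_add ?_ ?_)
      · rw [norm_mul]
        exact (mul_le_of_le_one_left (norm_nonneg _) (hle1 X hX)).trans (norm_le_pi_norm _ j)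
      · refine intervalIntegral.norm_integral_le_of_norm_le hX (ae_of_all _ fun y hy => ?_)
          (huc.intervalIntegrable _ _)
        rw [← mul_assoc, norm_mul]
        exact (mul_le_of_le_one_left (norm_nonneg _) (hle1 y hy.1.le)).trans
          ((norm_le_pi_norm _ j).trans (hφ y (hx.trans hy.1.le)))
    have hX0 : Tendsto (fun X => ‖D X‖ + (h x - h X)) atTop (𝓝 (h x)) := by
      simpa using hlim.norm.add (hh0.const_sub (h x))
    have hhx0 : 0 ≤ h x := ge_of_tendsto hX0 (by
      filter_upwards [eventually_ge_atTop x] with X hX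
      have hmono : h X ≤ h x := by
        simp only [hh]
        have := intervalIntegral.integral_nonneg (μ := volume) hX fun y _ => hu0 y
        rw [← intervalIntegral.integral_add_adjacent_intervals (huc.intervalIntegrable 0 x)
          (huc.intervalIntegrable x X)]
        linarith
      have := norm_nonneg (D X)
      linarith)
    rw [pi_norm_le_iff_of_nonneg hhx0]
    intro j
    exact ge_of_tendsto hX0 (by
      filter_upwards [eventually_ge_atTop x] with X hX using hle X hX j)
  have hexp0 : Tendsto (fun x => Real.exp (-κ * x)) atTop (𝓝 0) :=
    Real.tendsto_exp_atBot.comp (tendsto_id.const_mul_atTop_of_neg (by linarith : -κ < 0))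
  have hexpd : ∀ x, HasDerivAt (fun x => Real.exp (-κ * x)) (-κ * Real.exp (-κ * x)) x := by
    intro x
    have := ((hasDerivAt_id x).const_mul (-κ)).exp
    simpa [mul_comm] using this
  -- Integrating factor for h' = -u with u ≤ exp(-κx)(A + C h): m is nondecreasing with limit A,
  -- which bounds A + C h by A exp(C/κ).
  set m : ℝ → ℝ := fun x => (A + C * h x) * Real.exp (-(C / κ) * Real.exp (-κ * x)) with hm
  have hmd : ∀ x, HasDerivAt m (C * (Real.exp (-κ * x) * (A + C * h x) - u x) *
      Real.exp (-(C / κ) * Real.exp (-κ * x))) x := by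
    intro x
    have h1 := (((hhd x).const_mul C).const_add A).mul ((hexpd x).const_mul (-(C / κ))).exp
    refine h1.congr_deriv ?_
    field_simp
    ring
  have hmono : MonotoneOn m (Ici 0) := by
    refine monotoneOn_of_deriv_nonneg (convex_Ici 0)
      (fun x _ => (hmd x).continuousAt.continuousWithinAt)
      (fun x _ => (hmd x).differentiableAt.differentiableWithinAt) fun x hx => ?_
    rw [interior_Ici] at hx
    rw [(hmd x).deriv]
    have h1 : u x ≤ Real.exp (-κ * x) * (A + C * h x) := by
      simp only [hu]
      gcongr
      exact hDh x (mem_Ioi.1 hx).le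
    have h2 := Real.exp_pos (-(C / κ) * Real.exp (-κ * x))
    exact mul_nonneg (mul_nonneg hC (by linarith)) h2.le
  have hmlim : Tendsto m atTop (𝓝 A) := by
    have h1 : Tendsto (fun x => Real.exp (-(C / κ) * Real.exp (-κ * x))) atTop (𝓝 1) := by
      have := (Real.continuous_exp.tendsto _).comp (hexp0.const_mul (-(C / κ)))
      simpa [Function.comp_def] using this
    simpa [hm] using ((hh0.const_mul C).const_add A).mul h1
  have hmA : ∀ x, 0 ≤ x → A + C * h x ≤ A * Real.exp (C / κ) := by
    intro x hx
    have h1 : m x ≤ A := ge_of_tendsto hmlim (by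
      filter_upwards [eventually_ge_atTop x] with X hX
      exact hmono hx (hx.trans hX) hX)
    have h2 : A + C * h x = m x * Real.exp ((C / κ) * Real.exp (-κ * x)) := by
      simp only [hm]
      rw [mul_assoc, ← Real.exp_add]
      simp
    rw [h2]
    have h3 : Real.exp (-κ * x) ≤ 1 := Real.exp_le_one_iff.2 (by nlinarith)
    calc _ ≤ A * Real.exp ((C / κ) * Real.exp (-κ * x)) := by gcongr
      _ ≤ A * Real.exp (C / κ) := by
          gcongr
          exact mul_le_of_le_one_right (by positivity) h3
  -- With A + C h bounded, h decreases no faster than the exponential comparison function; their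
  -- difference is nonincreasing with limit 0, hence nonnegative.
  set n : ℝ → ℝ := fun x => A * (Real.exp (C / κ) / κ) * Real.exp (-κ * x) - h x with hn
  have hnd : ∀ x, HasDerivAt n (u x - A * Real.exp (C / κ) * Real.exp (-κ * x)) x := by
    intro x
    refine (((hexpd x).const_mul (A * (Real.exp (C / κ) / κ))).sub (hhd x)).congr_deriv ?_
    field_simp
    ring
  have hanti : AntitoneOn n (Ici 0) := by
    refine antitoneOn_of_deriv_nonpos (convex_Ici 0)
      (fun x _ => (hnd x).continuousAt.continuousWithinAt)
      (fun x _ => (hnd x).differentiableAt.differentiableWithinAt) fun x hx => ?_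
    rw [interior_Ici] at hx
    have hx' := (mem_Ioi.1 hx).le
    rw [(hnd x).deriv, sub_nonpos]
    simp only [hu]
    rw [mul_comm]
    gcongr
    exact (add_le_add_right (mul_le_mul_of_nonneg_left (hDh x hx') hC) A).trans (hmA x hx')
  have hnlim : Tendsto n atTop (𝓝 0) := by
    simpa [hn] using (hexp0.const_mul (A * (Real.exp (C / κ) / κ))).sub hh0
  have hn0 : 0 ≤ n x := le_of_tendsto hnlim (by
    filter_upwards [eventually_ge_atTop x] with X hX
    exact hanti hx (hx.trans hX) hX)
  have := hDh x hx
  simp only [hn] at hn0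
  linarith

theorem tendsto_mulVec {α : Type*} {l : Filter α} {T : α → Matrix ι ι ℂ} {T₀ : Matrix ι ι ℂ}
    (hT : Tendsto T l (𝓝 T₀)) {v : α → ι → ℂ} {v₀ : ι → ℂ} (hv : Tendsto v l (𝓝 v₀)) :
    Tendsto (fun x => (T x).mulVec (v x)) l (𝓝 (T₀.mulVec v₀)) :=
  tendsto_pi_nhds.2 fun i => tendsto_finsetSum _ fun j _ =>
    (tendsto_pi_nhds.1 (tendsto_pi_nhds.1 hT i) j).mul (tendsto_pi_nhds.1 hv j)

theorem continuous_of_hasDerivAt {w : ℝ → ι → ℂ} {w' : ℝ → ι → ℂ}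
    (hw : ∀ x, HasDerivAt w (w' x) x) : Continuous w :=
  continuous_iff_continuousAt.2 fun x => (hw x).continuousAt

theorem continuous_mulVec_cexp_smul (T : Matrix ι ι ℂ) (b : ℂ) {w w' : ℝ → ι → ℂ}
    (hw : ∀ x, HasDerivAt w (w' x) x) :
    Continuous fun x : ℝ => T.mulVec (Complex.exp (b * x) • w x) := by
  have h : Continuous fun x : ℝ => Complex.exp (b * x) • w x :=
    (continuous_cexp_mul b).smul (continuous_of_hasDerivAt hw)
  exact continuous_mulVec (A := fun _ => T) (fun _ _ => continuous_const) h

theorem exists_eventually_entry_bound {T : ℂ → Matrix ι ι ℂ} (hT : ContinuousAt T 0) :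
    ∃ t, 0 ≤ t ∧ ∀ᶠ z in 𝓝 0, ∀ i j, ‖T z i j‖ ≤ t := by
  obtain ⟨t, ht0, ht⟩ := exists_entry_bound (T 0)
  refine ⟨t + 1, by positivity, ?_⟩
  rw [eventually_all]; intro i
  rw [eventually_all]; intro j
  have h1 : Tendsto (fun z => ‖T z i j‖) (𝓝 0) (𝓝 ‖T 0 i j‖) :=
    (tendsto_pi_nhds.1 (tendsto_pi_nhds.1 hT i) j).norm
  filter_upwards [h1.eventually (gt_mem_nhds (lt_of_le_of_lt (ht i j) (lt_add_one t)))] with z hz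
  exact hz.le

variable [DecidableEq ι]

/-- Data of an exponentially convergent linear system with a diagonalizable limit. -/
structure DiagLimit (A : ℝ → Matrix ι ι ℂ) (A₀ T T' : Matrix ι ι ℂ) (a : ι → ℂ) (k : ι)
    (C κ : ℝ) : Prop where
  cont : ∀ i j, Continuous fun x => A x i j
  inv : T' * T = 1
  diag : A₀ * T = T * Matrix.diagonal a
  min : ∀ j, (a k).re ≤ (a j).re
  pos : 0 < κ
  decay : ∀ x, 0 ≤ x → ∀ i j, ‖A x i j - A₀ i j‖ ≤ C * Real.exp (-κ * x)

namespace DiagLimit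

variable {A : ℝ → Matrix ι ι ℂ} {A₀ T T' : Matrix ι ι ℂ} {a : ι → ℂ} {k : ι} {C κ : ℝ}

theorem nonneg (h : DiagLimit A A₀ T T' a k C κ) : 0 ≤ C := by
  have := (norm_nonneg _).trans (h.decay 0 le_rfl k k)
  simpa using this

/-- The equation in eigencoordinates, with the rate of the `k`-th direction removed. -/
theorem hasDerivAt_coord (h : DiagLimit A A₀ T T' a k C κ) {w : ℝ → ι → ℂ}
    (hw : ∀ x, HasDerivAt w ((A x).mulVec (w x)) x) (x : ℝ) (j : ι) :
    HasDerivAt (fun x : ℝ => T'.mulVec (Complex.exp (-a k * x) • w x) j)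
      ((a j - a k) * T'.mulVec (Complex.exp (-a k * x) • w x) j +
        (T' * (A x - A₀) * T).mulVec (T'.mulVec (Complex.exp (-a k * x) • w x)) j) x := by
  have hTT : T * T' = 1 := mul_eq_one_comm.1 h.inv
  have h1 : HasDerivAt (fun x : ℝ => Complex.exp (-a k * x) • w x)
      ((A x).mulVec (Complex.exp (-a k * x) • w x) - a k • Complex.exp (-a k * x) • w x) x := by
    refine ((hasDerivAt_cexp_mul (-a k) x).smul (hw x)).congr_deriv ?_
    rw [Matrix.mulVec_smul]
    module
  set v := Complex.exp (-a k * x) • w x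
  have h2 : HasDerivAt (fun x : ℝ => T'.mulVec (Complex.exp (-a k * x) • w x) j)
      (T'.mulVec ((A x).mulVec v - a k • v) j) x := by
    rw [hasDerivAt_pi] at h1
    simp only [Matrix.mulVec, dotProduct]
    exact HasDerivAt.fun_sum fun i _ => (h1 i).const_mul (T' j i)
  refine h2.congr_deriv ?_
  have h3 : T' * A₀ = Matrix.diagonal a * T' := by
    calc T' * A₀ = T' * A₀ * (T * T') := by rw [hTT, mul_one]
      _ = T' * (A₀ * T) * T' := by simp only [mul_assoc]
      _ = Matrix.diagonal a * T' := by rw [h.diag, ← mul_assoc, h.inv, one_mul]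
  have h4 : T' * A x = T' * (A x - A₀) * T * T' + Matrix.diagonal a * T' := by
    rw [mul_assoc _ T, hTT, mul_one, ← h3, mul_sub]; abel
  rw [Matrix.mulVec_sub, Matrix.mulVec_mulVec, h4, Matrix.add_mulVec, ← Matrix.mulVec_mulVec,
    ← Matrix.mulVec_mulVec _ (Matrix.diagonal a), Matrix.mulVec_smul T' (a k) v]
  simp only [Pi.add_apply, Pi.sub_apply, Pi.smul_apply, smul_eq_mul, Matrix.mulVec_diagonal]
  ring

theorem norm_conj_le (h : DiagLimit A A₀ T T' a k C κ) {t : ℝ} (ht0 : 0 ≤ t)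
    (ht : ∀ i j, ‖T i j‖ ≤ t) (ht' : ∀ i j, ‖T' i j‖ ≤ t) {x : ℝ} (hx : 0 ≤ x) (v : ι → ℂ) :
    ‖(T' * (A x - A₀) * T).mulVec v‖ ≤
      Real.exp (-κ * x) * (Fintype.card ι ^ 3 * t * t * C * ‖v‖) := by
  have h0 := h.nonneg
  refine (norm_conj_mulVec_le (m := C * Real.exp (-κ * x)) (by positivity) ht0 ht0
    (fun i j => h.decay x hx i j) ht ht' v).trans (le_of_eq (by ring))

/-- Solutions of extremal decay rate are determined by their asymptotics. -/
theorem unique (h : DiagLimit A A₀ T T' a k C κ) {w₁ w₂ : ℝ → ι → ℂ} {v : ι → ℂ}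
    (hw₁ : ∀ x, HasDerivAt w₁ ((A x).mulVec (w₁ x)) x)
    (hw₂ : ∀ x, HasDerivAt w₂ ((A x).mulVec (w₂ x)) x)
    (hv₁ : Tendsto (fun x : ℝ => Complex.exp (-a k * x) • w₁ x) atTop (𝓝 v))
    (hv₂ : Tendsto (fun x : ℝ => Complex.exp (-a k * x) • w₂ x) atTop (𝓝 v))
    {x : ℝ} (hx : 0 ≤ x) : w₁ x = w₂ x := by
  have hTT : T * T' = 1 := mul_eq_one_comm.1 h.inv
  obtain ⟨t₁, ht₁0, ht₁⟩ := exists_entry_bound T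
  obtain ⟨t₂, ht₂0, ht₂⟩ := exists_entry_bound T'
  have hw : ∀ x, HasDerivAt (fun x => w₁ x - w₂ x) ((A x).mulVec (w₁ x - w₂ x)) x := fun x => by
    rw [Matrix.mulVec_sub]; exact (hw₁ x).sub (hw₂ x)
  set D : ℝ → ι → ℂ := fun x => T'.mulVec (Complex.exp (-a k * x) • (w₁ x - w₂ x)) with hD
  have hDc : Continuous D := continuous_mulVec_cexp_smul _ _ hw
  have hlim : Tendsto D atTop (𝓝 0) := by
    have := tendsto_mulVec (tendsto_const_nhds (x := T')) (hv₁.sub hv₂)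
    simpa [D, smul_sub] using this
  have h0 := h.nonneg
  have key := norm_le_of_tendsto_zero (b := fun j => a j - a k) (D := D)
    (φ := fun x => (T' * (A x - A₀) * T).mulVec (D x)) (A := 0)
    (C := Fintype.card ι ^ 3 * max t₁ t₂ * max t₁ t₂ * C)
    (fun j => by simpa using h.min j)
    (continuous_mulVec (continuous_conj_entry h.cont _ _ _) hDc)
    (fun x j => h.hasDerivAt_coord hw x j) hlim h.pos le_rfl (by positivity) (fun x hx => by
      rw [zero_add]
      exact h.norm_conj_le (le_max_of_le_left ht₁0) (fun i j => (ht₁ i j).trans (le_max_left _ _))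
        (fun i j => (ht₂ i j).trans (le_max_right _ _)) hx _) hx
  rw [zero_mul, zero_mul, norm_le_zero_iff] at key
  have h1 : T.mulVec (D x) = 0 := by rw [key, Matrix.mulVec_zero]
  rw [hD] at h1
  simp only at h1
  rw [Matrix.mulVec_mulVec, hTT, Matrix.one_mulVec, smul_eq_zero] at h1
  exact sub_eq_zero.1 (h1.resolve_left (Complex.exp_ne_zero _))

/-- Uniform asymptotics of a solution of extremal decay rate. -/
theorem norm_coord_sub_le (h : DiagLimit A A₀ T T' a k C κ) {w : ℝ → ι → ℂ}
    (hw : ∀ x, HasDerivAt w ((A x).mulVec (w x)) x)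
    (hv : Tendsto (fun x : ℝ => Complex.exp (-a k * x) • w x) atTop (𝓝 fun i => T i k))
    {t : ℝ} (ht0 : 0 ≤ t)
    (ht : ∀ i j, ‖T i j‖ ≤ t) (ht' : ∀ i j, ‖T' i j‖ ≤ t) {x : ℝ} (hx : 0 ≤ x) :
    ‖T'.mulVec (Complex.exp (-a k * x) • w x) - Pi.single k 1‖ ≤
      Fintype.card ι ^ 3 * t * t * C * (Real.exp (Fintype.card ι ^ 3 * t * t * C / κ) / κ) *
        Real.exp (-κ * x) := by
  set Y : ℝ → ι → ℂ := fun x => T'.mulVec (Complex.exp (-a k * x) • w x) with hY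
  have hYc : Continuous Y := continuous_mulVec_cexp_smul _ _ hw
  have h0 := h.nonneg
  have hTk : T'.mulVec (fun i => T i k) = Pi.single k 1 := by
    ext i
    have : (T' * T) i k = (1 : Matrix ι ι ℂ) i k := by rw [h.inv]
    rw [Matrix.mul_apply] at this
    simp only [Matrix.mulVec, dotProduct, this, Matrix.one_apply, Pi.single_apply]
  have hlim : Tendsto (fun x => Y x - Pi.single k 1) atTop (𝓝 0) := by
    have := (tendsto_mulVec (tendsto_const_nhds (x := T')) hv).sub_const (Pi.single k (1 : ℂ))
    rwa [hTk, sub_self] at this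
  refine norm_le_of_tendsto_zero (b := fun j => a j - a k) (D := fun x => Y x - Pi.single k 1)
    (φ := fun x => (T' * (A x - A₀) * T).mulVec (Y x))
    (fun j => by simpa using h.min j)
    (continuous_mulVec (continuous_conj_entry h.cont _ _ _) hYc)
    (fun x j => ?_) hlim h.pos (by positivity) (by positivity) (fun x hx => ?_) hx
  · refine ((h.hasDerivAt_coord hw x j).sub_const (Pi.single (M := fun _ => ℂ) k 1 j)).congr_deriv ?_
    by_cases hj : j = k
    · subst hj; simp [Y]
    · simp [hj, Y]
  · refine (h.norm_conj_le ht0 ht ht' hx _).trans ?_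
    have h1 : ‖Y x‖ ≤ 1 + ‖Y x - Pi.single k 1‖ := by
      have h2 : ‖(Pi.single k 1 : ι → ℂ)‖ ≤ 1 := by
        rw [pi_norm_le_iff_of_nonneg zero_le_one]
        intro i
        by_cases hi : i = k
        · subst hi; simp
        · simp [hi]
      calc ‖Y x‖ = ‖Pi.single k 1 + (Y x - Pi.single k 1)‖ := by rw [add_sub_cancel]
        _ ≤ _ := (norm_add_le _ _).trans (by gcongr)
    gcongr
    calc _ ≤ Fintype.card ι ^ 3 * t * t * C * (1 + ‖Y x - Pi.single k 1‖) := by gcongr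
      _ = _ := by ring

theorem mulVec_coord (h : DiagLimit A A₀ T T' a k C κ) (w : ι → ℂ) (x : ℝ) :
    Complex.exp (a k * x) • T.mulVec (T'.mulVec (Complex.exp (-a k * x) • w)) = w := by
  have hTT : T * T' = 1 := mul_eq_one_comm.1 h.inv
  rw [Matrix.mulVec_mulVec, hTT, Matrix.one_mulVec, smul_smul, ← Complex.exp_add]
  simp

end DiagLimit

/-! ### Dependence of extremal solutions on the spectral parameter -/

section Family

variable {A : ℂ → ℝ → Matrix ι ι ℂ} {A₀ T T' : ℂ → Matrix ι ι ℂ} {a : ℂ → ι → ℂ} {k : ι}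
  {C κ : ℝ} {w : ℂ → ℝ → ι → ℂ}

/-- Uniform decay of a family of solutions of extremal decay rate. -/
theorem exists_norm_le_exp
    (h : ∀ᶠ z in 𝓝 0, DiagLimit (A z) (A₀ z) (T z) (T' z) (a z) k C κ)
    (hT : ContinuousAt T 0) (hT' : ContinuousAt T' 0)
    (hw : ∀ᶠ z in 𝓝 0, ∀ x, HasDerivAt (w z) ((A z x).mulVec (w z x)) x)
    (hv : ∀ᶠ z in 𝓝 0, Tendsto (fun x : ℝ => Complex.exp (-a z k * x) • w z x) atTop
      (𝓝 fun i => T z i k)) :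
    ∃ K, 0 ≤ K ∧ ∀ᶠ z in 𝓝 0, ∀ x, 0 ≤ x → ‖w z x‖ ≤ K * Real.exp ((a z k).re * x) := by
  obtain ⟨t₁, ht₁0, ht₁⟩ := exists_eventually_entry_bound hT
  obtain ⟨t₂, ht₂0, ht₂⟩ := exists_eventually_entry_bound hT'
  set t := max t₁ t₂
  have ht0 : 0 ≤ t := le_max_of_le_left ht₁0
  set K := Fintype.card ι ^ 3 * t * t * C * (Real.exp (Fintype.card ι ^ 3 * t * t * C / κ) / κ)
  have hC := h.self_of_nhds.nonneg
  have hκ := h.self_of_nhds.pos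
  have hK : 0 ≤ K := by positivity
  refine ⟨Fintype.card ι * t * (1 + K), by positivity, ?_⟩
  filter_upwards [h, hw, hv, ht₁, ht₂] with z hz hwz hvz h₁ h₂ x hx
  have hb := hz.norm_coord_sub_le hwz hvz ht0 (fun i j => (h₁ i j).trans (le_max_left _ _))
    (fun i j => (h₂ i j).trans (le_max_right _ _)) hx
  rw [← hz.mulVec_coord (w z x) x, norm_smul, norm_cexp_mul, mul_comm]
  set Y := (T' z).mulVec (Complex.exp (-a z k * x) • w z x)
  have h2 : ‖(Pi.single k 1 : ι → ℂ)‖ ≤ 1 := by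
    rw [pi_norm_le_iff_of_nonneg zero_le_one]
    intro i
    by_cases hi : i = k
    · subst hi; simp
    · simp [hi]
  have h3 : ‖Y‖ ≤ 1 + K := by
    calc ‖Y‖ = ‖Pi.single k 1 + (Y - Pi.single k 1)‖ := by rw [add_sub_cancel]
      _ ≤ 1 + K * Real.exp (-κ * x) := (norm_add_le _ _).trans (by gcongr)
      _ ≤ 1 + K * 1 := by
          gcongr
          exact Real.exp_le_one_iff.2 (by nlinarith)
      _ = _ := by ring
  gcongr
  refine (norm_mulVec_le_of_entry_le ht0 (fun i j => (h₁ i j).trans (le_max_left _ _)) _).trans ?_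
  gcongr

theorem conj_sub_conj (B B₀ S S₀ S' S₀' : Matrix ι ι ℂ) :
    S' * B * S - S₀' * B₀ * S₀ =
      (S' - S₀') * B * S + S₀' * (B - B₀) * S + S₀' * B₀ * (S - S₀) := by
  noncomm_ring

/-- Continuity in the parameter of a family of solutions of extremal decay rate. -/
theorem tendsto_extremal
    (h : ∀ᶠ z in 𝓝 0, DiagLimit (A z) (A₀ z) (T z) (T' z) (a z) k C κ)
    (hT : ContinuousAt T 0) (hT' : ContinuousAt T' 0) (ha : ContinuousAt a 0)
    (hdiff : ∀ᶠ z in 𝓝 0, ∀ x, 0 ≤ x → ∀ i j,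
      ‖((A z x - A₀ z) - (A 0 x - A₀ 0)) i j‖ ≤ ‖z‖ * C * Real.exp (-κ * x))
    (hw : ∀ᶠ z in 𝓝 0, ∀ x, HasDerivAt (w z) ((A z x).mulVec (w z x)) x)
    (hv : ∀ᶠ z in 𝓝 0, Tendsto (fun x : ℝ => Complex.exp (-a z k * x) • w z x) atTop
      (𝓝 fun i => T z i k)) {x : ℝ} (hx : 0 ≤ x) :
    Tendsto (fun z => w z x) (𝓝 0) (𝓝 (w 0 x)) := by
  obtain ⟨t₁, ht₁0, ht₁⟩ := exists_eventually_entry_bound hT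
  obtain ⟨t₂, ht₂0, ht₂⟩ := exists_eventually_entry_bound hT'
  set t := max t₁ t₂
  have ht0 : 0 ≤ t := le_max_of_le_left ht₁0
  have hTt : ∀ᶠ z in 𝓝 0, ∀ i j, ‖T z i j‖ ≤ t := by
    filter_upwards [ht₁] with z hz i j using (hz i j).trans (le_max_left _ _)
  have hTt' : ∀ᶠ z in 𝓝 0, ∀ i j, ‖T' z i j‖ ≤ t := by
    filter_upwards [ht₂] with z hz i j using (hz i j).trans (le_max_right _ _)
  have h0 := h.self_of_nhds
  have hw0 := hw.self_of_nhds
  have hv0 := hv.self_of_nhds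
  have hC := h0.nonneg
  have hκ := h0.pos
  set n : ℝ := Fintype.card ι ^ 3
  set K := n * t * t * C * (Real.exp (n * t * t * C / κ) / κ)
  have hn : 0 ≤ n := by positivity
  have hK : 0 ≤ K := by positivity
  set Y : ℂ → ℝ → ι → ℂ := fun z x => (T' z).mulVec (Complex.exp (-a z k * x) • w z x) with hY
  have hY0 : ∀ x, 0 ≤ x → ‖Y 0 x - Pi.single k 1‖ ≤ K * Real.exp (-κ * x) := fun x hx =>
    h0.norm_coord_sub_le hw0 hv0 ht0 hTt.self_of_nhds hTt'.self_of_nhds hx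
  have hsingle : ‖(Pi.single k 1 : ι → ℂ)‖ ≤ 1 := by
    rw [pi_norm_le_iff_of_nonneg zero_le_one]
    intro i
    by_cases hi : i = k
    · subst hi; simp
    · simp [hi]
  have hY0' : ∀ x, 0 ≤ x → ‖Y 0 x‖ ≤ 1 + K := by
    intro x hx
    calc ‖Y 0 x‖ = ‖Pi.single k 1 + (Y 0 x - Pi.single k 1)‖ := by rw [add_sub_cancel]
      _ ≤ 1 + K * Real.exp (-κ * x) := (norm_add_le _ _).trans (add_le_add hsingle (hY0 x hx))
      _ ≤ 1 + K * 1 := by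
          gcongr
          exact Real.exp_le_one_iff.2 (by nlinarith)
      _ = _ := by ring
  set S : (ℂ → Matrix ι ι ℂ) → ℂ → ℝ := fun T z => ∑ i, ∑ j, ‖T z i j - T 0 i j‖ with hS
  have hS0 : ∀ T z, 0 ≤ S T z := fun T z => by positivity
  have hSle : ∀ T z i j, ‖(T z - T 0) i j‖ ≤ S T z := by
    intro T z i j
    calc ‖(T z - T 0) i j‖ ≤ ∑ j, ‖T z i j - T 0 i j‖ :=
          Finset.single_le_sum (f := fun j => ‖T z i j - T 0 i j‖) (fun _ _ => norm_nonneg _)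
            (Finset.mem_univ j)
      _ ≤ _ := Finset.single_le_sum (f := fun i => ∑ j, ‖T z i j - T 0 i j‖)
          (fun _ _ => Finset.sum_nonneg fun _ _ => norm_nonneg _) (Finset.mem_univ i)
  have hSt : ∀ T : ℂ → Matrix ι ι ℂ, ContinuousAt T 0 → Tendsto (S T) (𝓝 0) (𝓝 0) := by
    intro T hT
    have : Tendsto (S T) (𝓝 0) (𝓝 (∑ i, ∑ j, ‖T 0 i j - T 0 i j‖)) :=
      tendsto_finsetSum _ fun i _ => tendsto_finsetSum _ fun j _ =>
        ((tendsto_pi_nhds.1 (tendsto_pi_nhds.1 hT i) j).sub_const _).norm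
    simpa using this
  set β : ℂ → ℝ := fun z => 2 * ‖a z - a 0‖
  have hβ : Tendsto β (𝓝 0) (𝓝 0) := by
    have : Tendsto β (𝓝 0) (𝓝 (2 * ‖a 0 - a 0‖)) := (ha.tendsto.sub_const _).norm.const_mul 2
    simpa using this
  -- Gathers all discrepancies between z and 0: those of the eigenvalues, of the eigenvector
  -- matrices and their inverses, and of the coefficients. It tends to 0 with z.
  set Q : ℂ → ℝ := fun z => β z * K +
    (n * S T' z * t * C + n * t * t * (‖z‖ * C) + n * t * S T z * C) * (1 + K) with hQ
  have hQt : Tendsto Q (𝓝 0) (𝓝 0) := by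
    have h1 : Tendsto (fun z : ℂ => ‖z‖) (𝓝 0) (𝓝 0) := by
      simpa using (continuous_norm (E := ℂ)).tendsto 0
    have := (hβ.mul_const K).add ((((((hSt T' hT').const_mul n).mul_const t).mul_const C).add
      ((h1.mul_const C).const_mul (n * t * t))).add
      (((hSt T hT).const_mul (n * t)).mul_const C) |>.mul_const (1 + K))
    simpa [hQ] using this
  have hYz : ∀ᶠ z in 𝓝 0, ‖Y z x - Y 0 x‖ ≤
      Q z * (Real.exp (n * t * t * C / κ) / κ) * Real.exp (-κ * x) := by
    filter_upwards [h, hw, hv, hTt, hTt', hdiff] with z hz hwz hvz htz htz' hdz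
    set Rz : ℝ → Matrix ι ι ℂ := fun x => T' z * (A z x - A₀ z) * T z
    set R0 : ℝ → Matrix ι ι ℂ := fun x => T' 0 * (A 0 x - A₀ 0) * T 0
    have hYzc : Continuous (Y z) := continuous_mulVec_cexp_smul _ _ hwz
    have hY0c : Continuous (Y 0) := continuous_mulVec_cexp_smul _ _ hw0
    have hQ0 : 0 ≤ Q z := by
      have := hS0 T z
      have := hS0 T' z
      positivity
    have hTk : ∀ z, DiagLimit (A z) (A₀ z) (T z) (T' z) (a z) k C κ →
        (T' z).mulVec (fun i => T z i k) = Pi.single k 1 := by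
      intro z hz
      ext i
      have : (T' z * T z) i k = (1 : Matrix ι ι ℂ) i k := by rw [hz.inv]
      rw [Matrix.mul_apply] at this
      simp only [Matrix.mulVec, dotProduct, this, Matrix.one_apply, Pi.single_apply]
    -- The eigenvalue discrepancy would act on Y 0, which does not decay. Its k-th entry vanishes,
    -- so e_k may be subtracted from Y 0 for free, and Y 0 - e_k decays exponentially, as the
    -- Gronwall estimate from infinity requires.
    refine norm_le_of_tendsto_zero (b := fun j => a z j - a z k) (D := fun x => Y z x - Y 0 x)
      (φ := fun x => ((fun j => (a z j - a z k) - (a 0 j - a 0 k)) * (Y 0 x - Pi.single k 1)) +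
        ((Rz x).mulVec (Y z x) - (R0 x).mulVec (Y 0 x)))
      (fun j => by simpa using hz.min j) ?_ (fun x j => ?_) ?_ hκ hQ0 (by positivity)
      (fun x hx => ?_) hx
    · exact (continuous_const.mul (hY0c.sub continuous_const)).add
        ((continuous_mulVec (continuous_conj_entry hz.cont _ _ _) hYzc).sub
        (continuous_mulVec (continuous_conj_entry h0.cont _ _ _) hY0c))
    · refine ((hz.hasDerivAt_coord hwz x j).sub (h0.hasDerivAt_coord hw0 x j)).congr_deriv ?_
      have hs : ((a z j - a z k) - (a 0 j - a 0 k)) * Pi.single (M := fun _ => ℂ) k 1 j = 0 := by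
        by_cases hj : j = k
        · subst hj; simp
        · simp [hj]
      simp only [Pi.add_apply, Pi.sub_apply, Pi.mul_apply]
      linear_combination hs
    · have h1 := tendsto_mulVec (tendsto_const_nhds (x := T' z)) hvz
      have h2 := tendsto_mulVec (tendsto_const_nhds (x := T' 0)) hv0
      rw [hTk z hz] at h1
      rw [hTk 0 h0] at h2
      simpa [hY] using h1.sub h2
    · have hE := Real.exp_pos (-κ * x)
      have e1 : ‖(fun j => (a z j - a z k) - (a 0 j - a 0 k)) * (Y 0 x - Pi.single k 1)‖ ≤
          β z * (K * Real.exp (-κ * x)) := by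
        refine (norm_mul_le _ _).trans ?_
        gcongr
        · rw [pi_norm_le_iff_of_nonneg (by positivity)]
          intro j
          have h1 := norm_le_pi_norm (a z - a 0) j
          have h2 := norm_le_pi_norm (a z - a 0) k
          simp only [Pi.sub_apply] at h1 h2
          calc _ = ‖(a z j - a 0 j) - (a z k - a 0 k)‖ := by congr 1; ring
            _ ≤ _ := (norm_sub_le _ _).trans (add_le_add h1 h2)
            _ = _ := by simp only [β]; ring
        · exact hY0 x hx
      have e2 : (Rz x).mulVec (Y z x) - (R0 x).mulVec (Y 0 x) =
          (Rz x).mulVec (Y z x - Y 0 x) + (Rz x - R0 x).mulVec (Y 0 x) := by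
        rw [Matrix.mulVec_sub, Matrix.sub_mulVec]; abel
      have e3 : ‖(Rz x).mulVec (Y z x - Y 0 x)‖ ≤
          Real.exp (-κ * x) * (n * t * t * C * ‖Y z x - Y 0 x‖) :=
        hz.norm_conj_le ht0 htz htz' hx _
      have e4 : ‖(Rz x - R0 x).mulVec (Y 0 x)‖ ≤
          (n * S T' z * t * (C * Real.exp (-κ * x)) +
            n * t * t * (‖z‖ * C * Real.exp (-κ * x)) +
            n * t * S T z * (C * Real.exp (-κ * x))) * ‖Y 0 x‖ := by
        simp only [Rz, R0]
        rw [conj_sub_conj, Matrix.add_mulVec, Matrix.add_mulVec, add_mul, add_mul]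
        refine (norm_add_le _ _).trans (add_le_add ((norm_add_le _ _).trans (add_le_add ?_ ?_)) ?_)
        · exact norm_conj_mulVec_le (by positivity) ht0 (hS0 _ _)
            (fun i j => hz.decay x hx i j) htz (hSle T' z) _
        · exact norm_conj_mulVec_le (by positivity) ht0 ht0
            (fun i j => hdz x hx i j) htz hTt'.self_of_nhds _
        · exact norm_conj_mulVec_le (by positivity) (hS0 _ _) ht0
            (fun i j => h0.decay x hx i j) (hSle T z) hTt'.self_of_nhds _
      rw [e2]
      have h5 := hS0 T z
      have h6 := hS0 T' z
      calc _ ≤ β z * (K * Real.exp (-κ * x)) +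
            (Real.exp (-κ * x) * (n * t * t * C * ‖Y z x - Y 0 x‖) +
            (n * S T' z * t * (C * Real.exp (-κ * x)) +
            n * t * t * (‖z‖ * C * Real.exp (-κ * x)) +
            n * t * S T z * (C * Real.exp (-κ * x))) * (1 + K)) := by
            refine (norm_add_le _ _).trans (add_le_add e1 ((norm_add_le _ _).trans
              (add_le_add e3 (e4.trans ?_))))
            exact mul_le_mul_of_nonneg_left (hY0' x hx) (by positivity)
        _ = _ := by simp only [hQ]; ring
  have hYlim : Tendsto (fun z => Y z x) (𝓝 0) (𝓝 (Y 0 x)) := by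
    rw [tendsto_iff_norm_sub_tendsto_zero]
    refine squeeze_zero' (Eventually.of_forall fun z => norm_nonneg _) hYz ?_
    simpa using (hQt.mul_const (Real.exp (n * t * t * C / κ) / κ)).mul_const (Real.exp (-κ * x))
  have hexp : Tendsto (fun z => Complex.exp (a z k * x)) (𝓝 0) (𝓝 (Complex.exp (a 0 k * x))) :=
    (Complex.continuous_exp.tendsto _).comp ((tendsto_pi_nhds.1 ha k).mul_const _)
  have hfin := hexp.smul (tendsto_mulVec hT hYlim)
  rw [h0.mulVec_coord (w 0 x) x] at hfin
  refine hfin.congr' ?_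
  filter_upwards [h] with z hz using hz.mulVec_coord (w z x) x

end Family

end Backward

/-! ### Asymptotics of planar orbits converging to a saddle -/

section Planar

/-- Bounded solutions near a saddle are asymptotic to the stable direction. -/
theorem eventually_abs_le_of_saddle {ξ₁ ξ₂ ξ₁' ξ₂' : ℝ → ℝ} {m₁ m₂ : ℝ} (h₁ : m₁ < 0)
    (h₂ : 0 < m₂) (hd₁ : ∀ x, HasDerivAt ξ₁ (ξ₁' x) x) (hd₂ : ∀ x, HasDerivAt ξ₂ (ξ₂' x) x)
    (he₁ : ∀ ε > 0, ∀ᶠ x in atTop, |ξ₁' x - m₁ * ξ₁ x| ≤ ε * (|ξ₁ x| + |ξ₂ x|))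
    (he₂ : ∀ ε > 0, ∀ᶠ x in atTop, |ξ₂' x - m₂ * ξ₂ x| ≤ ε * (|ξ₁ x| + |ξ₂ x|))
    (hl₁ : Tendsto ξ₁ atTop (𝓝 0)) (hl₂ : Tendsto ξ₂ atTop (𝓝 0)) {δ : ℝ} (hδ : 0 < δ)
    (hδ1 : δ ≤ 1) : ∀ᶠ x in atTop, |ξ₂ x| ≤ δ * |ξ₁ x| := by
  set k := min m₂ (-m₁)
  have hk : 0 < k := lt_min h₂ (by linarith)
  have hk₂ : k ≤ m₂ := min_le_left _ _
  have hk₁ : k ≤ -m₁ := min_le_right _ _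
  set ε := k * δ ^ 2 / 4 with hε
  have hε0 : 0 < ε := by positivity
  obtain ⟨X, hX⟩ := eventually_atTop.1 ((he₁ ε hε0).and (he₂ ε hε0))
  -- Outside the cone the growing coordinate dominates. The choice of ε makes the errors at most
  -- half of the hyperbolic terms, so q is eventually nondecreasing; as it tends to 0, it is
  -- nonpositive.
  set q : ℝ → ℝ := fun x => ξ₂ x ^ 2 - δ ^ 2 * ξ₁ x ^ 2 with hq
  have hqd : ∀ x, HasDerivAt q (2 * ξ₂ x * ξ₂' x - δ ^ 2 * (2 * ξ₁ x * ξ₁' x)) x := by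
    intro x
    refine (((hd₂ x).pow 2).sub (((hd₁ x).pow 2).const_mul (δ ^ 2))).congr_deriv ?_
    norm_num
  have hq0 : Tendsto q atTop (𝓝 0) := by
    simpa [hq] using (hl₂.pow 2).sub ((hl₁.pow 2).const_mul (δ ^ 2))
  have hmono : MonotoneOn q (Ici X) := by
    refine monotoneOn_of_deriv_nonneg (convex_Ici X)
      (fun x _ => (hqd x).continuousAt.continuousWithinAt)
      (fun x _ => (hqd x).differentiableAt.differentiableWithinAt) fun x hx => ?_
    rw [interior_Ici] at hx
    rw [(hqd x).deriv]
    obtain ⟨b₁, b₂⟩ := hX x (mem_Ioi.1 hx).le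
    set u := ξ₁ x
    set v := ξ₂ x
    have hs : 0 ≤ |u| + |v| := by positivity
    have c₁ : u * (ξ₁' x - m₁ * u) ≤ |u| * (ε * (|u| + |v|)) :=
      (le_abs_self _).trans (by rw [abs_mul]; gcongr)
    have c₂ : -(v * (ξ₂' x - m₂ * v)) ≤ |v| * (ε * (|u| + |v|)) :=
      (neg_le_abs _).trans (by rw [abs_mul]; gcongr)
    have hu : |u| ^ 2 = u ^ 2 := sq_abs u
    have hv : |v| ^ 2 = v ^ 2 := sq_abs v
    have hδ2 : δ ^ 2 ≤ 1 := pow_le_one₀ hδ.le hδ1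
    have d1 : δ ^ 2 * (|u| * (ε * (|u| + |v|))) ≤ 1 * (|u| * (ε * (|u| + |v|))) := by gcongr
    have d2 : (|u| + |v|) ^ 2 ≤ 2 * (u ^ 2 + v ^ 2) := by
      nlinarith [sq_nonneg (|u| - |v|)]
    have d3 : ε * (|u| + |v|) ^ 2 ≤ ε * (2 * (u ^ 2 + v ^ 2)) := by gcongr
    have d4 : ε * (2 * (u ^ 2 + v ^ 2)) ≤ k / 2 * (δ ^ 2 * u ^ 2 + v ^ 2) := by
      rw [hε]
      nlinarith [mul_nonneg hk.le (mul_nonneg (sub_nonneg.2 hδ2) (sq_nonneg v))]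
    have d5 : k * v ^ 2 ≤ m₂ * v ^ 2 := by gcongr
    have d6 : k * (δ ^ 2 * u ^ 2) ≤ -m₁ * (δ ^ 2 * u ^ 2) := by gcongr
    have d7 : δ ^ 2 * (u * (ξ₁' x - m₁ * u)) ≤ δ ^ 2 * (|u| * (ε * (|u| + |v|))) := by gcongr
    have d8 : 0 ≤ k * (δ ^ 2 * u ^ 2 + v ^ 2) := by positivity
    nlinarith
  filter_upwards [eventually_ge_atTop X] with x hx
  have hqx : q x ≤ 0 := ge_of_tendsto hq0 (by
    filter_upwards [eventually_ge_atTop x] with y hy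
    exact hmono hx (hx.trans hy) hy)
  refine abs_le_of_sq_le_sq' ?_ (by positivity) |> abs_le.2
  rw [mul_pow, sq_abs]
  simp only [hq] at hqx
  linarith

/-- Once the logarithmic derivative lies below -κ, e(x) exp(κx) decreases; on the remaining compact
interval two values differ by at most a constant factor, which is C. -/
theorem exists_exp_comparison {e ζ : ℝ → ℝ} {κ : ℝ} (he : ∀ x, 0 < e x)
    (hd : ∀ x, HasDerivAt e (ζ x * e x) x) (hζ : ∀ᶠ x in atTop, ζ x ≤ -κ) :
    ∃ C, 0 < C ∧ ∀ y x, 0 ≤ y → y ≤ x → e x ≤ C * e y * Real.exp (-κ * (x - y)) := by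
  obtain ⟨X₀, hX₀⟩ := eventually_atTop.1 hζ
  set X := max X₀ 0
  have hX0 : 0 ≤ X := le_max_right _ _
  set m : ℝ → ℝ := fun x => e x * Real.exp (κ * x) with hm
  have hm0 : ∀ x, 0 < m x := fun x => mul_pos (he x) (Real.exp_pos _)
  have hmd : ∀ x, HasDerivAt m ((ζ x + κ) * m x) x := by
    intro x
    have h1 : HasDerivAt (fun x => Real.exp (κ * x)) (Real.exp (κ * x) * κ) x := by
      simpa using ((hasDerivAt_id x).const_mul κ).exp
    exact ((hd x).mul h1).congr_deriv (by simp only [hm]; ring)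
  have hmc : Continuous m := continuous_iff_continuousAt.2 fun x => (hmd x).continuousAt
  have hanti : AntitoneOn m (Ici X) := by
    refine antitoneOn_of_deriv_nonpos (convex_Ici X) hmc.continuousOn
      (fun x _ => (hmd x).differentiableAt.differentiableWithinAt) fun x hx => ?_
    rw [interior_Ici] at hx
    rw [(hmd x).deriv]
    have := hX₀ x ((le_max_left _ _).trans (mem_Ioi.1 hx).le)
    nlinarith [hm0 x]
  obtain ⟨x₁, hx₁, hmin⟩ := isCompact_Icc.exists_isMinOn (nonempty_Icc.2 hX0) hmc.continuousOn
  obtain ⟨x₂, hx₂, hmax⟩ := isCompact_Icc.exists_isMaxOn (nonempty_Icc.2 hX0) hmc.continuousOn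
  set C := m x₂ / m x₁ with hC
  have hCpos : 0 < C := div_pos (hm0 _) (hm0 _)
  have hC1 : 1 ≤ C := (one_le_div (hm0 _)).2 (hmin hx₂)
  have hcomp : ∀ y x, 0 ≤ y → y ≤ X → 0 ≤ x → x ≤ X → m x ≤ C * m y := by
    intro y x hy hyX hx hxX
    calc m x ≤ m x₂ := hmax ⟨hx, hxX⟩
      _ = C * m x₁ := by rw [hC, div_mul_cancel₀ _ (hm0 _).ne']
      _ ≤ C * m y := by gcongr; exact hmin ⟨hy, hyX⟩
  have key : ∀ y x, 0 ≤ y → y ≤ x → m x ≤ C * m y := by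
    intro y x hy hyx
    rcases le_total x X with h | h
    · exact hcomp y x hy (hyx.trans h) (hy.trans hyx) h
    · rcases le_total y X with h' | h'
      · exact (hanti self_mem_Ici h h).trans (hcomp y X hy h' hX0 le_rfl)
      · exact (hanti h' h hyx).trans (le_mul_of_one_le_left (hm0 y).le hC1)
  refine ⟨C, hCpos, fun y x hy hyx => ?_⟩
  have h1 := key y x hy hyx
  simp only [hm] at h1
  have h2 : e x = e x * Real.exp (κ * x) * Real.exp (-κ * x) := by
    rw [mul_assoc, ← Real.exp_add]; simp
  rw [h2]
  calc _ ≤ C * (e y * Real.exp (κ * y)) * Real.exp (-κ * x) := by gcongr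
    _ = _ := by
        rw [show -κ * (x - y) = κ * y + -κ * x by ring, Real.exp_add]; ring

theorem exists_exp_bound_of_eventually {E : Type*} [NormedAddCommGroup E] {f : ℝ → E}
    (hf : Continuous f) {C κ : ℝ} (h : ∀ᶠ x in atTop, ‖f x‖ ≤ C * Real.exp (-κ * x)) :
    ∃ C', 0 ≤ C' ∧ ∀ x, 0 ≤ x → ‖f x‖ ≤ C' * Real.exp (-κ * x) := by
  obtain ⟨X, hX⟩ := eventually_atTop.1 h
  have hc : Continuous fun x => ‖f x‖ * Real.exp (κ * x) := by fun_prop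
  obtain ⟨M, hM⟩ := (isCompact_Icc (a := (0 : ℝ)) (b := X)).exists_bound_of_continuousOn
    hc.continuousOn
  refine ⟨max (max M C) 0, le_max_right _ _, fun x hx => ?_⟩
  rcases le_total x X with h | h
  · have h1 := (le_abs_self _).trans (hM x ⟨hx, h⟩)
    have h2 : ‖f x‖ = ‖f x‖ * Real.exp (κ * x) * Real.exp (-κ * x) := by
      rw [mul_assoc, ← Real.exp_add]; simp
    rw [h2]
    gcongr
    exact h1.trans ((le_max_left _ _).trans (le_max_left _ _))
  · refine (hX x h).trans ?_
    gcongr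
    exact (le_max_right _ _).trans (le_max_left _ _)

/-- Asymptotics of an orbit of `t' = p`, `p' = px` that converges to a saddle `(t₀, 0)` with
eigenvalues `m₁ < 0 < m₂`; `Ht`, `Hs` are the coefficients of the linearization along the orbit. -/
theorem exists_orbit_asymptotics {t p px Ht Hs : ℝ → ℝ} {t₀ m₁ m₂ : ℝ} (h₁ : m₁ < 0) (h₂ : 0 < m₂)
    (ht : ∀ x, HasDerivAt t (p x) x) (hp : ∀ x, HasDerivAt p (px x) x)
    (hpx : ∀ x, HasDerivAt px (Ht x * p x + Hs x * px x) x)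
    (hHs : Continuous Hs)
    (hlin : ∀ ε > 0, ∀ᶠ x in atTop,
      |px x - (-(m₁ * m₂) * (t x - t₀) + (m₁ + m₂) * p x)| ≤ ε * (|t x - t₀| + |p x|))
    (htl : Tendsto t atTop (𝓝 t₀)) (hpl : Tendsto p atTop (𝓝 0))
    (hHtl : Tendsto Ht atTop (𝓝 (-(m₁ * m₂)))) (hHsl : Tendsto Hs atTop (𝓝 (m₁ + m₂)))
    (hne : ∀ x, 0 < p x ^ 2 + px x ^ 2) (hne' : ∀ᶠ x in atTop, t x ≠ t₀ ∨ p x ≠ 0) :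
    (∀ᶠ x in atTop, p x * (t x - t₀) < 0) ∧ Tendsto (fun x => px x / p x) atTop (𝓝 m₁) ∧
    ∃ C κ, 0 < C ∧ 0 < κ ∧ κ < -m₁ ∧
      (∀ y x, 0 ≤ y → y ≤ x → √(p x ^ 2 + px x ^ 2) ≤
        C * √(p y ^ 2 + px y ^ 2) * Real.exp (-κ * (x - y))) ∧
      (∀ x y, 0 ≤ x → x ≤ y →
        Real.exp (-∫ s in (0 : ℝ)..y, Hs s) * √(p y ^ 2 + px y ^ 2) ≤
        C * (Real.exp (-∫ s in (0 : ℝ)..x, Hs s) * √(p x ^ 2 + px x ^ 2)) *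
          Real.exp (-κ * (y - x))) ∧
      (∀ x, 0 ≤ x → |t x - t₀| ≤ C * Real.exp (-κ * x)) := by
  have hm : 0 < m₂ - m₁ := by linarith
  have hρl : Tendsto (fun x => t x - t₀) atTop (𝓝 0) := by simpa using htl.sub_const t₀
  -- The coordinates p - m₂(t - t₀) and p - m₁(t - t₀) diagonalize the linearization, with rates m₁
  -- and m₂. The cone estimate says that the orbit enters tangentially to p = m₁(t - t₀).
  have cone : ∀ δ, 0 < δ → δ ≤ 1 → ∀ᶠ x in atTop,
      |p x - m₁ * (t x - t₀)| ≤ δ * |p x - m₂ * (t x - t₀)| := by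
    intro δ hδ hδ1
    have herr : ∀ ε > 0, ∀ᶠ x in atTop,
        |px x - (-(m₁ * m₂) * (t x - t₀) + (m₁ + m₂) * p x)| ≤
          ε * (|p x - m₂ * (t x - t₀)| + |p x - m₁ * (t x - t₀)|) := by
      intro ε hε
      set K := 2 / (m₂ - m₁) + (m₂ - m₁ + 2 * |m₁|) / (m₂ - m₁) + 1
      have hK : 0 < K := by positivity
      filter_upwards [hlin (ε / K) (by positivity)] with x hx
      refine hx.trans ?_
      set u := p x - m₂ * (t x - t₀) with hu
      set v := p x - m₁ * (t x - t₀) with hv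
      have e1 : t x - t₀ = (v - u) / (m₂ - m₁) := by rw [hu, hv]; field_simp; ring
      have e2 : p x = v + m₁ * ((v - u) / (m₂ - m₁)) := by rw [← e1, hv]; ring
      have f0 : |v - u| ≤ |u| + |v| := by rw [add_comm]; exact abs_sub v u
      have f1 : |(v - u) / (m₂ - m₁)| ≤ (|u| + |v|) / (m₂ - m₁) := by
        rw [abs_div, abs_of_pos hm]; gcongr
      have f2 : |v + m₁ * ((v - u) / (m₂ - m₁))| ≤ |v| + |m₁| * ((|u| + |v|) / (m₂ - m₁)) :=
        (abs_add_le _ _).trans (by rw [abs_mul]; gcongr)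
      have hsum : |t x - t₀| + |p x| ≤ K * (|u| + |v|) := by
        rw [e2, e1]
        have h3 : K * (|u| + |v|) = (|u| + |v|) / (m₂ - m₁) + (|v| + |m₁| * ((|u| + |v|) /
          (m₂ - m₁))) + ((|u| + |v|) / (m₂ - m₁) + |m₁| * ((|u| + |v|) / (m₂ - m₁)) + |u| +
          (|u| + |v|)) := by
          simp only [K]; field_simp; ring
        have h4 : 0 ≤ (|u| + |v|) / (m₂ - m₁) + |m₁| * ((|u| + |v|) / (m₂ - m₁)) + |u| +
          (|u| + |v|) := by positivity
        linarith
      calc ε / K * (|t x - t₀| + |p x|) ≤ ε / K * (K * (|u| + |v|)) := by gcongr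
        _ = _ := by field_simp
    refine eventually_abs_le_of_saddle (ξ₁ := fun x => p x - m₂ * (t x - t₀))
      (ξ₂ := fun x => p x - m₁ * (t x - t₀))
      (ξ₁' := fun x => px x - m₂ * p x) (ξ₂' := fun x => px x - m₁ * p x) h₁ h₂
      (fun x => (hp x).sub (((ht x).sub_const _).const_mul m₂))
      (fun x => (hp x).sub (((ht x).sub_const _).const_mul m₁)) ?_ ?_ ?_ ?_ hδ hδ1
    · intro ε hε
      filter_upwards [herr ε hε] with x hx
      convert hx using 2; ring
    · intro ε hε
      filter_upwards [herr ε hε] with x hx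
      convert hx using 2; ring
    · simpa using hpl.sub (hρl.const_mul m₂)
    · simpa using hpl.sub (hρl.const_mul m₁)
  have hρne : ∀ᶠ x in atTop, t x - t₀ ≠ 0 := by
    filter_upwards [cone (1 / 2) (by norm_num) (by norm_num), hne'] with x hx hx' h0
    rw [h0, mul_zero, mul_zero, sub_zero] at hx
    have : |p x| = 0 := le_antisymm (by linarith [abs_nonneg (p x)]) (abs_nonneg _)
    exact hx'.elim (fun h => h (sub_eq_zero.1 h0)) fun h => h (abs_eq_zero.1 this)
  have hpρ : Tendsto (fun x => p x / (t x - t₀)) atTop (𝓝 m₁) := by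
    rw [Metric.tendsto_nhds]
    intro ε hε
    set δ := min (1 / 2) (ε / (4 * (m₂ - m₁)))
    have hδ : 0 < δ := lt_min (by norm_num) (by positivity)
    have hδ2 : δ ≤ 1 / 2 := min_le_left _ _
    have hδε : δ * (4 * (m₂ - m₁)) ≤ ε := by
      rw [← le_div_iff₀ (by positivity)]; exact min_le_right _ _
    filter_upwards [cone δ hδ (by linarith), hρne] with x hx hx'
    have hρ : 0 < |t x - t₀| := abs_pos.2 hx'
    rw [Real.dist_eq, show p x / (t x - t₀) - m₁ = (p x - m₁ * (t x - t₀)) / (t x - t₀) by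
      field_simp, abs_div, div_lt_iff₀ hρ]
    have h3 : |p x - m₂ * (t x - t₀)| ≤ |p x - m₁ * (t x - t₀)| + (m₂ - m₁) * |t x - t₀| := by
      rw [← abs_of_pos hm, ← abs_mul]
      refine le_trans (le_of_eq ?_) (abs_sub _ _)
      congr 1; ring
    nlinarith [abs_nonneg (p x - m₁ * (t x - t₀)), mul_nonneg (sub_nonneg.2 hδε) hρ.le,
      mul_nonneg (sub_nonneg.2 hδ2) (abs_nonneg (p x - m₁ * (t x - t₀))), mul_pos hε hρ]
  have hsign : ∀ᶠ x in atTop, p x * (t x - t₀) < 0 := by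
    filter_upwards [hpρ.eventually (gt_mem_nhds h₁), hρne] with x hx hx'
    have := mul_neg_of_neg_of_pos hx (pow_pos (abs_pos.2 hx') 2)
    rw [sq_abs] at this
    have e : p x / (t x - t₀) * (t x - t₀) ^ 2 = p x * (t x - t₀) := by field_simp
    rwa [e] at this
  have hpxρ : Tendsto (fun x => px x / (t x - t₀)) atTop (𝓝 (m₁ * m₁)) := by
    have h3 : Tendsto (fun x => (px x - (-(m₁ * m₂) * (t x - t₀) + (m₁ + m₂) * p x)) / (t x - t₀))
        atTop (𝓝 0) := by
      rw [Metric.tendsto_nhds]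
      intro ε hε
      set K := 2 + |m₁|
      have hK : 0 < K := by positivity
      have hb : ∀ᶠ x in atTop, |p x / (t x - t₀)| < |m₁| + 1 / 2 :=
        hpρ.abs.eventually (gt_mem_nhds (by linarith))
      filter_upwards [hlin (ε / K) (by positivity), hρne, hb] with x hx hx' hb
      have hρ : 0 < |t x - t₀| := abs_pos.2 hx'
      rw [dist_zero_right, Real.norm_eq_abs, abs_div, div_lt_iff₀ hρ]
      rw [abs_div, div_lt_iff₀ hρ] at hb
      refine hx.trans_lt ?_
      rw [div_mul_eq_mul_div, div_lt_iff₀ hK, mul_assoc]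
      gcongr
      simp only [K]
      linarith
    have h4 := h3.add ((hpρ.const_mul (m₁ + m₂)).const_add (-(m₁ * m₂)))
    rw [show (0 : ℝ) + (-(m₁ * m₂) + (m₁ + m₂) * m₁) = m₁ * m₁ by ring] at h4
    refine h4.congr' ?_
    filter_upwards [hρne] with x hx'
    field_simp
    ring
  have hg : Tendsto (fun x => px x / p x) atTop (𝓝 m₁) := by
    have h3 := hpxρ.div hpρ h₁.ne
    rw [mul_div_assoc, div_self h₁.ne, mul_one] at h3
    refine h3.congr' ?_
    filter_upwards [hρne] with x hx'
    simp only [Pi.div_apply]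
    exact div_div_div_cancel_right₀ hx' _ _
  refine ⟨hsign, hg, ?_⟩
  set r : ℝ → ℝ := fun x => √(p x ^ 2 + px x ^ 2) with hr
  have hr0 : ∀ x, 0 < r x := fun x => Real.sqrt_pos.2 (hne x)
  -- The logarithmic derivative of r. Since px/p → m₁ and m₁ is a root of the characteristic
  -- equation, ζ → m₁.
  set ζ : ℝ → ℝ := fun x =>
    (p x * px x + px x * (Ht x * p x + Hs x * px x)) / (p x ^ 2 + px x ^ 2) with hζ
  have hrd : ∀ x, HasDerivAt r (ζ x * r x) x := by
    intro x
    have := (((hp x).pow 2).add ((hpx x).pow 2)).sqrt (hne x).ne'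
    refine this.congr_deriv ?_
    have h3 : r x ^ 2 = p x ^ 2 + px x ^ 2 := Real.sq_sqrt (hne x).le
    have h4 := (hr0 x).ne'
    simp only [hζ]
    rw [← h3]
    change _ / (2 * r x) = _
    field_simp
    norm_num
    ring
  have hζl : Tendsto ζ atTop (𝓝 m₁) := by
    have h3 := (hg.add (hg.mul (hHtl.add (hHsl.mul hg)))).div
      ((hg.pow 2).const_add 1) (by positivity)
    have e : (m₁ + m₁ * (-(m₁ * m₂) + (m₁ + m₂) * m₁)) / (1 + m₁ ^ 2) = m₁ := by
      rw [div_eq_iff (by positivity)]; ring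
    rw [e] at h3
    refine h3.congr' ?_
    filter_upwards [hsign] with x hx
    have hpne : p x ≠ 0 := fun h => by simp [h] at hx
    have := (hne x).ne'
    have h5 : 1 + (px x / p x) ^ 2 ≠ 0 := by positivity
    simp only [hζ, Pi.div_apply]
    rw [div_eq_div_iff h5 this]
    field_simp
  -- One rate for both comparisons: r has limiting rate m₁, and the weighted norm has -(m₁ + m₂) +
  -- m₁ = -m₂.
  set κ := min (-m₁) m₂ / 2
  have hmin : 0 < min (-m₁) m₂ := lt_min (by linarith) h₂
  have hκ : 0 < κ := half_pos hmin
  have hκ₁ : κ < -m₁ := (half_lt_self hmin).trans_le (min_le_left _ _)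
  have hκ₂ : κ < m₂ := (half_lt_self hmin).trans_le (min_le_right _ _)
  obtain ⟨C₁, hC₁, h3⟩ := exists_exp_comparison (κ := κ) hr0 hrd
    ((hζl.eventually (gt_mem_nhds (by linarith : m₁ < -κ))).mono fun _ h => h.le)
  have hEd : ∀ x, HasDerivAt (fun x => Real.exp (-∫ s in (0 : ℝ)..x, Hs s))
      (-Hs x * Real.exp (-∫ s in (0 : ℝ)..x, Hs s)) x := by
    intro x
    have := ((hHs.integral_hasStrictDerivAt 0 x).hasDerivAt.neg).exp
    exact this.congr_deriv (mul_comm _ _)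
  obtain ⟨C₂, hC₂, h4⟩ := exists_exp_comparison (κ := κ)
    (e := fun x => Real.exp (-∫ s in (0 : ℝ)..x, Hs s) * r x) (ζ := fun x => -Hs x + ζ x)
    (fun x => mul_pos (Real.exp_pos _) (hr0 x))
    (fun x => ((hEd x).mul (hrd x)).congr_deriv (by ring))
    (((hHsl.neg.add hζl).eventually (gt_mem_nhds (by linarith : -(m₁ + m₂) + m₁ < -κ))).mono
      fun _ h => h.le)
  have hev : ∀ᶠ x in atTop, ‖t x - t₀‖ ≤ 2 / -m₁ * (C₁ * r 0) * Real.exp (-κ * x) := by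
    filter_upwards [hpρ.eventually (gt_mem_nhds (by linarith : m₁ < m₁ / 2)), hρne,
      eventually_ge_atTop 0] with x hx hx' hx0
    have hρ : 0 < |t x - t₀| := abs_pos.2 hx'
    have h5 : -m₁ / 2 ≤ |p x| / |t x - t₀| := by
      rw [← abs_div]
      refine le_trans ?_ (neg_le_abs _)
      linarith
    rw [le_div_iff₀ hρ] at h5
    have h6 : |p x| ≤ r x := Real.abs_le_sqrt (by nlinarith [sq_nonneg (px x)])
    have h7 := h3 0 x le_rfl hx0
    rw [sub_zero] at h7
    rw [Real.norm_eq_abs, mul_assoc, div_mul_eq_mul_div, le_div_iff₀ (by linarith)]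
    nlinarith
  obtain ⟨C₃, hC₃, h5⟩ := exists_exp_bound_of_eventually
    (f := fun x => t x - t₀) (continuous_iff_continuousAt.2 fun x =>
      ((ht x).sub_const t₀).continuousAt) hev
  have hCm : C₁ ≤ max (max C₁ C₂) C₃ := (le_max_left _ _).trans (le_max_left _ _)
  have hCm₂ : C₂ ≤ max (max C₁ C₂) C₃ := (le_max_right _ _).trans (le_max_left _ _)
  have hCm₃ : C₃ ≤ max (max C₁ C₂) C₃ := le_max_right _ _
  refine ⟨max (max C₁ C₂) C₃, κ, hC₁.trans_le hCm, hκ, hκ₁, fun y x hy hyx => ?_,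
    fun x y hx hxy => ?_, fun x hx => ?_⟩
  · refine (h3 y x hy hyx).trans ?_
    have := (hr0 y).le
    gcongr
  · refine (h4 x y hx hxy).trans ?_
    have := (hr0 x).le
    gcongr
  · refine (h5 x hx).trans ?_
    gcongr

end Planar

/-! ### Invariant manifolds along a planar orbit -/

section Melnikov

noncomputable def orbitNorm (p px : ℝ → ℝ) (x : ℝ) : ℝ := √(p x ^ 2 + px x ^ 2)

/-- The reciprocal of Abel's factor: times the Wronskian of two solutions of y'' = Ht y + Hs y' it
is constant. Consequently (weight × norm)⁻¹ is the growth rate of the component normal to the orbit.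
-/
noncomputable def orbitWeight (Hs : ℝ → ℝ) (x : ℝ) : ℝ := Real.exp (-∫ s in (0 : ℝ)..x, Hs s)

/-- The linearization `y'' = Ht y + Hs y'` along a planar orbit, with its decaying solution `p`. -/
structure OrbitDichotomy (p px Ht Hs : ℝ → ℝ) (C κ B : ℝ) : Prop where
  deriv_p : ∀ x, HasDerivAt p (px x) x
  deriv_px : ∀ x, HasDerivAt px (Ht x * p x + Hs x * px x) x
  cont_Ht : Continuous Ht
  cont_Hs : Continuous Hs
  bound_Ht : ∀ x, 0 ≤ x → |Ht x| ≤ B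
  bound_Hs : ∀ x, 0 ≤ x → |Hs x| ≤ B
  ne : ∀ x, 0 < p x ^ 2 + px x ^ 2
  C_pos : 0 < C
  κ_pos : 0 < κ
  stable : ∀ y x, 0 ≤ y → y ≤ x →
    orbitNorm p px x ≤ C * orbitNorm p px y * Real.exp (-κ * (x - y))
  unstable : ∀ x y, 0 ≤ x → x ≤ y → orbitWeight Hs y * orbitNorm p px y ≤
    C * (orbitWeight Hs x * orbitNorm p px x) * Real.exp (-κ * (y - x))

/-- In the rotating frame (p, px)/r, (-px, p)/r, with r the orbit norm, the variational equation is
triangular: the normal component evolves by itself and drives the tangential one with this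
coefficient. -/
noncomputable def melTheta (p px Ht Hs : ℝ → ℝ) (x : ℝ) : ℝ :=
  (-px x ^ 2 + p x * (Ht x * p x + Hs x * px x) + p x ^ 2 - Ht x * px x ^ 2 + Hs x * p x * px x) /
    (p x ^ 2 + px x ^ 2)

/-- Component of the bounded solution normal to the orbit. -/
noncomputable def melB (p px Hs F : ℝ → ℝ) : ℝ → ℝ :=
  unstableOp (fun x => (orbitWeight Hs x * orbitNorm p px x)⁻¹)
    (fun x => p x * F x / orbitNorm p px x)

/-- Component of the bounded solution tangent to the orbit. -/
noncomputable def melA (p px Ht Hs F : ℝ → ℝ) : ℝ → ℝ :=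
  stableOp (orbitNorm p px)
    (fun x => melTheta p px Ht Hs x * melB p px Hs F x + px x * F x / orbitNorm p px x)

/-- The bounded solution of `y'' = Ht y + Hs y' + F` on the half-line, normal to the orbit at `0`. -/
noncomputable def melS (p px Ht Hs F : ℝ → ℝ) (x : ℝ) : ℝ × ℝ :=
  ((melA p px Ht Hs F x * p x - melB p px Hs F x * px x) / orbitNorm p px x,
    (melA p px Ht Hs F x * px x + melB p px Hs F x * p x) / orbitNorm p px x)

theorem hasDerivAt_orbitWeight {Hs : ℝ → ℝ} (h : Continuous Hs) (x : ℝ) :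
    HasDerivAt (orbitWeight Hs) (-Hs x * orbitWeight Hs x) x :=
  ((h.integral_hasStrictDerivAt 0 x).hasDerivAt.neg).exp.congr_deriv (mul_comm _ _)

theorem orbitWeight_pos (Hs : ℝ → ℝ) (x : ℝ) : 0 < orbitWeight Hs x := Real.exp_pos _

theorem orbitWeight_zero (Hs : ℝ → ℝ) : orbitWeight Hs 0 = 1 := by simp [orbitWeight]

namespace OrbitDichotomy

variable {p px Ht Hs : ℝ → ℝ} {C κ B : ℝ}

theorem norm_pos (h : OrbitDichotomy p px Ht Hs C κ B) (x : ℝ) : 0 < orbitNorm p px x :=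
  Real.sqrt_pos.2 (h.ne x)

theorem sq_norm (h : OrbitDichotomy p px Ht Hs C κ B) (x : ℝ) :
    orbitNorm p px x ^ 2 = p x ^ 2 + px x ^ 2 := Real.sq_sqrt (h.ne x).le

theorem abs_p_le (_ : OrbitDichotomy p px Ht Hs C κ B) (x : ℝ) : |p x| ≤ orbitNorm p px x :=
  Real.abs_le_sqrt (by nlinarith [sq_nonneg (px x)])

theorem abs_px_le (_ : OrbitDichotomy p px Ht Hs C κ B) (x : ℝ) : |px x| ≤ orbitNorm p px x :=
  Real.abs_le_sqrt (by nlinarith [sq_nonneg (p x)])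

theorem B_nonneg (h : OrbitDichotomy p px Ht Hs C κ B) : 0 ≤ B :=
  (abs_nonneg _).trans (h.bound_Ht 0 le_rfl)

theorem cont_p (h : OrbitDichotomy p px Ht Hs C κ B) : Continuous p :=
  continuous_iff_continuousAt.2 fun x => (h.deriv_p x).continuousAt

theorem cont_px (h : OrbitDichotomy p px Ht Hs C κ B) : Continuous px :=
  continuous_iff_continuousAt.2 fun x => (h.deriv_px x).continuousAt

theorem cont_norm (h : OrbitDichotomy p px Ht Hs C κ B) : Continuous (orbitNorm p px) :=
  ((h.cont_p.pow 2).add (h.cont_px.pow 2)).sqrt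

theorem cont_weight (h : OrbitDichotomy p px Ht Hs C κ B) : Continuous (orbitWeight Hs) :=
  continuous_iff_continuousAt.2 fun x => (hasDerivAt_orbitWeight h.cont_Hs x).continuousAt

theorem deriv_norm (h : OrbitDichotomy p px Ht Hs C κ B) (x : ℝ) :
    HasDerivAt (orbitNorm p px) ((p x * px x + px x * (Ht x * p x + Hs x * px x)) /
      (p x ^ 2 + px x ^ 2) * orbitNorm p px x) x := by
  have := (((h.deriv_p x).pow 2).add ((h.deriv_px x).pow 2)).sqrt (h.ne x).ne'
  refine this.congr_deriv ?_
  have h4 := (h.norm_pos x).ne'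
  rw [← h.sq_norm]
  change _ / (2 * orbitNorm p px x) = _
  field_simp
  norm_num
  ring

theorem weight_mul_norm_pos (h : OrbitDichotomy p px Ht Hs C κ B) (x : ℝ) :
    0 < orbitWeight Hs x * orbitNorm p px x := mul_pos (orbitWeight_pos _ _) (h.norm_pos x)

theorem cont_unstable (h : OrbitDichotomy p px Ht Hs C κ B) :
    Continuous fun x => (orbitWeight Hs x * orbitNorm p px x)⁻¹ :=
  (h.cont_weight.mul h.cont_norm).inv₀ fun x => (h.weight_mul_norm_pos x).ne'

theorem unstable_ne (h : OrbitDichotomy p px Ht Hs C κ B) (x : ℝ) :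
    (orbitWeight Hs x * orbitNorm p px x)⁻¹ ≠ 0 := inv_ne_zero (h.weight_mul_norm_pos x).ne'

theorem unstable_bound (h : OrbitDichotomy p px Ht Hs C κ B) (x y : ℝ) (hx : 0 ≤ x) (hxy : x ≤ y) :
    ‖(orbitWeight Hs x * orbitNorm p px x)⁻¹‖ * ‖(orbitWeight Hs y * orbitNorm p px y)⁻¹‖⁻¹ ≤
      C * Real.exp (-κ * (y - x)) := by
  have h1 := h.weight_mul_norm_pos x
  rw [norm_inv, norm_inv, inv_inv, Real.norm_of_nonneg h1.le,
    Real.norm_of_nonneg (h.weight_mul_norm_pos y).le, inv_mul_le_iff₀ h1]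
  exact (h.unstable x y hx hxy).trans (le_of_eq (by ring))

theorem stable_bound (h : OrbitDichotomy p px Ht Hs C κ B) (y x : ℝ) (hy : 0 ≤ y) (hyx : y ≤ x) :
    ‖orbitNorm p px x‖ * ‖orbitNorm p px y‖⁻¹ ≤ C * Real.exp (-κ * (x - y)) := by
  rw [Real.norm_of_nonneg (h.norm_pos x).le, Real.norm_of_nonneg (h.norm_pos y).le,
    mul_inv_le_iff₀ (h.norm_pos y)]
  exact (h.stable y x hy hyx).trans (le_of_eq (by ring))

theorem cont_theta (h : OrbitDichotomy p px Ht Hs C κ B) : Continuous (melTheta p px Ht Hs) := by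
  have h1 := h.cont_p
  have h2 := h.cont_px
  have h3 := h.cont_Ht
  have h4 := h.cont_Hs
  exact Continuous.div (by fun_prop) (by fun_prop) fun x => (h.ne x).ne'

theorem abs_theta_le (h : OrbitDichotomy p px Ht Hs C κ B) {x : ℝ} (hx : 0 ≤ x) :
    |melTheta p px Ht Hs x| ≤ 1 + 3 * B := by
  have hQ := h.ne x
  rw [melTheta, abs_div, abs_of_pos hQ, div_le_iff₀ hQ]
  have b1 := abs_le.1 (h.bound_Ht x hx)
  have b2 := abs_le.1 (h.bound_Hs x hx)
  have hB := h.B_nonneg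
  have c1 : |Ht x * (p x ^ 2 - px x ^ 2)| ≤ B * (p x ^ 2 + px x ^ 2) := by
    rw [abs_mul]
    refine mul_le_mul (h.bound_Ht x hx) ?_ (abs_nonneg _) hB
    rw [abs_le]; constructor <;> nlinarith [sq_nonneg (p x), sq_nonneg (px x)]
  have c2 : |Hs x * (2 * p x * px x)| ≤ B * (p x ^ 2 + px x ^ 2) := by
    rw [abs_mul]
    refine mul_le_mul (h.bound_Hs x hx) ?_ (abs_nonneg _) hB
    rw [abs_le]; constructor <;> nlinarith [sq_nonneg (p x + px x), sq_nonneg (p x - px x)]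
  have c3 : |p x ^ 2 - px x ^ 2| ≤ p x ^ 2 + px x ^ 2 := by
    rw [abs_le]; constructor <;> nlinarith [sq_nonneg (p x), sq_nonneg (px x)]
  have e : -px x ^ 2 + p x * (Ht x * p x + Hs x * px x) + p x ^ 2 - Ht x * px x ^ 2 +
      Hs x * p x * px x = (p x ^ 2 - px x ^ 2) + Ht x * (p x ^ 2 - px x ^ 2) +
      Hs x * (2 * p x * px x) := by ring
  rw [e]
  calc _ ≤ |p x ^ 2 - px x ^ 2| + |Ht x * (p x ^ 2 - px x ^ 2)| + |Hs x * (2 * p x * px x)| :=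
        (abs_add_le _ _).trans (add_le_add_left (abs_add_le _ _) _)
    _ ≤ _ := by nlinarith

variable {F G : ℝ → ℝ}

theorem cont_forcing (h : OrbitDichotomy p px Ht Hs C κ B) {q : ℝ → ℝ} (hq : Continuous q)
    (hF : Continuous F) : Continuous fun x => q x * F x / orbitNorm p px x :=
  (hq.mul hF).div h.cont_norm fun x => (h.norm_pos x).ne'

theorem abs_forcing_le (h : OrbitDichotomy p px Ht Hs C κ B) {q M x : ℝ}
    (hq : |q| ≤ orbitNorm p px x) (hF : |F x| ≤ M) : ‖q * F x / orbitNorm p px x‖ ≤ M := by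
  have h1 := h.norm_pos x
  rw [Real.norm_eq_abs, abs_div, abs_mul, abs_of_pos h1, div_le_iff₀ h1, mul_comm]
  exact mul_le_mul hF hq (abs_nonneg _) ((abs_nonneg _).trans hF)

theorem tendsto_forcing (h : OrbitDichotomy p px Ht Hs C κ B) {q : ℝ → ℝ}
    (hq : ∀ x, |q x| ≤ orbitNorm p px x) (hF0 : Tendsto F atTop (𝓝 0)) :
    Tendsto (fun x => q x * F x / orbitNorm p px x) atTop (𝓝 0) :=
  squeeze_zero_norm (fun x => h.abs_forcing_le (hq x) le_rfl) (by simpa using hF0.abs)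

theorem cont_melB (h : OrbitDichotomy p px Ht Hs C κ B) (hF : Continuous F) :
    Continuous (melB p px Hs F) :=
  continuous_unstableOp h.cont_unstable h.unstable_ne (h.cont_forcing h.cont_p hF)

theorem cont_melA_forcing (h : OrbitDichotomy p px Ht Hs C κ B) (hF : Continuous F) :
    Continuous fun x => melTheta p px Ht Hs x * melB p px Hs F x + px x * F x / orbitNorm p px x :=
  (h.cont_theta.mul (h.cont_melB hF)).add (h.cont_forcing h.cont_px hF)

theorem cont_melA (h : OrbitDichotomy p px Ht Hs C κ B) (hF : Continuous F) :
    Continuous (melA p px Ht Hs F) :=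
  continuous_stableOp h.cont_norm (fun x => (h.norm_pos x).ne') (h.cont_melA_forcing hF)

theorem abs_melB_le (h : OrbitDichotomy p px Ht Hs C κ B) (hF : Continuous F) {M : ℝ}
    (hM : ∀ x, 0 ≤ x → |F x| ≤ M) {x : ℝ} (hx : 0 ≤ x) : |melB p px Hs F x| ≤ C / κ * M :=
  norm_unstableOp_le h.κ_pos h.C_pos.le h.cont_unstable h.unstable_ne h.unstable_bound
    (h.cont_forcing h.cont_p hF) (fun y hy => h.abs_forcing_le (h.abs_p_le y) (hM y hy)) hx

theorem abs_melA_le (h : OrbitDichotomy p px Ht Hs C κ B) (hF : Continuous F) {M : ℝ}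
    (hM : ∀ x, 0 ≤ x → |F x| ≤ M) {x : ℝ} (hx : 0 ≤ x) :
    |melA p px Ht Hs F x| ≤ C / κ * ((1 + 3 * B) * (C / κ) + 1) * M := by
  have hB := h.B_nonneg
  have hC := h.C_pos
  have hκ := h.κ_pos
  have hM0 := (abs_nonneg _).trans (hM 0 le_rfl)
  have := norm_stableOp_le (M := ((1 + 3 * B) * (C / κ) + 1) * M) h.κ_pos h.C_pos.le (by positivity)
    hx h.stable_bound (f := fun x => melTheta p px Ht Hs x * melB p px Hs F x +
      px x * F x / orbitNorm p px x) fun y hy => by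
        refine (norm_add_le _ _).trans ?_
        have h1 := h.abs_forcing_le (h.abs_px_le y) (hM y hy)
        have h2 : ‖melTheta p px Ht Hs y * melB p px Hs F y‖ ≤ (1 + 3 * B) * (C / κ * M) := by
          rw [norm_mul]
          exact mul_le_mul (h.abs_theta_le hy) (h.abs_melB_le hF hM hy) (norm_nonneg _)
            (by positivity)
        linarith
  rw [← mul_assoc] at this
  exact this

/-- The norm of the solution operator `melS`. -/
noncomputable def bound (C κ B : ℝ) : ℝ := C / κ * ((1 + 3 * B) * (C / κ) + 1) + C / κ

theorem bound_nonneg (h : OrbitDichotomy p px Ht Hs C κ B) : 0 ≤ bound C κ B := by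
  have := h.B_nonneg
  have := h.C_pos
  have := h.κ_pos
  unfold bound
  positivity

theorem norm_melS_le' (h : OrbitDichotomy p px Ht Hs C κ B) (x : ℝ) :
    ‖melS p px Ht Hs F x‖ ≤ |melA p px Ht Hs F x| + |melB p px Hs F x| := by
  have h0 := h.norm_pos x
  have h1 := h.abs_p_le x
  have h2 := h.abs_px_le x
  set a := melA p px Ht Hs F x with ha
  set b := melB p px Hs F x with hb
  rw [melS, ← ha, ← hb, Prod.norm_def, max_le_iff]
  simp only [Real.norm_eq_abs, abs_div, abs_of_pos h0, div_le_iff₀ h0]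
  constructor
  · refine (abs_sub _ _).trans ?_
    rw [abs_mul, abs_mul, add_mul]; gcongr
  · refine (abs_add_le _ _).trans ?_
    rw [abs_mul, abs_mul, add_mul]; gcongr

theorem norm_melS_le (h : OrbitDichotomy p px Ht Hs C κ B) (hF : Continuous F) {M : ℝ}
    (hM : ∀ x, 0 ≤ x → |F x| ≤ M) {x : ℝ} (hx : 0 ≤ x) :
    ‖melS p px Ht Hs F x‖ ≤ bound C κ B * M := by
  refine (h.norm_melS_le' x).trans ?_
  rw [bound, add_mul]
  exact add_le_add (h.abs_melA_le hF hM hx) (h.abs_melB_le hF hM hx)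

theorem cont_melS (h : OrbitDichotomy p px Ht Hs C κ B) (hF : Continuous F) :
    Continuous (melS p px Ht Hs F) := by
  have h1 := h.cont_melA hF
  have h2 := h.cont_melB hF
  have h3 := h.cont_p
  have h4 := h.cont_px
  exact (((h1.mul h3).sub (h2.mul h4)).div h.cont_norm fun x => (h.norm_pos x).ne').prodMk
    (((h1.mul h4).add (h2.mul h3)).div h.cont_norm fun x => (h.norm_pos x).ne')

theorem tendsto_melS (h : OrbitDichotomy p px Ht Hs C κ B) (hF : Continuous F)
    (hF0 : Tendsto F atTop (𝓝 0)) : Tendsto (melS p px Ht Hs F) atTop (𝓝 0) := by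
  have hb : Tendsto (melB p px Hs F) atTop (𝓝 0) :=
    tendsto_unstableOp h.κ_pos h.C_pos.le h.cont_unstable h.unstable_ne h.unstable_bound
      (h.cont_forcing h.cont_p hF) (h.tendsto_forcing h.abs_p_le hF0)
  have hθ : Tendsto (fun x => melTheta p px Ht Hs x * melB p px Hs F x) atTop (𝓝 0) := by
    refine squeeze_zero_norm' (a := fun x => (1 + 3 * B) * |melB p px Hs F x|) ?_
      (by simpa using hb.abs.const_mul (1 + 3 * B))
    filter_upwards [eventually_ge_atTop 0] with x hx
    rw [norm_mul]
    exact mul_le_mul_of_nonneg_right (h.abs_theta_le hx) (norm_nonneg _)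
  have ha : Tendsto (melA p px Ht Hs F) atTop (𝓝 0) :=
    tendsto_stableOp h.κ_pos h.C_pos.le h.cont_norm (fun x => (h.norm_pos x).ne') h.stable_bound
      (h.cont_melA_forcing hF) (by simpa using hθ.add (h.tendsto_forcing h.abs_px_le hF0))
  exact squeeze_zero_norm h.norm_melS_le' (by simpa using ha.abs.add hb.abs)

theorem melS_sub (h : OrbitDichotomy p px Ht Hs C κ B) (hF : Continuous F) (hG : Continuous G)
    {M M' : ℝ} (hM : ∀ x, 0 ≤ x → |F x| ≤ M) (hM' : ∀ x, 0 ≤ x → |G x| ≤ M') (x : ℝ) :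
    melS p px Ht Hs F x - melS p px Ht Hs G x = melS p px Ht Hs (fun x => F x - G x) x := by
  have hb : ∀ x, melB p px Hs F x - melB p px Hs G x = melB p px Hs (fun x => F x - G x) x := by
    intro x
    rw [melB, melB, unstableOp_sub h.κ_pos h.cont_unstable h.unstable_ne h.unstable_bound
      (h.cont_forcing h.cont_p hF) (fun y hy => h.abs_forcing_le (h.abs_p_le y) (hM y hy))
      (h.cont_forcing h.cont_p hG) (fun y hy => h.abs_forcing_le (h.abs_p_le y) (hM' y hy)), melB]
    congr 1
    ext y; ring
  have ha : ∀ x, melA p px Ht Hs F x - melA p px Ht Hs G x =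
      melA p px Ht Hs (fun x => F x - G x) x := by
    intro x
    rw [melA, melA, stableOp_sub h.cont_norm (fun x => (h.norm_pos x).ne')
      (h.cont_melA_forcing hF) (h.cont_melA_forcing hG), melA]
    congr 1
    ext y
    rw [← hb]; ring
  simp only [melS, ← ha, ← hb, Prod.mk_sub_mk]
  ext <;> simp only <;> ring

theorem deriv_melS (h : OrbitDichotomy p px Ht Hs C κ B) (hF : Continuous F) (x : ℝ) :
    HasDerivAt (fun x => (melS p px Ht Hs F x).1) (melS p px Ht Hs F x).2 x ∧
    HasDerivAt (fun x => (melS p px Ht Hs F x).2)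
      (Ht x * (melS p px Ht Hs F x).1 + Hs x * (melS p px Ht Hs F x).2 + F x) x := by
  set ζ := (p x * px x + px x * (Ht x * p x + Hs x * px x)) / (p x ^ 2 + px x ^ 2) with hζ
  have hr := h.deriv_norm x
  rw [← hζ] at hr
  have hu : HasDerivAt (fun x => (orbitWeight Hs x * orbitNorm p px x)⁻¹)
      ((Hs x - ζ) * (orbitWeight Hs x * orbitNorm p px x)⁻¹) x := by
    refine (((hasDerivAt_orbitWeight h.cont_Hs x).mul hr).inv
      (h.weight_mul_norm_pos x).ne').congr_deriv ?_
    have h1 := (h.weight_mul_norm_pos x).ne'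
    have h2 := (h.norm_pos x).ne'
    have h3 := (orbitWeight_pos Hs x).ne'
    simp only [Pi.mul_apply]
    field_simp
    ring
  have hb : HasDerivAt (melB p px Hs F) _ x :=
    hasDerivAt_unstableOp h.cont_unstable h.unstable_ne (h.cont_forcing h.cont_p hF) hu
  have ha : HasDerivAt (melA p px Ht Hs F) _ x :=
    hasDerivAt_stableOp h.cont_norm (fun x => (h.norm_pos x).ne') (h.cont_melA_forcing hF) hr
  have hr0 := (h.norm_pos x).ne'
  have hsq := h.sq_norm x
  have hQ := (h.ne x).ne'
  have hζQ : ζ * (p x ^ 2 + px x ^ 2) = p x * px x + px x * (Ht x * p x + Hs x * px x) := by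
    rw [hζ]; field_simp
  clear_value ζ
  have hΘQ : melTheta p px Ht Hs x * (p x ^ 2 + px x ^ 2) =
    -px x ^ 2 + p x * (Ht x * p x + Hs x * px x) + p x ^ 2 - Ht x * px x ^ 2 +
      Hs x * p x * px x := by rw [melTheta]; field_simp
  change HasDerivAt (melB p px Hs F) ((Hs x - ζ) * melB p px Hs F x +
    p x * F x / orbitNorm p px x) x at hb
  change HasDerivAt (melA p px Ht Hs F) (ζ * melA p px Ht Hs F x +
    (melTheta p px Ht Hs x * melB p px Hs F x + px x * F x / orbitNorm p px x)) x at ha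
  constructor
  · refine (((ha.mul (h.deriv_p x)).sub (hb.mul (h.deriv_px x))).div hr hr0).congr_deriv ?_
    simp only [melS, Pi.mul_apply, Pi.sub_apply]
    set a := melA p px Ht Hs F x
    set b := melB p px Hs F x
    set Θ := melTheta p px Ht Hs x
    -- Multiplied by p² + px², this is a polynomial identity; it says that the terms in b combine to
    -- the frame vector itself.
    have key : Θ * p x - Hs x * px x + 2 * ζ * px x - (Ht x * p x + Hs x * px x) = p x := by
      apply mul_right_cancel₀ hQ
      linear_combination p x * hΘQ + 2 * px x * hζQ
    field_simp
    linear_combination b * orbitNorm p px x * key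
  · refine (((ha.mul (h.deriv_px x)).add (hb.mul (h.deriv_p x))).div hr hr0).congr_deriv ?_
    simp only [melS, Pi.mul_apply, Pi.add_apply]
    set a := melA p px Ht Hs F x
    set b := melB p px Hs F x
    set Θ := melTheta p px Ht Hs x
    have key : Θ * px x + Hs x * p x - 2 * ζ * p x + px x = Hs x * p x - Ht x * px x := by
      apply mul_right_cancel₀ hQ
      linear_combination px x * hΘQ - 2 * p x * hζQ
    field_simp
    linear_combination b * orbitNorm p px x * key - F x * hsq

theorem melS_normal (_ : OrbitDichotomy p px Ht Hs C κ B) (F : ℝ → ℝ) :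
    (melS p px Ht Hs F 0).1 * p 0 + (melS p px Ht Hs F 0).2 * px 0 = 0 := by
  have h1 : melA p px Ht Hs F 0 = 0 := by simp [melA, stableOp]
  simp only [melS, h1]
  ring

/-- The determinant with the tangent isolates the normal component b(0) times the orbit norm, and b
is an integral from infinity whose kernel combines with the projection of the forcing into weight
times p. -/
theorem melS_separation (h : OrbitDichotomy p px Ht Hs C κ B) (F : ℝ → ℝ) :
    p 0 * (melS p px Ht Hs F 0).2 - px 0 * (melS p px Ht Hs F 0).1 =
      -∫ x in Ioi (0 : ℝ), orbitWeight Hs x * p x * F x := by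
  have hr0 := (h.norm_pos 0).ne'
  have hsq := h.sq_norm 0
  have h1 : p 0 * (melS p px Ht Hs F 0).2 - px 0 * (melS p px Ht Hs F 0).1 =
      melB p px Hs F 0 * orbitNorm p px 0 := by
    simp only [melS]
    field_simp
    linear_combination (-melB p px Hs F 0) * hsq
  have h2 : (fun y => (orbitWeight Hs y * orbitNorm p px y)⁻¹⁻¹ *
      (p y * F y / orbitNorm p px y)) = fun x => orbitWeight Hs x * p x * F x := by
    ext y
    have := (h.norm_pos y).ne'
    rw [inv_inv]
    field_simp
  rw [h1, melB, unstableOp, h2, orbitWeight_zero]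
  simp
  field_simp

theorem abs_weight_mul_p_le (h : OrbitDichotomy p px Ht Hs C κ B) {x : ℝ} (hx : 0 ≤ x) :
    |orbitWeight Hs x * p x| ≤ C * orbitNorm p px 0 * Real.exp (-κ * x) := by
  have h1 := h.unstable 0 x le_rfl hx
  rw [sub_zero, orbitWeight_zero, one_mul] at h1
  refine le_trans ?_ h1
  rw [abs_mul, abs_of_pos (orbitWeight_pos _ _)]
  exact mul_le_mul_of_nonneg_left (h.abs_p_le x) (orbitWeight_pos _ _).le

theorem abs_weight_mul_px_le (h : OrbitDichotomy p px Ht Hs C κ B) {x : ℝ} (hx : 0 ≤ x) :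
    |orbitWeight Hs x * px x| ≤ C * orbitNorm p px 0 * Real.exp (-κ * x) := by
  have h1 := h.unstable 0 x le_rfl hx
  rw [sub_zero, orbitWeight_zero, one_mul] at h1
  refine le_trans ?_ h1
  rw [abs_mul, abs_of_pos (orbitWeight_pos _ _)]
  exact mul_le_mul_of_nonneg_left (h.abs_px_le x) (orbitWeight_pos _ _).le

theorem tendsto_exp_neg (h : OrbitDichotomy p px Ht Hs C κ B) (K : ℝ) :
    Tendsto (fun x => K * Real.exp (-κ * x)) atTop (𝓝 0) := by
  simpa using (Real.tendsto_exp_atBot.comp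
    (tendsto_id.const_mul_atTop_of_neg (by linarith [h.κ_pos] : -κ < 0))).const_mul K

theorem eq_const_of_hasDerivWithinAt_zero {f : ℝ → ℝ}
    (hf : ∀ x, 0 ≤ x → HasDerivWithinAt f 0 (Ici 0) x) {x : ℝ} (hx : 0 ≤ x) : f x = f 0 :=
  constant_of_has_deriv_right_zero (a := 0) (b := x)
    (fun y hy => ((hf y hy.1).continuousWithinAt.mono Icc_subset_Ici_self))
    (fun y hy => (hf y hy.1).mono (Ici_subset_Ici.2 hy.1)) x ⟨hx, le_rfl⟩

/-- Bounded solutions of the inhomogeneous linearization that are normal to the orbit at `0` are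
given by `melS`. -/
theorem eq_melS (h : OrbitDichotomy p px Ht Hs C κ B) (hF : Continuous F) {M : ℝ}
    (hM : ∀ x, 0 ≤ x → |F x| ≤ M) {y z : ℝ → ℝ}
    (hy : ∀ x, 0 ≤ x → HasDerivWithinAt y (z x) (Ici 0) x)
    (hz : ∀ x, 0 ≤ x → HasDerivWithinAt z (Ht x * y x + Hs x * z x + F x) (Ici 0) x)
    {N : ℝ} (hyN : ∀ x, 0 ≤ x → |y x| ≤ N) (hzN : ∀ x, 0 ≤ x → |z x| ≤ N)
    (h0 : y 0 * p 0 + z 0 * px 0 = 0) {x : ℝ} (hx : 0 ≤ x) :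
    (y x, z x) = melS p px Ht Hs F x := by
  set u : ℝ → ℝ := fun x => y x - (melS p px Ht Hs F x).1 with hu
  set v : ℝ → ℝ := fun x => z x - (melS p px Ht Hs F x).2 with hv
  have hud : ∀ x, 0 ≤ x → HasDerivWithinAt u (v x) (Ici 0) x := fun x hx =>
    (hy x hx).sub (h.deriv_melS hF x).1.hasDerivWithinAt
  have hvd : ∀ x, 0 ≤ x → HasDerivWithinAt v (Ht x * u x + Hs x * v x) (Ici 0) x := fun x hx =>
    ((hz x hx).sub (h.deriv_melS hF x).2.hasDerivWithinAt).congr_deriv (by simp only [hu, hv]; ring)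
  set N' := N + bound C κ B * M
  have hub : ∀ x, 0 ≤ x → |u x| ≤ N' := fun x hx => (abs_sub _ _).trans
    (add_le_add (hyN x hx) ((norm_fst_le _).trans (h.norm_melS_le hF hM hx)))
  have hvb : ∀ x, 0 ≤ x → |v x| ≤ N' := fun x hx => (abs_sub _ _).trans
    (add_le_add (hzN x hx) ((norm_snd_le _).trans (h.norm_melS_le hF hM hx)))
  -- The weighted Wronskian of the bounded difference with the orbit derivative is constant, and it
  -- tends to 0 because weight times (p, px) decays. So it vanishes, and the difference is parallel
  -- to (p, px).
  have hω : ∀ x, 0 ≤ x → p x * v x - px x * u x = 0 := by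
    set W : ℝ → ℝ := fun x => orbitWeight Hs x * (p x * v x - px x * u x) with hW
    have hWd : ∀ x, 0 ≤ x → HasDerivWithinAt W 0 (Ici 0) x := by
      intro x hx
      refine ((hasDerivAt_orbitWeight h.cont_Hs x).hasDerivWithinAt.mul
        (((h.deriv_p x).hasDerivWithinAt.mul (hvd x hx)).sub
        ((h.deriv_px x).hasDerivWithinAt.mul (hud x hx)))).congr_deriv ?_
      simp only [Pi.mul_apply, Pi.sub_apply]
      ring
    have hW0 : Tendsto W atTop (𝓝 0) := by
      refine squeeze_zero_norm' ?_ (h.tendsto_exp_neg (C * orbitNorm p px 0 * N' +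
        C * orbitNorm p px 0 * N'))
      filter_upwards [eventually_ge_atTop 0] with x hx
      have e : W x = orbitWeight Hs x * p x * v x - orbitWeight Hs x * px x * u x := by
        simp only [hW]; ring
      rw [e]
      refine (abs_sub _ _).trans ?_
      rw [abs_mul, abs_mul _ (u x), add_mul]
      have hn := (h.norm_pos 0).le
      have hC := h.C_pos.le
      refine add_le_add ?_ ?_
      · calc _ ≤ C * orbitNorm p px 0 * Real.exp (-κ * x) * N' :=
              mul_le_mul (h.abs_weight_mul_p_le hx) (hvb x hx) (abs_nonneg _) (by positivity)
          _ = _ := by ring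
      · calc _ ≤ C * orbitNorm p px 0 * Real.exp (-κ * x) * N' :=
              mul_le_mul (h.abs_weight_mul_px_le hx) (hub x hx) (abs_nonneg _) (by positivity)
          _ = _ := by ring
    have hW00 : W 0 = 0 := by
      refine tendsto_nhds_unique ?_ hW0
      refine tendsto_const_nhds.congr' ?_
      filter_upwards [eventually_ge_atTop 0] with x hx
      exact (eq_const_of_hasDerivWithinAt_zero hWd hx).symm
    intro x hx
    have h1 := eq_const_of_hasDerivWithinAt_zero hWd hx
    rw [hW00] at h1
    exact (mul_eq_zero.1 h1).resolve_left (orbitWeight_pos _ _).ne'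
  -- The factor of proportionality between (u, v) and (p, px). It is constant, and the normality
  -- condition at 0 makes it zero.
  set n : ℝ → ℝ := fun x => (p x * u x + px x * v x) / (p x ^ 2 + px x ^ 2) with hn
  have hnd : ∀ x, 0 ≤ x → HasDerivWithinAt n 0 (Ici 0) x := by
    intro x hx
    have hp := (h.deriv_p x).hasDerivWithinAt (s := Ici 0)
    have hpx := (h.deriv_px x).hasDerivWithinAt (s := Ici 0)
    refine (((hp.mul (hud x hx)).add (hpx.mul (hvd x hx))).div
      ((hp.pow 2).add (hpx.pow 2)) (h.ne x).ne').congr_deriv ?_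
    rw [div_eq_zero_iff]
    left
    simp only [Pi.mul_apply, Pi.add_apply, Pi.pow_apply]
    norm_num
    linear_combination (-px x ^ 2 + p x * (Ht x * p x + Hs x * px x) + p x ^ 2 - Ht x * px x ^ 2 +
      Hs x * p x * px x) * hω x hx
  have hn0 : n 0 = 0 := by
    have h1 := h.melS_normal F
    simp only [hn, hu, hv]
    rw [div_eq_zero_iff]
    left
    linear_combination h0 - h1
  have h1 := eq_const_of_hasDerivWithinAt_zero hnd hx
  rw [hn0, div_eq_zero_iff] at h1
  have h2 := h1.resolve_right (h.ne x).ne'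
  have h3 := hω x hx
  have hu0 : u x = 0 := by
    apply mul_left_cancel₀ (h.ne x).ne'
    linear_combination p x * h2 - px x * h3
  have hv0 : v x = 0 := by
    apply mul_left_cancel₀ (h.ne x).ne'
    linear_combination px x * h2 + p x * h3
  exact Prod.ext (sub_eq_zero.1 hu0) (sub_eq_zero.1 hv0)

end OrbitDichotomy

end Melnikov

/-! ### Nonlinear branches and differentiability of the separation -/

section MelnikovNonlinear

/-- Apply the hypothesis to the supremum itself, which is finite because of N, and absorb its half.
-/
theorem le_two_mul_of_bootstrap {f : ℝ → ℝ} {N a : ℝ} (hN : ∀ x, 0 ≤ x → f x ≤ N)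
    (h : ∀ m, (∀ x, 0 ≤ x → f x ≤ m) → ∀ x, 0 ≤ x → f x ≤ a + m / 2) {x : ℝ} (hx : 0 ≤ x) :
    f x ≤ 2 * a := by
  have hb : BddAbove (f '' Ici 0) := ⟨N, by rintro _ ⟨y, hy, rfl⟩; exact hN y hy⟩
  have hm : ∀ x, 0 ≤ x → f x ≤ sSup (f '' Ici 0) := fun x hx => le_csSup hb ⟨x, hx, rfl⟩
  have h1 : sSup (f '' Ici 0) ≤ a + sSup (f '' Ici 0) / 2 :=
    csSup_le ⟨f 0, 0, self_mem_Ici, rfl⟩ (by rintro _ ⟨y, hy, rfl⟩; exact h _ hm y hy)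
  linarith [hm x hx]

/-- Truncation to `[-δ, δ]`. -/
noncomputable def clamp (δ y : ℝ) : ℝ := max (-δ) (min y δ)

theorem abs_clamp_le {δ : ℝ} (hδ : 0 ≤ δ) (y : ℝ) : |clamp δ y| ≤ δ :=
  abs_le.2 ⟨le_max_left _ _, max_le (by linarith) (min_le_right _ _)⟩

theorem clamp_of_abs_le {δ y : ℝ} (h : |y| ≤ δ) : clamp δ y = y := by
  have := abs_le.1 h
  rw [clamp, min_eq_left this.2, max_eq_right this.1]

theorem abs_clamp_sub_le (δ y z : ℝ) : |clamp δ y - clamp δ z| ≤ |y - z| := by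
  unfold clamp
  refine (abs_max_sub_max_le_max _ _ _ _).trans ?_
  rw [sub_self, abs_zero]
  refine max_le (abs_nonneg _) ((abs_min_sub_min_le_max _ _ _ _).trans ?_)
  simp

theorem continuous_clamp (δ : ℝ) : Continuous (clamp δ) :=
  continuous_const.max (continuous_id.min continuous_const)

/-- The planar vector field `(t, p) ↦ (p, H c t p)` near the orbit `(t, p)` of `H c₀`. -/
structure NearOrbit (H : ℝ → ℝ → ℝ → ℝ) (c₀ : ℝ) (t p px Hc Ht Hs : ℝ → ℝ) (B δ₀ : ℝ) : Prop where
  deriv_t : ∀ x, HasDerivAt t (p x) x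
  px_eq : ∀ x, px x = H c₀ (t x) (p x)
  pos : 0 < δ₀
  cont_Hc : Continuous Hc
  bound_Hc : ∀ x, 0 ≤ x → |Hc x| ≤ B
  approx : ∀ ε > 0, ∃ δ > 0, ∀ x, 0 ≤ x → ∀ c c' y y' z z', |c - c₀| ≤ δ → |c' - c₀| ≤ δ →
    |y| ≤ δ → |y'| ≤ δ → |z| ≤ δ → |z'| ≤ δ →
    |H c (t x + y) (p x + z) - H c' (t x + y') (p x + z') -
      (Hc x * (c - c') + Ht x * (y - y') + Hs x * (z - z'))| ≤
      ε * (|c - c'| + |y - y'| + |z - z'|)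
  cont : ∀ c y z x, |c - c₀| ≤ δ₀ → |y| ≤ δ₀ → |z| ≤ δ₀ →
    ContinuousAt (fun v : ℝ × ℝ => H c v.1 v.2) (t x + y, p x + z)
  lim : ∀ c, |c - c₀| ≤ δ₀ → Tendsto (fun x => H c (t x) (p x)) atTop (𝓝 0)

namespace NearOrbit

variable {H : ℝ → ℝ → ℝ → ℝ} {c₀ : ℝ} {t p px Hc Ht Hs : ℝ → ℝ} {C κ B δ₀ : ℝ}

theorem cont_t (h : NearOrbit H c₀ t p px Hc Ht Hs B δ₀) : Continuous t :=
  continuous_iff_continuousAt.2 fun x => (h.deriv_t x).continuousAt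

/-- Existence of the perturbed invariant manifold. -/
theorem exists_branch (h : NearOrbit H c₀ t p px Hc Ht Hs B δ₀)
    (hd : OrbitDichotomy p px Ht Hs C κ B) :
    ∃ K, 0 ≤ K ∧ ∀ᶠ c in 𝓝 c₀, ∃ y z : ℝ → ℝ,
      (∀ x, 0 ≤ x → HasDerivWithinAt y (z x) (Ici 0) x) ∧
      (∀ x, 0 ≤ x → HasDerivWithinAt z (H c (t x + y x) (p x + z x) - px x) (Ici 0) x) ∧
      (∀ x, 0 ≤ x → |y x| ≤ K * |c - c₀| ∧ |z x| ≤ K * |c - c₀|) ∧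
      Tendsto y atTop (𝓝 0) ∧ Tendsto z atTop (𝓝 0) ∧ y 0 * p 0 + z 0 * px 0 = 0 := by
  set b := OrbitDichotomy.bound C κ B with hbdef
  have hb : 0 ≤ b := hd.bound_nonneg
  have hB : 0 ≤ B := hd.B_nonneg
  -- The remainder has Lipschitz constant 2 * ε, one ε for each state variable, so the contraction
  -- factor b * (2 * ε) is at most 1/2.
  set ε := 1 / (4 * (b + 1)) with hε
  have hε0 : 0 < ε := by positivity
  have hbε : b * (2 * ε) ≤ 1 / 2 := by
    rw [hε]; field_simp; linarith
  obtain ⟨δ₁, hδ₁, happ⟩ := h.approx ε hε0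
  set δ := min δ₁ δ₀
  have hδ : 0 < δ := lt_min hδ₁ h.pos
  have hδ1 : δ ≤ δ₁ := min_le_left _ _
  have hδ0 : δ ≤ δ₀ := min_le_right _ _
  set K := 2 * (b * (B + ε))
  have hK : 0 ≤ K := by positivity
  refine ⟨K, hK, ?_⟩
  have hc1 : ∀ᶠ c in 𝓝 c₀, |c - c₀| ≤ δ := by
    filter_upwards [Metric.closedBall_mem_nhds c₀ hδ] with c hc
    rwa [Metric.mem_closedBall, Real.dist_eq] at hc
  have hc2 : ∀ᶠ c in 𝓝 c₀, K * |c - c₀| ≤ δ := by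
    have : Tendsto (fun c => K * |c - c₀|) (𝓝 c₀) (𝓝 0) := by
      have := ((continuous_const (y := K)).mul (continuous_id.sub continuous_const).abs).tendsto
        (f := fun c => K * |c - c₀|) c₀
      simpa using this
    exact (this.eventually (gt_mem_nhds hδ)).mono fun _ h => h.le
  filter_upwards [hc1, hc2] with c hc hcK
  have hct := h.cont_t
  have hcp := hd.cont_p
  have hcHt := hd.cont_Ht
  have hcHs := hd.cont_Hs
  have h00 : |c₀ - c₀| ≤ δ₀ := by simpa using h.pos.le
  -- The remainder after subtraction of the linear part. Clamping makes it globally Lipschitz;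
  -- afterwards the solution is at most K * |c - c₀| ≤ δ, so the clamps are inactive.
  set g : ℝ → ℝ × ℝ → ℝ := fun x Y => H c (t x + clamp δ Y.1) (p x + clamp δ Y.2) -
    H c₀ (t x) (p x) - Ht x * clamp δ Y.1 - Hs x * clamp δ Y.2 with hg
  have hgc : ∀ Y : ℝ → ℝ × ℝ, Continuous Y → Continuous fun x => g x (Y x) := by
    intro Y hY
    have c1 : Continuous fun x => clamp δ (Y x).1 := (continuous_clamp δ).comp hY.fst
    have c2 : Continuous fun x => clamp δ (Y x).2 := (continuous_clamp δ).comp hY.snd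
    have c3 : Continuous fun x => H c (t x + clamp δ (Y x).1) (p x + clamp δ (Y x).2) := by
      refine continuous_iff_continuousAt.2 fun x => ?_
      exact (h.cont c _ _ x (hc.trans hδ0) ((abs_clamp_le hδ.le _).trans hδ0)
        ((abs_clamp_le hδ.le _).trans hδ0)).comp (f := fun x => (t x + clamp δ (Y x).1,
          p x + clamp δ (Y x).2)) ((hct.add c1).prodMk (hcp.add c2)).continuousAt
    have c4 : Continuous fun x => H c₀ (t x) (p x) := by
      have : (fun x => H c₀ (t x) (p x)) = px := funext fun x => (h.px_eq x).symm
      rw [this]; exact hd.cont_px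
    exact ((c3.sub c4).sub (hcHt.mul c1)).sub (hcHs.mul c2)
  have hclamp0 : clamp δ 0 = 0 := clamp_of_abs_le (by simpa using hδ.le)
  have hgL : ∀ x, 0 ≤ x → ∀ Y Y' : ℝ × ℝ, |g x Y - g x Y'| ≤ 2 * ε * ‖Y - Y'‖ := by
    intro x hx Y Y'
    have h1 := happ x hx c c (clamp δ Y.1) (clamp δ Y'.1) (clamp δ Y.2) (clamp δ Y'.2)
      (hc.trans hδ1) (hc.trans hδ1) ((abs_clamp_le hδ.le _).trans hδ1)
      ((abs_clamp_le hδ.le _).trans hδ1) ((abs_clamp_le hδ.le _).trans hδ1)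
      ((abs_clamp_le hδ.le _).trans hδ1)
    have h2 := (abs_clamp_sub_le δ Y.1 Y'.1).trans (norm_fst_le (Y - Y'))
    have h3 := (abs_clamp_sub_le δ Y.2 Y'.2).trans (norm_snd_le (Y - Y'))
    have e : g x Y - g x Y' = H c (t x + clamp δ Y.1) (p x + clamp δ Y.2) -
        H c (t x + clamp δ Y'.1) (p x + clamp δ Y'.2) - (Hc x * (c - c) +
        Ht x * (clamp δ Y.1 - clamp δ Y'.1) + Hs x * (clamp δ Y.2 - clamp δ Y'.2)) := by
      simp only [hg]; ring
    rw [e]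
    calc _ ≤ _ := h1
      _ ≤ ε * (0 + ‖Y - Y'‖ + ‖Y - Y'‖) := by
          rw [sub_self, abs_zero]; gcongr
      _ = _ := by ring
  have hg0 : ∀ x, 0 ≤ x → |g x 0| ≤ (B + ε) * |c - c₀| := by
    intro x hx
    have h1 := happ x hx c c₀ 0 0 0 0 (hc.trans hδ1) (by simpa using hδ₁.le) (by simpa using hδ₁.le)
      (by simpa using hδ₁.le) (by simpa using hδ₁.le) (by simpa using hδ₁.le)
    simp only [sub_self, abs_zero, add_zero, mul_zero] at h1
    have h2 : g x 0 = (H c (t x) (p x) - H c₀ (t x) (p x) - Hc x * (c - c₀)) + Hc x * (c - c₀) := by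
      simp only [hg, Prod.fst_zero, Prod.snd_zero, hclamp0]; ring_nf
    rw [h2]
    refine (abs_add_le _ _).trans ?_
    rw [abs_mul]
    nlinarith [mul_le_mul_of_nonneg_right (h.bound_Hc x hx) (abs_nonneg (c - c₀))]
  have hg0t : Tendsto (fun x => g x 0) atTop (𝓝 0) := by
    have h1 := (h.lim c (hc.trans hδ0)).sub (h.lim c₀ h00)
    simpa [hg, hclamp0] using h1
  set S : (ℝ → ℝ × ℝ) → ℝ → ℝ × ℝ := fun f => melS p px Ht Hs fun x => (f x).1 with hS
  have hfst : ∀ f : ℝ → ℝ × ℝ, Tendsto f atTop (𝓝 0) →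
      Tendsto (fun x => (f x).1) atTop (𝓝 0) := fun f hf =>
    (continuous_fst.tendsto _).comp hf
  obtain ⟨Y, hYc, hY0, hY⟩ := exists_fixedPoint_halfLine S (C := b) (L := 2 * ε)
    (fun f hf _ => hd.cont_melS hf.fst) (fun f hf hf0 => hd.tendsto_melS hf.fst (hfst f hf0))
    hb (by positivity) (by linarith)
    (fun f g hf hf0 hg hg0 M hM x hx => by
      obtain ⟨Mf, -, hMf⟩ := exists_bound_of_tendsto_zero hf hf0
      obtain ⟨Mg, -, hMg⟩ := exists_bound_of_tendsto_zero hg hg0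
      simp only [hS]
      rw [hd.melS_sub hf.fst hg.fst (fun y hy => (norm_fst_le _).trans (hMf y hy))
        (fun y hy => (norm_fst_le _).trans (hMg y hy))]
      exact hd.norm_melS_le (hf.fst.sub hg.fst)
        (fun y hy => (norm_fst_le (f y - g y)).trans (hM y hy)) hx)
    (fun x Y => (g x Y, 0)) (fun Y hY => (hgc Y hY).prodMk continuous_const)
    (fun x hx Y Y' => by
      rw [Prod.mk_sub_mk, sub_zero, Prod.norm_mk, norm_zero, max_eq_left (norm_nonneg _)]
      exact hgL x hx Y Y')
    (hg0t.prodMk_nhds tendsto_const_nhds)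
    (fun _ => 0) continuous_const tendsto_const_nhds
  have hYS : ∀ x, 0 ≤ x → Y x = melS p px Ht Hs (fun x => g x (Y x)) x := fun x hx => by
    have := hY x hx
    rwa [zero_add] at this
  have hgY := hgc Y hYc
  obtain ⟨N, -, hN⟩ := exists_bound_of_tendsto_zero hYc hY0
  have hgYb : ∀ m, (∀ x, 0 ≤ x → ‖Y x‖ ≤ m) → ∀ x, 0 ≤ x →
      |g x (Y x)| ≤ (B + ε) * |c - c₀| + 2 * ε * m := by
    intro m hm x hx
    calc |g x (Y x)| = |g x 0 + (g x (Y x) - g x 0)| := by rw [add_sub_cancel]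
      _ ≤ |g x 0| + |g x (Y x) - g x 0| := abs_add_le _ _
      _ ≤ (B + ε) * |c - c₀| + 2 * ε * m := by
          refine add_le_add (hg0 x hx) ((hgL x hx _ _).trans ?_)
          rw [sub_zero]
          have := hm x hx
          gcongr
  have hYK : ∀ x, 0 ≤ x → ‖Y x‖ ≤ K * |c - c₀| := by
    intro x hx
    have := le_two_mul_of_bootstrap (a := b * ((B + ε) * |c - c₀|)) hN (fun m hm x hx => by
      rw [hYS x hx]
      have hm0 := (norm_nonneg _).trans (hm 0 le_rfl)
      refine (hd.norm_melS_le hgY (hgYb m hm) hx).trans ?_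
      rw [mul_add, ← mul_assoc]
      nlinarith [mul_le_mul_of_nonneg_right hbε hm0]) hx
    calc _ ≤ _ := this
      _ = _ := by simp only [K]; ring
  have hY1 : ∀ x, 0 ≤ x → |(Y x).1| ≤ K * |c - c₀| := fun x hx => (norm_fst_le _).trans (hYK x hx)
  have hY2 : ∀ x, 0 ≤ x → |(Y x).2| ≤ K * |c - c₀| := fun x hx => (norm_snd_le _).trans (hYK x hx)
  refine ⟨fun x => (Y x).1, fun x => (Y x).2, fun x hx => ?_, fun x hx => ?_,
    fun x hx => ⟨hY1 x hx, hY2 x hx⟩, hfst Y hY0, (continuous_snd.tendsto _).comp hY0, ?_⟩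
  · have h1 := (hd.deriv_melS hgY x).1.hasDerivWithinAt (s := Ici 0)
    rw [← hYS x hx] at h1
    exact h1.congr_of_mem (fun z hz => by rw [hYS z hz]) hx
  · have h1 := (hd.deriv_melS hgY x).2.hasDerivWithinAt (s := Ici 0)
    rw [← hYS x hx] at h1
    refine (h1.congr_of_mem (fun z hz => by rw [hYS z hz]) hx).congr_deriv ?_
    simp only [hg]
    rw [clamp_of_abs_le ((hY1 x hx).trans hcK), clamp_of_abs_le ((hY2 x hx).trans hcK), h.px_eq]
    ring
  · have := hd.melS_normal (fun x => g x (Y x))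
    rwa [← hYS 0 le_rfl] at this

open MeasureTheory in
/-- The separation along the normal section is differentiable in the parameter. -/
theorem hasDerivAt_separation (h : NearOrbit H c₀ t p px Hc Ht Hs B δ₀)
    (hd : OrbitDichotomy p px Ht Hs C κ B) {y z : ℝ → ℝ → ℝ}
    (hsol : ∀ᶠ c in 𝓝 c₀, (∀ x, 0 ≤ x → HasDerivWithinAt (y c) (z c x) (Ici 0) x) ∧
      (∀ x, 0 ≤ x → HasDerivWithinAt (z c) (H c (t x + y c x) (p x + z c x) - px x) (Ici 0) x) ∧
      y c 0 * p 0 + z c 0 * px 0 = 0)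
    (hsmall : ∀ ε > 0, ∀ᶠ c in 𝓝 c₀, ∀ x, 0 ≤ x → |y c x| ≤ ε ∧ |z c x| ≤ ε) :
    HasDerivAt (fun c => p 0 * z c 0 - px 0 * y c 0)
      (-∫ x in Ioi (0 : ℝ), orbitWeight Hs x * p x * Hc x) c₀ := by
  set b := OrbitDichotomy.bound C κ B with hbdef
  have hb : 0 ≤ b := hd.bound_nonneg
  have hB : 0 ≤ B := hd.B_nonneg
  -- The forcing that the branch itself produces in the variational equation, frozen for negative
  -- arguments so as to be continuous on the whole line.
  set F : ℝ → ℝ → ℝ := fun c x => H c (t (max x 0) + y c (max x 0)) (p (max x 0) + z c (max x 0)) -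
    px (max x 0) - Ht (max x 0) * y c (max x 0) - Hs (max x 0) * z c (max x 0) with hF
  have hFx : ∀ c x, 0 ≤ x → F c x = H c (t x + y c x) (p x + z c x) - px x - Ht x * y c x -
      Hs x * z c x := fun c x hx => by simp only [hF, max_eq_left hx]
  have hcball : ∀ δ > 0, ∀ᶠ c in 𝓝 c₀, |c - c₀| ≤ δ := by
    intro δ hδ
    filter_upwards [Metric.closedBall_mem_nhds c₀ hδ] with c hc
    rwa [Metric.mem_closedBall, Real.dist_eq] at hc
  have hFapp : ∀ ε > 0, ∀ᶠ c in 𝓝 c₀, ∀ x, 0 ≤ x →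
      |F c x - (c - c₀) * Hc x| ≤ ε * (|c - c₀| + |y c x| + |z c x|) := by
    intro ε hε
    obtain ⟨δ, hδ, happ⟩ := h.approx ε hε
    filter_upwards [hcball δ hδ, hsmall δ hδ] with c hc hs x hx
    have h1 := happ x hx c c₀ (y c x) 0 (z c x) 0 hc (by simpa using hδ.le) (hs x hx).1
      (by simpa using hδ.le) (hs x hx).2 (by simpa using hδ.le)
    simp only [sub_zero, add_zero, ← h.px_eq] at h1
    rw [hFx c x hx]
    convert h1 using 2
    ring
  have hFc : ∀ᶠ c in 𝓝 c₀, Continuous (F c) := by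
    filter_upwards [hcball δ₀ h.pos, hsmall δ₀ h.pos, hsol] with c hc hs hc3
    have m : Continuous fun x : ℝ => max x 0 := continuous_id.max continuous_const
    have cy : Continuous fun x => y c (max x 0) :=
      ContinuousOn.comp_continuous (s := Ici 0) (fun x hx => (hc3.1 x hx).continuousWithinAt) m
        fun x => mem_Ici.2 (le_max_right _ _)
    have cz : Continuous fun x => z c (max x 0) :=
      ContinuousOn.comp_continuous (s := Ici 0) (fun x hx => (hc3.2.1 x hx).continuousWithinAt) m
        fun x => mem_Ici.2 (le_max_right _ _)
    have ct := h.cont_t.comp m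
    have cp := hd.cont_p.comp m
    have c3 : Continuous fun x => H c (t (max x 0) + y c (max x 0)) (p (max x 0) + z c (max x 0)) := by
      refine continuous_iff_continuousAt.2 fun x => ?_
      exact (h.cont c _ _ _ hc (hs _ (le_max_right x 0)).1 (hs _ (le_max_right x 0)).2).comp
        (f := fun x => (t (max x 0) + y c (max x 0), p (max x 0) + z c (max x 0)))
        ((ct.add cy).prodMk (cp.add cz)).continuousAt
    exact ((c3.sub (hd.cont_px.comp m)).sub ((hd.cont_Ht.comp m).mul cy)).sub
      ((hd.cont_Hs.comp m).mul cz)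
  set ε₀ := 1 / (4 * (b + 1)) with hε₀
  have hε₀0 : 0 < ε₀ := by positivity
  have hbε : b * (2 * ε₀) ≤ 1 / 2 := by
    rw [hε₀]; field_simp; linarith
  set K := 2 * (b * (B + ε₀))
  have hK : 0 ≤ K := by positivity
  -- By uniqueness of bounded normal solutions, the branch is `melS` of its own forcing. Feeding its
  -- bound back in upgrades the mere uniform smallness to O(|c - c₀|).
  have hrep : ∀ᶠ c in 𝓝 c₀, (∀ x, 0 ≤ x → (y c x, z c x) = melS p px Ht Hs (F c) x) ∧
      ∀ x, 0 ≤ x → ‖(y c x, z c x)‖ ≤ K * |c - c₀| := by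
    filter_upwards [hFapp ε₀ hε₀0, hFc, hsol, hsmall 1 one_pos] with c h1 h2 h3 h4
    have hFm : ∀ m, (∀ x, 0 ≤ x → ‖(y c x, z c x)‖ ≤ m) → ∀ x, 0 ≤ x →
        |F c x| ≤ (B + ε₀) * |c - c₀| + 2 * ε₀ * m := by
      intro m hm x hx
      have e1 := h1 x hx
      have e2 : |y c x| ≤ m := (norm_fst_le (y c x, z c x)).trans (hm x hx)
      have e3 : |z c x| ≤ m := (norm_snd_le (y c x, z c x)).trans (hm x hx)
      calc |F c x| = |(F c x - (c - c₀) * Hc x) + (c - c₀) * Hc x| := by rw [sub_add_cancel]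
        _ ≤ ε₀ * (|c - c₀| + |y c x| + |z c x|) + |c - c₀| * B := by
            refine (abs_add_le _ _).trans (add_le_add e1 ?_)
            rw [abs_mul]
            exact mul_le_mul_of_nonneg_left (h.bound_Hc x hx) (abs_nonneg _)
        _ ≤ ε₀ * (|c - c₀| + m + m) + |c - c₀| * B := by gcongr
        _ = _ := by ring
    have hN : ∀ x, 0 ≤ x → ‖(y c x, z c x)‖ ≤ 1 := fun x hx =>
      max_le (h4 x hx).1 (h4 x hx).2
    have heq : ∀ x, 0 ≤ x → (y c x, z c x) = melS p px Ht Hs (F c) x := fun x hx =>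
      hd.eq_melS h2 (hFm 1 hN) h3.1 (fun x hx => by
        refine (h3.2.1 x hx).congr_deriv ?_
        rw [hFx c x hx]; ring) (fun x hx => (h4 x hx).1) (fun x hx => (h4 x hx).2) h3.2.2 hx
    refine ⟨heq, fun x hx => ?_⟩
    have := le_two_mul_of_bootstrap (a := b * ((B + ε₀) * |c - c₀|)) hN (fun m hm x hx => by
      rw [heq x hx]
      have hm0 := (norm_nonneg _).trans (hm 0 le_rfl)
      refine (hd.norm_melS_le h2 (hFm m hm) hx).trans ?_
      rw [mul_add, ← mul_assoc]
      nlinarith [mul_le_mul_of_nonneg_right hbε hm0]) hx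
    calc _ ≤ _ := this
      _ = _ := by simp only [K]; ring
  have hsep : ∀ᶠ c in 𝓝 c₀, p 0 * z c 0 - px 0 * y c 0 =
      -∫ x in Ioi (0 : ℝ), orbitWeight Hs x * p x * F c x := by
    filter_upwards [hrep] with c hc
    have h1 := hd.melS_separation (F c)
    rwa [← hc.1 0 le_rfl] at h1
  have hc₀ : p 0 * z c₀ 0 - px 0 * y c₀ 0 = 0 := by
    have h1 := hrep.self_of_nhds.2 0 le_rfl
    rw [sub_self, abs_zero, mul_zero, norm_le_zero_iff] at h1
    have h2 : y c₀ 0 = 0 := congrArg Prod.fst h1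
    have h3 : z c₀ 0 = 0 := congrArg Prod.snd h1
    rw [h2, h3]; ring
  set k := C * orbitNorm p px 0
  have hk : 0 < k := mul_pos hd.C_pos (hd.norm_pos 0)
  have hκ := hd.κ_pos
  have hexp : IntegrableOn (fun x => Real.exp (-κ * x)) (Ioi 0) := exp_neg_integrableOn_Ioi 0 hκ
  have hwp : Continuous fun x => orbitWeight Hs x * p x := hd.cont_weight.mul hd.cont_p
  have hint : ∀ G : ℝ → ℝ, Continuous G → ∀ M, (∀ x, 0 ≤ x → |G x| ≤ M) →
      IntegrableOn (fun x => orbitWeight Hs x * p x * G x) (Ioi 0) := by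
    intro G hG M hM
    have hi : IntegrableOn (fun x => k * M * Real.exp (-κ * x)) (Ioi 0) := hexp.const_mul (k * M)
    refine Integrable.mono' hi (hwp.mul hG).aestronglyMeasurable.restrict
      ((ae_restrict_iff' measurableSet_Ioi).2 (ae_of_all _ fun x hx => ?_))
    have hx' := (mem_Ioi.1 hx).le
    rw [norm_mul]
    calc _ ≤ k * Real.exp (-κ * x) * M := mul_le_mul (hd.abs_weight_mul_p_le hx') (hM x hx')
          (abs_nonneg _) (by positivity)
      _ = _ := by ring
  rw [hasDerivAt_iff_isLittleO, Asymptotics.isLittleO_iff]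
  intro η hη
  -- Chosen so that k ε (1 + 2K) ∫ exp(-κx) over the half-line equals η.
  set ε := η * κ / (k * (1 + 2 * K)) with hε
  have hε0 : 0 < ε := by positivity
  filter_upwards [hsep, hrep, hFapp ε hε0, hFc] with c h1 h2 h3 h4
  rw [hc₀, h1, sub_zero, smul_eq_mul]
  have hb : ∀ x, 0 ≤ x → |F c x - (c - c₀) * Hc x| ≤ ε * ((1 + 2 * K) * |c - c₀|) := by
    intro x hx
    refine (h3 x hx).trans ?_
    have e2 : |y c x| ≤ K * |c - c₀| := (norm_fst_le (y c x, z c x)).trans (h2.2 x hx)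
    have e3 : |z c x| ≤ K * |c - c₀| := (norm_snd_le (y c x, z c x)).trans (h2.2 x hx)
    gcongr
    linarith
  have hHcc : Continuous fun x => (c - c₀) * Hc x := continuous_const.mul h.cont_Hc
  have hHcb : ∀ x, 0 ≤ x → |(c - c₀) * Hc x| ≤ |c - c₀| * B := fun x hx => by
    rw [abs_mul]; exact mul_le_mul_of_nonneg_left (h.bound_Hc x hx) (abs_nonneg _)
  have hFb : ∀ x, 0 ≤ x → |F c x| ≤ ε * ((1 + 2 * K) * |c - c₀|) + |c - c₀| * B := fun x hx => by
    calc |F c x| = |(F c x - (c - c₀) * Hc x) + (c - c₀) * Hc x| := by rw [sub_add_cancel]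
      _ ≤ _ := (abs_add_le _ _).trans (add_le_add (hb x hx) (hHcb x hx))
  have e : -(∫ x in Ioi (0 : ℝ), orbitWeight Hs x * p x * F c x) -
      (c - c₀) * -∫ x in Ioi (0 : ℝ), orbitWeight Hs x * p x * Hc x =
      -∫ x in Ioi (0 : ℝ), orbitWeight Hs x * p x * (F c x - (c - c₀) * Hc x) := by
    have : (c - c₀) * ∫ x in Ioi (0 : ℝ), orbitWeight Hs x * p x * Hc x =
        ∫ x in Ioi (0 : ℝ), orbitWeight Hs x * p x * ((c - c₀) * Hc x) := by
      rw [← integral_const_mul]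
      congr 1
      ext x; ring
    rw [mul_neg, this, sub_neg_eq_add, neg_add_eq_sub, ← integral_sub (hint _ hHcc _ hHcb)
      (hint _ h4 _ hFb), ← integral_neg]
    congr 1
    ext x; ring
  rw [e, norm_neg]
  have hfin : ‖∫ x in Ioi (0 : ℝ), orbitWeight Hs x * p x * (F c x - (c - c₀) * Hc x)‖ ≤
      ∫ x in Ioi (0 : ℝ), k * (ε * ((1 + 2 * K) * |c - c₀|)) * Real.exp (-κ * x) := by
    refine norm_integral_le_of_norm_le (hexp.const_mul _)
      ((ae_restrict_iff' measurableSet_Ioi).2 (ae_of_all _ fun x hx => ?_))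
    have hx' := (mem_Ioi.1 hx).le
    rw [norm_mul]
    calc _ ≤ k * Real.exp (-κ * x) * (ε * ((1 + 2 * K) * |c - c₀|)) :=
          mul_le_mul (hd.abs_weight_mul_p_le hx') (hb x hx') (abs_nonneg _) (by positivity)
      _ = _ := by ring
  refine hfin.trans (le_of_eq ?_)
  rw [integral_const_mul, integral_exp_mul_Ioi (by linarith : -κ < 0), hε, Real.norm_eq_abs]
  simp only [mul_zero, Real.exp_zero]
  field_simp

end NearOrbit

end MelnikovNonlinear

/-! ### Homoclinic orbits of planar vector fields -/

section PlaneOrbit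

/-- A `C¹` function is strictly differentiable uniformly near a compact set. -/
theorem exists_uniform_strict_fderiv {E : Type*} [NormedAddCommGroup E] [NormedSpace ℝ E]
    {f : E → ℝ} {K : Set E} (hK : IsCompact K) (hf : ∀ k ∈ K, ContDiffAt ℝ 1 f k) {ε : ℝ}
    (hε : 0 < ε) : ∃ δ > 0, ∀ k ∈ K, ∀ a b, ‖a - k‖ ≤ δ → ‖b - k‖ ≤ δ →
      |f a - f b - fderiv ℝ f k (a - b)| ≤ ε * ‖a - b‖ := by
  have key : ∃ δ > 0, ∀ k ∈ K ∩ K, ∀ a b, ‖a - k‖ ≤ δ → ‖b - k‖ ≤ δ →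
      |f a - f b - fderiv ℝ f k (a - b)| ≤ ε * ‖a - b‖ := by
    refine hK.induction_on (p := fun s => ∃ δ > 0, ∀ k ∈ s ∩ K, ∀ a b, ‖a - k‖ ≤ δ → ‖b - k‖ ≤ δ →
      |f a - f b - fderiv ℝ f k (a - b)| ≤ ε * ‖a - b‖) ?_ ?_ ?_ ?_
    · exact ⟨1, one_pos, fun k hk => absurd hk.1 (notMem_empty k)⟩
    · rintro s s' hs ⟨δ, hδ, h⟩
      exact ⟨δ, hδ, fun k hk => h k ⟨hs hk.1, hk.2⟩⟩
    · rintro s s' ⟨δ, hδ, h⟩ ⟨δ', hδ', h'⟩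
      refine ⟨min δ δ', lt_min hδ hδ', fun k hk a b ha hb => ?_⟩
      rcases hk.1 with hks | hks
      · exact h k ⟨hks, hk.2⟩ a b (ha.trans (min_le_left _ _)) (hb.trans (min_le_left _ _))
      · exact h' k ⟨hks, hk.2⟩ a b (ha.trans (min_le_right _ _)) (hb.trans (min_le_right _ _))
    · intro k hk
      have h1 := ((hf k hk).hasStrictFDerivAt one_ne_zero).isLittleO.def (half_pos hε)
      have h2 : ContinuousAt (fderiv ℝ f) k := (hf k hk).continuousAt_fderiv one_ne_zero
      obtain ⟨r₁, hr₁, h1⟩ := Metric.eventually_nhds_iff.1 h1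
      obtain ⟨r₂, hr₂, h2⟩ := Metric.continuousAt_iff.1 h2 (ε / 2) (half_pos hε)
      -- Points within r₁/4 of a base point within r₁/2 of k stay where the strict derivative at k
      -- is accurate; half of ε pays for that, the other half for moving the derivative from k to
      -- the base point.
      refine ⟨Metric.ball k (min (r₁ / 2) r₂), mem_nhdsWithin_of_mem_nhds
        (Metric.ball_mem_nhds _ (lt_min (half_pos hr₁) hr₂)), r₁ / 4, by positivity, ?_⟩
      rintro k' ⟨hk', -⟩ a b ha hb
      have hk1 := (Metric.mem_ball.1 hk').trans_le (min_le_left _ _)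
      have hk2 := h2 ((Metric.mem_ball.1 hk').trans_le (min_le_right _ _))
      have hball : ∀ a, ‖a - k'‖ ≤ r₁ / 4 → dist a k < r₁ := fun a ha => by
        have := dist_triangle a k' k
        rw [dist_eq_norm a k'] at this
        linarith
      have h3 := @h1 (a, b) (by
        rw [Prod.dist_eq]; exact max_lt (hball a ha) (hball b hb))
      rw [dist_eq_norm] at hk2
      calc |f a - f b - fderiv ℝ f k' (a - b)|
          = |(f a - f b - fderiv ℝ f k (a - b)) - (fderiv ℝ f k' - fderiv ℝ f k) (a - b)| := by
            rw [_root_.sub_apply]; congr 1; ring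
        _ ≤ ε / 2 * ‖a - b‖ + ε / 2 * ‖a - b‖ := by
            refine (abs_sub _ _).trans (add_le_add h3 ?_)
            exact ((fderiv ℝ f k' - fderiv ℝ f k).le_opNorm (a - b)).trans
              (mul_le_mul_of_nonneg_right hk2.le (norm_nonneg _))
        _ = _ := by ring
  obtain ⟨δ, hδ, h⟩ := key
  exact ⟨δ, hδ, fun k hk => h k ⟨hk, hk⟩⟩

/-- An orbit homoclinic to a saddle with eigenvalues `m₁ < 0 < m₂` of the planar vector field
`(t, p) ↦ (p, H c₀ t p)`. -/
structure PlaneOrbit (H : ℝ → ℝ → ℝ → ℝ) (c₀ t₀ m₁ m₂ : ℝ) (t p px Hc Ht Hs : ℝ → ℝ)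
    (B δ₀ : ℝ) : Prop where
  neg : m₁ < 0
  pos : 0 < m₂
  deriv_t : ∀ x, HasDerivAt t (p x) x
  deriv_p : ∀ x, HasDerivAt p (px x) x
  deriv_px : ∀ x, HasDerivAt px (Ht x * p x + Hs x * px x) x
  px_eq : ∀ x, px x = H c₀ (t x) (p x)
  δ_pos : 0 < δ₀
  cont_Hc : Continuous Hc
  cont_Ht : Continuous Ht
  cont_Hs : Continuous Hs
  bound_Hc : ∀ x, |Hc x| ≤ B
  bound_Ht : ∀ x, |Ht x| ≤ B
  bound_Hs : ∀ x, |Hs x| ≤ B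
  approx : ∀ ε > 0, ∃ δ > 0, ∀ x c c' y y' z z', |c - c₀| ≤ δ → |c' - c₀| ≤ δ →
    |y| ≤ δ → |y'| ≤ δ → |z| ≤ δ → |z'| ≤ δ →
    |H c (t x + y) (p x + z) - H c' (t x + y') (p x + z') -
      (Hc x * (c - c') + Ht x * (y - y') + Hs x * (z - z'))| ≤
      ε * (|c - c'| + |y - y'| + |z - z'|)
  cont : ∀ c y z x, |c - c₀| ≤ δ₀ → |y| ≤ δ₀ → |z| ≤ δ₀ →
    ContinuousAt (fun v : ℝ × ℝ => H c v.1 v.2) (t x + y, p x + z)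
  lim : ∀ c, |c - c₀| ≤ δ₀ → Tendsto (fun x => H c (t x) (p x)) (cocompact ℝ) (𝓝 0)
  lin : ∀ ε > 0, ∀ᶠ x in cocompact ℝ,
    |px x - (-(m₁ * m₂) * (t x - t₀) + (m₁ + m₂) * p x)| ≤ ε * (|t x - t₀| + |p x|)
  lim_t : Tendsto t (cocompact ℝ) (𝓝 t₀)
  lim_p : Tendsto p (cocompact ℝ) (𝓝 0)
  lim_Ht : Tendsto Ht (cocompact ℝ) (𝓝 (-(m₁ * m₂)))
  lim_Hs : Tendsto Hs (cocompact ℝ) (𝓝 (m₁ + m₂))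
  ne : ∀ x, 0 < p x ^ 2 + px x ^ 2
  ne_saddle : ∀ x, t x ≠ t₀ ∨ p x ≠ 0

theorem tendsto_neg_cocompact_real : Tendsto (fun x : ℝ => -x) (cocompact ℝ) (cocompact ℝ) :=
  (Homeomorph.neg ℝ).isClosedEmbedding.tendsto_cocompact

namespace PlaneOrbit

variable {H : ℝ → ℝ → ℝ → ℝ} {c₀ t₀ m₁ m₂ : ℝ} {t p px Hc Ht Hs : ℝ → ℝ} {B δ₀ : ℝ}

theorem nearOrbit (h : PlaneOrbit H c₀ t₀ m₁ m₂ t p px Hc Ht Hs B δ₀) :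
    NearOrbit H c₀ t p px Hc Ht Hs B δ₀ where
  deriv_t := h.deriv_t
  px_eq := h.px_eq
  pos := h.δ_pos
  cont_Hc := h.cont_Hc
  bound_Hc x _ := h.bound_Hc x
  approx ε hε := by
    obtain ⟨δ, hδ, hh⟩ := h.approx ε hε
    exact ⟨δ, hδ, fun x _ => hh x⟩
  cont := h.cont
  lim c hc := (h.lim c hc).mono_left atTop_le_cocompact

theorem asymptotics (h : PlaneOrbit H c₀ t₀ m₁ m₂ t p px Hc Ht Hs B δ₀) :
    (∀ᶠ x in atTop, p x * (t x - t₀) < 0) ∧ Tendsto (fun x => px x / p x) atTop (𝓝 m₁) ∧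
    ∃ C κ, κ < -m₁ ∧ OrbitDichotomy p px Ht Hs C κ B ∧
      ∀ x, 0 ≤ x → |t x - t₀| ≤ C * Real.exp (-κ * x) := by
  obtain ⟨h1, h2, C, κ, hC, hκ, hκm, h3, h4, h5⟩ := exists_orbit_asymptotics h.neg h.pos h.deriv_t
    h.deriv_p h.deriv_px h.cont_Hs (fun ε hε => (h.lin ε hε).filter_mono atTop_le_cocompact)
    (h.lim_t.mono_left atTop_le_cocompact) (h.lim_p.mono_left atTop_le_cocompact)
    (h.lim_Ht.mono_left atTop_le_cocompact) (h.lim_Hs.mono_left atTop_le_cocompact) h.ne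
    (Eventually.of_forall h.ne_saddle)
  exact ⟨h1, h2, C, κ, hκm, ⟨h.deriv_p, h.deriv_px, h.cont_Ht, h.cont_Hs, fun x _ => h.bound_Ht x,
    fun x _ => h.bound_Hs x, h.ne, hC, hκ, h3, h4⟩, h5⟩

/-- Reversal of the independent variable. -/
theorem reflect (h : PlaneOrbit H c₀ t₀ m₁ m₂ t p px Hc Ht Hs B δ₀) :
    PlaneOrbit (fun c y z => H c y (-z)) c₀ t₀ (-m₂) (-m₁) (fun x => t (-x)) (fun x => -p (-x))
      (fun x => px (-x)) (fun x => Hc (-x)) (fun x => Ht (-x)) (fun x => -Hs (-x)) B δ₀ where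
  neg := by linarith [h.pos]
  pos := by linarith [h.neg]
  deriv_t x := by
    have := (h.deriv_t (-x)).scomp x (hasDerivAt_neg x)
    simpa [Function.comp_def] using this
  deriv_p x := by
    have := ((h.deriv_p (-x)).scomp x (hasDerivAt_neg x)).neg
    exact HasDerivAt.congr_deriv (f := fun x => -p (-x)) this (by simp)
  deriv_px x := by
    have := (h.deriv_px (-x)).scomp x (hasDerivAt_neg x)
    refine HasDerivAt.congr_deriv (f := fun x => px (-x)) this ?_
    rw [smul_eq_mul]; ring
  px_eq x := by simp only [neg_neg]; exact h.px_eq (-x)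
  δ_pos := h.δ_pos
  cont_Hc := h.cont_Hc.comp continuous_neg
  cont_Ht := h.cont_Ht.comp continuous_neg
  cont_Hs := (h.cont_Hs.comp continuous_neg).neg
  bound_Hc x := h.bound_Hc _
  bound_Ht x := h.bound_Ht _
  bound_Hs x := by rw [abs_neg]; exact h.bound_Hs _
  approx ε hε := by
    obtain ⟨δ, hδ, hh⟩ := h.approx ε hε
    refine ⟨δ, hδ, fun x c c' y y' z z' hc hc' hy hy' hz hz' => ?_⟩
    have := hh (-x) c c' y y' (-z) (-z') hc hc' hy hy' (by rwa [abs_neg]) (by rwa [abs_neg])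
    have e : |z - z'| = |-z - -z'| := by rw [← abs_neg]; congr 1; ring
    rw [e]
    convert this using 2
    ring_nf
  cont c y z x hc hy hz := by
    have h1 := h.cont c y (-z) (-x) hc hy (by rwa [abs_neg])
    have h2 : ContinuousAt (fun v : ℝ × ℝ => (v.1, -v.2)) (t (-x) + y, -p (-x) + z) := by fun_prop
    refine ContinuousAt.comp (g := fun v : ℝ × ℝ => H c v.1 v.2) ?_ h2
    simpa [add_comm] using h1
  lim c hc := by
    simp only [neg_neg]
    exact (h.lim c hc).comp tendsto_neg_cocompact_real
  lin ε hε := by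
    filter_upwards [tendsto_neg_cocompact_real.eventually (h.lin ε hε)] with x hx
    rw [abs_neg]
    convert hx using 2
    ring
  lim_t := h.lim_t.comp tendsto_neg_cocompact_real
  lim_p := by simpa using (h.lim_p.comp tendsto_neg_cocompact_real).neg
  lim_Ht := by
    have := h.lim_Ht.comp tendsto_neg_cocompact_real
    rwa [show -(-m₂ * -m₁) = -(m₁ * m₂) by ring]
  lim_Hs := by
    have := (h.lim_Hs.comp tendsto_neg_cocompact_real).neg
    rwa [show -m₂ + -m₁ = -(m₁ + m₂) by ring]
  ne x := by rw [neg_sq]; exact h.ne (-x)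
  ne_saddle x := by rw [neg_ne_zero]; exact h.ne_saddle (-x)

end PlaneOrbit

theorem norm_triple_le {a b d δ : ℝ} (ha : |a| ≤ δ) (hb : |b| ≤ δ) (hd : |d| ≤ δ) :
    ‖((a, b, d) : ℝ × ℝ × ℝ)‖ ≤ δ := max_le ha (max_le hb hd)

theorem fderiv_triple (L : ℝ × ℝ × ℝ →L[ℝ] ℝ) (a b d : ℝ) :
    L (a, b, d) = L (1, 0, 0) * a + L (0, 1, 0) * b + L (0, 0, 1) * d := by
  have : ((a, b, d) : ℝ × ℝ × ℝ) = a • (1, 0, 0) + b • (0, 1, 0) + d • (0, 0, 1) := by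
    simp
  rw [this, map_add, map_add, map_smul, map_smul, map_smul]
  simp only [smul_eq_mul]; ring

/-- A solution of a planar linear system that vanishes somewhere vanishes identically. -/
theorem eq_zero_of_planar_linear {p px Ht Hs : ℝ → ℝ} {B : ℝ} (hp : ∀ x, HasDerivAt p (px x) x)
    (hpx : ∀ x, HasDerivAt px (Ht x * p x + Hs x * px x) x) (hHt : ∀ x, |Ht x| ≤ B)
    (hHs : ∀ x, |Hs x| ≤ B) {x₀ : ℝ} (h₀ : p x₀ ^ 2 + px x₀ ^ 2 = 0) (x : ℝ) :
    p x ^ 2 + px x ^ 2 = 0 := by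
  set Q : ℝ → ℝ := fun x => p x ^ 2 + px x ^ 2
  set Q' : ℝ → ℝ := fun x => 2 * p x * px x + 2 * px x * (Ht x * p x + Hs x * px x)
  have hQ : ∀ x, HasDerivAt Q (Q' x) x := fun x =>
    (((hp x).pow 2).add ((hpx x).pow 2)).congr_deriv (by simp only [Q']; ring)
  have hQ0 : ∀ x, 0 ≤ Q x := fun x => by positivity
  have hQ' : ∀ x, |Q' x| ≤ (1 + 3 * B) * Q x := by
    intro x
    have e1 := abs_le.1 (hHt x)
    have e2 := abs_le.1 (hHs x)
    have h1 : |2 * p x * px x| ≤ Q x := by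
      rw [abs_le]; constructor <;> simp only [Q] <;>
        nlinarith [sq_nonneg (p x + px x), sq_nonneg (p x - px x)]
    have h2 : |2 * px x ^ 2| ≤ 2 * Q x := by
      rw [abs_of_nonneg (by positivity)]; simp only [Q]; nlinarith [sq_nonneg (p x)]
    calc |Q' x| = |2 * p x * px x + (Ht x * (2 * p x * px x) + Hs x * (2 * px x ^ 2))| := by
          simp only [Q']; congr 1; ring
      _ ≤ |2 * p x * px x| + (|Ht x| * |2 * p x * px x| + |Hs x| * |2 * px x ^ 2|) := by
          rw [← abs_mul, ← abs_mul]
          exact (abs_add_le _ _).trans (add_le_add_right (abs_add_le _ _) _)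
      _ ≤ Q x + (B * Q x + B * (2 * Q x)) := by
          have hB : 0 ≤ B := (abs_nonneg _).trans (hHt x)
          have := hHt x
          have := hHs x
          gcongr
      _ = _ := by ring
  set k := 1 + 3 * B
  have hexp : ∀ a x, HasDerivAt (fun x => Real.exp (a * x)) (Real.exp (a * x) * a) x := fun a x => by
    simpa using ((hasDerivAt_id x).const_mul a).exp
  refine le_antisymm ?_ (hQ0 x)
  rcases le_total x₀ x with hx | hx
  · have hd : ∀ x, HasDerivAt (fun x => Q x * Real.exp (-k * x))
        (Q' x * Real.exp (-k * x) + Q x * (Real.exp (-k * x) * -k)) x := fun x =>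
      (hQ x).mul (hexp _ x)
    have := antitone_of_deriv_nonpos (fun x => (hd x).differentiableAt) (fun x => by
      rw [(hd x).deriv]
      nlinarith [(abs_le.1 (hQ' x)).2, Real.exp_pos (-k * x)]) hx
    simp only [Q, h₀, zero_mul] at this
    exact nonpos_of_mul_nonpos_left this (Real.exp_pos _)
  · have hd : ∀ x, HasDerivAt (fun x => Q x * Real.exp (k * x))
        (Q' x * Real.exp (k * x) + Q x * (Real.exp (k * x) * k)) x := fun x =>
      (hQ x).mul (hexp _ x)
    have := monotone_of_deriv_nonneg (fun x => (hd x).differentiableAt) (fun x => by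
      rw [(hd x).deriv]
      nlinarith [(abs_le.1 (hQ' x)).1, Real.exp_pos (k * x)]) hx
    simp only [Q, h₀, zero_mul] at this
    exact nonpos_of_mul_nonpos_left this (Real.exp_pos _)

/-- Both ends have the same limit, so the orbit together with its rest point is compact. This makes
the C¹ regularity uniform: bounded coefficients, a common radius inside U, and a uniform strict
derivative. -/
theorem PlaneOrbit.exists_of_contDiff {f : ℝ × ℝ × ℝ → ℝ} {U : Set (ℝ × ℝ × ℝ)} (hU : IsOpen U)
    (hf : ∀ v ∈ U, ContDiffAt ℝ 1 f v) {c₀ t₀ m₁ m₂ : ℝ} {t p px : ℝ → ℝ} (h₁ : m₁ < 0)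
    (h₂ : 0 < m₂) (ht : ∀ x, HasDerivAt t (p x) x) (hp : ∀ x, HasDerivAt p (px x) x)
    (hpx : ∀ x, px x = f (c₀, t x, p x)) (hmem : ∀ x, (c₀, t x, p x) ∈ U)
    (hmem₀ : (c₀, t₀, 0) ∈ U) (htl : Tendsto t (cocompact ℝ) (𝓝 t₀))
    (hpl : Tendsto p (cocompact ℝ) (𝓝 0)) (hzero : ∀ c, f (c, t₀, 0) = 0) (hne : ∃ x, t x ≠ t₀)
    (hm : fderiv ℝ f (c₀, t₀, 0) (0, 1, 0) = -(m₁ * m₂))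
    (hm' : fderiv ℝ f (c₀, t₀, 0) (0, 0, 1) = m₁ + m₂) :
    ∃ B δ₀, PlaneOrbit (fun c y z => f (c, y, z)) c₀ t₀ m₁ m₂ t p px
      (fun x => fderiv ℝ f (c₀, t x, p x) (1, 0, 0)) (fun x => fderiv ℝ f (c₀, t x, p x) (0, 1, 0))
      (fun x => fderiv ℝ f (c₀, t x, p x) (0, 0, 1)) B δ₀ ∧
      ∀ c y z x, |c - c₀| ≤ δ₀ → |y| ≤ δ₀ → |z| ≤ δ₀ → (c, t x + y, p x + z) ∈ U := by
  have hct : Continuous t := continuous_iff_continuousAt.2 fun x => (ht x).continuousAt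
  have hcp : Continuous p := continuous_iff_continuousAt.2 fun x => (hp x).continuousAt
  set γ : ℝ → ℝ × ℝ × ℝ := fun x => (c₀, t x, p x)
  have hγ : Continuous γ := continuous_const.prodMk (hct.prodMk hcp)
  have hγl : Tendsto γ (cocompact ℝ) (𝓝 (c₀, t₀, 0)) :=
    tendsto_const_nhds.prodMk_nhds (htl.prodMk_nhds hpl)
  set K := insert (c₀, t₀, (0 : ℝ)) (range γ) with hKdef
  have hK : IsCompact K := hγl.isCompact_insert_range_of_cocompact hγ
  have hKU : K ⊆ U := insert_subset hmem₀ (range_subset_iff.2 hmem)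
  have hγK : ∀ x, γ x ∈ K := fun x => mem_insert_of_mem _ (mem_range_self x)
  obtain ⟨δ₀, hδ₀, hthick⟩ := hK.exists_cthickening_subset_open hU hKU
  have hball : ∀ k ∈ K, ∀ v, ‖v - k‖ ≤ δ₀ → v ∈ U := fun k hk v hv =>
    hthick (Metric.mem_cthickening_of_dist_le v k δ₀ K hk (by rwa [dist_eq_norm]))
  have hU' : ∀ c y z x, |c - c₀| ≤ δ₀ → |y| ≤ δ₀ → |z| ≤ δ₀ → (c, t x + y, p x + z) ∈ U :=
    fun c y z x hc hy hz => hball (γ x) (hγK x) _ (by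
      simp only [γ, Prod.mk_sub_mk, add_sub_cancel_left]
      exact norm_triple_le hc hy hz)
  have hfc : ∀ k ∈ U, ContinuousAt (fderiv ℝ f) k := fun k hk =>
    (hf k hk).continuousAt_fderiv one_ne_zero
  have hcf : ∀ e : ℝ × ℝ × ℝ, Continuous fun x => fderiv ℝ f (γ x) e := fun e =>
    continuous_iff_continuousAt.2 fun x =>
      ((hfc _ (hmem x)).comp (f := γ) hγ.continuousAt).clm_apply continuousAt_const
  have hlf : ∀ e : ℝ × ℝ × ℝ, Tendsto (fun x => fderiv ℝ f (γ x) e) (cocompact ℝ)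
      (𝓝 (fderiv ℝ f (c₀, t₀, 0) e)) := fun e =>
    ((ContinuousLinearMap.apply ℝ ℝ e).continuous.tendsto _).comp ((hfc _ hmem₀).tendsto.comp hγl)
  have hbf : ∃ B, ∀ k ∈ K, ‖fderiv ℝ f k‖ ≤ B := by
    have : ContinuousOn (fderiv ℝ f) K := fun k hk => (hfc k (hKU hk)).continuousWithinAt
    exact hK.exists_bound_of_continuousOn this
  obtain ⟨B, hB⟩ := hbf
  have hbe : ∀ e : ℝ × ℝ × ℝ, ‖e‖ ≤ 1 → ∀ x, |fderiv ℝ f (γ x) e| ≤ B := fun e he x =>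
    ((fderiv ℝ f (γ x)).le_opNorm e).trans ((mul_le_mul (hB _ (hγK x)) he (norm_nonneg _)
      ((norm_nonneg _).trans (hB _ (hγK x)))).trans_eq (mul_one B))
  have hder : ∀ x, HasDerivAt px (fderiv ℝ f (γ x) (0, 1, 0) * p x +
      fderiv ℝ f (γ x) (0, 0, 1) * px x) x := by
    intro x
    have h1 := ((hf _ (hmem x)).differentiableAt one_ne_zero).hasFDerivAt.comp_hasDerivAt x
      ((hasDerivAt_const x c₀).prodMk ((ht x).prodMk (hp x)))
    have h2 : px = f ∘ γ := funext hpx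
    rw [h2]
    refine h1.congr_deriv ?_
    rw [fderiv_triple]
    simp [γ, hpx x]
  -- The velocity (p, px) solves the linear variational equation; if it vanished at one point it
  -- would vanish identically, and the orbit would be constant.
  have hne0 : ∀ x, 0 < p x ^ 2 + px x ^ 2 := by
    intro x
    refine lt_of_le_of_ne (by positivity) fun h0 => ?_
    have h1 := eq_zero_of_planar_linear hp hder (hbe _ (norm_triple_le (by simp) (by simp)
      (by simp))) (hbe _ (norm_triple_le (by simp) (by simp) (by simp))) h0.symm
    have h2 : ∀ x, p x = 0 := fun x => by nlinarith [h1 x, sq_nonneg (p x), sq_nonneg (px x)]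
    obtain ⟨x₁, hx₁⟩ := hne
    have h3 : ∀ x, t x = t x₁ := fun x => is_const_of_deriv_eq_zero
      (fun x => (ht x).differentiableAt) (fun x => by rw [(ht x).deriv, h2 x]) x x₁
    refine hx₁ (tendsto_nhds_unique (l := cocompact ℝ) ?_ htl)
    exact tendsto_const_nhds.congr fun x => (h3 x).symm
  refine ⟨B, δ₀, ⟨h₁, h₂, ht, hp, hder, hpx, hδ₀, hcf _, hcf _, hcf _,
    hbe _ (norm_triple_le (by simp) (by simp) (by simp)),
    hbe _ (norm_triple_le (by simp) (by simp) (by simp)),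
    hbe _ (norm_triple_le (by simp) (by simp) (by simp)), ?_, ?_, ?_, ?_, htl, hpl, ?_, ?_, hne0,
    ?_⟩, hU'⟩
  · intro ε hε
    obtain ⟨δ, hδ, h⟩ := exists_uniform_strict_fderiv hK (fun k hk => hf k (hKU hk)) hε
    refine ⟨δ, hδ, fun x c c' y y' z z' hc hc' hy hy' hz hz' => ?_⟩
    have h1 := h (γ x) (hγK x) (c, t x + y, p x + z) (c', t x + y', p x + z')
      (by simp only [γ, Prod.mk_sub_mk, add_sub_cancel_left]; exact norm_triple_le hc hy hz)
      (by simp only [γ, Prod.mk_sub_mk, add_sub_cancel_left]; exact norm_triple_le hc' hy' hz')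
    simp only [Prod.mk_sub_mk, add_sub_add_left_eq_sub] at h1
    rw [fderiv_triple] at h1
    refine h1.trans (mul_le_mul_of_nonneg_left (norm_triple_le ?_ ?_ ?_) hε.le) <;>
    linarith [abs_nonneg (c - c'), abs_nonneg (y - y'), abs_nonneg (z - z')]
  · intro c y z x hc hy hz
    exact (hf _ (hU' c y z x hc hy hz)).continuousAt.comp (f := fun v : ℝ × ℝ => (c, v))
      (by fun_prop)
  · intro c hc
    have hcU : (c, t₀, (0 : ℝ)) ∈ U := hball _ (mem_insert _ _) _ (by
      simp only [Prod.mk_sub_mk, sub_self]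
      exact norm_triple_le hc (by simpa using hδ₀.le) (by simpa using hδ₀.le))
    rw [← hzero c]
    exact (hf _ hcU).continuousAt.tendsto.comp
      (tendsto_const_nhds.prodMk_nhds (htl.prodMk_nhds hpl))
  · intro ε hε
    have h1 := ((hf _ hmem₀).differentiableAt one_ne_zero).hasFDerivAt.isLittleO.def hε
    filter_upwards [hγl.eventually h1] with x hx
    have e : γ x - (c₀, t₀, 0) = (0, t x - t₀, p x) := by simp [γ]
    rw [e, fderiv_triple, hm, hm', hzero, ← hpx] at hx
    simp only [mul_zero, zero_add, sub_zero] at hx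
    refine hx.trans (mul_le_mul_of_nonneg_left (norm_triple_le ?_ ?_ ?_) hε.le)
    · rw [abs_zero]; positivity
    · linarith [abs_nonneg (p x)]
    · linarith [abs_nonneg (t x - t₀)]
  · rw [← hm]; exact hlf _
  · rw [← hm']; exact hlf _
  · intro x
    by_contra! hx
    have h1 := hpx x
    rw [hx.1, hx.2, hzero] at h1
    have h2 := hne0 x
    rw [h1, hx.2] at h2
    norm_num at h2

end PlaneOrbit

/-! ### The profile equation as a planar vector field -/

namespace StVenant

variable {P : StVenant}

/-- The second derivative `t''` as a function of `(t, t')`, according to the profile equation. -/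
noncomputable def accel (P : StVenant) (c q y z : ℝ) : ℝ :=
  y ^ 2 / (c * P.nu) * (1 - y ^ (P.s + 1) * (q - c * y) ^ P.r - c ^ 2 * z +
    P.F⁻¹ * (y ^ 3)⁻¹ * z) + 2 * z ^ 2 / y

/-- Only the total flux is assumed differentiable. Solving it for the derivative, possible since c ν
t⁻² does not vanish, shows that t' is itself differentiable, which yields the planar system. -/
theorem isProfileOn_iff {c q : ℝ} (hc : c ≠ 0) (hnu : P.nu ≠ 0) {t tx : ℝ → ℝ} {I : Set ℝ} :
    P.IsProfileOn c q t tx I ↔ ∀ x ∈ I, 0 < t x ∧ 0 < q - c * t x ∧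
      HasDerivWithinAt t (tx x) I x ∧ HasDerivWithinAt tx (P.accel c q (t x) (tx x)) I x := by
  constructor
  · intro h x hx
    obtain ⟨ht0, hu0, ht, hG⟩ := h x hx
    refine ⟨ht0, hu0, ht, ?_⟩
    have h1 := ((ht.pow 2).div_const (c * P.nu)).mul ((hG.sub (ht.const_mul (c ^ 2))).sub
      (((ht.pow 2).inv (pow_ne_zero 2 ht0.ne')).const_mul (2 * P.F)⁻¹))
    refine (h1.congr_of_mem (fun y hy => ?_) hx).congr_deriv ?_
    · have := (h y hy).1.ne'
      simp
      field_simp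
      ring
    · simp only [accel, Pi.sub_apply, Pi.pow_apply, Pi.inv_apply]
      field_simp
      ring
  · intro h x hx
    obtain ⟨ht0, hu0, ht, htx⟩ := h x hx
    refine ⟨ht0, hu0, ht, ?_⟩
    have h2 := (ht.pow 2).inv (by positivity : t x ^ 2 ≠ 0)
    have h1 := ((ht.const_mul (c ^ 2)).add (h2.const_mul (2 * P.F)⁻¹)).add
      ((h2.mul htx).const_mul (c * P.nu))
    refine h1.congr_deriv ?_
    simp only [accel, Pi.pow_apply, Pi.inv_apply]
    field_simp
    ring

/-- The set of speeds and states at which the profile equation is regular. -/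
def regularSet (c₀ q₀ t₀ : ℝ) : Set (ℝ × ℝ × ℝ) :=
  {v | 0 < v.1 ∧ 0 < v.2.1 ∧ 0 < q₀ + (v.1 - c₀) * t₀ - v.1 * v.2.1}

theorem isOpen_regularSet (c₀ q₀ t₀ : ℝ) : IsOpen (regularSet c₀ q₀ t₀) :=
  (isOpen_lt continuous_const continuous_fst).inter
    ((isOpen_lt continuous_const (continuous_fst.comp continuous_snd)).inter
      (isOpen_lt (g := fun v : ℝ × ℝ × ℝ => q₀ + (v.1 - c₀) * t₀ - v.1 * v.2.1) continuous_const
        (by fun_prop)))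

/-- `accel` as a function of the speed and the state, the end state being fixed. -/
noncomputable def accelField (P : StVenant) (c₀ q₀ t₀ : ℝ) (v : ℝ × ℝ × ℝ) : ℝ :=
  P.accel v.1 (q₀ + (v.1 - c₀) * t₀) v.2.1 v.2.2

theorem contDiffAt_accelField (hnu : P.nu ≠ 0) {c₀ q₀ t₀ : ℝ} {v : ℝ × ℝ × ℝ}
    (hv : v ∈ regularSet c₀ q₀ t₀) : ContDiffAt ℝ 1 (P.accelField c₀ q₀ t₀) v := by
  obtain ⟨h1, h2, h3⟩ := hv
  unfold accelField accel
  have e2 : ContDiffAt ℝ 1 (fun v : ℝ × ℝ × ℝ => v.2.1) v := by fun_prop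
  have e3 : ContDiffAt ℝ 1 (fun v : ℝ × ℝ × ℝ => q₀ + (v.1 - c₀) * t₀ - v.1 * v.2.1) v := by fun_prop
  have f1 := e2.rpow_const_of_ne (p := P.s + 1) h2.ne'
  have f2 := e3.rpow_const_of_ne (p := P.r) h3.ne'
  have f3 : ContDiffAt ℝ 1 (fun v : ℝ × ℝ × ℝ => (v.2.1 ^ 3)⁻¹) v :=
    (e2.pow 3).inv (pow_ne_zero 3 h2.ne')
  have f4 : ContDiffAt ℝ 1 (fun v : ℝ × ℝ × ℝ => v.2.1 ^ 2 / (v.1 * P.nu)) v :=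
    (e2.pow 2).div (by fun_prop) (mul_ne_zero h1.ne' hnu)
  have f5 : ContDiffAt ℝ 1 (fun v : ℝ × ℝ × ℝ => 2 * v.2.2 ^ 2 / v.2.1) v :=
    ContDiffAt.div (by fun_prop) e2 h2.ne'
  exact (f4.mul (((contDiffAt_const.sub (f1.mul f2)).sub (by fun_prop)).add
    ((contDiffAt_const.mul f3).mul (by fun_prop)))).add f5

/-- The result is expressed through `accel`, which along the orbit equals t''; this is how the
x-derivative of `alpha` later appears in the variational equation. -/
theorem hasDerivAt_accel_state {c q y z : ℝ} (hc : c ≠ 0) (hnu : P.nu ≠ 0) (hy : 0 < y)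
    (hu : 0 < q - c * y) : HasDerivAt (fun y => P.accel c q y z)
      (2 / y * (P.accel c q y z - 2 * z ^ 2 / y) + y ^ 2 / (c * P.nu) *
        (-((P.s + 1) * y ^ P.s * (q - c * y) ^ P.r) +
          c * (P.r * y ^ (P.s + 1) * (q - c * y) ^ (P.r - 1)) - 3 * P.F⁻¹ * (y ^ 4)⁻¹ * z) -
        2 * z ^ 2 / y ^ 2) y := by
  have h1 := (hasDerivAt_id y).rpow_const (p := P.s + 1) (Or.inl hy.ne')
  have h2 := (((hasDerivAt_id y).const_mul c).const_sub q).rpow_const (p := P.r) (Or.inl hu.ne')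
  have h3 := ((hasDerivAt_id y).pow 3).inv (pow_ne_zero 3 hy.ne')
  have h4 := (((hasDerivAt_id y).pow 2).div_const (c * P.nu)).mul
    ((((h1.mul h2).const_sub 1).sub_const (c ^ 2 * z)).add ((h3.const_mul P.F⁻¹).mul_const z))
  have h5 := h4.add ((hasDerivAt_id y).fun_inv hy.ne' |>.const_mul (2 * z ^ 2))
  refine h5.congr_deriv ?_
  simp only [accel, id, add_sub_cancel_right, Pi.add_apply, Pi.pow_apply, Pi.mul_apply, Pi.inv_apply]
  field_simp
  ring

theorem hasDerivAt_accel_velocity {c q y z : ℝ} : HasDerivAt (fun z => P.accel c q y z)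
    (y ^ 2 / (c * P.nu) * (-c ^ 2 + P.F⁻¹ * (y ^ 3)⁻¹) + 4 * z / y) z := by
  have h1 := (((((hasDerivAt_id z).const_mul (c ^ 2)).const_sub
    (1 - y ^ (P.s + 1) * (q - c * y) ^ P.r)).add ((hasDerivAt_id z).const_mul
    (P.F⁻¹ * (y ^ 3)⁻¹))).const_mul (y ^ 2 / (c * P.nu))).add
    ((((hasDerivAt_id z).pow 2).const_mul 2).div_const y)
  refine h1.congr_deriv ?_
  simp only [id]
  ring

theorem hasDerivAt_accel_speed {c c₀ q₀ t₀ y z : ℝ} (hc : c ≠ 0) (hnu : P.nu ≠ 0)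
    (hu : 0 < q₀ + (c - c₀) * t₀ - c * y) (hy : 0 < y) :
    HasDerivAt (fun c => P.accel c (q₀ + (c - c₀) * t₀) y z)
      (y ^ 2 / (c * P.nu) * (-(P.r * y ^ (P.s + 1) * (q₀ + (c - c₀) * t₀ - c * y) ^ (P.r - 1)) *
        (t₀ - y) - 2 * c * z) - c⁻¹ * (P.accel c (q₀ + (c - c₀) * t₀) y z - 2 * z ^ 2 / y)) c := by
  have h1 := (((((hasDerivAt_id c).sub_const c₀).mul_const t₀).const_add q₀).sub
    ((hasDerivAt_id c).mul_const y)).rpow_const (p := P.r) (Or.inl hu.ne')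
  have h2 := ((hasDerivAt_id c).mul_const P.nu).fun_inv (mul_ne_zero hc hnu) |>.const_mul (y ^ 2)
  have h3 := (h2.mul ((((h1.const_mul (y ^ (P.s + 1))).const_sub 1).sub
    (((hasDerivAt_id c).pow 2).mul_const z)).add_const (P.F⁻¹ * (y ^ 3)⁻¹ * z))).add_const
    (2 * z ^ 2 / y)
  refine h3.congr_deriv ?_
  simp only [accel, id, Pi.pow_apply, Pi.sub_apply]
  field_simp
  ring

end StVenant

/-- Maximum principle for functions with limits at both ends. -/
theorem le_of_pos_second_deriv {t p px : ℝ → ℝ} {t₀ : ℝ} (ht : ∀ x, HasDerivAt t (p x) x)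
    (hp : ∀ x, HasDerivAt p (px x) x) (htl : Tendsto t (cocompact ℝ) (𝓝 t₀))
    (h : ∀ x, p x = 0 → t₀ < t x → 0 < px x) (x : ℝ) : t x ≤ t₀ := by
  by_contra! hx
  have hct : Continuous t := continuous_iff_continuousAt.2 fun x => (ht x).continuousAt
  obtain ⟨y, hy⟩ := hct.exists_forall_ge' x ((htl.eventually (gt_mem_nhds hx)).mono fun _ h => h.le)
  have hmax : IsLocalMax t y := Eventually.of_forall hy
  have hpy : p y = 0 := by rw [← (ht y).deriv]; exact hmax.deriv_eq_zero
  have hd : deriv t = p := funext fun x => (ht x).deriv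
  have hpos : 0 < px y := h y hpy (hx.trans_le (hy x))
  have hmin : IsLocalMin t y := isLocalMin_of_deriv_deriv_pos (by rw [hd, (hp y).deriv]; exact hpos)
    (by rw [hd, hpy]) (ht y).continuousAt
  have hconst : t =ᶠ[𝓝 y] fun _ => t y := by
    filter_upwards [hmin] with z hz using le_antisymm (hy z) hz
  have h0 : px y = 0 := by
    rw [← (hp y).deriv, ← hd, hconst.deriv.deriv_eq]
    simp
  exact hpos.ne' h0

/-! ### Sign of the speed, and position of the orbit relative to the rest state -/

namespace StVenant

variable {P : StVenant} {c q t₀ : ℝ}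

/-- The saddle condition multiplied by r/u₀ > 0: it bears on the logarithmic derivative of the drag
at the rest state. -/
theorem IsSaddle.slope (hr : 1 ≤ P.r) (h : P.IsSaddle c q t₀) :
    c * ((P.s + 1) / t₀ - c * (P.r / (q - c * t₀))) < 0 := by
  obtain ⟨h1, h2, -, h4⟩ := h
  have hr' : 0 < P.r := by linarith
  have e : c * ((P.s + 1) / t₀ - c * (P.r / (q - c * t₀))) =
      P.r / (q - c * t₀) * (c * ((P.s + 1) / P.r * ((q - c * t₀) / t₀) - c)) := by
    field_simp
  rw [e]
  exact mul_neg_of_pos_of_neg (by positivity) h4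

theorem IsSaddle.ne_zero (h : P.IsSaddle c q t₀) : c ≠ 0 := by
  rintro rfl
  have := h.2.2.2
  simp at this

/-- The logarithm of the drag is concave in y, so it lies below its tangent at t₀; for c > 0 that
tangent has negative slope by the saddle condition. -/
theorem IsSaddle.drag_lt_one (hr : 1 ≤ P.r) (hs : 0 ≤ P.s) (h : P.IsSaddle c q t₀) (hc : 0 < c)
    {y : ℝ} (hy : t₀ < y) (hu : 0 < q - c * y) : y ^ (P.s + 1) * (q - c * y) ^ P.r < 1 := by
  have hsl := h.slope hr
  obtain ⟨h1, h2, h3, -⟩ := h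
  have hy0 := h1.trans hy
  have l3 := congrArg Real.log h3
  rw [Real.log_one, Real.log_mul (Real.rpow_pos_of_pos h1 _).ne' (Real.rpow_pos_of_pos h2 _).ne',
    Real.log_rpow h1, Real.log_rpow h2] at l3
  rw [← Real.log_neg_iff (by positivity), Real.log_mul (Real.rpow_pos_of_pos hy0 _).ne'
    (Real.rpow_pos_of_pos hu _).ne', Real.log_rpow hy0, Real.log_rpow hu]
  have a1 := Real.log_le_sub_one_of_pos (div_pos hy0 h1)
  have a2 := Real.log_le_sub_one_of_pos (div_pos hu h2)
  rw [Real.log_div hy0.ne' h1.ne'] at a1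
  rw [Real.log_div hu.ne' h2.ne'] at a2
  have hsl' : (P.s + 1) / t₀ - c * (P.r / (q - c * t₀)) < 0 := by
    by_contra! hcon
    exact absurd (mul_nonneg hc.le hcon) (not_le.2 hsl)
  have e : (P.s + 1) * (y / t₀ - 1) + P.r * ((q - c * y) / (q - c * t₀) - 1) =
      (y - t₀) * ((P.s + 1) / t₀ - c * (P.r / (q - c * t₀))) := by
    have e1 : y / t₀ - 1 = (y - t₀) / t₀ := by rw [sub_div, div_self h1.ne']
    have e2 : (q - c * y) / (q - c * t₀) - 1 = -(c * (y - t₀)) / (q - c * t₀) := by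
      rw [div_sub_one h2.ne']; congr 1; ring
    rw [e1, e2]
    ring
  nlinarith [mul_le_mul_of_nonneg_left a1 (by linarith : 0 ≤ P.s + 1),
    mul_le_mul_of_nonneg_left a2 (by linarith : 0 ≤ P.r), mul_neg_of_pos_of_neg (sub_pos.2 hy) hsl']

/-- For c < 0 the velocity q - c y increases with y, so both factors of the drag increase, and the
drag passes through 1 only at t₀. -/
theorem IsSaddle.lt_drag (hr : 1 ≤ P.r) (hs : 0 ≤ P.s) (h : P.IsSaddle c q t₀) (hc : c < 0)
    {y : ℝ} (hy : t₀ < y) : 1 < y ^ (P.s + 1) * (q - c * y) ^ P.r := by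
  obtain ⟨h1, h2, h3, -⟩ := h
  refine h3.symm.trans_lt ?_
  have hu : q - c * t₀ < q - c * y := by nlinarith
  exact mul_lt_mul'' (Real.rpow_lt_rpow h1.le hy (by linarith : 0 < P.s + 1))
    (Real.rpow_lt_rpow h2.le hu (by linarith : 0 < P.r)) (Real.rpow_nonneg h1.le _)
    (Real.rpow_nonneg h2.le _)

theorem IsSaddle.drag_lt (hr : 1 ≤ P.r) (hs : 0 ≤ P.s) (h : P.IsSaddle c q t₀) (hc : c < 0)
    {y : ℝ} (hy0 : 0 < y) (hu0 : 0 < q - c * y) (hy : y < t₀) :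
    y ^ (P.s + 1) * (q - c * y) ^ P.r < 1 := by
  obtain ⟨h1, h2, h3, -⟩ := h
  refine lt_of_lt_of_eq ?_ h3
  have hu : q - c * y < q - c * t₀ := by nlinarith
  exact mul_lt_mul'' (Real.rpow_lt_rpow hy0.le hy (by linarith : 0 < P.s + 1))
    (Real.rpow_lt_rpow hu0.le hu (by linarith : 0 < P.r)) (Real.rpow_nonneg hy0.le _)
    (Real.rpow_nonneg hu0.le _)

theorem IsHomoclinic.hasDerivAt (hnu : P.nu ≠ 0) (hc : c ≠ 0) {t tx : ℝ → ℝ}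
    (h : P.IsHomoclinic c q t₀ t tx) (x : ℝ) : 0 < t x ∧ 0 < q - c * t x ∧
      HasDerivAt t (tx x) x ∧ HasDerivAt tx (P.accel c q (t x) (tx x)) x := by
  have := (isProfileOn_iff hc hnu).1 h.1 x (mem_univ x)
  simpa only [hasDerivWithinAt_univ] using this

theorem IsHomoclinic.tendsto {t tx : ℝ → ℝ} (h : P.IsHomoclinic c q t₀ t tx) :
    Tendsto t (cocompact ℝ) (𝓝 t₀) ∧ Tendsto tx (cocompact ℝ) (𝓝 0) := by
  rw [cocompact_eq_atBot_atTop]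
  exact ⟨h.2.2.2.2.1.sup h.2.2.1, h.2.2.2.2.2.sup h.2.2.2.1⟩

theorem accel_rest (c q y : ℝ) :
    P.accel c q y 0 = y ^ 2 / (c * P.nu) * (1 - y ^ (P.s + 1) * (q - c * y) ^ P.r) := by
  simp [accel]

/-- If c were negative, the drag would be above 1 over t₀ and below 1 under it. The acceleration at
rest would then exclude a maximum above t₀ and a minimum below, and the orbit would be constant. -/
theorem IsHomoclinic.speed_pos (hnu : 0 < P.nu) (hr : 1 ≤ P.r) (hs : 0 ≤ P.s)
    (hsad : P.IsSaddle c q t₀) {t tx : ℝ → ℝ} (h : P.IsHomoclinic c q t₀ t tx) : 0 < c := by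
  by_contra! hc
  have hc' := lt_of_le_of_ne hc hsad.ne_zero
  have hd := h.hasDerivAt hnu.ne' hc'.ne
  have hl := h.tendsto.1
  have hden : c * P.nu < 0 := mul_neg_of_neg_of_pos hc' hnu
  have h1 := le_of_pos_second_deriv (fun x => (hd x).2.2.1) (fun x => (hd x).2.2.2) hl
    (fun x hx hx' => by
      rw [hx, accel_rest]
      have := hsad.lt_drag hr hs hc' hx'
      exact mul_pos_of_neg_of_neg (div_neg_of_pos_of_neg (pow_pos (hd x).1 2) hden) (by linarith))
  have h2 := le_of_pos_second_deriv (t := fun x => -t x) (t₀ := -t₀)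
    (fun x => (hd x).2.2.1.fun_neg) (fun x => (hd x).2.2.2.fun_neg) hl.neg
    (fun x hx hx' => by
      rw [neg_eq_zero.1 hx, accel_rest, neg_pos]
      have := hsad.drag_lt hr hs hc' (hd x).1 (hd x).2.1 (by linarith)
      exact mul_neg_of_neg_of_pos (div_neg_of_pos_of_neg (pow_pos (hd x).1 2) hden) (by linarith))
  obtain ⟨x, hx⟩ := h.2.1
  exact hx (le_antisymm (h1 x) (by linarith [h2 x]))

/-- A maximum above t₀ is impossible because the drag is below 1 there. This one-sidedness
determines the sign of t' at both ends, and through it the sign relation of the theorem. -/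
theorem IsHomoclinic.le (hnu : 0 < P.nu) (hr : 1 ≤ P.r) (hs : 0 ≤ P.s)
    (hsad : P.IsSaddle c q t₀) {t tx : ℝ → ℝ} (h : P.IsHomoclinic c q t₀ t tx) (x : ℝ) :
    t x ≤ t₀ := by
  have hc := h.speed_pos hnu hr hs hsad
  have hd := h.hasDerivAt hnu.ne' hc.ne'
  refine le_of_pos_second_deriv (fun x => (hd x).2.2.1) (fun x => (hd x).2.2.2) h.tendsto.1
    (fun x hx hx' => ?_) x
  rw [hx, accel_rest]
  have := hsad.drag_lt_one hr hs hc hx' (hd x).2.1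
  exact mul_pos (div_pos (pow_pos (hd x).1 2) (mul_pos hc hnu)) (by linarith)

/-- Derivative of the drag `t ^ (s+1) u ^ r` with respect to `t`. -/
noncomputable def dragT (P : StVenant) (c q y : ℝ) : ℝ := (P.s + 1) * y ^ P.s * (q - c * y) ^ P.r

/-- Derivative of the drag `t ^ (s+1) u ^ r` with respect to `u`. -/
noncomputable def dragU (P : StVenant) (c q y : ℝ) : ℝ :=
  P.r * y ^ (P.s + 1) * (q - c * y) ^ (P.r - 1)

/-- Derivative of `alpha` along a profile. -/
noncomputable def alphaDeriv (P : StVenant) (c y z w : ℝ) : ℝ :=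
  -3 * (y ^ 4)⁻¹ * z * (P.F⁻¹ + 2 * c * P.nu * z) + (y ^ 3)⁻¹ * (2 * c * P.nu * w)

/-- Derivative of the acceleration with respect to the velocity. -/
noncomputable def velCoeff (P : StVenant) (c : ℝ) (t p : ℝ → ℝ) (x : ℝ) : ℝ :=
  t x ^ 2 / (c * P.nu) * (-c ^ 2 + P.F⁻¹ * (t x ^ 3)⁻¹) + 4 * p x / t x

/-- Derivative of the acceleration with respect to the state. -/
noncomputable def stateCoeff (P : StVenant) (c q : ℝ) (t p px : ℝ → ℝ) (x : ℝ) : ℝ :=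
  t x ^ 2 / (c * P.nu) * (P.alphaDeriv c (t x) (p x) (px x) - P.dragT c q (t x) +
    c * P.dragU c q (t x))

/-- Derivative of the acceleration with respect to the speed. -/
noncomputable def speedCoeff (P : StVenant) (c q t₀ : ℝ) (t p px : ℝ → ℝ) (x : ℝ) : ℝ :=
  t x ^ 2 / (c * P.nu) * (-P.dragU c q (t x) * (t₀ - t x) - 2 * c * p x) -
    c⁻¹ * (px x - 2 * p x ^ 2 / t x)

/-- A homoclinic orbit of the profile equation, with its derivatives `p`, `px`. -/
structure ProfileOrbit (P : StVenant) (c q t₀ m₁ m₂ B δ₀ : ℝ) (t p px : ℝ → ℝ) : Prop where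
  nu_pos : 0 < P.nu
  c_pos : 0 < c
  t₀_pos : 0 < t₀
  u₀_pos : 0 < q - c * t₀
  dragT_pos : 0 < P.dragT c q t₀
  t_pos : ∀ x, 0 < t x
  u_pos : ∀ x, 0 < q - c * t x
  t_le : ∀ x, t x ≤ t₀
  plane : PlaneOrbit (fun c' y z => P.accel c' (q + (c' - c) * t₀) y z) c t₀ m₁ m₂ t p px
    (P.speedCoeff c q t₀ t p px) (P.stateCoeff c q t p px) (P.velCoeff c t p) B δ₀
  regular : ∀ c' y z x, |c' - c| ≤ δ₀ → |y| ≤ δ₀ → |z| ≤ δ₀ →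
    (c', t x + y, p x + z) ∈ regularSet c q t₀
  prod : m₁ * m₂ = t₀ ^ 2 / (c * P.nu) * (P.dragT c q t₀ - c * P.dragU c q t₀)
  sum : m₁ + m₂ = t₀ ^ 2 / (c * P.nu) * (-c ^ 2 + P.F⁻¹ * (t₀ ^ 3)⁻¹)

theorem hasDerivAt_accelField_comp {c₀ q₀ t₀ : ℝ} (hnu : P.nu ≠ 0) {v : ℝ × ℝ × ℝ}
    (hv : v ∈ regularSet c₀ q₀ t₀) {g : ℝ → ℝ × ℝ × ℝ} {e : ℝ × ℝ × ℝ} {y : ℝ} (hgy : g y = v)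
    (hg : HasDerivAt g e y) :
    HasDerivAt (fun y => P.accelField c₀ q₀ t₀ (g y)) (fderiv ℝ (P.accelField c₀ q₀ t₀) v e) y := by
  subst hgy
  exact ((contDiffAt_accelField hnu hv).differentiableAt one_ne_zero).hasFDerivAt.comp_hasDerivAt y hg

theorem fderiv_accelField_state {t₀ : ℝ} (hnu : P.nu ≠ 0) {y z : ℝ}
    (hv : (c, y, z) ∈ regularSet c q t₀) :
    fderiv ℝ (P.accelField c q t₀) (c, y, z) (0, 1, 0) = y ^ 2 / (c * P.nu) *
      (P.alphaDeriv c y z (P.accel c q y z) - P.dragT c q y + c * P.dragU c q y) := by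
  have h1 := hasDerivAt_accelField_comp hnu hv (g := fun y => (c, y, z)) rfl
    ((hasDerivAt_const y c).prodMk ((hasDerivAt_id y).prodMk (hasDerivAt_const y z)))
  obtain ⟨hc, hy, hu⟩ := hv
  simp only [sub_self, zero_mul, add_zero] at hu
  have h2 := hasDerivAt_accel_state (z := z) hc.ne' hnu hy hu
  simp only [accelField, sub_self, zero_mul, add_zero] at h1
  simp only at hc hy
  rw [h1.unique h2]
  simp only [alphaDeriv, dragT, dragU]
  field_simp
  ring

theorem fderiv_accelField_velocity {t₀ : ℝ} (hnu : P.nu ≠ 0) {y z : ℝ}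
    (hv : (c, y, z) ∈ regularSet c q t₀) :
    fderiv ℝ (P.accelField c q t₀) (c, y, z) (0, 0, 1) =
      y ^ 2 / (c * P.nu) * (-c ^ 2 + P.F⁻¹ * (y ^ 3)⁻¹) + 4 * z / y := by
  have h1 := hasDerivAt_accelField_comp hnu hv (g := fun z => (c, y, z)) rfl
    ((hasDerivAt_const z c).prodMk ((hasDerivAt_const z y).prodMk (hasDerivAt_id z)))
  simp only [accelField, sub_self, zero_mul, add_zero] at h1
  exact h1.unique hasDerivAt_accel_velocity

theorem fderiv_accelField_speed {t₀ : ℝ} (hnu : P.nu ≠ 0) {y z : ℝ}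
    (hv : (c, y, z) ∈ regularSet c q t₀) :
    fderiv ℝ (P.accelField c q t₀) (c, y, z) (1, 0, 0) =
      y ^ 2 / (c * P.nu) * (-P.dragU c q y * (t₀ - y) - 2 * c * z) -
        c⁻¹ * (P.accel c q y z - 2 * z ^ 2 / y) := by
  have h1 := hasDerivAt_accelField_comp hnu hv (g := fun c => (c, y, z)) rfl
    ((hasDerivAt_id c).prodMk ((hasDerivAt_const c y).prodMk (hasDerivAt_const c z)))
  obtain ⟨hc, hy, hu⟩ := hv
  have h2 := hasDerivAt_accel_speed (z := z) hc.ne' hnu hu hy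
  simp only [accelField] at h1
  rw [h1.unique h2]
  simp [dragU]

theorem exists_roots_of_prod_neg {h k : ℝ} (hh : 0 < h) :
    ∃ m₁ m₂ : ℝ, m₁ < 0 ∧ 0 < m₂ ∧ m₁ * m₂ = -h ∧ m₁ + m₂ = k := by
  have h1 : |k| < √(k ^ 2 + 4 * h) := by
    rw [← Real.sqrt_sq_eq_abs]
    exact Real.sqrt_lt_sqrt (sq_nonneg _) (by linarith)
  have h2 : √(k ^ 2 + 4 * h) ^ 2 = k ^ 2 + 4 * h := Real.sq_sqrt (by positivity)
  have h3 := abs_lt.1 h1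
  exact ⟨(k - √(k ^ 2 + 4 * h)) / 2, (k + √(k ^ 2 + 4 * h)) / 2, by linarith, by linarith,
    by linear_combination (-1 / 4 : ℝ) * h2, by ring⟩

theorem IsHomoclinic.exists_profileOrbit (hnu : 0 < P.nu) (hr : 1 ≤ P.r) (hs : 0 ≤ P.s)
    (hsad : P.IsSaddle c q t₀) {t tx : ℝ → ℝ} (h : P.IsHomoclinic c q t₀ t tx) :
    ∃ px m₁ m₂ B δ₀, P.ProfileOrbit c q t₀ m₁ m₂ B δ₀ t tx px := by
  have hc := h.speed_pos hnu hr hs hsad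
  have hd := h.hasDerivAt hnu.ne' hc.ne'
  have hsl := hsad.slope hr
  have ht₀ := hsad.1
  have hu₀ := hsad.2.1
  have heq := hsad.2.2.1
  have eT : P.dragT c q t₀ = (P.s + 1) / t₀ := by
    rw [dragT, ← mul_one ((P.s + 1) / t₀), ← heq, Real.rpow_add_one ht₀.ne']
    field_simp
  have eU : P.dragU c q t₀ = P.r / (q - c * t₀) := by
    rw [dragU, Real.rpow_sub_one hu₀.ne']
    linear_combination (P.r / (q - c * t₀)) * heq
  -- This makes the product of the two eigenvalues at the rest state negative.
  have hslope : P.dragT c q t₀ - c * P.dragU c q t₀ < 0 := by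
    rw [eT, eU]
    by_contra! hcon
    exact absurd (mul_nonneg hc.le hcon) (not_le.2 hsl)
  have hmem : ∀ x, (c, t x, tx x) ∈ regularSet c q t₀ := fun x =>
    ⟨hc, (hd x).1, by simpa using (hd x).2.1⟩
  have hmem₀ : (c, t₀, (0 : ℝ)) ∈ regularSet c q t₀ := ⟨hc, ht₀, by simpa using hu₀⟩
  have hk : 0 < t₀ ^ 2 / (c * P.nu) := div_pos (pow_pos ht₀ 2) (mul_pos hc hnu)
  obtain ⟨m₁, m₂, hm₁, hm₂, hprod, hsum⟩ := exists_roots_of_prod_neg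
    (h := -(t₀ ^ 2 / (c * P.nu) * (P.dragT c q t₀ - c * P.dragU c q t₀)))
    (k := t₀ ^ 2 / (c * P.nu) * (-c ^ 2 + P.F⁻¹ * (t₀ ^ 3)⁻¹))
    (by rw [neg_pos]; exact mul_neg_of_pos_of_neg hk hslope)
  rw [neg_neg] at hprod
  have hrest : ∀ c', P.accelField c q t₀ (c', t₀, 0) = 0 := by
    intro c'
    have : q + (c' - c) * t₀ - c' * t₀ = q - c * t₀ := by ring
    rw [accelField, accel_rest, this, heq, sub_self, mul_zero]
  set px : ℝ → ℝ := fun x => P.accel c q (t x) (tx x)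
  obtain ⟨B, δ₀, h1, h2⟩ := PlaneOrbit.exists_of_contDiff (isOpen_regularSet c q t₀)
    (fun v hv => contDiffAt_accelField hnu.ne' hv) hm₁ hm₂ (fun x => (hd x).2.2.1)
    (px := px) (fun x => (hd x).2.2.2) (fun x => by simp [accelField, px]) hmem hmem₀ h.tendsto.1
    h.tendsto.2 hrest h.2.1
    (by rw [fderiv_accelField_state hnu.ne' hmem₀, hprod]; rw [accel_rest, heq]; simp [alphaDeriv]; ring)
    (by rw [fderiv_accelField_velocity hnu.ne' hmem₀, hsum]; ring)
  refine ⟨px, m₁, m₂, B, δ₀, hnu, hc, ht₀, hu₀, ?_, fun x => (hd x).1, fun x => (hd x).2.1,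
    h.le hnu hr hs hsad, ?_, h2, hprod, hsum⟩
  · rw [eT]; positivity
  · have e1 : (fun x => fderiv ℝ (P.accelField c q t₀) (c, t x, tx x) (1, 0, 0)) =
        P.speedCoeff c q t₀ t tx px := funext fun x => fderiv_accelField_speed hnu.ne' (hmem x)
    have e2 : (fun x => fderiv ℝ (P.accelField c q t₀) (c, t x, tx x) (0, 1, 0)) =
        P.stateCoeff c q t tx px := funext fun x => fderiv_accelField_state hnu.ne' (hmem x)
    have e3 : (fun x => fderiv ℝ (P.accelField c q t₀) (c, t x, tx x) (0, 0, 1)) =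
        P.velCoeff c t tx := funext fun x => fderiv_accelField_velocity hnu.ne' (hmem x)
    rw [e1, e2, e3] at h1
    exact h1

end StVenant

theorem hasDerivWithinAt_neg_comp {f : ℝ → ℝ} {f' x : ℝ} (h : HasDerivWithinAt f f' (Ici 0) (-x)) :
    HasDerivWithinAt (fun y => f (-y)) (-f') (Iic 0) x := by
  have := hasDerivWithinAt_comp_neg_Ici (x₀ := 0) (x := x) (by rwa [zero_sub])
  simpa only [zero_sub] using this

theorem hasDerivWithinAt_neg_comp' {f : ℝ → ℝ} {f' x : ℝ} (h : HasDerivWithinAt f f' (Iic 0) (-x)) :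
    HasDerivWithinAt (fun y => f (-y)) (-f') (Ici 0) x := by
  have := h.scomp x ((hasDerivAt_neg x).hasDerivWithinAt (s := Ici 0))
    (fun y hy => by simpa using hy)
  simpa [Function.comp_def] using this

theorem orbitWeight_reflect (Hs : ℝ → ℝ) (x : ℝ) :
    orbitWeight (fun x => -Hs (-x)) x = orbitWeight Hs (-x) := by
  rw [orbitWeight, orbitWeight, intervalIntegral.integral_neg,
    intervalIntegral.integral_comp_neg, neg_zero, intervalIntegral.integral_symm, neg_neg]

/-! ### The branches of the profile equation and the derivative of their separation -/

namespace StVenant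

variable {P : StVenant} {c q t₀ m₁ m₂ B δ₀ : ℝ} {t p px : ℝ → ℝ}

namespace ProfileOrbit

theorem eventually_abs_sub_le {ε : ℝ} (hε : 0 < ε) : ∀ᶠ c' in 𝓝 c, |c' - c| ≤ ε := by
  filter_upwards [Metric.closedBall_mem_nhds c hε] with c' hc'
  rwa [Metric.mem_closedBall, Real.dist_eq] at hc'

theorem eventually_mul_abs_sub_lt (K : ℝ) {ε : ℝ} (hε : 0 < ε) :
    ∀ᶠ c' in 𝓝 c, K * |c' - c| < ε := by
  have : Tendsto (fun c' => K * |c' - c|) (𝓝 c) (𝓝 0) := by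
    have := ((continuous_const (y := K)).mul (continuous_id.sub continuous_const).abs).tendsto
      (f := fun c' => K * |c' - c|) c
    simpa using this
  exact this.eventually (gt_mem_nhds hε)

/-- A deviation of order |c' - c| gives uniform convergence, and it keeps the perturbed orbit in the
regular set, where the planar system is equivalent to the profile equation. -/
theorem isManifoldBranch_of (h : P.ProfileOrbit c q t₀ m₁ m₂ B δ₀ t p px) {I : Set ℝ}
    {l : Filter ℝ} (hl : l ≤ cocompact ℝ) {y z : ℝ → ℝ → ℝ} {K : ℝ}
    (hyz : ∀ᶠ c' in 𝓝 c, (∀ x ∈ I, HasDerivWithinAt (y c') (z c' x) I x) ∧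
      (∀ x ∈ I, HasDerivWithinAt (z c') (P.accel c' (q + (c' - c) * t₀) (t x + y c' x)
        (p x + z c' x) - px x) I x) ∧
      (∀ x ∈ I, |y c' x| ≤ K * |c' - c| ∧ |z c' x| ≤ K * |c' - c|) ∧
      Tendsto (y c') l (𝓝 0) ∧ Tendsto (z c') l (𝓝 0) ∧ y c' 0 * p 0 + z c' 0 * px 0 = 0) :
    P.IsManifoldBranch c q t₀ t p I l (fun c' x => t x + y c' x) (fun c' x => p x + z c' x) := by
  have hδ := h.plane.δ_pos
  refine ⟨?_, ?_, ?_⟩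
  · filter_upwards [hyz, eventually_abs_sub_le hδ, eventually_mul_abs_sub_lt K hδ] with c' hc h1 h2
    obtain ⟨hy, hz, hb, hyl, hzl, hn⟩ := hc
    have hreg : ∀ x ∈ I, (c', t x + y c' x, p x + z c' x) ∈ regularSet c q t₀ := fun x hx =>
      h.regular _ _ _ x h1 ((hb x hx).1.trans h2.le) ((hb x hx).2.trans h2.le)
    refine ⟨?_, ?_, ?_, ?_⟩
    · rcases I.eq_empty_or_nonempty with rfl | ⟨x₀, hx₀⟩
      · exact fun x hx => absurd hx (notMem_empty x)
      refine (isProfileOn_iff (hreg x₀ hx₀).1.ne' h.nu_pos.ne').2 fun x hx => ?_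
      obtain ⟨-, ht0, hu0⟩ := hreg x hx
      refine ⟨ht0, hu0, (h.plane.deriv_t x).hasDerivWithinAt.add (hy x hx), ?_⟩
      exact ((h.plane.deriv_p x).hasDerivWithinAt.add (hz x hx)).congr_deriv (by ring)
    · simpa using (h.plane.lim_t.mono_left hl).add hyl
    · simpa using (h.plane.lim_p.mono_left hl).add hzl
    · rw [(h.plane.deriv_p 0).deriv, add_sub_cancel_left, add_sub_cancel_left, hn]
  · refine Metric.tendstoUniformlyOn_iff.2 fun ε hε => ?_
    filter_upwards [hyz, eventually_mul_abs_sub_lt K hε] with c' hc h2 x hx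
    rw [dist_self_add_right, Real.norm_eq_abs]
    exact (hc.2.2.1 x hx).1.trans_lt h2
  · refine Metric.tendstoUniformlyOn_iff.2 fun ε hε => ?_
    filter_upwards [hyz, eventually_mul_abs_sub_lt K hε] with c' hc h2 x hx
    rw [dist_self_add_right, Real.norm_eq_abs]
    exact (hc.2.2.1 x hx).2.trans_lt h2

theorem exists_choice {α : Type*} {l : Filter α} {Q : α → (ℝ → ℝ) → (ℝ → ℝ) → Prop}
    (h : ∀ᶠ a in l, ∃ y z, Q a y z) : ∃ y z : α → ℝ → ℝ, ∀ᶠ a in l, Q a (y a) (z a) := by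
  have : ∀ a, ∃ y z, (∃ y z, Q a y z) → Q a y z := fun a => by
    by_cases ha : ∃ y z, Q a y z
    · obtain ⟨y, z, hh⟩ := ha
      exact ⟨y, z, fun _ => hh⟩
    · exact ⟨0, 0, fun h => absurd h ha⟩
  choose y z hyz using this
  exact ⟨y, z, h.mono fun a ha => hyz a ha⟩

theorem exists_stable_branch (h : P.ProfileOrbit c q t₀ m₁ m₂ B δ₀ t p px) :
    ∃ Tp Tpx, P.IsManifoldBranch c q t₀ t p (Ici 0) atTop Tp Tpx := by
  obtain ⟨-, -, C, κ, -, hd, -⟩ := h.plane.asymptotics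
  obtain ⟨K, -, hK⟩ := h.plane.nearOrbit.exists_branch hd
  obtain ⟨y, z, hyz⟩ := exists_choice hK
  exact ⟨_, _, h.isManifoldBranch_of atTop_le_cocompact hyz⟩

/-- Reversal of x, with the velocity changing sign, turns the unstable manifold into the stable
manifold of the reflected field. -/
theorem exists_unstable_branch (h : P.ProfileOrbit c q t₀ m₁ m₂ B δ₀ t p px) :
    ∃ Tm Tmx, P.IsManifoldBranch c q t₀ t p (Iic 0) atBot Tm Tmx := by
  obtain ⟨-, -, C, κ, -, hd, -⟩ := h.plane.reflect.asymptotics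
  obtain ⟨K, -, hK⟩ := h.plane.reflect.nearOrbit.exists_branch hd
  obtain ⟨y, z, hyz⟩ := exists_choice hK
  refine ⟨_, _, h.isManifoldBranch_of atBot_le_cocompact (y := fun c' x => y c' (-x))
    (z := fun c' x => -z c' (-x)) (K := K) ?_⟩
  filter_upwards [hyz] with c' ⟨hy, hz, hb, hyl, hzl, hn⟩
  refine ⟨fun x hx => ?_, fun x hx => ?_, fun x hx => ?_, hyl.comp tendsto_neg_atBot_atTop, ?_, ?_⟩
  · exact hasDerivWithinAt_neg_comp (hy (-x) (by simpa using hx))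
  · refine (hasDerivWithinAt_neg_comp (hz (-x) (by simpa using hx))).fun_neg.congr_deriv ?_
    rw [neg_neg, neg_neg, neg_add, neg_neg]
  · rw [abs_neg]
    exact hb (-x) (by simpa using hx)
  · simpa using (hzl.comp tendsto_neg_atBot_atTop).neg
  · simp only [neg_zero] at hn ⊢
    linarith

theorem branch_eventually (h : P.ProfileOrbit c q t₀ m₁ m₂ B δ₀ t p px) {I : Set ℝ}
    {l : Filter ℝ} {T Tx : ℝ → ℝ → ℝ} (hT : P.IsManifoldBranch c q t₀ t p I l T Tx) :
    ∀ᶠ c' in 𝓝 c, (∀ x ∈ I, HasDerivWithinAt (fun x => T c' x - t x) (Tx c' x - p x) I x) ∧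
      (∀ x ∈ I, HasDerivWithinAt (fun x => Tx c' x - p x)
        (P.accel c' (q + (c' - c) * t₀) (T c' x) (Tx c' x) - px x) I x) ∧
      (T c' 0 - t 0) * p 0 + (Tx c' 0 - p 0) * px 0 = 0 := by
  filter_upwards [hT.1, eventually_ne_nhds h.c_pos.ne'] with c' hc hc0
  have h1 := (isProfileOn_iff hc0 h.nu_pos.ne').1 hc.1
  refine ⟨fun x hx => (h1 x hx).2.2.1.fun_sub (h.plane.deriv_t x).hasDerivWithinAt,
    fun x hx => (h1 x hx).2.2.2.fun_sub (h.plane.deriv_p x).hasDerivWithinAt, ?_⟩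
  rw [← (h.plane.deriv_p 0).deriv]
  exact hc.2.2.2

theorem branch_small {I : Set ℝ} {l : Filter ℝ} {T Tx : ℝ → ℝ → ℝ}
    (hT : P.IsManifoldBranch c q t₀ t p I l T Tx) {ε : ℝ} (hε : 0 < ε) :
    ∀ᶠ c' in 𝓝 c, ∀ x ∈ I, |T c' x - t x| ≤ ε ∧ |Tx c' x - p x| ≤ ε := by
  filter_upwards [Metric.tendstoUniformlyOn_iff.1 hT.2.1 ε hε,
    Metric.tendstoUniformlyOn_iff.1 hT.2.2 ε hε] with c' h1 h2 x hx
  rw [← Real.dist_eq, ← Real.dist_eq, dist_comm, dist_comm (Tx c' x)]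
  exact ⟨(h1 x hx).le, (h2 x hx).le⟩

/-- A property holding eventually near c holds at c itself, so uniform closeness for every ε forces
equality there. -/
theorem branch_center {I : Set ℝ} {l : Filter ℝ} {T Tx : ℝ → ℝ → ℝ}
    (hT : P.IsManifoldBranch c q t₀ t p I l T Tx) {x : ℝ} (hx : x ∈ I) :
    T c x = t x ∧ Tx c x = p x := by
  have h := fun ε (hε : 0 < ε) => (branch_small hT hε).self_of_nhds x hx
  exact ⟨sub_eq_zero.1 (abs_nonpos_iff.1 (le_of_forall_pos_le_add fun ε hε => by
      simpa using (h ε hε).1)),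
    sub_eq_zero.1 (abs_nonpos_iff.1 (le_of_forall_pos_le_add fun ε hε => by
      simpa using (h ε hε).2))⟩

theorem melnikov_center {Tp Tpx Tm Tmx : ℝ → ℝ → ℝ}
    (hTp : P.IsManifoldBranch c q t₀ t p (Ici 0) atTop Tp Tpx)
    (hTm : P.IsManifoldBranch c q t₀ t p (Iic 0) atBot Tm Tmx) :
    melnikov p Tp Tpx Tm Tmx c = 0 := by
  have h1 := branch_center hTp self_mem_Ici
  have h2 := branch_center hTm self_mem_Iic
  rw [melnikov, Matrix.det_fin_two_of, h1.1, h1.2, h2.1, h2.2]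
  ring

/-- The integrand of the Melnikov integral. -/
noncomputable def melnikovDensity (P : StVenant) (c q t₀ : ℝ) (t p px : ℝ → ℝ) (x : ℝ) : ℝ :=
  orbitWeight (P.velCoeff c t p) x * p x * P.speedCoeff c q t₀ t p px x

-- The determinant is linear in the difference of the branches: subtract from the separation of the
-- stable branch that of the unstable one, the latter computed in the reflected system.
open MeasureTheory in
theorem hasDerivAt_melnikov (h : P.ProfileOrbit c q t₀ m₁ m₂ B δ₀ t p px)
    {Tp Tpx Tm Tmx : ℝ → ℝ → ℝ} (hTp : P.IsManifoldBranch c q t₀ t p (Ici 0) atTop Tp Tpx)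
    (hTm : P.IsManifoldBranch c q t₀ t p (Iic 0) atBot Tm Tmx) :
    HasDerivAt (melnikov p Tp Tpx Tm Tmx)
      (-((∫ x in Ioi (0 : ℝ), melnikovDensity P c q t₀ t p px x) +
        ∫ x in Ioi (0 : ℝ), melnikovDensity P c q t₀ t p px (-x))) c := by
  obtain ⟨-, -, C, κ, -, hd, -⟩ := h.plane.asymptotics
  obtain ⟨-, -, C', κ', -, hd', -⟩ := h.plane.reflect.asymptotics
  have d1 := h.plane.nearOrbit.hasDerivAt_separation hd (y := fun c' x => Tp c' x - t x)
    (z := fun c' x => Tpx c' x - p x) (by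
      filter_upwards [h.branch_eventually hTp] with c' hc
      refine ⟨hc.1, fun x hx => ?_, hc.2.2⟩
      simpa only [add_sub_cancel] using hc.2.1 x hx) (fun ε hε => branch_small hTp hε)
  have d2 := h.plane.reflect.nearOrbit.hasDerivAt_separation hd'
    (y := fun c' x => Tm c' (-x) - t (-x)) (z := fun c' x => -(Tmx c' (-x) - p (-x))) (by
      filter_upwards [h.branch_eventually hTm] with c' hc
      refine ⟨fun x hx => ?_, fun x hx => ?_, ?_⟩
      · exact hasDerivWithinAt_neg_comp' (hc.1 (-x) (by simpa using hx))
      · refine (hasDerivWithinAt_neg_comp' (hc.2.1 (-x) (by simpa using hx))).fun_neg.congr_deriv ?_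
        rw [neg_neg, ← neg_add, neg_neg, add_sub_cancel, add_sub_cancel]
      · simp only [neg_zero]
        linarith [hc.2.2]) (fun ε hε => by
      filter_upwards [branch_small hTm hε] with c' hc x hx
      rw [abs_neg]
      exact hc (-x) (by simpa using hx))
  refine ((d1.sub d2).congr_of_eventuallyEq ?_).congr_deriv ?_
  · refine Eventually.of_forall fun c' => ?_
    rw [melnikov, Matrix.det_fin_two_of, (h.plane.deriv_p 0).deriv]
    simp only [neg_zero, Pi.sub_apply]
    ring
  · rw [neg_add]
    congr 1
    rw [← integral_neg]
    congr 1
    ext x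
    rw [melnikovDensity, orbitWeight_reflect]
    ring

end ProfileOrbit

end StVenant

/-! ### Cross products: from pairs of solutions to the adjoint equation -/

section TripleProduct

open Matrix

variable {R : Type*} [CommRing R]

/-- The action of A on the second exterior power of a three-dimensional space is trace minus
transpose; hence the cross product of two solutions solves the adjoint equation up to a trace
factor. -/
theorem cross_mulVec (A : Matrix (Fin 3) (Fin 3) R) (u v : Fin 3 → R) :
    crossProduct (A *ᵥ u) v + crossProduct u (A *ᵥ v) =
      A.trace • crossProduct u v - Aᵀ *ᵥ crossProduct u v := by
  ext i
  fin_cases i <;>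
  simp [cross_apply, mulVec, dotProduct, Fin.sum_univ_three, trace] <;> ring

theorem cross_sum_smul (M : Matrix (Fin 2) (Fin 2) R) (W : Fin 2 → Fin 3 → R) :
    crossProduct (∑ i, M i 0 • W i) (∑ i, M i 1 • W i) = M.det • crossProduct (W 0) (W 1) := by
  ext i
  fin_cases i <;> simp [cross_apply, det_fin_two, Fin.sum_univ_two] <;> ring

/-- Cramer's rule, without inverting the determinant of the basis. -/
theorem cross_dotProduct_smul (u v w y : Fin 3 → R) : (crossProduct u v ⬝ᵥ w) • y =
    (crossProduct y v ⬝ᵥ w) • u + (crossProduct u y ⬝ᵥ w) • v + (crossProduct u v ⬝ᵥ y) • w := by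
  ext i
  fin_cases i <;> simp [cross_apply, dotProduct, Fin.sum_univ_three] <;> ring

theorem StVenant.det3_eq (u v w : Fin 3 → ℂ) : StVenant.det3 u v w = crossProduct u v ⬝ᵥ w := by
  simp [StVenant.det3, cross_apply, dotProduct, Fin.sum_univ_three, det_fin_three]
  ring

theorem hasDerivAt_cross {u v : ℝ → Fin 3 → ℂ} {u' v' : Fin 3 → ℂ} {x : ℝ}
    (hu : HasDerivAt u u' x) (hv : HasDerivAt v v' x) :
    HasDerivAt (fun x => crossProduct (u x) (v x)) (crossProduct u' (v x) + crossProduct (u x) v') x := by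
  rw [hasDerivAt_pi] at hu hv ⊢
  intro i
  fin_cases i <;> simp only [cross_apply]
  · exact (((hu 1).mul (hv 2)).sub ((hu 2).mul (hv 1))).congr_deriv (by simp; ring)
  · exact (((hu 2).mul (hv 0)).sub ((hu 0).mul (hv 2))).congr_deriv (by simp; ring)
  · exact (((hu 0).mul (hv 1)).sub ((hu 1).mul (hv 0))).congr_deriv (by simp; ring)

theorem continuous_cross : Continuous fun y : (Fin 3 → ℂ) × (Fin 3 → ℂ) => crossProduct y.1 y.2 := by
  refine continuous_pi fun i => ?_
  fin_cases i <;> simp only [cross_apply] <;> simp <;> fun_prop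

-- Liouville's formula: the determinant times exp(-x tr M) has zero derivative and equals 1 at the
-- origin.
attribute [local instance] Matrix.linftyOpNormedRing Matrix.linftyOpNormedAlgebra in
theorem det_exp_smul_fin_two (M : Matrix (Fin 2) (Fin 2) ℂ) (x : ℂ) :
    (NormedSpace.exp (x • M)).det = Complex.exp (x * M.trace) := by
  have h := fun x : ℂ => hasDerivAt_exp_smul_const' M x
  have he : ∀ i j x, HasDerivAt (fun x : ℂ => NormedSpace.exp (x • M) i j)
      ((M * NormedSpace.exp (x • M)) i j) x := fun i j x =>
    (hasDerivAt_pi.1 (hasDerivAt_pi.1 (h x) i) j)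
  have hd : ∀ x, HasDerivAt (fun x : ℂ => (NormedSpace.exp (x • M)).det * Complex.exp (-(x * M.trace)))
      0 x := by
    intro x
    simp only [det_fin_two]
    refine ((((he 0 0 x).mul (he 1 1 x)).sub ((he 0 1 x).mul (he 1 0 x))).mul
      ((hasDerivAt_mul_const M.trace).fun_neg.cexp)).congr_deriv ?_
    simp only [mul_apply, Fin.sum_univ_two, trace_fin_two, Pi.sub_apply, Pi.mul_apply]
    ring
  have hc := is_const_of_deriv_eq_zero (fun x => (hd x).differentiableAt) (fun x => (hd x).deriv) x 0
  simp only [zero_smul, NormedSpace.exp_zero, det_one, zero_mul, neg_zero, Complex.exp_zero,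
    mul_one, Complex.exp_neg] at hc
  rw [← div_eq_mul_inv, div_eq_one_iff_eq (Complex.exp_ne_zero _)] at hc
  exact hc

end TripleProduct

/-! ### The Evans function as a pairing of two extremal solutions -/

section EvansValue

open Matrix

/-- Data of a system on the line whose limits at both ends agree and are diagonalizable, with a
simple eigenvalue of smallest real part. -/
structure EvansData (A : ℝ → Matrix (Fin 3) (Fin 3) ℂ) (A₀ T T' : Matrix (Fin 3) (Fin 3) ℂ)
    (a : Fin 3 → ℂ) (C κ : ℝ) (Θ : ℝ → ℂ) (Θ₀ : ℂ) : Prop where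
  stable : DiagLimit A A₀ T T' a 2 C κ
  unstable : DiagLimit (fun x => (A (-x))ᵀ) A₀ᵀ T'ᵀ Tᵀ a 2 C κ
  gap : ∀ j, j ≠ 2 → (a 2).re < (a j).re
  deriv_trace : ∀ x, HasDerivAt Θ ((A x).trace - A₀.trace) x
  trace_zero : Θ 0 = 0
  trace_lim : Tendsto Θ atBot (𝓝 Θ₀)

/-- The solution with prescribed decaying behaviour at `+∞`, and the solution of the adjoint
equation, written backwards, with prescribed decaying behaviour at `-∞`. -/
structure EvansPair (A : ℝ → Matrix (Fin 3) (Fin 3) ℂ) (T T' : Matrix (Fin 3) (Fin 3) ℂ)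
    (a : Fin 3 → ℂ) (w η : ℝ → Fin 3 → ℂ) : Prop where
  deriv_w : ∀ x, HasDerivAt w (A x *ᵥ w x) x
  lim_w : Tendsto (fun x : ℝ => Complex.exp (-a 2 * x) • w x) atTop (𝓝 fun i => T i 2)
  deriv_η : ∀ x, HasDerivAt η ((A (-x))ᵀ *ᵥ η x) x
  lim_η : Tendsto (fun x : ℝ => Complex.exp (-a 2 * x) • η x) atTop (𝓝 fun i => T' 2 i)

variable {A : ℝ → Matrix (Fin 3) (Fin 3) ℂ} {A₀ T T' : Matrix (Fin 3) (Fin 3) ℂ}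
  {a : Fin 3 → ℂ} {C κ : ℝ} {Θ : ℝ → ℂ} {Θ₀ : ℂ} {w η : ℝ → Fin 3 → ℂ}

/-- Two solutions with prescribed joint asymptotics at `-∞`, and the growth of their cross
product. -/
theorem tendsto_cross {V : Fin 2 → Fin 3 → ℂ} {M : Matrix (Fin 2) (Fin 2) ℂ}
    {W : Fin 2 → ℝ → Fin 3 → ℂ}
    (hWl : ∀ j, Tendsto (fun x : ℝ => ∑ i, NormedSpace.exp (-(x : ℂ) • M) i j • W i x) atBot
      (𝓝 (V j))) :
    Tendsto (fun x : ℝ => Complex.exp (-(x : ℂ) * M.trace) • crossProduct (W 0 x) (W 1 x)) atBot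
      (𝓝 (crossProduct (V 0) (V 1))) := by
  refine ((continuous_cross.tendsto (V 0, V 1)).comp ((hWl 0).prodMk_nhds (hWl 1))).congr fun x => ?_
  rw [← det_exp_smul_fin_two]
  exact cross_sum_smul _ fun i => W i x

namespace EvansData

theorem mulVec_col (h : EvansData A A₀ T T' a C κ Θ Θ₀) (j : Fin 3) :
    A₀ *ᵥ (fun i => T i j) = a j • fun i => T i j := by
  ext i
  have := congrFun (congrFun h.stable.diag i) j
  rw [mul_diagonal, mul_apply] at this
  simp only [mulVec, dotProduct, Pi.smul_apply, smul_eq_mul]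
  rw [this, mul_comm]

theorem mul_inv (h : EvansData A A₀ T T' a C κ Θ Θ₀) : T * T' = 1 := mul_eq_one_comm.1 h.stable.inv

/-- An eigenvector for the smallest eigenvalue is a multiple of the last column of `T`. -/
theorem exists_eq_smul_col (h : EvansData A A₀ T T' a C κ Θ Θ₀) {v : Fin 3 → ℂ}
    (hv : A₀ *ᵥ v = a 2 • v) : ∃ g : ℂ, v = g • fun i => T i 2 := by
  have h1 : diagonal a *ᵥ (T' *ᵥ v) = a 2 • (T' *ᵥ v) := by
    have : T' * A₀ = diagonal a * T' := by
      calc T' * A₀ = T' * A₀ * (T * T') := by rw [h.mul_inv, mul_one]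
        _ = T' * (A₀ * T) * T' := by simp only [mul_assoc]
        _ = _ := by rw [h.stable.diag, ← mul_assoc, h.stable.inv, one_mul]
    rw [mulVec_mulVec, ← this, ← mulVec_mulVec, hv, mulVec_smul]
  refine ⟨(T' *ᵥ v) 2, ?_⟩
  have h2 : ∀ j, j ≠ 2 → (T' *ᵥ v) j = 0 := by
    intro j hj
    have h3 := congrFun h1 j
    rw [mulVec_diagonal, Pi.smul_apply, smul_eq_mul] at h3
    refine (mul_eq_mul_right_iff.1 h3).resolve_left fun h4 => ?_
    have := h.gap j hj
    rw [h4] at this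
    exact lt_irrefl _ this
  have h3 : v = T *ᵥ (T' *ᵥ v) := by rw [mulVec_mulVec, h.mul_inv, one_mulVec]
  ext i
  conv_lhs => rw [h3]
  simp only [mulVec, dotProduct, Fin.sum_univ_three, Pi.smul_apply, smul_eq_mul] at h2 ⊢
  have e0 := h2 0 (by decide)
  have e1 := h2 1 (by decide)
  rw [e0, e1]
  ring

/-- A left eigenvector for the smallest eigenvalue is a multiple of the last row of `T'`. -/
theorem eq_smul_row (h : EvansData A A₀ T T' a C κ Θ Θ₀) {n : Fin 3 → ℂ}
    (hn : ∀ y, n ⬝ᵥ (A₀ *ᵥ y) = a 2 * n ⬝ᵥ y) :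
    n = (n ⬝ᵥ fun i => T i 2) • fun i => T' 2 i := by
  have h2 : ∀ j, j ≠ 2 → (n ⬝ᵥ fun i => T i j) = 0 := by
    intro j hj
    have h3 := hn fun i => T i j
    rw [h.mulVec_col, dotProduct_smul, smul_eq_mul] at h3
    refine (mul_eq_mul_right_iff.1 h3).resolve_left fun h4 => ?_
    have := h.gap j hj
    rw [h4] at this
    exact lt_irrefl _ this
  have h3 : n = (n ᵥ* T) ᵥ* T' := by rw [vecMul_vecMul, h.mul_inv, vecMul_one]
  have e0 : (n ᵥ* T) 0 = 0 := h2 0 (by decide)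
  have e1 : (n ᵥ* T) 1 = 0 := h2 1 (by decide)
  ext i
  conv_lhs => rw [h3]
  rw [vecMul, dotProduct, Fin.sum_univ_three, e0, e1]
  simp [vecMul]

/-- The definition only asks that m lie to the left of the spectrum of M. As the invariant plane and
v together span the space, the leftmost eigenvalue of A₀ is m or an eigenvalue of M, and the latter
would place m strictly to its left. -/
theorem smallest_eq (h : EvansData A A₀ T T' a C κ Θ Θ₀) {V : Fin 2 → Fin 3 → ℂ} {v : Fin 3 → ℂ}
    {M : Matrix (Fin 2) (Fin 2) ℂ} {m : ℂ} (hV : ∀ j, A₀ *ᵥ V j = ∑ i, M i j • V i)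
    (hv : A₀ *ᵥ v = m • v) (hm : ∀ k ∈ spectrum ℂ M, m.re < k.re)
    (hn : ∀ y, crossProduct (V 0) (V 1) ⬝ᵥ (A₀ *ᵥ y) = m * crossProduct (V 0) (V 1) ⬝ᵥ y)
    (hΔ : crossProduct (V 0) (V 1) ⬝ᵥ v ≠ 0) : m = a 2 := by
  set τ : Fin 3 → ℂ := fun i => T i 2
  have hτ : A₀ *ᵥ τ = a 2 • τ := h.mulVec_col 2
  have hτ0 : τ ≠ 0 := by
    intro h0
    have h1 : (T' * T) 2 2 = 1 := by rw [h.stable.inv]; simp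
    have h2 : ∀ i, T i 2 = 0 := fun i => congrFun h0 i
    rw [mul_apply] at h1
    simp [h2] at h1
  have hmin : (a 2).re ≤ m.re := by
    have h1 : diagonal a *ᵥ (T' *ᵥ v) = m • (T' *ᵥ v) := by
      have : T' * A₀ = diagonal a * T' := by
        calc T' * A₀ = T' * A₀ * (T * T') := by rw [h.mul_inv, mul_one]
          _ = T' * (A₀ * T) * T' := by simp only [mul_assoc]
          _ = _ := by rw [h.stable.diag, ← mul_assoc, h.stable.inv, one_mul]
      rw [mulVec_mulVec, ← this, ← mulVec_mulVec, hv, mulVec_smul]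
    have h2 : T' *ᵥ v ≠ 0 := by
      intro h0
      have h3 : v = T *ᵥ (T' *ᵥ v) := by rw [mulVec_mulVec, h.mul_inv, one_mulVec]
      rw [h0, mulVec_zero] at h3
      rw [h3, dotProduct_zero] at hΔ
      exact hΔ rfl
    obtain ⟨j, hj⟩ := Function.ne_iff.1 h2
    have h3 := congrFun h1 j
    rw [mulVec_diagonal, Pi.smul_apply, smul_eq_mul] at h3
    rw [← mul_right_cancel₀ hj h3]
    exact h.stable.min j
  have h1 := hn τ
  rw [hτ, dotProduct_smul, smul_eq_mul] at h1
  rcases mul_eq_mul_right_iff.1 h1 with h2 | h2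
  · exact h2.symm
  exfalso
  set Δ := crossProduct (V 0) (V 1) ⬝ᵥ v
  set x : Fin 2 → ℂ := ![crossProduct τ (V 1) ⬝ᵥ v, crossProduct (V 0) τ ⬝ᵥ v]
  -- If the normal of the plane annihilates the extremal eigenvector, Cramer's rule puts that
  -- eigenvector in the plane, and its coordinates form an eigenvector of M.
  have hx : Δ • τ = x 0 • V 0 + x 1 • V 1 := by
    rw [cross_dotProduct_smul (V 0) (V 1) v τ, h2, zero_smul, add_zero]
    rfl
  have hx0 : x ≠ 0 := by
    intro h0
    rw [h0, Pi.zero_apply, Pi.zero_apply, zero_smul, zero_smul, add_zero] at hx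
    exact hτ0 ((smul_eq_zero.1 hx).resolve_left hΔ)
  have key : (∑ i, ((M *ᵥ x) i - a 2 * x i) • V i) = 0 := by
    have e1 : A₀ *ᵥ (Δ • τ) = a 2 • (Δ • τ) := by rw [mulVec_smul, hτ, smul_comm]
    rw [hx, mulVec_add, mulVec_smul, mulVec_smul, hV, hV] at e1
    rw [← sub_eq_zero] at e1
    rw [← e1]
    simp only [Fin.sum_univ_two, mulVec, dotProduct]
    module
  have hMx : M *ᵥ x = a 2 • x := by
    rw [Fin.sum_univ_two] at key
    have k0 := congrArg (fun y => crossProduct y (V 1) ⬝ᵥ v) key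
    have k1 := congrArg (fun y => crossProduct (V 0) y ⬝ᵥ v) key
    simp only [map_add, map_smul, LinearMap.add_apply, LinearMap.smul_apply, cross_self, smul_zero,
      add_zero, zero_add, smul_dotProduct, map_zero, LinearMap.zero_apply, zero_dotProduct,
      smul_eq_mul] at k0 k1
    ext i
    fin_cases i
    · exact sub_eq_zero.1 ((mul_eq_zero.1 k0).resolve_right hΔ)
    · exact sub_eq_zero.1 ((mul_eq_zero.1 k1).resolve_right hΔ)
  have hspec : a 2 ∈ spectrum ℂ M := by
    rw [spectrum.mem_iff]
    intro hu
    refine hx0 (mulVec_injective_iff_isUnit.2 hu ?_)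
    rw [mulVec_zero, sub_mulVec, hMx, Algebra.algebraMap_eq_smul_one, smul_mulVec, one_mulVec,
      sub_self]
  exact absurd (hm _ hspec) (not_lt.2 hmin)

/-- The normal of an invariant plane is a left eigenvector; its eigenvalue is the trace of A₀ minus
the trace on the plane. -/
theorem cross_dotProduct_mulVec {V : Fin 2 → Fin 3 → ℂ} {M : Matrix (Fin 2) (Fin 2) ℂ}
    (hV : ∀ j, A₀ *ᵥ V j = ∑ i, M i j • V i) (y : Fin 3 → ℂ) :
    crossProduct (V 0) (V 1) ⬝ᵥ (A₀ *ᵥ y) =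
      (A₀.trace - M.trace) * crossProduct (V 0) (V 1) ⬝ᵥ y := by
  have h1 := congrArg (fun u => u ⬝ᵥ y) (cross_mulVec A₀ (V 0) (V 1))
  simp only [hV, Fin.sum_univ_two, map_add, map_smul, LinearMap.add_apply, LinearMap.smul_apply,
    cross_self, smul_zero, add_zero, zero_add, add_dotProduct, sub_dotProduct, smul_dotProduct,
    smul_eq_mul, mulVec_transpose, ← dotProduct_mulVec] at h1
  rw [trace_fin_two M]
  linear_combination h1

/-- The value of the Evans function, computed from a normalized pair of solutions. -/
theorem value_eq (h : EvansData A A₀ T T' a C κ Θ Θ₀) (hp : EvansPair A T T' a w η)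
    {V : Fin 2 → Fin 3 → ℂ} {v : Fin 3 → ℂ} {M : Matrix (Fin 2) (Fin 2) ℂ} {m : ℂ}
    {W : Fin 2 → ℝ → Fin 3 → ℂ} {w' : ℝ → Fin 3 → ℂ} (hV : ∀ j, A₀ *ᵥ V j = ∑ i, M i j • V i)
    (hv : A₀ *ᵥ v = m • v) (hm : ∀ k ∈ spectrum ℂ M, m.re < k.re)
    (hΔ : crossProduct (V 0) (V 1) ⬝ᵥ v ≠ 0)
    (hW : ∀ j x, HasDerivAt (W j) (A x *ᵥ W j x) x)
    (hw' : ∀ x, HasDerivAt w' (A x *ᵥ w' x) x)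
    (hWl : ∀ j, Tendsto (fun x : ℝ => ∑ i, NormedSpace.exp (-(x : ℂ) • M) i j • W i x) atBot
      (𝓝 (V j)))
    (hwl : Tendsto (fun x : ℝ => Complex.exp (-m * x) • w' x) atTop (𝓝 v)) :
    crossProduct (W 0 0) (W 1 0) ⬝ᵥ w' 0 / crossProduct (V 0) (V 1) ⬝ᵥ v =
      Complex.exp (-Θ₀) * η 0 ⬝ᵥ w 0 := by
  set n := crossProduct (V 0) (V 1) with hn
  have hcr : ∀ y, n ⬝ᵥ (A₀ *ᵥ y) = (A₀.trace - M.trace) * n ⬝ᵥ y := cross_dotProduct_mulVec hV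
  have hmtr : m = A₀.trace - M.trace := by
    have h1 := hcr v
    rw [hv, dotProduct_smul, smul_eq_mul] at h1
    exact mul_right_cancel₀ hΔ h1
  have hma : m = a 2 := h.smallest_eq hV hv hm (by rw [← hn, hmtr]; exact hcr) hΔ
  rw [← hmtr, hma] at hcr
  obtain ⟨g, hg⟩ := h.exists_eq_smul_col (hma ▸ hv)
  have hrow := h.eq_smul_row hcr
  set b := n ⬝ᵥ fun i => T i 2 with hb
  have hgb : n ⬝ᵥ v = g * b := by rw [hg, dotProduct_smul, smul_eq_mul]
  have hw0 : w' 0 = g • w 0 := by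
    refine h.stable.unique hw' (w₂ := fun x => g • w x) (fun x => ?_) (hma ▸ hwl) ?_ le_rfl
    · rw [mulVec_smul]; exact (hp.deriv_w x).const_smul g
    · rw [hg]
      refine (hp.lim_w.const_smul g).congr fun x => ?_
      rw [smul_comm]
  -- Dividing the cross product by the exponential of the integrated trace gives a genuine solution
  -- of the adjoint equation. Its asymptotics at -∞ are those of the normal of the plane, up to the
  -- factor exp(-Θ₀).
  set ξ : ℝ → Fin 3 → ℂ := fun x => Complex.exp (-Θ x - x * A₀.trace) • crossProduct (W 0 x) (W 1 x)
    with hξ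
  have hξd : ∀ x, HasDerivAt ξ (-((A x)ᵀ *ᵥ ξ x)) x := by
    intro x
    have h1 := hasDerivAt_cross (hW 0 x) (hW 1 x)
    rw [cross_mulVec] at h1
    have h2 : HasDerivAt (fun x : ℝ => Complex.exp (-Θ x - x * A₀.trace))
        (Complex.exp (-Θ x - x * A₀.trace) * -(A x).trace) x := by
      have h3 := ((h.deriv_trace x).fun_neg.fun_sub
        ((hasDerivAt_id x).ofReal_comp.mul_const A₀.trace)).cexp
      exact h3.congr_deriv (by simp)
    refine (h2.smul h1).congr_deriv ?_
    simp only [hξ, mulVec_smul]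
    module
  have hηl : Tendsto (fun x : ℝ => Complex.exp (-a 2 * x) • ξ (-x)) atTop
      (𝓝 (Complex.exp (-Θ₀) • n)) := by
    have h1 := h.trace_lim.neg.cexp.smul (tendsto_cross hWl)
    refine (h1.comp tendsto_neg_atTop_atBot).congr fun x => ?_
    simp only [Function.comp_apply, hξ]
    rw [smul_smul, smul_smul, ← Complex.exp_add, ← Complex.exp_add, ← hma, hmtr]
    congr 2
    push_cast
    ring
  -- Extremal solutions are determined by their asymptotics, so the reversed ξ is a multiple of η;
  -- all choices of bases then cancel in the quotient.
  have hη0 : ξ (-0) = (Complex.exp (-Θ₀) * b) • η 0 := by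
    refine h.unstable.unique (w₁ := fun x => ξ (-x))
      (w₂ := fun x => (Complex.exp (-Θ₀) * b) • η x) (fun x => ?_) (fun x => ?_) hηl ?_ le_rfl
    · have := (hξd (-x)).scomp x (hasDerivAt_neg x)
      exact HasDerivAt.congr_deriv (f := fun x => ξ (-x)) this (by simp)
    · rw [mulVec_smul]; exact (hp.deriv_η x).const_smul (Complex.exp (-Θ₀) * b)
    · rw [hrow, smul_smul]
      refine (hp.lim_η.const_smul (Complex.exp (-Θ₀) * b)).congr fun x => ?_
      rw [smul_comm]
  have hξ0 : ξ (-0) = crossProduct (W 0 0) (W 1 0) := by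
    simp [hξ, h.trace_zero]
  rw [← hξ0, hη0, hw0, smul_dotProduct, dotProduct_smul, div_eq_iff hΔ, hgb, smul_eq_mul,
    smul_eq_mul]
  ring

end EvansData

end EvansValue

section EvansValue

open Matrix

variable {A : ℝ → Matrix (Fin 3) (Fin 3) ℂ} {A₀ T T' : Matrix (Fin 3) (Fin 3) ℂ}
  {a : Fin 3 → ℂ} {C κ : ℝ} {Θ : ℝ → ℂ} {Θ₀ : ℂ} {w η : ℝ → Fin 3 → ℂ}

theorem EvansData.exists_pair (h : EvansData A A₀ T T' a C κ Θ Θ₀) {Λ : ℝ}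
    (hΛ : ∀ x i j, ‖A x i j‖ ≤ Λ) : ∃ w η, EvansPair A T T' a w η := by
  obtain ⟨w, hw, hwl⟩ := exists_asymptotic_solution h.stable.cont hΛ h.stable.inv h.stable.diag
    h.stable.pos h.stable.decay 2
  obtain ⟨η, hη, hηl⟩ := exists_asymptotic_solution h.unstable.cont (fun x i j => hΛ (-x) j i)
    h.unstable.inv h.unstable.diag h.unstable.pos h.unstable.decay 2
  exact ⟨w, η, hw, hwl, hη, hηl⟩

/-- Solutions with prescribed asymptotics at `-∞`. -/
theorem EvansData.exists_solution_atBot (h : EvansData A A₀ T T' a C κ Θ Θ₀) {Λ : ℝ}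
    (hΛ : ∀ x i j, ‖A x i j‖ ≤ Λ) (k : Fin 3) : ∃ W : ℝ → Fin 3 → ℂ,
      (∀ x, HasDerivAt W (A x *ᵥ W x) x) ∧
      Tendsto (fun x : ℝ => Complex.exp (-a k * x) • W x) atBot (𝓝 fun i => T i k) := by
  obtain ⟨W, hW, hWl⟩ := exists_asymptotic_solution (A := fun x => -A (-x)) (A₀ := -A₀) (T := T)
    (T' := T') (a := -a) (Λ := Λ) (C := C) (κ := κ) (fun i j => (h.unstable.cont j i).neg)
    (fun x i j => by rw [Matrix.neg_apply, norm_neg]; exact hΛ _ _ _) h.stable.inv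
    (by rw [neg_mul, h.stable.diag, ← mul_neg, diagonal_neg]; rfl) h.stable.pos
    (fun x hx i j => by
      rw [Matrix.neg_apply, Matrix.neg_apply, ← neg_sub', norm_neg]
      exact h.unstable.decay x hx j i) k
  refine ⟨fun x => W (-x), fun x => ?_, ?_⟩
  · have := (hW (-x)).scomp x (hasDerivAt_neg x)
    exact HasDerivAt.congr_deriv (f := fun x => W (-x)) this (by simp [neg_mulVec])
  · refine (hWl.comp tendsto_neg_atBot_atTop).congr fun x => ?_
    simp only [Function.comp_apply, Pi.neg_apply]
    congr 2
    push_cast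
    ring

/-- Any admissible choice gives the pairing. A choice exists: with eigenvectors as basis, M is
diagonal, its exponential is explicit, and solutions with one eigenvector as asymptotic direction
suffice. -/
theorem StVenant.isEvansValue_iff {P : StVenant} {c q t₀ : ℝ} {t tx : ℝ → ℝ} {z : ℂ}
    (h : EvansData (fun x => P.evansMatrix c q t tx x z) (P.limitMatrix c q t₀ z) T T' a C κ Θ Θ₀)
    (hp : EvansPair (fun x => P.evansMatrix c q t tx x z) T T' a w η) {Λ : ℝ}
    (hΛ : ∀ x i j, ‖P.evansMatrix c q t tx x z i j‖ ≤ Λ) (D : ℂ) :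
    P.IsEvansValue c q t₀ t tx z D ↔ D = Complex.exp (-Θ₀) * η 0 ⬝ᵥ w 0 := by
  constructor
  · rintro ⟨V, v, M, m, W, w', hV, hv, hm, hΔ, hW, hw', hWl, hwl, rfl⟩
    rw [StVenant.det3_eq] at hΔ
    rw [StVenant.det3_eq, StVenant.det3_eq]
    exact h.value_eq hp hV hv hm hΔ hW hw' hWl hwl
  · intro hD
    obtain ⟨W₀, hW₀, hW₀l⟩ := h.exists_solution_atBot hΛ 0
    obtain ⟨W₁, hW₁, hW₁l⟩ := h.exists_solution_atBot hΛ 1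
    have hV : ∀ j, P.limitMatrix c q t₀ z *ᵥ (![fun i => T i 0, fun i => T i 1] j) =
        ∑ i, diagonal ![a 0, a 1] i j • ![fun i => T i 0, fun i => T i 1] i := by
      intro j
      fin_cases j
      · simpa [Fin.sum_univ_two] using h.mulVec_col 0
      · simpa [Fin.sum_univ_two] using h.mulVec_col 1
    have hm : ∀ k ∈ spectrum ℂ (diagonal ![a 0, a 1]), (a 2).re < k.re := by
      intro k hk
      rw [spectrum_diagonal] at hk
      obtain ⟨j, rfl⟩ := hk
      fin_cases j
      · exact h.gap 0 (by decide)
      · exact h.gap 1 (by decide)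
    have hΔ : crossProduct (fun i => T i 0) (fun i => T i 1) ⬝ᵥ (fun i => T i 2) ≠ 0 := by
      have h1 : T.det = crossProduct (fun i => T i 0) (fun i => T i 1) ⬝ᵥ (fun i => T i 2) := by
        simp [cross_apply, dotProduct, Fin.sum_univ_three, det_fin_three]
        ring
      rw [← h1]
      intro h0
      have h2 := congrArg det h.stable.inv
      rw [det_mul, h0, mul_zero, det_one] at h2
      exact zero_ne_one h2
    have hW : ∀ j x, HasDerivAt (![W₀, W₁] j) (P.evansMatrix c q t tx x z *ᵥ (![W₀, W₁] j x)) x := by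
      intro j
      fin_cases j
      · exact hW₀
      · exact hW₁
    have hWl : ∀ j, Tendsto (fun x : ℝ => ∑ i, NormedSpace.exp (-(x : ℂ) • diagonal ![a 0, a 1]) i j •
        ![W₀, W₁] i x) atBot (𝓝 (![fun i => T i 0, fun i => T i 1] j)) := by
      intro j
      have e : ∀ x : ℝ, NormedSpace.exp (-(x : ℂ) • diagonal ![a 0, a 1]) =
          diagonal fun i => Complex.exp (-(x : ℂ) * ![a 0, a 1] i) := fun x => by
        rw [← diagonal_smul, exp_diagonal]
        congr 1
        ext i
        rw [Pi.exp_def, Complex.exp_eq_exp_ℂ]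
        rfl
      simp only [e]
      fin_cases j
      · refine hW₀l.congr fun x => ?_
        simp [Fin.sum_univ_two, mul_comm]
      · refine hW₁l.congr fun x => ?_
        simp [Fin.sum_univ_two, mul_comm]
    refine ⟨_, _, _, _, _, w, hV, h.mulVec_col 2, hm, ?_, hW, hp.deriv_w, hWl, hp.lim_w, ?_⟩
    · rw [StVenant.det3_eq]
      exact hΔ
    · rw [hD, StVenant.det3_eq, StVenant.det3_eq]
      exact (h.value_eq hp hV (h.mulVec_col 2) hm hΔ hW hp.deriv_w hWl hp.lim_w).symm

end EvansValue

/-! ### Eigenvalues and eigenvectors of the limit matrix near z = 0 -/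

section Spectral

open Matrix

/-- A simple zero of a `C¹` function continues to a zero depending continuously on the parameter. -/
theorem exists_continuousAt_zero {χ : ℂ × ℂ → ℂ} {μ₀ d : ℂ} (hχ : ContDiffAt ℂ 1 χ (0, μ₀))
    (h0 : χ (0, μ₀) = 0) (hd : HasDerivAt (fun μ => χ (0, μ)) d μ₀) (hne : d ≠ 0) :
    ∃ a : ℂ → ℂ, a 0 = μ₀ ∧ ContinuousAt a 0 ∧ ∀ᶠ z in 𝓝 0, χ (z, a z) = 0 := by
  have hs := hχ.hasStrictFDerivAt one_ne_zero
  have h1 : fderiv ℂ χ (0, μ₀) (0, 1) = d := by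
    have := hs.hasFDerivAt.comp_hasDerivAt μ₀ ((hasDerivAt_const μ₀ (0 : ℂ)).prodMk (hasDerivAt_id μ₀))
    exact this.unique hd
  have hinv : (fderiv ℂ χ (0, μ₀) ∘L .inr ℂ ℂ ℂ).IsInvertible := by
    refine ⟨ContinuousLinearEquiv.unitsEquivAut ℂ (Units.mk0 d hne), ?_⟩
    ext
    simp [h1]
  set a := hs.implicitFunctionOfProdDomain hinv
  have ha0 : a 0 = μ₀ :=
    (hs.eventually_apply_eq_iff_implicitFunctionOfProdDomain hinv).self_of_nhds.mp rfl
  refine ⟨a, ha0, ?_, ?_⟩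
  · have := hs.tendsto_implicitFunctionOfProdDomain hinv
    rw [ContinuousAt, ha0]
    exact this
  · filter_upwards [hs.eventually_apply_implicitFunctionOfProdDomain hinv] with z hz
    rw [hz, h0]

theorem ContinuousAt.matrix_inv_of_det_ne_zero {T : ℂ → Matrix (Fin 3) (Fin 3) ℂ} {z : ℂ}
    (hT : ContinuousAt T z) (hdet : (T z).det ≠ 0) : ContinuousAt (fun z => (T z)⁻¹) z := by
  refine (continuousAt_matrix_inv (T z) ?_).comp hT
  rw [Ring.inverse_eq_inv']
  exact continuousAt_inv₀ hdet

variable (c ν y g h α : ℝ)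

/-- The limit matrix of the eigenvalue equations. -/
noncomputable def restMatrix (z : ℂ) : Matrix (Fin 3) (Fin 3) ℂ :=
  !![z / c, 0, -y / c; 0, 0, y; (g - α * z / c) / ν, (z + h) / ν, (-c * y + α * y / c) / ν]

/-- Its characteristic function, up to a factor. -/
noncomputable def restChar (v : ℂ × ℂ) : ℂ :=
  (v.1 - c * v.2) * (ν * v.2 ^ 2 / y - v.1 - h + (c - α / c) * v.2) - v.2 * (g - α * v.1 / c)

/-- Eigenvector normalized to have second entry 1: the second row of the matrix gives the third
entry, the third row the first, and the first row is then the characteristic equation. -/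
noncomputable def restVec (z μ : ℂ) : Fin 3 → ℂ :=
  ![(ν * μ ^ 2 / y - z - h + (c - α / c) * μ) / (g - α * z / c), 1, μ / y]

variable {c ν y g h α}

theorem restMatrix_mulVec (hc : c ≠ 0) (hν : ν ≠ 0) (hy : y ≠ 0) {z μ : ℂ}
    (hg : (g : ℂ) - α * z / c ≠ 0) (hχ : restChar c ν y g h α (z, μ) = 0) :
    restMatrix c ν y g h α z *ᵥ restVec c ν y g h α z μ = μ • restVec c ν y g h α z μ := by
  have hc' : (c : ℂ) ≠ 0 := Complex.ofReal_ne_zero.2 hc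
  have hν' : (ν : ℂ) ≠ 0 := Complex.ofReal_ne_zero.2 hν
  have hy' : (y : ℂ) ≠ 0 := Complex.ofReal_ne_zero.2 hy
  simp only [restChar] at hχ
  obtain ⟨ρ, hρ⟩ : ∃ ρ : ℂ, ρ = (ν * μ ^ 2 / y - z - h + (c - α / c) * μ) / (g - α * z / c) :=
    ⟨_, rfl⟩
  have e1 : ρ * (g - α * z / c) = ν * μ ^ 2 / y - z - h + (c - α / c) * μ := by
    rw [hρ, div_mul_cancel₀ _ hg]
  have e2 : (z - c * μ) * ρ = μ := by
    refine mul_right_cancel₀ hg ?_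
    rw [mul_assoc, e1]
    linear_combination hχ
  rw [restVec, ← hρ]
  ext i
  fin_cases i <;> simp [restMatrix, mulVec, dotProduct, Fin.sum_univ_three]
  · field_simp
    linear_combination e2
  · field_simp
  · field_simp at e1 ⊢
    linear_combination e1

/-- At z = 0 the eigenvalues are those of the planar saddle, together with 0, which comes from the
conserved quantity. -/
theorem restChar_zero {m₁ m₂ : ℝ} (hc : c ≠ 0) (hν : ν ≠ 0) (hy : y ≠ 0)
    (hprod : m₁ * m₂ = y / (c * ν) * (g - c * h)) (hsum : m₁ + m₂ = y / (c * ν) * (-c ^ 2 + α))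
    (μ : ℂ) : restChar c ν y g h α (0, μ) = -(c * ν / y) * (μ * (μ - m₁) * (μ - m₂)) := by
  have hc' : (c : ℂ) ≠ 0 := Complex.ofReal_ne_zero.2 hc
  have hν' : (ν : ℂ) ≠ 0 := Complex.ofReal_ne_zero.2 hν
  have hy' : (y : ℂ) ≠ 0 := Complex.ofReal_ne_zero.2 hy
  have p' : (m₁ : ℂ) * m₂ = y / (c * ν) * (g - c * h) := by exact_mod_cast congrArg Complex.ofReal hprod
  have s' : (m₁ : ℂ) + m₂ = y / (c * ν) * (-c ^ 2 + α) := by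
    exact_mod_cast congrArg Complex.ofReal hsum
  have : μ * (μ - m₁) * (μ - m₂) = μ * (μ ^ 2 - (m₁ + m₂) * μ + m₁ * m₂) := by ring
  rw [this, p', s', restChar]
  field_simp
  ring

-- The three zeros at z = 0 are simple and continue by the implicit function theorem. The two
-- recorded entries, of the extremal right and left eigenvectors, are the ones that later decide the
-- signs.
set_option maxHeartbeats 800000 in
theorem exists_spectral_data {m₁ m₂ : ℝ} (hc : c ≠ 0) (hν : ν ≠ 0) (hy : y ≠ 0) (hg : g ≠ 0)
    (hm₁ : m₁ < 0) (hm₂ : 0 < m₂) (hprod : m₁ * m₂ = y / (c * ν) * (g - c * h))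
    (hsum : m₁ + m₂ = y / (c * ν) * (-c ^ 2 + α)) :
    ∃ (T T' : ℂ → Matrix (Fin 3) (Fin 3) ℂ) (a : ℂ → Fin 3 → ℂ), ContinuousAt T 0 ∧
      ContinuousAt T' 0 ∧ ContinuousAt a 0 ∧ a 0 2 = m₁ ∧ T 0 1 2 = 1 ∧
      T' 0 2 2 = y / (m₁ - m₂) ∧
      ∀ᶠ z in 𝓝 0, T' z * T z = 1 ∧ restMatrix c ν y g h α z * T z = T z * diagonal (a z) ∧
        ∀ j, j ≠ 2 → (a z 2).re < (a z j).re := by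
  have hc' : (c : ℂ) ≠ 0 := Complex.ofReal_ne_zero.2 hc
  have hν' : (ν : ℂ) ≠ 0 := Complex.ofReal_ne_zero.2 hν
  have hy' : (y : ℂ) ≠ 0 := Complex.ofReal_ne_zero.2 hy
  have hg' : (g : ℂ) ≠ 0 := Complex.ofReal_ne_zero.2 hg
  have hm₁' : (m₁ : ℂ) ≠ 0 := Complex.ofReal_ne_zero.2 hm₁.ne
  have hm₂' : (m₂ : ℂ) ≠ 0 := Complex.ofReal_ne_zero.2 hm₂.ne'
  have hm : (m₁ : ℂ) - m₂ ≠ 0 := by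
    rw [sub_ne_zero]; exact_mod_cast (hm₁.trans hm₂).ne
  have hk : -((c : ℂ) * ν / y) ≠ 0 := neg_ne_zero.2 (div_ne_zero (mul_ne_zero hc' hν') hy')
  have hχ0 := restChar_zero hc hν hy hprod hsum
  have hsmooth : ∀ v, ContDiffAt ℂ 1 (restChar c ν y g h α) v := fun v => by
    unfold restChar
    fun_prop
  have hder : ∀ μ : ℂ, HasDerivAt (fun μ => restChar c ν y g h α (0, μ))
      (-(c * ν / y) * ((μ - m₁) * (μ - m₂) + μ * (μ - m₂) + μ * (μ - m₁))) μ := fun μ => by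
    simp only [hχ0]
    refine ((((hasDerivAt_id μ).mul ((hasDerivAt_id μ).sub_const (m₁ : ℂ))).mul
      ((hasDerivAt_id μ).sub_const (m₂ : ℂ))).const_mul (-((c : ℂ) * ν / y))).congr_deriv ?_
    simp only [id, Pi.mul_apply]
    ring
  obtain ⟨a₀, ha₀, ha₀c, ha₀χ⟩ := exists_continuousAt_zero (μ₀ := 0) (hsmooth _) (by rw [hχ0]; ring)
    (hder 0) (mul_ne_zero hk (by simpa using ⟨hm₁.ne, hm₂.ne'⟩))
  obtain ⟨a₁, ha₁, ha₁c, ha₁χ⟩ := exists_continuousAt_zero (μ₀ := m₂) (hsmooth _)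
    (by rw [hχ0]; ring) (hder m₂) (mul_ne_zero hk (by
      rw [sub_self, mul_zero, mul_zero, zero_add, zero_add]
      exact mul_ne_zero hm₂' (by rwa [← neg_sub, neg_ne_zero])))
  obtain ⟨a₂, ha₂, ha₂c, ha₂χ⟩ := exists_continuousAt_zero (μ₀ := m₁) (hsmooth _)
    (by rw [hχ0]; ring) (hder m₁) (mul_ne_zero hk (by
      rw [sub_self, mul_zero, zero_mul, zero_add, add_zero]
      exact mul_ne_zero hm₁' hm))
  -- The eigenvalue continuing m₁, the one of least real part, is given the index 2.
  set a : ℂ → Fin 3 → ℂ := fun z => ![a₀ z, a₁ z, a₂ z] with ha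
  have hac : ∀ j, ContinuousAt (fun z => a z j) 0 := by
    intro j
    fin_cases j
    exacts [ha₀c, ha₁c, ha₂c]
  set T : ℂ → Matrix (Fin 3) (Fin 3) ℂ := fun z => of fun i j => restVec c ν y g h α z (a z j) i
    with hT
  have hgc : ContinuousAt (fun z : ℂ => (g : ℂ) - α * z / c) 0 := by fun_prop
  have hTc : ContinuousAt T 0 := by
    refine continuousAt_pi.2 fun i => continuousAt_pi.2 fun j => ?_
    have h1 := hac j
    simp only [hT, of_apply, restVec]
    fin_cases i
    · refine ContinuousAt.div ?_ hgc (by simpa using hg')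
      fun_prop
    · exact continuousAt_const
    · exact h1.div_const _
  have hρ : ∀ m : ℝ, m ≠ 0 → restChar c ν y g h α (0, m) = 0 →
      ((ν : ℂ) * m ^ 2 / y - 0 - h + (c - α / c) * m) / (g - α * 0 / c) = -1 / c := by
    intro m hm0 hχ
    have hm0' : (m : ℂ) ≠ 0 := Complex.ofReal_ne_zero.2 hm0
    simp only [restChar] at hχ
    rw [mul_zero, zero_div, sub_zero, sub_zero, div_eq_div_iff hg' hc']
    refine mul_left_cancel₀ hm0' ?_
    rw [mul_zero, zero_div] at hχ
    linear_combination -hχ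
  have hT0 : T 0 = !![-(h : ℂ) / g, -1 / c, -1 / c; 1, 1, 1; 0, m₂ / y, m₁ / y] := by
    ext i j
    fin_cases i <;> fin_cases j <;> simp [hT, restVec, ha, ha₀, ha₁, ha₂]
    · simpa [neg_div] using hρ m₂ hm₂.ne' (by rw [hχ0]; ring)
    · simpa [neg_div] using hρ m₁ hm₁.ne (by rw [hχ0]; ring)
  have hdet : (T 0).det ≠ 0 := by
    have hgh : (g : ℂ) - c * h ≠ 0 := by
      intro h0
      have h1 : g - c * h = 0 := by exact_mod_cast h0
      rw [h1, mul_zero] at hprod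
      exact (mul_neg_of_neg_of_pos hm₁ hm₂).ne hprod
    have : (T 0).det = -((g - c * h) / (c * g)) * ((m₂ - m₁) / y) := by
      rw [hT0, det_fin_three]
      simp
      field_simp
      ring
    rw [this]
    exact mul_ne_zero (neg_ne_zero.2 (div_ne_zero hgh (mul_ne_zero hc' hg')))
      (div_ne_zero (by rwa [← neg_sub, neg_ne_zero]) hy')
  have hdc : ContinuousAt (fun z => (T z).det) 0 :=
    (continuous_id.matrix_det (A := fun M : Matrix (Fin 3) (Fin 3) ℂ => M)).continuousAt.comp hTc
  have hinv0 : (T 0)⁻¹ * T 0 = 1 := nonsing_inv_mul _ (isUnit_iff_ne_zero.2 hdet)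
  refine ⟨T, fun z => (T z)⁻¹, a, hTc, hTc.matrix_inv_of_det_ne_zero hdet, continuousAt_pi.2 hac, ?_,
    ?_, ?_, ?_⟩
  · simp [ha, ha₂]
  · rw [hT0]; simp
  · have r1 := congrFun (congrFun hinv0 2) 1
    have r2 := congrFun (congrFun hinv0 2) 2
    rw [mul_apply, Fin.sum_univ_three, hT0] at r1 r2
    simp only [of_apply, cons_val', cons_val_zero, cons_val_fin_one, cons_val_one, cons_val,
      one_apply_eq, ne_eq, Fin.reduceEq, not_false_eq_true, one_apply_ne] at r1 r2
    rw [← hT0] at r1 r2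
    field_simp at r1 r2 ⊢
    refine mul_left_cancel₀ hc' ?_
    linear_combination r2 - r1
  · have hre : ∀ j : Fin 3, j ≠ 2 → ∀ᶠ z in 𝓝 0, (a z 2).re < (a z j).re := by
      intro j hj
      refine ((Complex.continuous_re.continuousAt.comp (hac 2)).tendsto).eventually_lt
        ((Complex.continuous_re.continuousAt.comp (hac j)).tendsto) ?_
      fin_cases j
      · simpa [ha, ha₀, ha₂] using hm₁
      · simpa [ha, ha₁, ha₂] using hm₁.trans hm₂
      · exact absurd rfl hj
    have hg0 : (g : ℂ) - α * 0 / c ≠ 0 := by simpa using hg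
    filter_upwards [hdc.eventually_ne hdet, hgc.eventually_ne hg0, ha₀χ, ha₁χ, ha₂χ,
      eventually_all.2 fun j => eventually_imp_distrib_left.2 (hre j)] with z h1 h2 h3 h4 h5 h6
    refine ⟨nonsing_inv_mul _ (isUnit_iff_ne_zero.2 h1), ?_, h6⟩
    have hχz : ∀ j, restChar c ν y g h α (z, a z j) = 0 := by
      intro j
      fin_cases j
      exacts [h3, h4, h5]
    ext i j
    have := congrFun (restMatrix_mulVec hc hν hy h2 (hχz j)) i
    rw [mul_diagonal, mul_apply]
    simp only [mulVec, dotProduct, Pi.smul_apply, smul_eq_mul] at this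
    simp only [hT, of_apply]
    rw [this, mul_comm]

end Spectral

/-! ### Exponential convergence of coefficients along the orbit -/

section ExpBounds

/-- Differentiability at the limit point alone transfers the exponential rate from the state to a
function of it; continuity covers the remaining bounded interval. -/
theorem exists_exp_bound_comp {E : Type*} [NormedAddCommGroup E] [NormedSpace ℝ E] {G : E → ℝ}
    {X : ℝ → E} {X₀ : E} (hG : DifferentiableAt ℝ G X₀) (hc : Continuous fun x => G (X x))
    {C κ : ℝ} (hκ : 0 < κ) (hb : ∀ x, 0 ≤ x → ‖X x - X₀‖ ≤ C * Real.exp (-κ * x)) :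
    ∃ C', 0 ≤ C' ∧ ∀ x, 0 ≤ x → |G (X x) - G X₀| ≤ C' * Real.exp (-κ * x) := by
  have hexp : Tendsto (fun x => C * Real.exp (-κ * x)) atTop (𝓝 0) := by
    have h1 : Tendsto (fun x => -κ * x) atTop atBot :=
      tendsto_id.const_mul_atTop_of_neg (neg_lt_zero.2 hκ)
    simpa using (Real.tendsto_exp_atBot.comp h1).const_mul C
  have hX : Tendsto X atTop (𝓝 X₀) := by
    rw [tendsto_iff_norm_sub_tendsto_zero]
    refine squeeze_zero' (Eventually.of_forall fun x => norm_nonneg _) ?_ hexp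
    filter_upwards [eventually_ge_atTop 0] with x hx using hb x hx
  obtain ⟨c, hc0, hO⟩ := hG.isBigO_sub.exists_pos
  have h1 : ∀ᶠ x in atTop, ‖G (X x) - G X₀‖ ≤ c * C * Real.exp (-κ * x) := by
    filter_upwards [hX.eventually hO.bound, eventually_ge_atTop 0] with x hx hx0
    rw [mul_assoc]
    exact hx.trans (mul_le_mul_of_nonneg_left (hb x hx0) hc0.le)
  exact exists_exp_bound_of_eventually (hc.sub continuous_const) h1

theorem exists_uniform_exp_bound {f : Fin 3 → Fin 3 → ℝ → ℝ} {κ : ℝ}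
    (h : ∀ i j, ∃ C', 0 ≤ C' ∧ ∀ x, 0 ≤ x → |f i j x| ≤ C' * Real.exp (-κ * x)) :
    ∃ C, 0 ≤ C ∧ ∀ i j x, 0 ≤ x → |f i j x| ≤ C * Real.exp (-κ * x) := by
  choose C' hC0 hC using h
  refine ⟨∑ i, ∑ j, C' i j, Finset.sum_nonneg fun i _ => Finset.sum_nonneg fun j _ => hC0 i j,
    fun i j x hx => (hC i j x hx).trans (mul_le_mul_of_nonneg_right ?_ (Real.exp_pos _).le)⟩
  exact (Finset.single_le_sum (f := fun j => C' i j) (fun j _ => hC0 i j) (Finset.mem_univ j)).trans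
    (Finset.single_le_sum (f := fun i => ∑ j, C' i j)
      (fun i _ => Finset.sum_nonneg fun j _ => hC0 i j) (Finset.mem_univ i))

open MeasureTheory in
theorem tendsto_integral_of_exp_bound {f : ℝ → ℝ} (hf : Continuous f) {C κ : ℝ} (hκ : 0 < κ)
    (hb : ∀ x, 0 ≤ x → |f (-x)| ≤ C * Real.exp (-κ * x)) :
    Tendsto (fun x => ∫ s in (0 : ℝ)..x, f s) atBot (𝓝 (-∫ s in Ioi (0 : ℝ), f (-s))) := by
  have hi : IntegrableOn (fun s => f (-s)) (Ioi 0) :=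
    Integrable.mono' ((exp_neg_integrableOn_Ioi 0 hκ).const_mul C)
      (hf.comp continuous_neg).aestronglyMeasurable.restrict
      ((ae_restrict_iff' measurableSet_Ioi).2 (ae_of_all _ fun x hx => hb x (mem_Ioi.1 hx).le))
  have h1 := (intervalIntegral_tendsto_integral_Ioi 0 hi tendsto_id).neg.comp
    tendsto_neg_atBot_atTop
  refine h1.congr fun x => ?_
  simp only [Function.comp_apply, id, intervalIntegral.integral_comp_neg, neg_neg, neg_zero]
  rw [intervalIntegral.integral_symm, neg_neg]

theorem PlaneOrbit.exists_decay {H : ℝ → ℝ → ℝ → ℝ} {c₀ t₀ m₁ m₂ : ℝ} {t p px Hc Ht Hs : ℝ → ℝ}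
    {B δ₀ : ℝ} (h : PlaneOrbit H c₀ t₀ m₁ m₂ t p px Hc Ht Hs B δ₀) : ∃ C κ, 0 < κ ∧ 0 ≤ C ∧
      ∀ x, 0 ≤ x → ‖(t x, p x, px x) - (t₀, (0 : ℝ), (0 : ℝ))‖ ≤ C * Real.exp (-κ * x) := by
  obtain ⟨-, -, C, κ, -, hd, ht⟩ := h.asymptotics
  have hn := hd.norm_pos 0
  refine ⟨C + C * orbitNorm p px 0, κ, hd.κ_pos, by have := hd.C_pos; positivity, fun x hx => ?_⟩
  have h1 := hd.stable 0 x le_rfl hx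
  rw [sub_zero] at h1
  have h2 := Real.exp_pos (-κ * x)
  have hC := hd.C_pos
  have h3 : C * Real.exp (-κ * x) ≤ (C + C * orbitNorm p px 0) * Real.exp (-κ * x) := by
    gcongr; exact le_add_of_nonneg_right (by positivity)
  have h4 : C * orbitNorm p px 0 * Real.exp (-κ * x) ≤
      (C + C * orbitNorm p px 0) * Real.exp (-κ * x) := by
    gcongr; exact le_add_of_nonneg_left hC.le
  simp only [Prod.mk_sub_mk, sub_zero]
  exact norm_triple_le ((ht x hx).trans h3) ((hd.abs_p_le x).trans (h1.trans h4))
    ((hd.abs_px_le x).trans (h1.trans h4))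

end ExpBounds

/-! ### The coefficient matrix as an affine function of z -/

namespace StVenant

open Matrix

variable {P : StVenant} {c q t₀ m₁ m₂ B δ₀ : ℝ} {t p px : ℝ → ℝ}

/-- The part of the coefficient matrix independent of the spectral parameter. -/
noncomputable def evansReal (P : StVenant) (c q : ℝ) (v : ℝ × ℝ × ℝ) : Matrix (Fin 3) (Fin 3) ℝ :=
  !![0, 0, -v.1 ^ 2 / c;
     0, 0, v.1 ^ 2;
     (P.dragT c q v.1 - P.alphaDeriv c v.1 v.2.1 v.2.2) / P.nu, P.dragU c q v.1 / P.nu,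
      (-c * v.1 ^ 2 + (v.1 ^ 3)⁻¹ * (P.F⁻¹ + 2 * c * P.nu * v.2.1) * v.1 ^ 2 / c) / P.nu]

/-- The coefficient of the spectral parameter. -/
noncomputable def evansSlope (P : StVenant) (c : ℝ) (v : ℝ × ℝ × ℝ) : Matrix (Fin 3) (Fin 3) ℝ :=
  !![c⁻¹, 0, 0; 0, 0, 0; -((v.1 ^ 3)⁻¹ * (P.F⁻¹ + 2 * c * P.nu * v.2.1)) / (c * P.nu), P.nu⁻¹, 0]

theorem differentiableAt_evansReal {v : ℝ × ℝ × ℝ} (hv : 0 < v.1)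
    (hu : 0 < q - c * v.1) (i j : Fin 3) :
    DifferentiableAt ℝ (fun v => P.evansReal c q v i j) v := by
  have e1 : DifferentiableAt ℝ (fun v : ℝ × ℝ × ℝ => v.1) v := by fun_prop
  have e2 : DifferentiableAt ℝ (fun v : ℝ × ℝ × ℝ => q - c * v.1) v := by fun_prop
  have f1 : ∀ k : ℝ, DifferentiableAt ℝ (fun v : ℝ × ℝ × ℝ => v.1 ^ k) v := fun k =>
    e1.rpow_const (Or.inl hv.ne')
  have f2 : ∀ k : ℝ, DifferentiableAt ℝ (fun v : ℝ × ℝ × ℝ => (q - c * v.1) ^ k) v := fun k =>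
    e2.rpow_const (Or.inl hu.ne')
  have f3 : ∀ n : ℕ, DifferentiableAt ℝ (fun v : ℝ × ℝ × ℝ => (v.1 ^ n)⁻¹) v := fun n =>
    (e1.pow n).inv (pow_ne_zero n hv.ne')
  have g1 := f1 P.s
  have g2 := f1 (P.s + 1)
  have g3 := f2 P.r
  have g4 := f2 (P.r - 1)
  have g5 := f3 3
  have g6 := f3 4
  fin_cases i <;> fin_cases j <;> simp [evansReal, dragT, dragU, alphaDeriv] <;> fun_prop

theorem differentiableAt_evansSlope {v : ℝ × ℝ × ℝ} (hv : 0 < v.1) (i j : Fin 3) :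
    DifferentiableAt ℝ (fun v => P.evansSlope c v i j) v := by
  have e1 : DifferentiableAt ℝ (fun v : ℝ × ℝ × ℝ => v.1) v := by fun_prop
  have f3 : DifferentiableAt ℝ (fun v : ℝ × ℝ × ℝ => (v.1 ^ 3)⁻¹) v :=
    (e1.pow 3).inv (pow_ne_zero 3 hv.ne')
  fin_cases i <;> fin_cases j <;> simp [evansSlope] <;> fun_prop

theorem hasDerivAt_alpha {x : ℝ} (ht0 : 0 < t x) (ht : HasDerivAt t (p x) x)
    (hp : HasDerivAt p (px x) x) :
    HasDerivAt (P.alpha c t p) (P.alphaDeriv c (t x) (p x) (px x)) x := by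
  unfold alpha
  refine (((ht.pow 3).inv (pow_ne_zero 3 ht0.ne')).mul
    ((hp.const_mul (2 * c * P.nu)).const_add P.F⁻¹)).congr_deriv ?_
  simp only [alphaDeriv, Pi.pow_apply, Pi.inv_apply]
  field_simp
  ring

theorem evansMatrix_apply_eq (hnu : P.nu ≠ 0) (hc : c ≠ 0) {x : ℝ} {w : ℝ}
    (hα : deriv (P.alpha c t p) x = P.alphaDeriv c (t x) (p x) w) (z : ℂ) (i j : Fin 3) :
    P.evansMatrix c q t p x z i j = (P.evansReal c q (t x, p x, w) i j : ℂ) +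
      z * (P.evansSlope c (t x, p x, w) i j : ℂ) := by
  have hc' : (c : ℂ) ≠ 0 := Complex.ofReal_ne_zero.2 hc
  have hν' : (P.nu : ℂ) ≠ 0 := Complex.ofReal_ne_zero.2 hnu
  simp only [evansMatrix, hα]
  fin_cases i <;> fin_cases j <;>
    simp [evansReal, evansSlope, dragT, dragU, alpha] <;> field_simp <;> ring

theorem limitMatrix_apply_eq (hnu : P.nu ≠ 0) (hc : c ≠ 0) (z : ℂ) (i j : Fin 3) :
    P.limitMatrix c q t₀ z i j = (P.evansReal c q (t₀, 0, 0) i j : ℂ) +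
      z * (P.evansSlope c (t₀, 0, 0) i j : ℂ) := by
  refine evansMatrix_apply_eq hnu hc ?_ z i j
  have : P.alpha c (fun _ => t₀) (fun _ => 0) = fun _ => (t₀ ^ 3)⁻¹ * P.F⁻¹ := by
    ext; simp [alpha]
  rw [this]
  simp [alphaDeriv]

theorem limitMatrix_eq_restMatrix (z : ℂ) : P.limitMatrix c q t₀ z =
    restMatrix c P.nu (t₀ ^ 2) (P.dragT c q t₀) (P.dragU c q t₀) (P.F⁻¹ * (t₀ ^ 3)⁻¹) z := by
  have : P.alpha c (fun _ => t₀) (fun _ => 0) = fun _ => P.F⁻¹ * (t₀ ^ 3)⁻¹ := by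
    ext; simp [alpha, mul_comm]
  simp only [limitMatrix, evansMatrix, this, restMatrix, dragT, dragU]
  simp

end StVenant

open Matrix in
/-- A family of eigenvalue problems depending on the spectral parameter `z` near `0`. -/
structure EvansFamily (A : ℂ → ℝ → Matrix (Fin 3) (Fin 3) ℂ)
    (A₀ T T' : ℂ → Matrix (Fin 3) (Fin 3) ℂ) (a : ℂ → Fin 3 → ℂ) (C κ : ℝ) (Θ : ℝ → ℂ) (Θ₀ : ℂ)
    (B : ℝ → Matrix (Fin 3) (Fin 3) ℂ) (b : ℝ) : Prop where
  data : ∀ᶠ z in 𝓝 0, EvansData (A z) (A₀ z) (T z) (T' z) (a z) C κ Θ Θ₀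
  cont_T : ContinuousAt T 0
  cont_T' : ContinuousAt T' 0
  cont_a : ContinuousAt a 0
  affine : ∀ z x, A z x = A 0 x + z • B x
  cont_B : ∀ i j, Continuous fun x => B x i j
  bound_B : ∀ x i j, ‖B x i j‖ ≤ b
  bound : ∃ Λ, ∀ x i j, ‖A 0 x i j‖ ≤ Λ
  diff_stable : ∀ z x, 0 ≤ x → ∀ i j,
    ‖((A z x - A₀ z) - (A 0 x - A₀ 0)) i j‖ ≤ ‖z‖ * C * Real.exp (-κ * x)
  diff_unstable : ∀ z x, 0 ≤ x → ∀ i j,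
    ‖(((A z (-x))ᵀ - (A₀ z)ᵀ) - ((A 0 (-x))ᵀ - (A₀ 0)ᵀ)) i j‖ ≤ ‖z‖ * C * Real.exp (-κ * x)

namespace StVenant

open Matrix

variable {P : StVenant} {c q t₀ m₁ m₂ B δ₀ : ℝ} {t p px : ℝ → ℝ}

theorem exp_bound_mono {C C' κ κ' x : ℝ} (hC : C ≤ C') (hκ : κ' ≤ κ) (hC0 : 0 ≤ C') (hx : 0 ≤ x) :
    C * Real.exp (-κ * x) ≤ C' * Real.exp (-κ' * x) := by
  refine (mul_le_mul_of_nonneg_right hC (Real.exp_pos _).le).trans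
    (mul_le_mul_of_nonneg_left (Real.exp_le_exp.2 ?_) hC0)
  nlinarith

theorem exists_bound_of_exp_bounds {f : ℝ → ℝ} {f₀ C κ : ℝ} (hκ : 0 ≤ κ) (hC : 0 ≤ C)
    (h1 : ∀ x, 0 ≤ x → |f x - f₀| ≤ C * Real.exp (-κ * x))
    (h2 : ∀ x, 0 ≤ x → |f (-x) - f₀| ≤ C * Real.exp (-κ * x)) (x : ℝ) : |f x| ≤ |f₀| + C := by
  have h3 : |f x - f₀| ≤ C * Real.exp (-κ * |x|) := by
    rcases le_total 0 x with hx | hx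
    · rw [abs_of_nonneg hx]; exact h1 x hx
    · rw [abs_of_nonpos hx]; simpa using h2 (-x) (by linarith)
  have h4 : Real.exp (-κ * |x|) ≤ 1 := Real.exp_le_one_iff.2 (by nlinarith [abs_nonneg x])
  have h5 : C * Real.exp (-κ * |x|) ≤ C := by nlinarith
  calc |f x| = |f₀ + (f x - f₀)| := by rw [add_sub_cancel]
    _ ≤ |f₀| + |f x - f₀| := abs_add_le _ _
    _ ≤ _ := by linarith

namespace ProfileOrbit

/-- The coefficient of the spectral parameter, along the orbit. -/
noncomputable def slopeMatrix (P : StVenant) (c : ℝ) (t p px : ℝ → ℝ) (x : ℝ) :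
    Matrix (Fin 3) (Fin 3) ℂ :=
  of fun i j => (P.evansSlope c (t x, p x, px x) i j : ℂ)

theorem continuous_state (h : P.ProfileOrbit c q t₀ m₁ m₂ B δ₀ t p px) :
    Continuous fun x => (t x, p x, px x) :=
  (continuous_iff_continuousAt.2 fun x => (h.plane.deriv_t x).continuousAt).prodMk
    ((continuous_iff_continuousAt.2 fun x => (h.plane.deriv_p x).continuousAt).prodMk
      (continuous_iff_continuousAt.2 fun x => (h.plane.deriv_px x).continuousAt))

theorem continuous_evansReal (h : P.ProfileOrbit c q t₀ m₁ m₂ B δ₀ t p px) (i j : Fin 3) :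
    Continuous fun x => P.evansReal c q (t x, p x, px x) i j :=
  continuous_iff_continuousAt.2 fun x =>
    (differentiableAt_evansReal (v := (t x, p x, px x)) (h.t_pos x) (h.u_pos x)
      i j).continuousAt.comp (f := fun x => (t x, p x, px x)) h.continuous_state.continuousAt

theorem continuous_evansSlope (h : P.ProfileOrbit c q t₀ m₁ m₂ B δ₀ t p px) (i j : Fin 3) :
    Continuous fun x => P.evansSlope c (t x, p x, px x) i j :=
  continuous_iff_continuousAt.2 fun x =>
    (differentiableAt_evansSlope (v := (t x, p x, px x)) (h.t_pos x)
      i j).continuousAt.comp (f := fun x => (t x, p x, px x)) h.continuous_state.continuousAt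

theorem exists_entry_decay (h : P.ProfileOrbit c q t₀ m₁ m₂ B δ₀ t p px) :
    ∃ C κ, 0 < κ ∧ 0 ≤ C ∧ ∀ i j x, 0 ≤ x →
      |P.evansReal c q (t x, p x, px x) i j - P.evansReal c q (t₀, 0, 0) i j| ≤
        C * Real.exp (-κ * x) ∧
      |P.evansReal c q (t (-x), p (-x), px (-x)) i j - P.evansReal c q (t₀, 0, 0) i j| ≤
        C * Real.exp (-κ * x) ∧
      |P.evansSlope c (t x, p x, px x) i j - P.evansSlope c (t₀, 0, 0) i j| ≤
        C * Real.exp (-κ * x) ∧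
      |P.evansSlope c (t (-x), p (-x), px (-x)) i j - P.evansSlope c (t₀, 0, 0) i j| ≤
        C * Real.exp (-κ * x) := by
  obtain ⟨C₁, κ₁, hκ₁, hC₁, h₁⟩ := h.plane.exists_decay
  obtain ⟨C₂, κ₂, hκ₂, hC₂, h₂⟩ := h.plane.reflect.exists_decay
  have h₂' : ∀ x, 0 ≤ x → ‖(t (-x), p (-x), px (-x)) - (t₀, (0 : ℝ), (0 : ℝ))‖ ≤
      C₂ * Real.exp (-κ₂ * x) := fun x hx => by
    refine le_of_eq_of_le ?_ (h₂ x hx)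
    simp only [Prod.mk_sub_mk, sub_zero, Prod.norm_mk, norm_neg]
  set κ := min κ₁ κ₂
  have hκ : 0 < κ := lt_min hκ₁ hκ₂
  have hX₁ : ∀ x, 0 ≤ x → ‖(t x, p x, px x) - (t₀, (0 : ℝ), (0 : ℝ))‖ ≤
      max C₁ C₂ * Real.exp (-κ * x) := fun x hx =>
    (h₁ x hx).trans (exp_bound_mono (le_max_left _ _) (min_le_left _ _) (le_max_of_le_left hC₁) hx)
  have hX₂ : ∀ x, 0 ≤ x → ‖(t (-x), p (-x), px (-x)) - (t₀, (0 : ℝ), (0 : ℝ))‖ ≤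
      max C₁ C₂ * Real.exp (-κ * x) := fun x hx =>
    (h₂' x hx).trans (exp_bound_mono (le_max_right _ _) (min_le_right _ _) (le_max_of_le_left hC₁) hx)
  have hRc := h.continuous_evansReal
  have hSc := h.continuous_evansSlope
  have hR₀ := differentiableAt_evansReal (P := P) (v := (t₀, (0 : ℝ), (0 : ℝ))) h.t₀_pos h.u₀_pos
  have hS₀ := differentiableAt_evansSlope (P := P) (c := c) (v := (t₀, (0 : ℝ), (0 : ℝ))) h.t₀_pos
  obtain ⟨D₁, hD₁, hb₁⟩ := exists_uniform_exp_bound fun i j =>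
    exists_exp_bound_comp (hR₀ i j) (hRc i j) hκ hX₁
  obtain ⟨D₂, hD₂, hb₂⟩ := exists_uniform_exp_bound fun i j =>
    exists_exp_bound_comp (hR₀ i j) ((hRc i j).comp continuous_neg) hκ hX₂
  obtain ⟨D₃, hD₃, hb₃⟩ := exists_uniform_exp_bound fun i j =>
    exists_exp_bound_comp (hS₀ i j) (hSc i j) hκ hX₁
  obtain ⟨D₄, hD₄, hb₄⟩ := exists_uniform_exp_bound fun i j =>
    exists_exp_bound_comp (hS₀ i j) ((hSc i j).comp continuous_neg) hκ hX₂
  have hmono : ∀ D, D ≤ D₁ + D₂ + D₃ + D₄ → ∀ x : ℝ, D * Real.exp (-κ * x) ≤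
      (D₁ + D₂ + D₃ + D₄) * Real.exp (-κ * x) := fun D hD x =>
    mul_le_mul_of_nonneg_right hD (Real.exp_pos _).le
  exact ⟨D₁ + D₂ + D₃ + D₄, κ, hκ, by positivity, fun i j x hx =>
    ⟨(hb₁ i j x hx).trans (hmono _ (by linarith) x), (hb₂ i j x hx).trans (hmono _ (by linarith) x),
      (hb₃ i j x hx).trans (hmono _ (by linarith) x),
      (hb₄ i j x hx).trans (hmono _ (by linarith) x)⟩⟩

theorem evansMatrix_eq (h : P.ProfileOrbit c q t₀ m₁ m₂ B δ₀ t p px) (z : ℂ) (x : ℝ)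
    (i j : Fin 3) : P.evansMatrix c q t p x z i j = (P.evansReal c q (t x, p x, px x) i j : ℂ) +
      z * (P.evansSlope c (t x, p x, px x) i j : ℂ) :=
  evansMatrix_apply_eq h.nu_pos.ne' h.c_pos.ne' (hasDerivAt_alpha (h.t_pos x) (h.plane.deriv_t x)
    (h.plane.deriv_p x)).deriv z i j

set_option maxHeartbeats 1000000 in
theorem exists_evansFamily (h : P.ProfileOrbit c q t₀ m₁ m₂ B δ₀ t p px) :
    ∃ T T' a C κ Θ b, ∃ Θ₀ : ℝ, EvansFamily (fun z x => P.evansMatrix c q t p x z)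
      (P.limitMatrix c q t₀) T T' a C κ Θ Θ₀ (slopeMatrix P c t p px) b ∧
      a 0 2 = m₁ ∧ T 0 1 2 = 1 ∧ T' 0 2 2 = ((t₀ ^ 2 : ℝ) : ℂ) / (m₁ - m₂) := by
  have hA := h.evansMatrix_eq
  have hA₀ := limitMatrix_apply_eq (P := P) (q := q) (t₀ := t₀) h.nu_pos.ne' h.c_pos.ne'
  obtain ⟨T, T', a, hT, hT', ha, ha2, hT2, hT'2, hev⟩ := exists_spectral_data
    (α := P.F⁻¹ * (t₀ ^ 3)⁻¹) h.c_pos.ne' h.nu_pos.ne' (pow_pos h.t₀_pos 2).ne' h.dragT_pos.ne'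
    h.plane.neg h.plane.pos h.prod h.sum
  obtain ⟨C, κ, hκ, hC, hdec⟩ := h.exists_entry_decay
  set R : Fin 3 → Fin 3 → ℝ → ℝ := fun i j x => P.evansReal c q (t x, p x, px x) i j with hR
  set S : Fin 3 → Fin 3 → ℝ → ℝ := fun i j x => P.evansSlope c (t x, p x, px x) i j with hS
  have hRc : ∀ i j, Continuous (R i j) := h.continuous_evansReal
  have hSc : ∀ i j, Continuous (S i j) := h.continuous_evansSlope
  have hRb := fun i j => exists_bound_of_exp_bounds (f := R i j) hκ.le hC (fun x hx => (hdec i j x hx).1)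
    (fun x hx => (hdec i j x hx).2.1)
  have hSb := fun i j => exists_bound_of_exp_bounds (f := S i j) hκ.le hC
    (fun x hx => (hdec i j x hx).2.2.1) (fun x hx => (hdec i j x hx).2.2.2)
  have hmax : ∀ f : Fin 3 → Fin 3 → ℝ, ∃ M, ∀ i j, f i j ≤ M := fun f => by
    obtain ⟨M, hM⟩ := Finite.exists_le fun ij : Fin 3 × Fin 3 => f ij.1 ij.2
    exact ⟨M, fun i j => hM (i, j)⟩
  have hAc : ∀ z i j, Continuous fun x => P.evansMatrix c q t p x z i j := fun z i j => by
    simp only [hA]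
    exact (Complex.continuous_ofReal.comp (hRc i j)).add
      (continuous_const.mul (Complex.continuous_ofReal.comp (hSc i j)))
  have hnz : ∀ᶠ z : ℂ in 𝓝 0, ‖z‖ ≤ 1 := by
    filter_upwards [Metric.closedBall_mem_nhds (0 : ℂ) one_pos] with z hz
    simpa using hz
  -- The part free of z and z times its coefficient contribute C each once ‖z‖ ≤ 1, hence 2 * C.
  have hdec1 : ∀ z : ℂ, ‖z‖ ≤ 1 → ∀ x, 0 ≤ x → ∀ i j, ‖P.evansMatrix c q t p x z i j -
      P.limitMatrix c q t₀ z i j‖ ≤ 2 * C * Real.exp (-κ * x) ∧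
      ‖P.evansMatrix c q t p (-x) z i j - P.limitMatrix c q t₀ z i j‖ ≤
        2 * C * Real.exp (-κ * x) := by
    intro z hz x hx i j
    have key : ∀ r r₀ s s₀ : ℝ, |r - r₀| ≤ C * Real.exp (-κ * x) → |s - s₀| ≤ C * Real.exp (-κ * x) →
        ‖((r : ℂ) + z * s) - (r₀ + z * s₀)‖ ≤ 2 * C * Real.exp (-κ * x) := by
      intro r r₀ s s₀ h1 h2
      have e : ((r : ℂ) + z * s) - (r₀ + z * s₀) = ((r - r₀ : ℝ) : ℂ) + z * ((s - s₀ : ℝ) : ℂ) := by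
        push_cast; ring
      rw [e]
      refine (norm_add_le _ _).trans ?_
      rw [norm_mul, Complex.norm_real, Complex.norm_real, Real.norm_eq_abs, Real.norm_eq_abs]
      nlinarith [mul_le_mul_of_nonneg_right hz (abs_nonneg (s - s₀))]
    rw [hA, hA, hA₀]
    obtain ⟨d1, d2, d3, d4⟩ := hdec i j x hx
    exact ⟨key _ _ _ _ d1 d3, key _ _ _ _ d2 d4⟩
  have hdiff : ∀ z : ℂ, ∀ x, 0 ≤ x → ∀ i j, ‖(P.evansMatrix c q t p x z i j -
      P.limitMatrix c q t₀ z i j) - (P.evansMatrix c q t p x 0 i j - P.limitMatrix c q t₀ 0 i j)‖ ≤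
        ‖z‖ * (2 * C) * Real.exp (-κ * x) ∧
      ‖(P.evansMatrix c q t p (-x) z i j - P.limitMatrix c q t₀ z i j) -
        (P.evansMatrix c q t p (-x) 0 i j - P.limitMatrix c q t₀ 0 i j)‖ ≤
        ‖z‖ * (2 * C) * Real.exp (-κ * x) := by
    intro z x hx i j
    have key : ∀ r r₀ s s₀ : ℝ, |s - s₀| ≤ C * Real.exp (-κ * x) →
        ‖(((r : ℂ) + z * s) - (r₀ + z * s₀)) - (((r : ℂ) + 0 * s) - (r₀ + 0 * s₀))‖ ≤
          ‖z‖ * (2 * C) * Real.exp (-κ * x) := by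
      intro r r₀ s s₀ h2
      have e : (((r : ℂ) + z * s) - (r₀ + z * s₀)) - (((r : ℂ) + 0 * s) - (r₀ + 0 * s₀)) =
          z * ((s - s₀ : ℝ) : ℂ) := by
        push_cast; ring
      rw [e, norm_mul, Complex.norm_real, Real.norm_eq_abs, mul_assoc]
      have := Real.exp_pos (-κ * x)
      refine mul_le_mul_of_nonneg_left (h2.trans ?_) (norm_nonneg _)
      nlinarith [mul_nonneg hC this.le]
    simp only [hA, hA₀]
    obtain ⟨-, -, d3, d4⟩ := hdec i j x hx
    exact ⟨key _ _ _ _ d3, key _ _ _ _ d4⟩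
  set f : ℝ → ℝ := fun x => R 2 2 x - P.evansReal c q (t₀, 0, 0) 2 2 with hf
  have hfc : Continuous f := (hRc 2 2).sub continuous_const
  have hΘl := tendsto_integral_of_exp_bound hfc hκ fun x hx => (hdec 2 2 x hx).2.1
  set Θ₀ : ℝ := -∫ s in Ioi (0 : ℝ), f (-s)
  set Θ : ℝ → ℂ := fun x => ((∫ s in (0 : ℝ)..x, f s : ℝ) : ℂ) with hΘ
  -- The only z in the trace is z/c, which cancels against the limit. So a single real-valued Θ
  -- serves every z, and exp(-Θ₀) is a positive constant factor of the Evans function.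
  have htr : ∀ z x, (P.evansMatrix c q t p x z).trace - (P.limitMatrix c q t₀ z).trace = (f x : ℂ) := by
    intro z x
    simp only [trace, Fin.sum_univ_three, diag_apply, hA, hA₀, hf, hR]
    simp [evansReal, evansSlope]
  obtain ⟨b, hb⟩ := hmax fun i j => |P.evansSlope c (t₀, 0, 0) i j| + C
  obtain ⟨Λ, hΛ⟩ := hmax fun i j => |P.evansReal c q (t₀, 0, 0) i j| + C
  refine ⟨T, T', a, 2 * C, κ, Θ, b, Θ₀, ⟨?_, hT, hT', ha, ?_, ?_, ?_, ⟨Λ, ?_⟩, ?_, ?_⟩, ha2, hT2,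
    hT'2⟩
  · filter_upwards [hev, hnz] with z ⟨h1, h2, h3⟩ hz
    rw [← limitMatrix_eq_restMatrix] at h2
    have hmin : ∀ j, (a z 2).re ≤ (a z j).re := fun j => by
      rcases eq_or_ne j 2 with rfl | hj
      · exact le_rfl
      · exact (h3 j hj).le
    refine ⟨⟨hAc z, h1, h2, hmin, hκ, fun x hx i j => (hdec1 z hz x hx i j).1⟩,
      ⟨fun i j => (hAc z j i).comp continuous_neg, ?_, ?_, hmin, hκ,
        fun x hx i j => (hdec1 z hz x hx j i).2⟩, h3, ?_, ?_, ?_⟩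
    · rw [← transpose_mul, h1, transpose_one]
    · have hTT : T z * T' z = 1 := mul_eq_one_comm.1 h1
      have e : T' z * P.limitMatrix c q t₀ z = diagonal (a z) * T' z := by
        calc T' z * P.limitMatrix c q t₀ z = T' z * P.limitMatrix c q t₀ z * (T z * T' z) := by
              rw [hTT, mul_one]
          _ = T' z * (P.limitMatrix c q t₀ z * T z) * T' z := by simp only [mul_assoc]
          _ = _ := by rw [h2, ← mul_assoc, h1, one_mul]
      rw [← transpose_mul, e, transpose_mul, diagonal_transpose]
    · intro x
      rw [htr]
      exact ((hfc.integral_hasStrictDerivAt 0 x).hasDerivAt).ofReal_comp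
    · simp [hΘ]
    · exact (Complex.continuous_ofReal.tendsto Θ₀).comp hΘl
  · intro z x
    ext i j
    simp only [hA, Matrix.add_apply, Matrix.smul_apply, slopeMatrix, of_apply, smul_eq_mul]
    ring
  · exact fun i j => Complex.continuous_ofReal.comp (hSc i j)
  · intro x i j
    rw [slopeMatrix, of_apply, Complex.norm_real]
    exact (hSb i j x).trans (hb i j)
  · intro x i j
    rw [hA, zero_mul, add_zero, Complex.norm_real]
    exact (hRb i j x).trans (hΛ i j)
  · exact fun z x hx i j => (hdiff z x hx i j).1
  · exact fun z x hx i j => (hdiff z x hx j i).2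

end ProfileOrbit

end StVenant

/-! ### First-order expansion of pairings with unperturbed adjoint solutions -/

section Pairing

open Matrix MeasureTheory

theorem norm_dotProduct_le_card {ι : Type*} [Fintype ι] (u v : ι → ℂ) :
    ‖u ⬝ᵥ v‖ ≤ Fintype.card ι * (‖u‖ * ‖v‖) := by
  rw [dotProduct]
  refine (norm_sum_le _ _).trans ?_
  have : ∀ i ∈ Finset.univ, ‖u i * v i‖ ≤ ‖u‖ * ‖v‖ := fun i _ => by
    rw [norm_mul]
    exact mul_le_mul (norm_le_pi_norm u i) (norm_le_pi_norm v i) (norm_nonneg _) (norm_nonneg _)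
  refine (Finset.sum_le_card_nsmul _ _ _ this).trans_eq ?_
  rw [nsmul_eq_mul, Finset.card_univ]

theorem HasDerivAt.dotProduct' {ι : Type*} [Fintype ι] {u v : ℝ → ι → ℂ} {u' v' : ι → ℂ} {x : ℝ}
    (hu : HasDerivAt u u' x) (hv : HasDerivAt v v' x) :
    HasDerivAt (fun x => u x ⬝ᵥ v x) (u' ⬝ᵥ v x + u x ⬝ᵥ v') x := by
  simp only [dotProduct, ← Finset.sum_add_distrib]
  exact HasDerivAt.fun_sum fun i _ => (hasDerivAt_pi.1 hu i).mul (hasDerivAt_pi.1 hv i)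

theorem continuous_dotProduct' {ι α : Type*} [Fintype ι] [TopologicalSpace α] {u v : α → ι → ℂ}
    (hu : Continuous u) (hv : Continuous v) : Continuous fun x => u x ⬝ᵥ v x :=
  continuous_finsetSum _ fun i _ => ((continuous_apply i).comp hu).mul ((continuous_apply i).comp hv)

theorem tendsto_dotProduct' {ι α : Type*} [Fintype ι] {l : Filter α} {u v : α → ι → ℂ}
    {u₀ v₀ : ι → ℂ} (hu : Tendsto u l (𝓝 u₀)) (hv : Tendsto v l (𝓝 v₀)) :
    Tendsto (fun x => u x ⬝ᵥ v x) l (𝓝 (u₀ ⬝ᵥ v₀)) :=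
  tendsto_finsetSum _ fun i _ => (tendsto_pi_nhds.1 hu i).mul (tendsto_pi_nhds.1 hv i)

variable {ι : Type*} [Fintype ι] [DecidableEq ι]

/-- The pairing of the perturbed decaying solutions with a bounded adjoint solution of the
unperturbed system is of first order in the perturbation. -/
theorem tendsto_pairing {A : ℂ → ℝ → Matrix ι ι ℂ} {A₀ T T' : ℂ → Matrix ι ι ℂ} {a : ℂ → ι → ℂ}
    {k : ι} {C κ b : ℝ} (h : ∀ᶠ z in 𝓝 0, DiagLimit (A z) (A₀ z) (T z) (T' z) (a z) k C κ)
    (hT : ContinuousAt T 0) (hT' : ContinuousAt T' 0) (ha : ContinuousAt a 0)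
    (hdiff : ∀ z x, 0 ≤ x → ∀ i j,
      ‖((A z x - A₀ z) - (A 0 x - A₀ 0)) i j‖ ≤ ‖z‖ * C * Real.exp (-κ * x))
    {B : ℝ → Matrix ι ι ℂ} (hAB : ∀ z x, A z x = A 0 x + z • B x)
    (hBc : ∀ i j, Continuous fun x => B x i j) (hBb : ∀ x i j, ‖B x i j‖ ≤ b)
    {w : ℂ → ℝ → ι → ℂ} (hw : ∀ᶠ z in 𝓝 0, ∀ x, HasDerivAt (w z) (A z x *ᵥ w z x) x)
    (hv : ∀ᶠ z in 𝓝 0, Tendsto (fun x : ℝ => Complex.exp (-a z k * x) • w z x) atTop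
      (𝓝 fun i => T z i k)) (hneg : (a 0 k).re < 0) {ψ : ℝ → ι → ℂ}
    (hψ : ∀ x, HasDerivAt ψ (-((A 0 x)ᵀ *ᵥ ψ x)) x) {M : ℝ} (hM : ∀ x, 0 ≤ x → ‖ψ x‖ ≤ M) :
    (∀ᶠ z in 𝓝 0, ψ 0 ⬝ᵥ w z 0 = z * -∫ x in Ioi (0 : ℝ), ψ x ⬝ᵥ (B x *ᵥ w z x)) ∧
    Tendsto (fun z => -∫ x in Ioi (0 : ℝ), ψ x ⬝ᵥ (B x *ᵥ w z x)) (𝓝 0)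
      (𝓝 (-∫ x in Ioi (0 : ℝ), ψ x ⬝ᵥ (B x *ᵥ w 0 x))) := by
  obtain ⟨K, hK, hwK⟩ := exists_norm_le_exp h hT hT' hw hv
  have hb : 0 ≤ b := (norm_nonneg _).trans (hBb 0 k k)
  have hM0 : 0 ≤ M := (norm_nonneg _).trans (hM 0 le_rfl)
  -- Half of the decay rate at z = 0 remains a valid rate for all z near 0; this gives the
  -- dominating function.
  set ρ := -(a 0 k).re / 2 with hρ
  have hρ0 : 0 < ρ := by rw [hρ]; linarith
  have hre : ∀ᶠ z in 𝓝 0, (a z k).re ≤ -ρ := by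
    have h1 : ContinuousAt (fun z => (a z k).re) 0 :=
      Complex.continuous_re.continuousAt.comp (continuousAt_pi.1 ha k)
    exact (h1.eventually_lt continuousAt_const (by rw [hρ]; linarith)).mono fun _ h => h.le
  have hwρ : ∀ᶠ z in 𝓝 0, ∀ x, 0 ≤ x → ‖w z x‖ ≤ K * Real.exp (-ρ * x) := by
    filter_upwards [hwK, hre] with z h1 h2 x hx
    refine (h1 x hx).trans (mul_le_mul_of_nonneg_left (Real.exp_le_exp.2 ?_) hK)
    exact mul_le_mul_of_nonneg_right h2 hx
  set L : ℝ := Fintype.card ι * (M * (Fintype.card ι * b * K)) with hL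
  have hbd : ∀ᶠ z in 𝓝 0, ∀ x, 0 ≤ x → ‖ψ x ⬝ᵥ (B x *ᵥ w z x)‖ ≤ L * Real.exp (-ρ * x) := by
    filter_upwards [hwρ] with z h1 x hx
    refine (norm_dotProduct_le_card _ _).trans ?_
    rw [hL, mul_assoc, mul_assoc]
    refine mul_le_mul_of_nonneg_left (mul_le_mul (hM x hx) ?_ (norm_nonneg _) hM0) (by positivity)
    refine (norm_mulVec_le_of_entry_le hb (hBb x) _).trans ?_
    rw [mul_assoc _ K]
    exact mul_le_mul_of_nonneg_left (h1 x hx) (by positivity)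
  have hexp : IntegrableOn (fun x => L * Real.exp (-ρ * x)) (Ioi 0) :=
    (exp_neg_integrableOn_Ioi 0 hρ0).const_mul L
  have hψc : Continuous ψ := continuous_of_hasDerivAt hψ
  have hmeas : ∀ᶠ z in 𝓝 0, Continuous fun x => ψ x ⬝ᵥ (B x *ᵥ w z x) := by
    filter_upwards [hw] with z h1
    exact continuous_dotProduct' hψc (continuous_mulVec hBc (continuous_of_hasDerivAt h1))
  have hae : ∀ {f : ℝ → ℂ}, (∀ x, 0 ≤ x → ‖f x‖ ≤ L * Real.exp (-ρ * x)) →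
      ∀ᵐ x ∂(volume.restrict (Ioi (0 : ℝ))), ‖f x‖ ≤ L * Real.exp (-ρ * x) := fun hf =>
    (ae_restrict_iff' measurableSet_Ioi).2 (ae_of_all _ fun x hx => hf x (mem_Ioi.1 hx).le)
  refine ⟨?_, Tendsto.neg ?_⟩
  · filter_upwards [hw, hbd, hmeas, hwρ] with z h1 h2 h3 h4
    -- Since ψ solves the adjoint equation at z = 0, only the perturbation z B survives in the
    -- derivative; integrating from 0 to infinity exhibits the factor z.
    have hd : ∀ x ∈ Ici (0 : ℝ), HasDerivAt (fun x => ψ x ⬝ᵥ w z x)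
        (z * ψ x ⬝ᵥ (B x *ᵥ w z x)) x := by
      intro x _
      refine ((hψ x).dotProduct' (h1 x)).congr_deriv ?_
      rw [hAB z x, add_mulVec, dotProduct_add, smul_mulVec, dotProduct_smul, smul_eq_mul,
        neg_dotProduct, mulVec_transpose, ← dotProduct_mulVec]
      ring
    have hint : IntegrableOn (fun x => ψ x ⬝ᵥ (B x *ᵥ w z x)) (Ioi 0) :=
      Integrable.mono' hexp h3.aestronglyMeasurable.restrict (hae h2)
    have hlim : Tendsto (fun x => ψ x ⬝ᵥ w z x) atTop (𝓝 0) := by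
      have hlin : Tendsto (fun x => Fintype.card ι * (M * (K * Real.exp (-ρ * x)))) atTop (𝓝 0) := by
        have h5 : Tendsto (fun x => -ρ * x) atTop atBot :=
          tendsto_id.const_mul_atTop_of_neg (neg_lt_zero.2 hρ0)
        simpa using (((Real.tendsto_exp_atBot.comp h5).const_mul K).const_mul M).const_mul
          (Fintype.card ι : ℝ)
      refine squeeze_zero_norm' ?_ hlin
      filter_upwards [eventually_ge_atTop 0] with x hx
      refine (norm_dotProduct_le_card _ _).trans (mul_le_mul_of_nonneg_left ?_ (by positivity))
      exact mul_le_mul (hM x hx) (h4 x hx) (norm_nonneg _) hM0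
    have := integral_Ioi_of_hasDerivAt_of_tendsto' hd (hint.const_mul z) hlim
    rw [integral_const_mul, zero_sub] at this
    rw [mul_neg, this, neg_neg]
  · refine tendsto_integral_filter_of_dominated_convergence _ ?_ (hbd.mono fun z hz => hae hz) hexp ?_
    · exact hmeas.mono fun z hz => hz.aestronglyMeasurable.restrict
    · refine (ae_restrict_iff' measurableSet_Ioi).2 (ae_of_all _ fun x hx => ?_)
      have := tendsto_extremal h hT hT' ha (Eventually.of_forall hdiff) hw hv (mem_Ioi.1 hx).le
      exact tendsto_dotProduct' tendsto_const_nhds (tendsto_mulVec tendsto_const_nhds this)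

end Pairing

/-! ### Derivative of the pairing of the two extremal solutions -/

section Derivative

open Matrix MeasureTheory

variable {A : ℂ → ℝ → Matrix (Fin 3) (Fin 3) ℂ} {A₀ T T' : ℂ → Matrix (Fin 3) (Fin 3) ℂ}
  {a : ℂ → Fin 3 → ℂ} {C κ b : ℝ} {Θ : ℝ → ℂ} {Θ₀ : ℂ} {B : ℝ → Matrix (Fin 3) (Fin 3) ℂ}
  {w η : ℂ → ℝ → Fin 3 → ℂ}

theorem EvansFamily.exists_bound (h : EvansFamily A A₀ T T' a C κ Θ Θ₀ B b) (z : ℂ) :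
    ∃ Λ, ∀ x i j, ‖A z x i j‖ ≤ Λ := by
  obtain ⟨Λ, hΛ⟩ := h.bound
  refine ⟨Λ + ‖z‖ * b, fun x i j => ?_⟩
  rw [h.affine z x, Matrix.add_apply, Matrix.smul_apply, smul_eq_mul]
  refine (norm_add_le _ _).trans (add_le_add (hΛ x i j) ?_)
  rw [norm_mul]
  exact mul_le_mul_of_nonneg_left (h.bound_B x i j) (norm_nonneg _)

theorem EvansFamily.exists_pairs (h : EvansFamily A A₀ T T' a C κ Θ Θ₀ B b) :
    ∃ w η : ℂ → ℝ → Fin 3 → ℂ, ∀ᶠ z in 𝓝 0, EvansPair (A z) (T z) (T' z) (a z) (w z) (η z) := by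
  have : ∀ z, ∃ w η, EvansData (A z) (A₀ z) (T z) (T' z) (a z) C κ Θ Θ₀ →
      EvansPair (A z) (T z) (T' z) (a z) w η := fun z => by
    by_cases hz : EvansData (A z) (A₀ z) (T z) (T' z) (a z) C κ Θ Θ₀
    · obtain ⟨Λ, hΛ⟩ := h.exists_bound z
      obtain ⟨w, η, hp⟩ := hz.exists_pair hΛ
      exact ⟨w, η, fun _ => hp⟩
    · exact ⟨0, 0, fun hh => absurd hh hz⟩
  choose w η hwη using this
  exact ⟨w, η, h.data.mono fun z hz => hwη z hz⟩

/-- First-order expansion of the pairing of the extremal solutions. -/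
theorem EvansFamily.hasDerivAt_pairing (h : EvansFamily A A₀ T T' a C κ Θ Θ₀ B b)
    (hp : ∀ᶠ z in 𝓝 0, EvansPair (A z) (T z) (T' z) (a z) (w z) (η z)) (hneg : (a 0 2).re < 0)
    {Φ ψ₁ ψ₂ : ℝ → Fin 3 → ℂ} (hΦ : ∀ x, HasDerivAt Φ (A 0 x *ᵥ Φ x) x)
    (hψ₁ : ∀ x, HasDerivAt ψ₁ (-((A 0 x)ᵀ *ᵥ ψ₁ x)) x)
    (hψ₂ : ∀ x, HasDerivAt ψ₂ (-((A 0 x)ᵀ *ᵥ ψ₂ x)) x) {M : ℝ}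
    (hΦM : ∀ x, 0 ≤ x → ‖Φ (-x)‖ ≤ M) (hψ₁M : ∀ x, 0 ≤ x → ‖ψ₁ x‖ ≤ M)
    (hψ₂M : ∀ x, 0 ≤ x → ‖ψ₂ x‖ ≤ M) {k β : ℂ} (hw₀ : ∀ x, 0 ≤ x → w 0 x = k • Φ x)
    (hη₀ : ∀ x, 0 ≤ x → η 0 x = β • ψ₁ (-x)) {N : (Fin 3 → ℂ) →ₗ[ℂ] ℂ} {n₁ n₂ : Fin 3 → ℂ}
    (hN : ∀ W, W = N W • Φ 0 + (ψ₁ 0 ⬝ᵥ W) • n₁ + (ψ₂ 0 ⬝ᵥ W) • n₂) (hNΦ : N (Φ 0) = 1)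
    (hn₁ : ψ₁ 0 ⬝ᵥ n₁ = 1) (hn₂ : ψ₁ 0 ⬝ᵥ n₂ = 0) :
    HasDerivAt (fun z => η z 0 ⬝ᵥ w z 0) (-(k * β) *
      ((∫ x in Ioi (0 : ℝ), ψ₁ x ⬝ᵥ (B x *ᵥ Φ x)) +
        ∫ x in Ioi (0 : ℝ), ψ₁ (-x) ⬝ᵥ (B (-x) *ᵥ Φ (-x)))) 0 := by
  have hs := h.data.mono fun z hz => hz.stable
  have hu := h.data.mono fun z hz => hz.unstable
  have hwd := hp.mono fun z hz => hz.deriv_w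
  have hwl := hp.mono fun z hz => hz.lim_w
  have hηd := hp.mono fun z hz => hz.deriv_η
  have hηl := hp.mono fun z hz => hz.lim_η
  have hcT : ContinuousAt (fun z => (T z)ᵀ) 0 :=
    (continuous_id.matrix_transpose (A := fun M : Matrix (Fin 3) (Fin 3) ℂ => M)).continuousAt.comp
      h.cont_T
  have hcT' : ContinuousAt (fun z => (T' z)ᵀ) 0 :=
    (continuous_id.matrix_transpose (A := fun M : Matrix (Fin 3) (Fin 3) ℂ => M)).continuousAt.comp
      h.cont_T'
  obtain ⟨e₁, l₁⟩ := tendsto_pairing hs h.cont_T h.cont_T' h.cont_a h.diff_stable h.affine h.cont_B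
    h.bound_B hwd hwl hneg hψ₁ hψ₁M
  obtain ⟨e₂, l₂⟩ := tendsto_pairing hs h.cont_T h.cont_T' h.cont_a h.diff_stable h.affine h.cont_B
    h.bound_B hwd hwl hneg hψ₂ hψ₂M
  obtain ⟨e₃, l₃⟩ := tendsto_pairing (B := fun x => (B (-x))ᵀ) (ψ := fun x => Φ (-x)) hu hcT' hcT
    h.cont_a h.diff_unstable
    (fun z x => by rw [h.affine z, transpose_add, transpose_smul])
    (fun i j => (h.cont_B j i).comp continuous_neg) (fun x i j => h.bound_B (-x) j i) hηd hηl hneg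
    (fun x => by
      rw [transpose_transpose]
      have := (hΦ (-x)).scomp x (hasDerivAt_neg x)
      exact HasDerivAt.congr_deriv (f := fun x => Φ (-x)) this (by simp)) hΦM
  have hw0 := tendsto_extremal hs h.cont_T h.cont_T' h.cont_a (Eventually.of_forall h.diff_stable)
    hwd hwl le_rfl
  have hη0 := tendsto_extremal hu hcT' hcT h.cont_a (Eventually.of_forall h.diff_unstable)
    hηd hηl le_rfl
  have hNc : Continuous N := N.continuous_of_finiteDimensional
  set I₁ : ℂ → ℂ := fun z => -∫ x in Ioi (0 : ℝ), ψ₁ x ⬝ᵥ (B x *ᵥ w z x) with hI₁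
  set I₂ : ℂ → ℂ := fun z => -∫ x in Ioi (0 : ℝ), ψ₂ x ⬝ᵥ (B x *ᵥ w z x)
  set I₃ : ℂ → ℂ := fun z => -∫ x in Ioi (0 : ℝ), Φ (-x) ⬝ᵥ ((B (-x))ᵀ *ᵥ η z x) with hI₃
  -- Expand w z 0 by the resolution of the identity `hN`. The terms contain η against Φ, and ψ₁ and
  -- ψ₂ against w; each pairing carries a factor z, and G is what remains.
  set G : ℂ → ℂ := fun z => N (w z 0) * I₃ z + I₁ z * (η z 0 ⬝ᵥ n₁) + I₂ z * (η z 0 ⬝ᵥ n₂) with hG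
  have hGl : Tendsto G (𝓝 0) (𝓝 (G 0)) :=
    ((((hNc.tendsto _).comp hw0).mul l₃).add (l₁.mul (tendsto_dotProduct' hη0 tendsto_const_nhds))).add
      (l₂.mul (tendsto_dotProduct' hη0 tendsto_const_nhds))
  have hzG : ∀ᶠ z in 𝓝 0, η z 0 ⬝ᵥ w z 0 = z * G z := by
    filter_upwards [e₁, e₂, e₃] with z h1 h2 h3
    conv_lhs => rw [hN (w z 0)]
    rw [dotProduct_add, dotProduct_add, dotProduct_smul, dotProduct_smul, dotProduct_smul, h1, h2,
      dotProduct_comm _ (Φ 0)]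
    rw [neg_zero] at h3
    rw [h3]
    simp only [hG, smul_eq_mul]
    ring
  -- At z = 0, η is a multiple of ψ₁, which annihilates n₂, so the term with ψ₂ drops out; the other
  -- two are the halves of one integral over the line.
  have hG0 : G 0 = -(k * β) * ((∫ x in Ioi (0 : ℝ), ψ₁ x ⬝ᵥ (B x *ᵥ Φ x)) +
        ∫ x in Ioi (0 : ℝ), ψ₁ (-x) ⬝ᵥ (B (-x) *ᵥ Φ (-x))) := by
    have g1 : I₁ 0 = -(k * ∫ x in Ioi (0 : ℝ), ψ₁ x ⬝ᵥ (B x *ᵥ Φ x)) := by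
      simp only [hI₁]
      rw [← integral_const_mul, setIntegral_congr_fun measurableSet_Ioi]
      intro x hx
      simp only
      rw [hw₀ x (mem_Ioi.1 hx).le, mulVec_smul, dotProduct_smul, smul_eq_mul]
    have g3 : I₃ 0 = -(β * ∫ x in Ioi (0 : ℝ), ψ₁ (-x) ⬝ᵥ (B (-x) *ᵥ Φ (-x))) := by
      simp only [hI₃]
      rw [← integral_const_mul, setIntegral_congr_fun measurableSet_Ioi]
      intro x hx
      simp only
      rw [hη₀ x (mem_Ioi.1 hx).le, mulVec_smul, dotProduct_smul, smul_eq_mul, mulVec_transpose,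
        dotProduct_comm, ← dotProduct_mulVec]
    simp only [hG]
    rw [g1, g3, hw₀ 0 le_rfl, hη₀ 0 le_rfl, neg_zero, map_smul, hNΦ, smul_dotProduct,
      smul_dotProduct, hn₁, hn₂]
    simp only [smul_eq_mul]
    ring
  rw [← hG0]
  -- Continuity of G at 0 suffices: the difference quotient of z G(z) at 0 is G itself.
  have hd : HasDerivAt (fun z => z * G z) (G 0) 0 := by
    rw [hasDerivAt_iff_tendsto_slope]
    refine (hGl.mono_left nhdsWithin_le_nhds).congr' ?_
    filter_upwards [self_mem_nhdsWithin] with z hz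
    rw [slope_def_field]
    have hz0 : z ≠ 0 := hz
    field_simp
    ring
  exact hd.congr_of_eventuallyEq hzG

end Derivative

/-! ### Bounded solutions at z = 0 of the eigenvalue equations and of their adjoint -/

namespace StVenant

open Matrix MeasureTheory

variable {P : StVenant} {c q t₀ m₁ m₂ B δ₀ : ℝ} {t p px : ℝ → ℝ}

namespace ProfileOrbit

/-- Density of the second component of the bounded solution of the adjoint equation. -/
noncomputable def dragDensity (P : StVenant) (c q : ℝ) (t p : ℝ → ℝ) (x : ℝ) : ℝ :=
  orbitWeight (P.velCoeff c t p) x * p x * (P.dragU c q (t x) * t x ^ 2 / (c * P.nu))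

/-- The primitive of `dragDensity` that vanishes at `-∞`. -/
noncomputable def dragPrimitive (P : StVenant) (c q : ℝ) (t p : ℝ → ℝ) (x : ℝ) : ℝ :=
  (∫ s in Ioi (0 : ℝ), dragDensity P c q t p (-s)) + ∫ s in (0 : ℝ)..x, dragDensity P c q t p s

/-- The derivative of the profile, as a solution of the eigenvalue equations at `0`. -/
noncomputable def tangent (c : ℝ) (t p px : ℝ → ℝ) (x : ℝ) : Fin 3 → ℝ :=
  ![p x, -c * p x, -c * px x / t x ^ 2]

/-- The bounded solution of the adjoint eigenvalue equations at `0` that vanishes at `-∞`. -/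
noncomputable def cotangent (P : StVenant) (c q : ℝ) (t p px : ℝ → ℝ) (x : ℝ) : Fin 3 → ℝ :=
  ![-(orbitWeight (P.velCoeff c t p) x * px x) + c * dragPrimitive P c q t p x,
    dragPrimitive P c q t p x, -(orbitWeight (P.velCoeff c t p) x * p x * t x ^ 2 / c)]

/-- Translation invariance: differentiating the profile, with u' = -c τ', solves the eigenvalue
equations at z = 0. -/
theorem hasDerivAt_tangent (h : P.ProfileOrbit c q t₀ m₁ m₂ B δ₀ t p px) (x : ℝ) (i : Fin 3) :
    HasDerivAt (fun x => tangent c t p px x i)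
      ((P.evansReal c q (t x, p x, px x) *ᵥ tangent c t p px x) i) x := by
  have ht := h.t_pos x
  have hν := h.nu_pos
  have hc := h.c_pos
  fin_cases i
  · refine (h.plane.deriv_p x).congr_deriv ?_
    simp [tangent, evansReal, mulVec, dotProduct, Fin.sum_univ_three]
    field_simp
  · refine ((h.plane.deriv_p x).const_mul (-c)).congr_deriv ?_
    simp [tangent, evansReal, mulVec, dotProduct, Fin.sum_univ_three]
    field_simp
  · refine (((h.plane.deriv_px x).const_mul (-c)).div ((h.plane.deriv_t x).pow 2)
      (pow_pos ht 2).ne').congr_deriv ?_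
    simp [tangent, evansReal, mulVec, dotProduct, Fin.sum_univ_three, stateCoeff, velCoeff]
    field_simp
    ring

theorem continuous_dragDensity (h : P.ProfileOrbit c q t₀ m₁ m₂ B δ₀ t p px) :
    Continuous (dragDensity P c q t p) := by
  have ht : Continuous t := continuous_iff_continuousAt.2 fun x => (h.plane.deriv_t x).continuousAt
  have hp : Continuous p := continuous_iff_continuousAt.2 fun x => (h.plane.deriv_p x).continuousAt
  have he : Continuous (orbitWeight (P.velCoeff c t p)) := continuous_iff_continuousAt.2 fun x =>
    (hasDerivAt_orbitWeight h.plane.cont_Hs x).continuousAt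
  have h1 : Continuous fun x => P.dragU c q (t x) := by
    have := (h.continuous_evansReal 2 1).mul (continuous_const (y := P.nu))
    refine this.congr fun x => ?_
    have hν := h.nu_pos
    simp [evansReal]
    field_simp
  exact (he.mul hp).mul ((h1.mul (ht.pow 2)).div_const _)

theorem hasDerivAt_dragPrimitive (h : P.ProfileOrbit c q t₀ m₁ m₂ B δ₀ t p px) (x : ℝ) :
    HasDerivAt (dragPrimitive P c q t p) (dragDensity P c q t p x) x :=
  (intervalIntegral.integral_hasDerivAt_right (h.continuous_dragDensity.intervalIntegrable _ _)
    (h.continuous_dragDensity.stronglyMeasurableAtFilter _ _)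
    h.continuous_dragDensity.continuousAt).const_add _

/-- The planar adjoint solution is weight × (-px, p). Its lift to three components is completed by a
variable multiple of the conserved covector (c, 1, 0), whose coefficient is the primitive of the
drag term. -/
theorem hasDerivAt_cotangent (h : P.ProfileOrbit c q t₀ m₁ m₂ B δ₀ t p px) (x : ℝ) (i : Fin 3) :
    HasDerivAt (fun x => cotangent P c q t p px x i)
      (-((P.evansReal c q (t x, p x, px x))ᵀ *ᵥ cotangent P c q t p px x) i) x := by
  have ht := h.t_pos x
  have hν := h.nu_pos
  have hc := h.c_pos
  have hK := h.hasDerivAt_dragPrimitive x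
  have he := hasDerivAt_orbitWeight h.plane.cont_Hs x
  fin_cases i
  · refine ((he.mul (h.plane.deriv_px x)).neg.add (hK.const_mul c)).congr_deriv ?_
    simp [cotangent, evansReal, mulVec, dotProduct, Fin.sum_univ_three, stateCoeff, velCoeff,
      dragDensity]
    field_simp
    ring
  · refine hK.congr_deriv ?_
    simp [cotangent, evansReal, mulVec, dotProduct, Fin.sum_univ_three, dragDensity]
    field_simp
  · refine (((he.mul (h.plane.deriv_p x)).mul ((h.plane.deriv_t x).pow 2)).div_const
      c).neg.congr_deriv ?_
    simp [cotangent, evansReal, mulVec, dotProduct, Fin.sum_univ_three, velCoeff]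
    field_simp
    ring

/-- Exponential decay of the orbit and of the weighted orbit at both ends. -/
theorem exists_orbit_decay (h : P.ProfileOrbit c q t₀ m₁ m₂ B δ₀ t p px) :
    ∃ C κ, 0 < κ ∧ 0 ≤ C ∧ ∀ x, |p x| ≤ C * Real.exp (-κ * |x|) ∧
      |px x| ≤ C * Real.exp (-κ * |x|) ∧
      |orbitWeight (P.velCoeff c t p) x * p x| ≤ C * Real.exp (-κ * |x|) ∧
      |orbitWeight (P.velCoeff c t p) x * px x| ≤ C * Real.exp (-κ * |x|) := by
  obtain ⟨-, -, C, κ, -, hd, -⟩ := h.plane.asymptotics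
  obtain ⟨-, -, C', κ', -, hd', -⟩ := h.plane.reflect.asymptotics
  have hn := hd.norm_pos 0
  have hn' := hd'.norm_pos 0
  have hC := hd.C_pos
  have hC' := hd'.C_pos
  set n := orbitNorm p px 0
  set n' := orbitNorm (fun x => -p (-x)) (fun x => px (-x)) 0
  have h1 : ∀ x : ℝ, 0 ≤ x → C * n * Real.exp (-κ * x) ≤
      (C * n + C' * n') * Real.exp (-min κ κ' * x) := fun x hx =>
    exp_bound_mono (le_add_of_nonneg_right (by positivity)) (min_le_left _ _) (by positivity) hx
  have h2 : ∀ x : ℝ, 0 ≤ x → C' * n' * Real.exp (-κ' * x) ≤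
      (C * n + C' * n') * Real.exp (-min κ κ' * x) := fun x hx =>
    exp_bound_mono (le_add_of_nonneg_left (by positivity)) (min_le_right _ _) (by positivity) hx
  refine ⟨C * n + C' * n', min κ κ', lt_min hd.κ_pos hd'.κ_pos, by positivity, fun x => ?_⟩
  rcases le_total 0 x with hx | hx
  · have h3 := hd.stable 0 x le_rfl hx
    rw [sub_zero] at h3
    rw [abs_of_nonneg hx]
    exact ⟨(hd.abs_p_le x).trans (h3.trans (h1 x hx)), (hd.abs_px_le x).trans (h3.trans (h1 x hx)),
      (hd.abs_weight_mul_p_le hx).trans (h1 x hx), (hd.abs_weight_mul_px_le hx).trans (h1 x hx)⟩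
  · have hx' : 0 ≤ -x := by linarith
    have h3 := hd'.stable 0 (-x) le_rfl hx'
    have h4 := hd'.abs_p_le (-x)
    have h5 := hd'.abs_px_le (-x)
    have h6 := hd'.abs_weight_mul_p_le hx'
    have h7 := hd'.abs_weight_mul_px_le hx'
    simp only [orbitWeight_reflect, neg_neg, abs_neg, mul_neg, sub_zero] at h3 h4 h5 h6 h7
    rw [abs_of_nonpos hx]
    simp only [mul_neg] at h1 h2 ⊢
    have h8 := h2 (-x) hx'
    simp only [mul_neg] at h8
    exact ⟨h4.trans (h3.trans h8), h5.trans (h3.trans h8), h6.trans h8, h7.trans h8⟩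

end ProfileOrbit

end StVenant

/-! ### Identification of the extremal solutions at z = 0 -/

section Kernel

open Matrix

theorem tendsto_zero_of_exp_smul {w : ℝ → Fin 3 → ℂ} {a : ℂ} {v : Fin 3 → ℂ} (ha : a.re < 0)
    (h : Tendsto (fun x : ℝ => Complex.exp (-a * x) • w x) atTop (𝓝 v)) :
    Tendsto w atTop (𝓝 0) := by
  have h1 : Tendsto (fun x : ℝ => Complex.exp (a * x)) atTop (𝓝 0) := by
    rw [tendsto_zero_iff_norm_tendsto_zero]
    simp only [Complex.norm_exp, Complex.re_mul_ofReal]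
    exact Real.tendsto_exp_atBot.comp (tendsto_id.const_mul_atTop_of_neg ha)
  have h2 := h1.smul h
  rw [zero_smul] at h2
  refine h2.congr fun x => ?_
  rw [smul_smul, ← Complex.exp_add]
  simp

theorem tendsto_dotProduct_zero {l : Filter ℝ} {ψ w : ℝ → Fin 3 → ℂ} {M : ℝ}
    (hψ : ∀ᶠ x in l, ‖ψ x‖ ≤ M) (hw : Tendsto w l (𝓝 0)) :
    Tendsto (fun x => ψ x ⬝ᵥ w x) l (𝓝 0) := by
  have h1 : Tendsto (fun x => (Fintype.card (Fin 3) : ℝ) * (M * ‖w x‖)) l (𝓝 0) := by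
    simpa using (hw.norm.const_mul M).const_mul (Fintype.card (Fin 3) : ℝ)
  refine squeeze_zero_norm' ?_ h1
  filter_upwards [hψ] with x hx
  refine (norm_dotProduct_le_card _ _).trans ?_
  gcongr

variable {A : ℝ → Matrix (Fin 3) (Fin 3) ℂ} {Λ M : ℝ}

theorem eq_of_linear_system {u v : ℝ → Fin 3 → ℂ} (hA : ∀ x i j, ‖A x i j‖ ≤ Λ)
    (hu : ∀ x, HasDerivAt u (A x *ᵥ u x) x) (hv : ∀ x, HasDerivAt v (A x *ᵥ v x) x)
    (h0 : u 0 = v 0) : u = v := by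
  have hΛ : 0 ≤ Λ := (norm_nonneg _).trans (hA 0 0 0)
  refine ODE_solution_unique_univ (v := fun x w => A x *ᵥ w) (s := fun _ => univ)
    (K := ⟨Fintype.card (Fin 3) * Λ, by positivity⟩) (t₀ := 0) (fun x => ?_)
    (fun x => ⟨hu x, mem_univ _⟩) (fun x => ⟨hv x, mem_univ _⟩) h0
  refine (LipschitzWith.of_dist_le_mul fun y z => ?_).lipschitzOnWith
  rw [dist_eq_norm, dist_eq_norm, ← mulVec_sub]
  exact norm_mulVec_le_of_entry_le hΛ (hA x) _

theorem dotProduct_eq_of_adjoint {ψ w : ℝ → Fin 3 → ℂ} (hw : ∀ x, HasDerivAt w (A x *ᵥ w x) x)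
    (hψ : ∀ x, HasDerivAt ψ (-((A x)ᵀ *ᵥ ψ x)) x) (x y : ℝ) : ψ x ⬝ᵥ w x = ψ y ⬝ᵥ w y := by
  have hd : ∀ x, HasDerivAt (fun x => ψ x ⬝ᵥ w x) 0 x := fun x => by
    refine ((hψ x).dotProduct' (hw x)).congr_deriv ?_
    rw [neg_dotProduct, mulVec_transpose, ← dotProduct_mulVec]
    ring
  exact is_const_of_deriv_eq_zero (fun x => (hd x).differentiableAt) (fun x => (hd x).deriv) x y

variable {Φ ψ₁ ψ₂ : ℝ → Fin 3 → ℂ} {N : (Fin 3 → ℂ) →ₗ[ℂ] ℂ} {n₁ n₂ : Fin 3 → ℂ}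

/-- The pairing with an adjoint solution is constant; for a bounded one and a decaying w it is zero.
So w at 0 is a multiple of Φ at 0, and uniqueness of the initial value problem propagates this. -/
theorem eq_smul_of_tendsto_zero (hA : ∀ x i j, ‖A x i j‖ ≤ Λ)
    (hΦ : ∀ x, HasDerivAt Φ (A x *ᵥ Φ x) x)
    (hψ₁ : ∀ x, HasDerivAt ψ₁ (-((A x)ᵀ *ᵥ ψ₁ x)) x)
    (hψ₂ : ∀ x, HasDerivAt ψ₂ (-((A x)ᵀ *ᵥ ψ₂ x)) x)
    (hψ₁M : ∀ x, ‖ψ₁ x‖ ≤ M) (hψ₂M : ∀ x, ‖ψ₂ x‖ ≤ M)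
    (hN : ∀ W, W = N W • Φ 0 + (ψ₁ 0 ⬝ᵥ W) • n₁ + (ψ₂ 0 ⬝ᵥ W) • n₂)
    {w : ℝ → Fin 3 → ℂ} (hw : ∀ x, HasDerivAt w (A x *ᵥ w x) x) (hl : Tendsto w atTop (𝓝 0)) :
    ∃ k : ℂ, ∀ x, w x = k • Φ x := by
  have h0 : ∀ ψ : ℝ → Fin 3 → ℂ, (∀ x, HasDerivAt ψ (-((A x)ᵀ *ᵥ ψ x)) x) →
      (∀ x, ‖ψ x‖ ≤ M) → ψ 0 ⬝ᵥ w 0 = 0 := fun ψ h1 h2 =>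
    tendsto_nhds_unique (tendsto_const_nhds.congr fun x => dotProduct_eq_of_adjoint hw h1 0 x)
      (tendsto_dotProduct_zero (Eventually.of_forall h2) hl)
  refine ⟨N (w 0), fun x => congrFun (eq_of_linear_system (v := fun x => N (w 0) • Φ x) hA hw
    (fun x => ?_) ?_) x⟩
  · rw [mulVec_smul]
    exact (hΦ x).const_smul (N (w 0))
  · have := hN (w 0)
    rwa [h0 ψ₁ hψ₁ hψ₁M, h0 ψ₂ hψ₂ hψ₂M, zero_smul, zero_smul, add_zero, add_zero] at this

/-- Pairing with Φ leaves a combination of ψ₁ and ψ₂; the entry of ψ₂ that is constantly 1 is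
incompatible with decay at -∞. -/
theorem adjoint_eq_smul_of_tendsto_zero (hA : ∀ x i j, ‖A x i j‖ ≤ Λ)
    (hΦ : ∀ x, HasDerivAt Φ (A x *ᵥ Φ x) x)
    (hψ₁ : ∀ x, HasDerivAt ψ₁ (-((A x)ᵀ *ᵥ ψ₁ x)) x)
    (hψ₂ : ∀ x, HasDerivAt ψ₂ (-((A x)ᵀ *ᵥ ψ₂ x)) x) (hΦM : ∀ x, ‖Φ x‖ ≤ M)
    (hN : ∀ W, W = N W • Φ 0 + (ψ₁ 0 ⬝ᵥ W) • n₁ + (ψ₂ 0 ⬝ᵥ W) • n₂)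
    (hψ₁l : Tendsto ψ₁ atBot (𝓝 0)) {i : Fin 3} (hi : ∀ x, ψ₂ x i = 1)
    {y : ℝ → Fin 3 → ℂ} (hy : ∀ x, HasDerivAt y (-((A x)ᵀ *ᵥ y x)) x)
    (hl : Tendsto y atBot (𝓝 0)) : ∃ β : ℂ, ∀ x, y x = β • ψ₁ x := by
  have h0 : Φ 0 ⬝ᵥ y 0 = 0 := by
    refine tendsto_nhds_unique (tendsto_const_nhds.congr fun x => ?_)
      (tendsto_dotProduct_zero (Eventually.of_forall hΦM) hl)
    rw [dotProduct_comm, dotProduct_comm (Φ x)]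
    exact dotProduct_eq_of_adjoint hΦ hy 0 x
  set β := y 0 ⬝ᵥ n₁
  set j := y 0 ⬝ᵥ n₂
  have h1 : y 0 = β • ψ₁ 0 + j • ψ₂ 0 := by
    refine dotProduct_eq _ _ fun W => ?_
    conv_lhs => rw [hN W]
    rw [dotProduct_add, dotProduct_add, dotProduct_smul, dotProduct_smul, dotProduct_smul,
      dotProduct_comm _ (Φ 0), h0, add_dotProduct, smul_dotProduct, smul_dotProduct]
    simp only [smul_eq_mul, β, j]
    ring
  have h2 : y = fun x => β • ψ₁ x + j • ψ₂ x := by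
    refine eq_of_linear_system (A := fun x => -(A x)ᵀ) (Λ := Λ)
      (fun x i j => by simpa using hA x j i) (fun x => by simpa [neg_mulVec] using hy x)
      (fun x => ?_) h1
    refine (((hψ₁ x).const_smul β).add ((hψ₂ x).const_smul j)).congr_deriv ?_
    rw [neg_mulVec, mulVec_add, mulVec_smul, mulVec_smul, neg_add, smul_neg, smul_neg]
  have hj : j = 0 := by
    have e := hl.sub (hψ₁l.const_smul β)
    rw [smul_zero, sub_zero] at e
    refine tendsto_nhds_unique (tendsto_const_nhds.congr fun x => ?_) (tendsto_pi_nhds.1 e i)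
    rw [h2]
    simp [hi]
  refine ⟨β, fun x => ?_⟩
  rw [h2, hj]
  simp

/-- Used to read off a sign: k times nonnegative reals tends to the real number ℓ ≠ 0, so k is real
with the sign of ℓ. -/
theorem exists_ofReal_of_tendsto {l : Filter ℝ} [l.NeBot] {r : ℝ → ℝ} {k : ℂ} {ℓ : ℝ} (hℓ : ℓ ≠ 0)
    (hr : ∀ᶠ x in l, 0 ≤ r x) (h : Tendsto (fun x => k * (r x : ℂ)) l (𝓝 (ℓ : ℂ))) :
    ∃ ρ : ℝ, 0 < ρ ∧ k = ((ℓ * ρ : ℝ) : ℂ) := by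
  have hℓ' : (ℓ : ℂ) ≠ 0 := Complex.ofReal_ne_zero.2 hℓ
  have hk : k ≠ 0 := by
    rintro rfl
    simp only [zero_mul] at h
    exact hℓ' (tendsto_nhds_unique tendsto_const_nhds h).symm
  have h1 : Tendsto (fun x => (r x : ℂ)) l (𝓝 (k⁻¹ * ℓ)) := by
    refine (h.const_mul k⁻¹).congr fun x => ?_
    rw [inv_mul_cancel_left₀ hk]
  have h2 : Tendsto r l (𝓝 (k⁻¹ * ℓ).re) :=
    ((Complex.continuous_re.tendsto _).comp h1).congr fun x => Complex.ofReal_re _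
  have h3 : k⁻¹ * ℓ = (((k⁻¹ * ℓ).re : ℝ) : ℂ) :=
    tendsto_nhds_unique h1 ((Complex.continuous_ofReal.tendsto _).comp h2)
  set s := (k⁻¹ * ℓ).re
  have hs : 0 ≤ s := ge_of_tendsto h2 hr
  have hs0 : s ≠ 0 := fun hh => by
    rw [hh, Complex.ofReal_zero] at h3
    exact (mul_ne_zero (inv_ne_zero hk) hℓ') h3
  refine ⟨s⁻¹, inv_pos.2 (lt_of_le_of_ne hs hs0.symm), ?_⟩
  have hs' : (s : ℂ) ≠ 0 := Complex.ofReal_ne_zero.2 hs0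
  push_cast
  rw [eq_mul_inv_iff_mul_eq₀ hs', ← h3, mul_inv_cancel_left₀ hk]

end Kernel

theorem hasDerivAt_ofReal_pi {v : ℝ → Fin 3 → ℝ} {v' : Fin 3 → ℝ} {x : ℝ}
    (h : ∀ i, HasDerivAt (fun x => v x i) (v' i) x) :
    HasDerivAt (fun x i => (v x i : ℂ)) (fun i => (v' i : ℂ)) x :=
  hasDerivAt_pi.2 fun i => (h i).ofReal_comp

theorem norm_ofReal_pi_le {v : Fin 3 → ℝ} {M : ℝ} (h : ∀ i, |v i| ≤ M) :
    ‖fun i => (v i : ℂ)‖ ≤ M :=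
  (pi_norm_le_iff_of_nonneg ((abs_nonneg _).trans (h 0))).2 fun i => by
    rw [Complex.norm_real]; exact h i

/-! ### Equality of the Evans and Melnikov integrals -/

namespace StVenant

open Matrix MeasureTheory

variable {P : StVenant} {c q t₀ m₁ m₂ B δ₀ : ℝ} {t p px : ℝ → ℝ}

namespace ProfileOrbit

theorem integrable_of_decay {f : ℝ → ℝ} (hf : Continuous f) {C κ : ℝ} (hκ : 0 < κ)
    (h : ∀ x, |f x| ≤ C * Real.exp (-κ * |x|)) : IntegrableOn f (Ioi 0) :=
  Integrable.mono' ((exp_neg_integrableOn_Ioi 0 hκ).const_mul C)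
    hf.aestronglyMeasurable.restrict ((ae_restrict_iff' measurableSet_Ioi).2
      (ae_of_all _ fun x hx => by
        have := h x
        rwa [abs_of_pos (mem_Ioi.1 hx)] at this))

theorem tendsto_zero_of_decay {f : ℝ → ℝ} {C κ : ℝ} (hκ : 0 < κ)
    (h : ∀ x, |f x| ≤ C * Real.exp (-κ * |x|)) : Tendsto f (cocompact ℝ) (𝓝 0) := by
  refine squeeze_zero_norm h ?_
  have h1 : Tendsto (fun x : ℝ => -κ * |x|) (cocompact ℝ) atBot :=
    tendsto_norm_cocompact_atTop.const_mul_atTop_of_neg (neg_lt_zero.2 hκ)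
  simpa using (Real.tendsto_exp_atBot.comp h1).const_mul C

theorem exists_dragDensity_decay (h : P.ProfileOrbit c q t₀ m₁ m₂ B δ₀ t p px) :
    ∃ C κ, 0 < κ ∧ ∀ x, |dragDensity P c q t p x| ≤ C * Real.exp (-κ * |x|) := by
  obtain ⟨C, κ, hκ, hC, hd⟩ := h.exists_orbit_decay
  obtain ⟨T, T', a, C', κ', Θ, b, Θ₀, hfam, -⟩ := h.exists_evansFamily
  obtain ⟨Λ, hΛ⟩ := hfam.bound
  have hν := h.nu_pos
  have hc := h.c_pos
  -- The drag derivative is ν times the entry (2, 1) of the matrix at z = 0, so the bound of the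
  -- family applies.
  have e1 : ∀ x, |P.dragU c q (t x)| ≤ P.nu * Λ := fun x => by
    have := hΛ x 2 1
    rw [h.evansMatrix_eq, zero_mul, add_zero, Complex.norm_real, Real.norm_eq_abs] at this
    simp only [evansReal] at this
    simp [abs_div, abs_of_pos hν] at this
    rwa [div_le_iff₀' hν] at this
  refine ⟨C * (P.nu * Λ * t₀ ^ 2 / (c * P.nu)), κ, hκ, fun x => ?_⟩
  have ht := h.t_pos x
  rw [dragDensity, abs_mul, mul_right_comm]
  refine mul_le_mul (hd x).2.2.1 ?_ (abs_nonneg _) (by positivity)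
  rw [abs_div, abs_mul, abs_of_pos (mul_pos hc hν), abs_of_pos (pow_pos ht 2)]
  have := e1 x
  have := h.t_le x
  have := (abs_nonneg _).trans (e1 x)
  gcongr

theorem tendsto_dragPrimitive (h : P.ProfileOrbit c q t₀ m₁ m₂ B δ₀ t p px) :
    Tendsto (dragPrimitive P c q t p) atBot (𝓝 0) := by
  obtain ⟨C, κ, hκ, hd⟩ := h.exists_dragDensity_decay
  have := (tendsto_integral_of_exp_bound h.continuous_dragDensity hκ fun x hx => by
    simpa [abs_of_nonneg hx] using hd (-x)).const_add
      (∫ s in Ioi (0 : ℝ), dragDensity P c q t p (-s))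
  rwa [add_neg_cancel] at this

theorem exists_dragPrimitive_bound (h : P.ProfileOrbit c q t₀ m₁ m₂ B δ₀ t p px) :
    ∃ M, ∀ x, |dragPrimitive P c q t p x| ≤ M := by
  obtain ⟨C, κ, hκ, hd⟩ := h.exists_dragDensity_decay
  have hc := h.continuous_dragDensity
  have key : ∀ f : ℝ → ℝ, Continuous f → (∀ x, |f x| ≤ C * Real.exp (-κ * |x|)) → ∀ x, 0 ≤ x →
      |∫ s in (0 : ℝ)..x, f s| ≤ ∫ s in Ioi (0 : ℝ), |f s| := fun f hf hb x hx => by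
    refine (intervalIntegral.abs_integral_le_integral_abs hx).trans ?_
    rw [intervalIntegral.integral_of_le hx]
    exact setIntegral_mono_set (integrable_of_decay hf hκ hb).abs
      (ae_of_all _ fun _ => abs_nonneg _) Ioc_subset_Ioi_self.eventuallyLE
  refine ⟨|∫ s in Ioi (0 : ℝ), dragDensity P c q t p (-s)| +
    ((∫ s in Ioi (0 : ℝ), |dragDensity P c q t p s|) +
      ∫ s in Ioi (0 : ℝ), |dragDensity P c q t p (-s)|), fun x => ?_⟩
  refine (abs_add_le _ _).trans (add_le_add_right ?_ _)
  have n1 : 0 ≤ ∫ s in Ioi (0 : ℝ), |dragDensity P c q t p s| :=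
    integral_nonneg fun _ => abs_nonneg _
  have n2 : 0 ≤ ∫ s in Ioi (0 : ℝ), |dragDensity P c q t p (-s)| :=
    integral_nonneg fun _ => abs_nonneg _
  rcases le_total 0 x with hx | hx
  · exact (key _ hc hd x hx).trans (by linarith)
  · have := key (fun s => dragDensity P c q t p (-s)) (hc.comp continuous_neg)
      (fun x => by simpa using hd (-x)) (-x) (by linarith)
    rw [intervalIntegral.integral_comp_neg, neg_neg, neg_zero, intervalIntegral.integral_symm,
      abs_neg] at this
    exact this.trans (by linarith)

/-- The pairing of the bounded solution of the adjoint equation with the slope matrix. -/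
noncomputable def slopeDensity (P : StVenant) (c q : ℝ) (t p px : ℝ → ℝ) (x : ℝ) : ℝ :=
  cotangent P c q t p px x ⬝ᵥ (P.evansSlope c (t x, p x, px x) *ᵥ tangent c t p px x)

theorem slopeDensity_eq (P : StVenant) (c q : ℝ) (t p px : ℝ → ℝ) (x : ℝ) :
    slopeDensity P c q t p px x = p x * (cotangent P c q t p px x 0 * c⁻¹ +
      cotangent P c q t p px x 2 * (P.evansSlope c (t x, p x, px x) 2 0 - c * P.nu⁻¹)) := by
  simp [slopeDensity, dotProduct, mulVec, Fin.sum_univ_three, tangent, evansSlope]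
  ring

theorem exists_cotangent_bound (h : P.ProfileOrbit c q t₀ m₁ m₂ B δ₀ t p px) :
    ∃ M, ∀ x i, |cotangent P c q t p px x i| ≤ M := by
  obtain ⟨C, κ, hκ, hC, hd⟩ := h.exists_orbit_decay
  obtain ⟨M, hM⟩ := h.exists_dragPrimitive_bound
  have hM0 := (abs_nonneg _).trans (hM 0)
  have hc := h.c_pos
  have ht₀ := h.t₀_pos
  have hexp : ∀ x : ℝ, C * Real.exp (-κ * |x|) ≤ C := fun x =>
    mul_le_of_le_one_right hC (Real.exp_le_one_iff.2 (by nlinarith [abs_nonneg x]))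
  refine ⟨C + c * M + M + C * t₀ ^ 2 / c, fun x i => ?_⟩
  have a1 := hM x
  have a2 := (hd x).2.2.1.trans (hexp x)
  have a3 := (hd x).2.2.2.trans (hexp x)
  have a4 : 0 ≤ c * M := by positivity
  have a5 : 0 ≤ C * t₀ ^ 2 / c := by positivity
  have ht := h.t_pos x
  have ht' := h.t_le x
  fin_cases i
  · simp only [cotangent, Fin.zero_eta, cons_val_zero]
    refine (abs_add_le _ _).trans ?_
    rw [abs_neg, abs_mul c, abs_of_pos hc]
    nlinarith
  · simp only [cotangent, Fin.mk_one, cons_val_one, cons_val_zero]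
    linarith
  · simp only [cotangent, Fin.reduceFinMk, cons_val]
    rw [abs_neg, abs_div, abs_mul, abs_of_pos hc, abs_of_pos (pow_pos ht 2)]
    have : |orbitWeight (P.velCoeff c t p) x * p x| * t x ^ 2 / c ≤ C * t₀ ^ 2 / c := by gcongr
    linarith

theorem exists_evansSlope_bound (h : P.ProfileOrbit c q t₀ m₁ m₂ B δ₀ t p px) :
    ∃ b, ∀ x i j, |P.evansSlope c (t x, p x, px x) i j| ≤ b := by
  obtain ⟨T, T', a, C', κ', Θ, b, Θ₀, hfam, -⟩ := h.exists_evansFamily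
  exact ⟨b, fun x i j => by simpa [slopeMatrix] using hfam.bound_B x i j⟩

theorem exists_slopeDensity_decay (h : P.ProfileOrbit c q t₀ m₁ m₂ B δ₀ t p px) :
    ∃ C κ, 0 < κ ∧ ∀ x, |slopeDensity P c q t p px x| ≤ C * Real.exp (-κ * |x|) := by
  obtain ⟨C, κ, hκ, hC, hd⟩ := h.exists_orbit_decay
  obtain ⟨M, hM⟩ := h.exists_cotangent_bound
  obtain ⟨b, hb⟩ := h.exists_evansSlope_bound
  have hM0 := (abs_nonneg _).trans (hM 0 0)
  have hc := h.c_pos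
  have hν := h.nu_pos
  refine ⟨C * (M * c⁻¹ + M * (b + c * P.nu⁻¹)), κ, hκ, fun x => ?_⟩
  rw [slopeDensity_eq, abs_mul, mul_right_comm]
  refine mul_le_mul (hd x).1 ?_ (abs_nonneg _) (by positivity)
  refine (abs_add_le _ _).trans ?_
  rw [abs_mul, abs_mul, abs_of_pos (inv_pos.2 hc)]
  have e1 : |P.evansSlope c (t x, p x, px x) 2 0 - c * P.nu⁻¹| ≤ b + c * P.nu⁻¹ := by
    refine (abs_sub _ _).trans (add_le_add (hb x 2 0) ?_)
    rw [abs_of_pos (by positivity)]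
  exact add_le_add (mul_le_mul_of_nonneg_right (hM x 0) (by positivity))
    (mul_le_mul (hM x 2) e1 (abs_nonneg _) hM0)

theorem exists_melnikovDensity_decay (h : P.ProfileOrbit c q t₀ m₁ m₂ B δ₀ t p px) :
    ∃ C κ, 0 < κ ∧ ∀ x, |melnikovDensity P c q t₀ t p px x| ≤ C * Real.exp (-κ * |x|) := by
  obtain ⟨C, κ, hκ, hC, hd⟩ := h.exists_orbit_decay
  refine ⟨C * B, κ, hκ, fun x => ?_⟩
  rw [melnikovDensity, abs_mul, mul_right_comm]
  exact mul_le_mul (hd x).2.2.1 (h.plane.bound_Hc x) (abs_nonneg _) (by positivity)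

/-- The identity behind the theorem: the two integrands, of the Evans and of the Melnikov
derivative, add up to an exact derivative, by the equations for the weight, the orbit and the drag
primitive. -/
theorem hasDerivAt_boundary (h : P.ProfileOrbit c q t₀ m₁ m₂ B δ₀ t p px) (x : ℝ) :
    HasDerivAt (fun x => dragPrimitive P c q t p x * (t x - t₀) -
      orbitWeight (P.velCoeff c t p) x * p x * p x / c)
      (slopeDensity P c q t p px x + melnikovDensity P c q t₀ t p px x) x := by
  have he := hasDerivAt_orbitWeight h.plane.cont_Hs x
  have ht := h.t_pos x
  have hν := h.nu_pos
  have hc := h.c_pos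
  refine (((h.hasDerivAt_dragPrimitive x).mul ((h.plane.deriv_t x).sub_const t₀)).sub
    (((he.mul (h.plane.deriv_p x)).mul (h.plane.deriv_p x)).div_const c)).congr_deriv ?_
  simp only [slopeDensity_eq, melnikovDensity, speedCoeff, dragDensity, cotangent, evansSlope,
    velCoeff]
  simp
  field_simp
  ring

theorem tendsto_boundary (h : P.ProfileOrbit c q t₀ m₁ m₂ B δ₀ t p px) :
    Tendsto (fun x => dragPrimitive P c q t p x * (t x - t₀) -
      orbitWeight (P.velCoeff c t p) x * p x * p x / c) (cocompact ℝ) (𝓝 0) := by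
  obtain ⟨C, κ, hκ, hC, hd⟩ := h.exists_orbit_decay
  obtain ⟨M, hM⟩ := h.exists_dragPrimitive_bound
  have h1 : Tendsto (fun x => t x - t₀) (cocompact ℝ) (𝓝 0) := by
    simpa using h.plane.lim_t.sub_const t₀
  have h2 : Tendsto (fun x => M * |t x - t₀|) (cocompact ℝ) (𝓝 0) := by
    simpa using h1.abs.const_mul M
  have h3 : Tendsto (fun x => dragPrimitive P c q t p x * (t x - t₀)) (cocompact ℝ) (𝓝 0) :=
    squeeze_zero_norm (fun x => by
      rw [Real.norm_eq_abs, abs_mul]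
      exact mul_le_mul_of_nonneg_right (hM x) (abs_nonneg _)) h2
  have h4 := tendsto_zero_of_decay hκ fun x => (hd x).2.2.1
  simpa using h3.sub ((h4.mul h.plane.lim_p).div_const c)

/-- The first-order pairing is the Melnikov integral. -/
theorem integral_slopeDensity (h : P.ProfileOrbit c q t₀ m₁ m₂ B δ₀ t p px) :
    (∫ x in Ioi (0 : ℝ), slopeDensity P c q t p px x) +
      ∫ x in Ioi (0 : ℝ), slopeDensity P c q t p px (-x) =
    -((∫ x in Ioi (0 : ℝ), melnikovDensity P c q t₀ t p px x) +
      ∫ x in Ioi (0 : ℝ), melnikovDensity P c q t₀ t p px (-x)) := by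
  have ct : Continuous t := continuous_iff_continuousAt.2 fun x => (h.plane.deriv_t x).continuousAt
  have cp : Continuous p := continuous_iff_continuousAt.2 fun x => (h.plane.deriv_p x).continuousAt
  have ce : Continuous (orbitWeight (P.velCoeff c t p)) := continuous_iff_continuousAt.2 fun x =>
    (hasDerivAt_orbitWeight h.plane.cont_Hs x).continuousAt
  have cψ : ∀ i, Continuous fun x => cotangent P c q t p px x i := fun i =>
    continuous_iff_continuousAt.2 fun x => (h.hasDerivAt_cotangent x i).continuousAt
  have cS : Continuous (slopeDensity P c q t p px) := by
    have e : slopeDensity P c q t p px = _ := funext (slopeDensity_eq P c q t p px)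
    rw [e]
    exact cp.mul (((cψ 0).mul continuous_const).add
      ((cψ 2).mul ((h.continuous_evansSlope 2 0).sub continuous_const)))
  have cM : Continuous (melnikovDensity P c q t₀ t p px) := (ce.mul cp).mul h.plane.cont_Hc
  obtain ⟨C, κ, hκ, hS⟩ := h.exists_slopeDensity_decay
  obtain ⟨C', κ', hκ', hM⟩ := h.exists_melnikovDensity_decay
  have iS := integrable_of_decay cS hκ hS
  have iM := integrable_of_decay cM hκ' hM
  have iS' := integrable_of_decay (cS.comp continuous_neg) hκ (fun x => by simpa using hS (-x))
  have iM' := integrable_of_decay (cM.comp continuous_neg) hκ' (fun x => by simpa using hM (-x))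
  have hl := h.tendsto_boundary
  -- The two half-lines contribute opposite boundary values at 0, and nothing at infinity.
  have e1 := integral_Ioi_of_hasDerivAt_of_tendsto' (a := 0) (fun x _ => h.hasDerivAt_boundary x)
    (iS.add iM) (hl.mono_left atTop_le_cocompact)
  have e2 := integral_Ioi_of_hasDerivAt_of_tendsto' (a := 0) (fun x _ =>
    ((h.hasDerivAt_boundary (-x)).comp x (hasDerivAt_neg x)).congr_deriv (mul_neg_one _))
    (iS'.add iM').neg ((hl.comp tendsto_neg_cocompact_real).mono_left atTop_le_cocompact)
  rw [integral_neg] at e2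
  have a1 := integral_add iS iM
  have a2 := integral_add iS' iM'
  simp only [Function.comp_apply, neg_zero] at e1 e2 a1 a2
  rw [a1] at e1
  rw [a2] at e2
  linarith

end ProfileOrbit

end StVenant

/-! ### A dual basis at the origin and the signs of the multipliers -/

namespace StVenant

open Matrix MeasureTheory

variable {P : StVenant} {c q t₀ m₁ m₂ B δ₀ : ℝ} {t p px : ℝ → ℝ}

namespace ProfileOrbit

theorem evansMatrix_zero (h : P.ProfileOrbit c q t₀ m₁ m₂ B δ₀ t p px) (x : ℝ) :
    P.evansMatrix c q t p x 0 =
      (P.evansReal c q (t x, p x, px x)).map (Complex.ofRealHom : ℝ →+* ℂ) := by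
  ext i j
  rw [h.evansMatrix_eq, zero_mul, add_zero]
  rfl

theorem hasDerivAt_tangent_ofReal (h : P.ProfileOrbit c q t₀ m₁ m₂ B δ₀ t p px) (x : ℝ) :
    HasDerivAt (fun x i => (tangent c t p px x i : ℂ))
      (P.evansMatrix c q t p x 0 *ᵥ fun i => (tangent c t p px x i : ℂ)) x := by
  refine (hasDerivAt_ofReal_pi (h.hasDerivAt_tangent x)).congr_deriv ?_
  rw [h.evansMatrix_zero]
  ext i
  exact RingHom.map_mulVec Complex.ofRealHom _ _ i

theorem hasDerivAt_adjoint_ofReal (h : P.ProfileOrbit c q t₀ m₁ m₂ B δ₀ t p px)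
    {ψ : ℝ → Fin 3 → ℝ} {x : ℝ} (hψ : ∀ i, HasDerivAt (fun x => ψ x i)
      (-((P.evansReal c q (t x, p x, px x))ᵀ *ᵥ ψ x) i) x) :
    HasDerivAt (fun x i => (ψ x i : ℂ))
      (-((P.evansMatrix c q t p x 0)ᵀ *ᵥ fun i => (ψ x i : ℂ))) x := by
  refine (hasDerivAt_ofReal_pi hψ).congr_deriv ?_
  rw [h.evansMatrix_zero, ← transpose_map]
  ext i
  rw [Complex.ofReal_neg, Pi.neg_apply]
  exact congrArg Neg.neg (RingHom.map_mulVec Complex.ofRealHom _ _ i)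

/-- At z = 0 the combination c τ + u is constant along solutions of the eigenvalue equations. -/
theorem hasDerivAt_conserved (h : P.ProfileOrbit c q t₀ m₁ m₂ B δ₀ t p px) (x : ℝ) (i : Fin 3) :
    HasDerivAt (fun _ => (![c, 1, 0] : Fin 3 → ℝ) i)
      (-((P.evansReal c q (t x, p x, px x))ᵀ *ᵥ ![c, 1, 0]) i) x := by
  have hc := h.c_pos
  refine (hasDerivAt_const x _).congr_deriv ?_
  fin_cases i <;> simp [evansReal, mulVec, dotProduct, Fin.sum_univ_three]
  field_simp
  ring

theorem exists_tangent_bound (h : P.ProfileOrbit c q t₀ m₁ m₂ B δ₀ t p px) :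
    ∃ M, ∀ x i, |tangent c t p px x i| ≤ M := by
  have hct : ∀ i, Continuous fun x => tangent c t p px x i := fun i =>
    continuous_iff_continuousAt.2 fun x => (h.hasDerivAt_tangent x i).continuousAt
  obtain ⟨C, κ, hκ, hC, hd⟩ := h.exists_orbit_decay
  have hpx := tendsto_zero_of_decay hκ fun x => (hd x).2.1
  have hl : ∀ i, Tendsto (fun x => tangent c t p px x i) (cocompact ℝ) (𝓝 0) := fun i => by
    fin_cases i
    · exact h.plane.lim_p
    · simpa [tangent] using h.plane.lim_p.const_mul (-c)
    · have e := (hpx.const_mul (-c)).div (h.plane.lim_t.pow 2) (pow_pos h.t₀_pos 2).ne'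
      rw [mul_zero, zero_div] at e
      exact e
  have hb : ∀ i, ∃ M, ∀ x, |tangent c t p px x i| ≤ M := fun i => by
    obtain ⟨y, hy⟩ | hy := em (∃ y, 0 < |tangent c t p px y i|)
    · obtain ⟨z, hz⟩ := (hct i).abs.exists_forall_ge' y
        (((hl i).abs.eventually (by rw [abs_zero]; exact gt_mem_nhds hy)).mono fun _ hx => le_of_lt hx)
      exact ⟨_, hz⟩
    · exact ⟨0, fun x => not_lt.1 fun hx => hy ⟨x, hx⟩⟩
  choose M hM using hb
  exact ⟨|M 0| + |M 1| + |M 2|, fun x i => (hM i x).trans (by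
    fin_cases i <;> simp <;>
      linarith [abs_nonneg (M 0), abs_nonneg (M 1), abs_nonneg (M 2), le_abs_self (M 0),
        le_abs_self (M 1), le_abs_self (M 2)])⟩

theorem tendsto_cotangent (h : P.ProfileOrbit c q t₀ m₁ m₂ B δ₀ t p px) :
    Tendsto (fun x i => (cotangent P c q t p px x i : ℂ)) atBot (𝓝 0) := by
  obtain ⟨C, κ, hκ, hC, hd⟩ := h.exists_orbit_decay
  have h1 := (tendsto_zero_of_decay hκ fun x => (hd x).2.2.1).mono_left atBot_le_cocompact
  have h2 := (tendsto_zero_of_decay hκ fun x => (hd x).2.2.2).mono_left atBot_le_cocompact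
  have h3 := h.tendsto_dragPrimitive
  have h4 := h.plane.lim_t.mono_left atBot_le_cocompact
  refine tendsto_pi_nhds.2 fun i => ?_
  have : Tendsto (fun x => cotangent P c q t p px x i) atBot (𝓝 0) := by
    fin_cases i
    · simpa [cotangent] using h2.neg.add (h3.const_mul c)
    · exact h3
    · simpa [cotangent] using ((h1.mul (h4.pow 2)).div_const c).neg
  exact (Complex.continuous_ofReal.tendsto 0).comp this

/-- The component along the profile derivative. -/
noncomputable def tangentPart (c : ℝ) (t p px : ℝ → ℝ) : (Fin 3 → ℂ) →ₗ[ℂ] ℂ :=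
  ((p 0 / (p 0 ^ 2 + px 0 ^ 2) : ℝ) : ℂ) • LinearMap.proj 0 -
    ((t 0 ^ 2 / c * px 0 / (p 0 ^ 2 + px 0 ^ 2) : ℝ) : ℂ) • LinearMap.proj 2

/-- The vector dual to `cotangent` at `0`. -/
noncomputable def normalVec (c : ℝ) (t p px : ℝ → ℝ) : Fin 3 → ℂ := fun i =>
  ((![-px 0, c * px 0, -c * p 0 / t 0 ^ 2] i / (p 0 ^ 2 + px 0 ^ 2) : ℝ) : ℂ)

theorem tangentPart_tangent (h : P.ProfileOrbit c q t₀ m₁ m₂ B δ₀ t p px) :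
    tangentPart c t p px (fun i => (tangent c t p px 0 i : ℂ)) = 1 := by
  have h1 : ((t 0 : ℝ) : ℂ) ≠ 0 := Complex.ofReal_ne_zero.2 (h.t_pos 0).ne'
  have h2 : (c : ℂ) ≠ 0 := Complex.ofReal_ne_zero.2 h.c_pos.ne'
  have h3 : ((p 0 : ℂ) ^ 2 + (px 0 : ℂ) ^ 2) ≠ 0 := by
    exact_mod_cast (h.plane.ne 0).ne'
  simp [tangentPart, tangent]
  field_simp
  ring

theorem cotangent_normalVec (h : P.ProfileOrbit c q t₀ m₁ m₂ B δ₀ t p px) :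
    (fun i => (cotangent P c q t p px 0 i : ℂ)) ⬝ᵥ normalVec c t p px = 1 := by
  have h1 : ((t 0 : ℝ) : ℂ) ≠ 0 := Complex.ofReal_ne_zero.2 (h.t_pos 0).ne'
  have h2 : (c : ℂ) ≠ 0 := Complex.ofReal_ne_zero.2 h.c_pos.ne'
  have h3 : ((p 0 : ℂ) ^ 2 + (px 0 : ℂ) ^ 2) ≠ 0 := by
    exact_mod_cast (h.plane.ne 0).ne'
  simp [cotangent, normalVec, dotProduct, Fin.sum_univ_three, orbitWeight_zero]
  field_simp
  ring

/-- The vectors `tangent`, `normalVec` and the corrected second unit vector form a basis, whose dual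
basis is `tangentPart`, `cotangent` and (c, 1, 0). The correction makes the last vector orthogonal
to `cotangent`. -/
theorem eq_tangentPart_add (h : P.ProfileOrbit c q t₀ m₁ m₂ B δ₀ t p px) (W : Fin 3 → ℂ) :
    W = tangentPart c t p px W • (fun i => (tangent c t p px 0 i : ℂ)) +
      ((fun i => (cotangent P c q t p px 0 i : ℂ)) ⬝ᵥ W) • normalVec c t p px +
      ((fun i => ((![c, 1, 0] : Fin 3 → ℝ) i : ℂ)) ⬝ᵥ W) •
        (Pi.single 1 1 - (dragPrimitive P c q t p 0 : ℂ) • normalVec c t p px) := by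
  have h1 : ((t 0 : ℝ) : ℂ) ≠ 0 := Complex.ofReal_ne_zero.2 (h.t_pos 0).ne'
  have h2 : (c : ℂ) ≠ 0 := Complex.ofReal_ne_zero.2 h.c_pos.ne'
  have h3 : ((p 0 : ℂ) ^ 2 + (px 0 : ℂ) ^ 2) ≠ 0 := by
    exact_mod_cast (h.plane.ne 0).ne'
  ext i
  fin_cases i <;>
    simp [tangentPart, tangent, cotangent, normalVec, dotProduct, Fin.sum_univ_three,
      orbitWeight_zero] <;> field_simp <;> ring

variable {T T' : ℂ → Matrix (Fin 3) (Fin 3) ℂ} {a : ℂ → Fin 3 → ℂ} {C κ b : ℝ} {Θ : ℝ → ℂ} {Θ₀ : ℂ}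
  {w η : ℂ → ℝ → Fin 3 → ℂ}

/-- Near +∞ the orbit approaches t₀ from below, so p > 0 and the second entry -c p of the
translation mode is negative, whereas the extremal eigenvector has second entry 1. -/
theorem exists_pos_of_decaying (h : P.ProfileOrbit c q t₀ m₁ m₂ B δ₀ t p px)
    {w : ℝ → Fin 3 → ℂ} {k : ℂ} (hw : ∀ x, w x = k • fun i => (tangent c t p px x i : ℂ))
    (hl : Tendsto (fun x : ℝ => Complex.exp (-(m₁ : ℂ) * x) • w x) atTop (𝓝 fun i => T 0 i 2))
    (hT : T 0 1 2 = 1) : ∃ ρ : ℝ, 0 < ρ ∧ k = ((-ρ : ℝ) : ℂ) := by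
  have hc := h.c_pos
  have h1 := tendsto_pi_nhds.1 hl 1
  rw [hT] at h1
  obtain ⟨ρ, hρ, e⟩ := exists_ofReal_of_tendsto (l := atTop) (k := -k) (ℓ := 1)
    (r := fun x => Real.exp (-m₁ * x) * (c * p x)) one_ne_zero (by
      filter_upwards [h.plane.asymptotics.1] with x hx
      have h2 := h.t_le x
      have h3 : 0 ≤ p x := by
        by_contra! hp
        exact absurd (mul_nonneg_of_nonpos_of_nonpos hp.le (sub_nonpos.2 h2)) (not_le.2 hx)
      positivity) (by
      rw [Complex.ofReal_one]
      refine h1.congr fun x => ?_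
      rw [hw]
      simp [tangent]
      ring)
  refine ⟨ρ, hρ, ?_⟩
  rw [← neg_neg k, e]
  simp

/-- Near -∞ the orbit leaves t₀ downwards, so p < 0 and the third entry of the cotangent is
positive, whereas that of the normalized left eigenvector, t₀²/(m₁ - m₂), is negative. -/
theorem exists_pos_of_decaying_adjoint (h : P.ProfileOrbit c q t₀ m₁ m₂ B δ₀ t p px)
    {η : ℝ → Fin 3 → ℂ} {β : ℂ}
    (hη : ∀ x, η x = β • fun i => (cotangent P c q t p px (-x) i : ℂ))
    (hl : Tendsto (fun x : ℝ => Complex.exp (-(m₁ : ℂ) * x) • η x) atTop (𝓝 fun i => T' 0 2 i))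
    (hT' : T' 0 2 2 = ((t₀ ^ 2 : ℝ) : ℂ) / (m₁ - m₂)) :
    ∃ ρ : ℝ, 0 < ρ ∧ β = ((-ρ : ℝ) : ℂ) := by
  have hc := h.c_pos
  have hneg : m₁ - m₂ < 0 := by linarith [h.plane.neg, h.plane.pos]
  have ht₀ := pow_pos h.t₀_pos 2
  have hℓ : t₀ ^ 2 / (m₁ - m₂) < 0 := div_neg_of_pos_of_neg ht₀ hneg
  have h1 := tendsto_pi_nhds.1 hl 2
  rw [hT'] at h1
  obtain ⟨ρ, hρ, e⟩ := exists_ofReal_of_tendsto (l := atTop) (k := β) (ℓ := t₀ ^ 2 / (m₁ - m₂))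
    (r := fun x => Real.exp (-m₁ * x) * cotangent P c q t p px (-x) 2) hℓ.ne (by
      filter_upwards [h.plane.reflect.asymptotics.1] with x hx
      have h2 := h.t_le (-x)
      have h3 : 0 ≤ -p (-x) := by
        by_contra! hp
        exact absurd (mul_nonneg_of_nonpos_of_nonpos hp.le (sub_nonpos.2 h2)) (not_le.2 hx)
      have h4 := orbitWeight_pos (P.velCoeff c t p) (-x)
      have h5 : cotangent P c q t p px (-x) 2 =
          orbitWeight (P.velCoeff c t p) (-x) * -p (-x) * t (-x) ^ 2 / c := by
        simp [cotangent]
        ring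
      rw [h5]
      positivity) (by
      have e2 : ((t₀ ^ 2 / (m₁ - m₂) : ℝ) : ℂ) = ((t₀ ^ 2 : ℝ) : ℂ) / (m₁ - m₂) := by push_cast; rfl
      rw [e2]
      refine h1.congr fun x => ?_
      rw [hη]
      simp
      ring)
  refine ⟨-(t₀ ^ 2 / (m₁ - m₂) * ρ), by nlinarith, ?_⟩
  rw [neg_neg, e]

/-- The derivative at the origin of the pairing of the extremal solutions is a negative multiple of
the Melnikov integral. -/
theorem hasDerivAt_pairing (h : P.ProfileOrbit c q t₀ m₁ m₂ B δ₀ t p px)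
    (hf : EvansFamily (fun z x => P.evansMatrix c q t p x z) (P.limitMatrix c q t₀) T T' a C κ Θ Θ₀
      (slopeMatrix P c t p px) b) (ha : a 0 2 = m₁) (hT : T 0 1 2 = 1)
    (hT' : T' 0 2 2 = ((t₀ ^ 2 : ℝ) : ℂ) / (m₁ - m₂))
    (hp : ∀ᶠ z in 𝓝 0, EvansPair (fun x => P.evansMatrix c q t p x z) (T z) (T' z) (a z) (w z)
      (η z)) :
    ∃ ρ : ℝ, 0 < ρ ∧ HasDerivAt (fun z => η z 0 ⬝ᵥ w z 0)
      ((-ρ * -((∫ x in Ioi (0 : ℝ), melnikovDensity P c q t₀ t p px x) +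
        ∫ x in Ioi (0 : ℝ), melnikovDensity P c q t₀ t p px (-x)) : ℝ) : ℂ) 0 := by
  have hp0 := hp.self_of_nhds
  obtain ⟨Λ, hΛ⟩ := hf.exists_bound 0
  have hneg : (a 0 2).re < 0 := by rw [ha]; exact h.plane.neg
  obtain ⟨M₁, hM₁⟩ := h.exists_tangent_bound
  obtain ⟨M₂, hM₂⟩ := h.exists_cotangent_bound
  have hΦ := h.hasDerivAt_tangent_ofReal
  have hψ₁ := fun x => h.hasDerivAt_adjoint_ofReal (h.hasDerivAt_cotangent x)
  have hψ₂ := fun x => h.hasDerivAt_adjoint_ofReal (ψ := fun _ => ![c, 1, 0])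
    (h.hasDerivAt_conserved x)
  set M := max M₁ (max M₂ (c + 1)) with hM
  have hΦM : ∀ x, ‖fun i => (tangent c t p px x i : ℂ)‖ ≤ M := fun x =>
    norm_ofReal_pi_le fun i => (hM₁ x i).trans (le_max_left _ _)
  have hψ₁M : ∀ x, ‖fun i => (cotangent P c q t p px x i : ℂ)‖ ≤ M := fun x =>
    norm_ofReal_pi_le fun i => (hM₂ x i).trans ((le_max_left _ _).trans (le_max_right _ _))
  have hψ₂M : ‖fun i => ((![c, 1, 0] : Fin 3 → ℝ) i : ℂ)‖ ≤ M :=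
    norm_ofReal_pi_le fun i => by
      have hc := h.c_pos
      refine le_trans ?_ ((le_max_right _ _).trans (le_max_right _ _))
      fin_cases i <;> simp [abs_of_pos hc] <;> linarith
  have hN := h.eq_tangentPart_add
  obtain ⟨k, hk⟩ := eq_smul_of_tendsto_zero hΛ hΦ hψ₁ hψ₂ hψ₁M (fun _ => hψ₂M) hN hp0.deriv_w
    (tendsto_zero_of_exp_smul hneg hp0.lim_w)
  have hη0 := (tendsto_zero_of_exp_smul hneg hp0.lim_η).comp tendsto_neg_atBot_atTop
  obtain ⟨β, hβ⟩ := adjoint_eq_smul_of_tendsto_zero hΛ hΦ hψ₁ hψ₂ hΦM hN h.tendsto_cotangent (i := 1)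
    (fun _ => by simp) (y := fun x => η 0 (-x)) (fun x => by
      have := (hp0.deriv_η (-x)).scomp x (hasDerivAt_neg x)
      exact HasDerivAt.congr_deriv (f := fun x => η 0 (-x)) this (by simp)) hη0
  have hβ' : ∀ x, η 0 x = β • fun i => (cotangent P c q t p px (-x) i : ℂ) := fun x => by
    simpa using hβ (-x)
  obtain ⟨ρ₁, hρ₁, rfl⟩ := h.exists_pos_of_decaying (T := T) hk (by rw [← ha]; exact hp0.lim_w) hT
  obtain ⟨ρ₂, hρ₂, rfl⟩ := h.exists_pos_of_decaying_adjoint (T' := T') hβ'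
    (by rw [← ha]; exact hp0.lim_η) hT'
  -- The multipliers are k = -ρ₁ and β = -ρ₂, so the factor -(kβ) is -ρ₁ρ₂.
  refine ⟨ρ₁ * ρ₂, mul_pos hρ₁ hρ₂, ?_⟩
  have hn₁ := h.cotangent_normalVec
  refine (hf.hasDerivAt_pairing hp hneg hΦ hψ₁ hψ₂ (fun x _ => hΦM (-x)) (fun x _ => hψ₁M x)
    (fun _ _ => hψ₂M) (fun x _ => hk x) (fun x _ => hβ' x) hN h.tangentPart_tangent hn₁
    ?_).congr_deriv ?_
  · rw [dotProduct_sub, dotProduct_smul, hn₁]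
    simp [cotangent]
  · have e : ∀ x, ((fun i => (cotangent P c q t p px x i : ℂ)) ⬝ᵥ
        (slopeMatrix P c t p px x *ᵥ fun i => (tangent c t p px x i : ℂ))) =
        (slopeDensity P c q t p px x : ℂ) := fun x => by
      simp [slopeDensity, dotProduct, mulVec, slopeMatrix]
    simp only [e, integral_complex_ofReal]
    rw [← h.integral_slopeDensity]
    push_cast
    ring

end ProfileOrbit

end StVenant

theorem mainTheorem2 (P : StVenant) (hF : 0 < P.F) (hnu : 0 < P.nu)
    (hr : P.r ∈ Set.Icc (1 : ℝ) 2) (hs : P.s ∈ Set.Icc (0 : ℝ) 2)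
    (c₀ q₀ t₀ : ℝ) (hsaddle : P.IsSaddle c₀ q₀ t₀)
    (t tx : ℝ → ℝ) (hhom : P.IsHomoclinic c₀ q₀ t₀ t tx) :
    -- the stable and unstable branches, hence the Melnikov separation, exist
    (∃ Tp Tpx, P.IsManifoldBranch c₀ q₀ t₀ t tx (Set.Ici 0) Filter.atTop Tp Tpx) ∧
    (∃ Tm Tmx, P.IsManifoldBranch c₀ q₀ t₀ t tx (Set.Iic 0) Filter.atBot Tm Tmx) ∧
    -- the Evans function is well defined near the origin
    (∀ᶠ z in nhds (0 : ℂ), ∃! D, P.IsEvansValue c₀ q₀ t₀ t tx z D) ∧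
    -- both derivatives exist, and their signs are opposite
    ∃ D₁ d₁ : ℝ, HasDerivAt (P.evans c₀ q₀ t₀ t tx) (D₁ : ℂ) 0 ∧
      (∀ Tp Tpx Tm Tmx : ℝ → ℝ → ℝ,
        P.IsManifoldBranch c₀ q₀ t₀ t tx (Set.Ici 0) Filter.atTop Tp Tpx →
        P.IsManifoldBranch c₀ q₀ t₀ t tx (Set.Iic 0) Filter.atBot Tm Tmx →
        StVenant.melnikov tx Tp Tpx Tm Tmx c₀ = 0 ∧
        HasDerivAt (StVenant.melnikov tx Tp Tpx Tm Tmx) d₁ c₀) ∧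
      SignType.sign D₁ = -SignType.sign d₁ := by
  obtain ⟨px, m₁, m₂, B, δ₀, h⟩ := hhom.exists_profileOrbit hnu hr.1 hs.1 hsaddle
  obtain ⟨T, T', a, C, κ, Θ, b, Θ₀, hf, ha, hT, hT'⟩ := h.exists_evansFamily
  obtain ⟨w, η, hp⟩ := hf.exists_pairs
  have hval : ∀ᶠ z in 𝓝 (0 : ℂ), ∀ D, P.IsEvansValue c₀ q₀ t₀ t tx z D ↔
      D = Complex.exp (-Θ₀) * dotProduct (η z 0) (w z 0) := by
    filter_upwards [hf.data, hp] with z hz hpz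
    obtain ⟨Λ, hΛ⟩ := hf.exists_bound z
    exact StVenant.isEvansValue_iff hz hpz hΛ
  -- The Evans function is a choice among admissible values; near 0 there is exactly one, so the
  -- choice is the pairing.
  have hev : P.evans c₀ q₀ t₀ t tx =ᶠ[𝓝 0] fun z => Complex.exp (-Θ₀) * dotProduct (η z 0) (w z 0) := by
    filter_upwards [hval] with z hz
    exact (hz _).1 (Classical.epsilon_spec ⟨_, (hz _).2 rfl⟩)
  obtain ⟨ρ, hρ, hd⟩ := h.hasDerivAt_pairing hf ha hT hT' hp
  set d₁ : ℝ := -((∫ x in Set.Ioi (0 : ℝ), StVenant.ProfileOrbit.melnikovDensity P c₀ q₀ t₀ t tx px x) +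
    ∫ x in Set.Ioi (0 : ℝ), StVenant.ProfileOrbit.melnikovDensity P c₀ q₀ t₀ t tx px (-x))
  refine ⟨h.exists_stable_branch, h.exists_unstable_branch,
    hval.mono fun z hz => ⟨_, (hz _).2 rfl, fun D hD => (hz D).1 hD⟩, Real.exp (-Θ₀) * (-ρ * d₁), d₁,
    ((hd.const_mul _).congr_of_eventuallyEq hev).congr_deriv ?_, fun Tp Tpx Tm Tmx hTp hTm =>
    ⟨StVenant.ProfileOrbit.melnikov_center hTp hTm, h.hasDerivAt_melnikov hTp hTm⟩, ?_⟩
  · push_cast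
    rfl
  · rw [sign_mul, sign_mul, sign_pos (Real.exp_pos _), sign_neg (neg_lt_zero.2 hρ), one_mul,
      neg_one_mul]
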